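/- **Setting.** Let $g\in C^\infty(\mathbb R)$ be odd and $2\pi$-periodic, with $g(0)=g(\pi)=0$, $g>0$ on $(0,\pi)$, $g'(0)=1$, $g'(\pi)=-1$, and put $f=gg'$. Let $\chi\ge 0$ be a smooth nonincreasing function with $\chi=1$ on $(-\infty,1]$ and $\chi=0$ on $[2,\infty)$; write $\chi_B(y)=\chi(y/B)$. Write $\Lambda h=y\,\partial_y h$, $\Delta h=\partial_y^2h+\frac1y\partial_yh$, $\int h=\int_0^\infty h(y)\,y\,dy$ and $(h,k)=\int hk$. Let $Q$ be the least energy harmonic map: $\Lambda Q=g(Q)$, $Q(0)=0$, $Q(y)\to\pi$ as $y\to\infty$, with the scaling fixed by $y(\pi-Q(y))\to 2$. Let $$H=-\Delta+\frac{f'(Q)}{y^2},\qquad \Gamma(y)=\Lambda Q(y)\int_1^y\frac{dx}{x(\Lambda Q(x))^2},$$ $$H^{-1}h(y)=-\Gamma(y)\int_0^y h\,\Lambda Q\,x\,dx+\Lambda Q(y)\int_0^y h\,\Gamma\,x\,dx .$$ Fix an integer $L\ge1$ and let $b=(b_1,\dots,b_L)$, $b_1>0$, $b_{L+1}=0$.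 **Approximate profile.** Let $B_0=b_1^{-1/2}$, $B_1=|\log b_1|\,b_1^{-1/2}$, $T_i=(-1)^iH^{-i}\Lambda Q$ $(i\ge0)$, $$c_{b_1}=\frac{4}{\int\chi_{B_0/4}(\Lambda Q)^2},\qquad d_{b_1}=c_{b_1}\int_0^{B_0}\chi_{B_0/4}\,\Lambda Q\,\Gamma\,y\,dy,$$ $$\Sigma_{b_1}=H^{-1}\big\{-c_{b_1}\chi_{B_0/4}\Lambda Q+d_{b_1}H[(1-\chi_{B_0})\Lambda Q]\big\},$$ $$\Theta_i=\Lambda T_i-(2i-1)T_i-(-1)^{i+1}H^{-i+1}\Sigma_{b_1}\qquad(i\ge1).$$ Set $S_1=0$ and, inductively for $1\le i\le L+1$, $S_{i+1}=-H^{-1}\Phi_{i+1}$ with $$\Phi_{i+1}=\mathbf 1_{i\le L}\,b_1b_i\Theta_i+b_1\Lambda S_i+\frac{P_{i+1}}{y^2}-\sum_{j=1}^{i-1}\big((2j-1+c_{b_1})b_1b_j-b_{j+1}\big)\frac{\partial S_i}{\partial b_j}.$$ Here $P_{i+1}$ is the part of weight $i+1$ of $\sum_{j=2}^{L+2}\frac{f^{(j)}(Q)}{j!}\big(\sum_{k=1}^Lb_kT_k+\sum_{k=2}^{L+2}S_k\big)^j$,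 where $b_kT_k$ and $S_k$ have weight $k$ and weights add under multiplication (only $T_k,S_k$ with $k\le i$ contribute). Let $$\tilde Q_b=Q+\chi_{B_1}\Big(\sum_{i=1}^Lb_iT_i+\sum_{i=2}^{L+2}S_i\Big).$$ For $M>0$ let $\Phi_M=\sum_{p=0}^Lc_{p,M}H^p(\chi_M\Lambda Q)$ with $c_{0,M}=1$ and $$c_{k,M}=(-1)^{k+1}\,\frac{\sum_{p=0}^{k-1}c_{p,M}\big(H^p(\chi_M\Lambda Q),T_k\big)}{(\chi_M\Lambda Q,\Lambda Q)},\qquad 1\le k\le L .$$ **Reference solution.** Let $c_1=\frac{L}{2L-1}$, $d_1=-\frac{2L}{(2L-1)^2}$ and, for $1\le k\le L-1$, $$c_{k+1}=-\frac{L-k}{2L-1}c_k,\qquad d_{k+1}=-\frac{L-k}{2L-1}d_k+\frac{4L(L-k)}{(2L-1)^2}c_k .$$ Let $b_k^e(s)=\frac{c_k}{s^k}+\frac{d_k}{s^k\log s}$. Let $A_L$ be the $L\times L$ matrix with $$(A_LU)_k=-(2k-1)c_kU_1+\frac{L-k}{2L-1}U_k+U_{k+1},\qquad U_{L+1}=0,$$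 and fix an invertible $P_L$ with $A_L=P_L^{-1}\,\mathrm{diag}\big(-1,\tfrac2{2L-1},\tfrac3{2L-1},\dots,\tfrac L{2L-1}\big)P_L$. **Bootstrap regime.** Let $M,K>0$, $s_0>1$. Let $u(t,r)$, $t\in[0,T)$, be a smooth solution of $$\partial_tu-\partial_r^2u-\frac{\partial_ru}{r}+\frac{f(u)}{r^2}=0,$$ with $u(t,\cdot)$ extending to a smooth odd function of $r$, and suppose that $u(t,r)=(\tilde Q_{b(t)}+\varepsilon)(t,r/\lambda(t))$ with $C^1$ parameters $\lambda(t)>0$, $b(t)=(b_1,\dots,b_L)(t)$ such that $$(\varepsilon(t),H^k\Phi_M)=0,\qquad 0\le k\le L .$$ Let $s(t)=s_0+\int_0^t\lambda(\tau)^{-2}d\tau$, let the subscript $s$ denote $\frac{d}{ds}=\lambda^2\frac{d}{dt}$, and put $\mathcal E_{2k}=\int|H^k\varepsilon|^2$. The solution is in the bootstrap regime with constants $(M,K,s_0)$ on $[0,T)$ if for all $t\in[0,T)$ the integrals below are finite and $$\int|\partial_y\varepsilon|^2+\int\frac{|\varepsilon|^2}{y^2}\le10\,b_1(0)^{1/4},\qquad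 \mathcal E_{2k}\le b_1^{(2k-1)\frac{2L}{2L-1}}|\log b_1|^K\ (1\le k\le L),\qquad \mathcal E_{2L+2}\le K\frac{b_1^{2L+2}}{|\log b_1|^2},$$ and $V=P_LU$, where $b_k=b_k^e(s)+\frac{U_k}{s^k(\log s)^{5/4}}$ for $1\le k\le L$, satisfies $|V_1|\le2$ and $\big(\sum_{k=2}^LV_k^2\big)^{1/2}\le2$. **Lemma (modulation equations).** There are constants $C>0$ and $M_0>1$, depending only on $L,g,\chi,P_L$, such that for every $M\ge M_0$ and every $K>0$ there is $s_{\min}=s_{\min}(M,K)>1$ with the following property. If $s_0\ge s_{\min}$ and a solution is in the bootstrap regime with constants $(M,K,s_0)$ on $[0,T)$, then for all $t\in[0,T)$ $$\Big|\frac{\lambda_s}{\lambda}+b_1\Big|+\sum_{k=1}^{L-1}\big|(b_k)_s+(2k-1+c_{b_1})b_1b_k-b_{k+1}\big|\le C\,b_1^{L+\frac32},$$ $$\big|(b_L)_s+(2L-1+c_{b_1})b_1b_L\big|\le\frac{C}{\sqrt{\log M}}\left(\sqrt{\mathcal E_{2L+2}}+\frac{b_1^{L+1}}{|\log b_1|}\right).$$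 -/

import Mathlib

open scoped ContDiff

noncomputable section

namespace HeatFlow

/-! All functions of the radial variable are functions `ℝ → ℝ` of which only the values
on `(0, ∞)` matter. -/

/-- Assumption `(H)` on the target revolution surface, with metric `du² + g(u)² dθ²`. -/
structure IsTarget (g : ℝ → ℝ) : Prop where
  smooth : ContDiff ℝ ∞ g
  odd : ∀ u, g (-u) = -g u
  periodic : ∀ u, g (u + 2 * Real.pi) = g u
  zero : g 0 = 0
  pi : g Real.pi = 0
  pos : ∀ u, 0 < u → u < Real.pi → 0 < g u
  deriv_zero : deriv g 0 = 1
  deriv_pi : deriv g Real.pi = -1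

/-- A smooth nonincreasing cut-off function, equal to `1` for `y ≤ 1` and to `0` for `y ≥ 2`. -/
structure IsCutoff (χ : ℝ → ℝ) : Prop where
  smooth : ContDiff ℝ ∞ χ
  nonneg : ∀ y, 0 ≤ χ y
  antitone : Antitone χ
  one : ∀ y, y ≤ 1 → χ y = 1
  zero : ∀ y, 2 ≤ y → χ y = 0

/-- The least energy harmonic map: `y Q' = g(Q)`, `Q(0) = 0`, `Q(∞) = π`. The solution is unique
up to scaling, and the scaling is fixed by `Q(y) = π - 2/y + o(1/y)` at infinity. -/
structure IsGroundState (g Q : ℝ → ℝ) : Prop where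
  ode : ∀ y, 0 < y → HasDerivAt Q (g (Q y) / y) y
  origin : Filter.Tendsto Q (nhdsWithin 0 (Set.Ioi 0)) (nhds 0)
  infinity : Filter.Tendsto Q Filter.atTop (nhds Real.pi)
  scaling : Filter.Tendsto (fun y => y * (Real.pi - Q y)) Filter.atTop (nhds 2)

/-- The scaling generator `Λ f = y ∂_y f`. -/
def scal (f : ℝ → ℝ) (y : ℝ) : ℝ := y * deriv f y

/-- The nonlinearity `f = g g'`. -/
def nonlin (g : ℝ → ℝ) (u : ℝ) : ℝ := g u * deriv g u

/-- The two dimensional radial Laplacian. -/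
def lap (f : ℝ → ℝ) (y : ℝ) : ℝ := deriv (deriv f) y + deriv f y / y

/-- The linearized operator `H = -Δ + V / y²`, with `V = f'(Q)`. -/
def opH (g Q f : ℝ → ℝ) (y : ℝ) : ℝ :=
  -lap f y + deriv (nonlin g) (Q y) / y ^ 2 * f y

/-- The iterates `H^k`. -/
def opHpow (g Q : ℝ → ℝ) (k : ℕ) (f : ℝ → ℝ) : ℝ → ℝ := (opH g Q)^[k] f

/-- The radial inner product `(f, h) = ∫₀^∞ f h y dy`. -/
def ip (f h : ℝ → ℝ) : ℝ := ∫ y in Set.Ioi (0 : ℝ), f y * h y * y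

/-- `χ_B(y) = χ(y / B)`. -/
def cut (χ : ℝ → ℝ) (B y : ℝ) : ℝ := χ (y / B)

/-- The second, singular, solution of `H Γ = 0`. -/
def Gam (Q : ℝ → ℝ) (y : ℝ) : ℝ :=
  scal Q y * ∫ x in (1 : ℝ)..y, 1 / (x * scal Q x ^ 2)

/-- The formal inverse `H⁻¹`. -/
def invH (Q f : ℝ → ℝ) (y : ℝ) : ℝ :=
  -Gam Q y * (∫ x in (0 : ℝ)..y, f x * scal Q x * x)
    + scal Q y * ∫ x in (0 : ℝ)..y, f x * Gam Q x * x

/-- `T_i = (-1)^i H^{-i} Λ Q`. -/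
def Tprof (Q : ℝ → ℝ) (i : ℕ) (y : ℝ) : ℝ := (-1) ^ i * (invH Q)^[i] (scal Q) y

def B0 (b₁ : ℝ) : ℝ := 1 / Real.sqrt b₁

def B1 (b₁ : ℝ) : ℝ := |Real.log b₁| / Real.sqrt b₁

/-- The constant `c_{b₁}`. -/
def cb (Q χ : ℝ → ℝ) (b₁ : ℝ) : ℝ :=
  4 / ∫ y in Set.Ioi (0 : ℝ), cut χ (B0 b₁ / 4) y * scal Q y ^ 2 * y

/-- The constant `d_{b₁}`. -/
def db (Q χ : ℝ → ℝ) (b₁ : ℝ) : ℝ :=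
  cb Q χ b₁ * ∫ y in (0 : ℝ)..(B0 b₁), cut χ (B0 b₁ / 4) y * scal Q y * Gam Q y * y

/-- The radiation `Σ_{b₁}`. -/
def radSigma (g Q χ : ℝ → ℝ) (b₁ : ℝ) : ℝ → ℝ :=
  invH Q fun y => -cb Q χ b₁ * cut χ (B0 b₁ / 4) y * scal Q y
    + db Q χ b₁ * opH g Q (fun x => (1 - cut χ (B0 b₁) x) * scal Q x) y

/-- `Θ_i = Λ T_i - (2i-1) T_i - (-1)^{i+1} H^{-i+1} Σ_{b₁}`, for `i ≥ 1`. -/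
def Theta (g Q χ : ℝ → ℝ) (b₁ : ℝ) (i : ℕ) (y : ℝ) : ℝ :=
  scal (Tprof Q i) y - (2 * (i : ℝ) - 1) * Tprof Q i y
    - (-1) ^ (i + 1) * (invH Q)^[i - 1] (radSigma g Q χ b₁) y

/-- The part of weight `i + 1` of the Taylor polynomial
`∑_{j=2}^{L+2} f^{(j)}(Q) / j! * α_b^j`, where `α_b = ∑_k (b_k T_k + S_k)` and the index `k` term
has weight `k`; as `j ≥ 2`, only the terms `k ≤ i` contribute. The weights are tracked by the
powers of a polynomial variable. -/
def Ppart (g Q : ℝ → ℝ) (L i : ℕ) (S : ℕ → (ℕ → ℝ) → ℝ → ℝ) (b : ℕ → ℝ) (y : ℝ) : ℝ :=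
  ∑ j ∈ Finset.Icc 2 (L + 2), iteratedDeriv j (nonlin g) (Q y) / (j.factorial : ℝ) *
    ((∑ k ∈ Finset.Icc 1 i,
      Polynomial.C ((if k ≤ L then b k * Tprof Q k y else 0) + S k b y)
        * (Polynomial.X : Polynomial ℝ) ^ k) ^ j).coeff (i + 1)

/-- The partial derivative `∂F/∂b_j` at `(b, y)`. -/
def dparam (F : (ℕ → ℝ) → ℝ → ℝ) (j : ℕ) (b : ℕ → ℝ) (y : ℝ) : ℝ :=
  deriv (fun x => F (Function.update b j x) y) (b j)

/-- The source `Φ_{i+1}` of the profile `S_{i+1}`, `1 ≤ i ≤ L + 1`, in terms of the profiles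
`S_1, …, S_i`. The parameters are `b = (b_1, …, b_L)`, with `b_{L+1} = 0`. -/
def Phi (g Q χ : ℝ → ℝ) (L i : ℕ) (S : ℕ → (ℕ → ℝ) → ℝ → ℝ) (b : ℕ → ℝ) (y : ℝ) : ℝ :=
  (if i ≤ L then b 1 * b i * Theta g Q χ (b 1) i y else 0)
    + b 1 * scal (S i b) y
    + Ppart g Q L i S b y / y ^ 2
    - ∑ j ∈ Finset.Icc 1 (i - 1),
        ((2 * (j : ℝ) - 1 + cb Q χ (b 1)) * b 1 * b j - b (j + 1)) * dparam (S i) j b y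

/-- The profiles `S_1 = 0`, `S_i = -H⁻¹ Φ_i` for `i ≥ 2`. -/
def Sprof (g Q χ : ℝ → ℝ) (L : ℕ) : ℕ → (ℕ → ℝ) → ℝ → ℝ
  | 0 => fun _ _ => 0
  | 1 => fun _ _ => 0
  | n + 2 => fun b y =>
      -invH Q (Phi g Q χ L (n + 1)
        (fun k => if _h : k < n + 2 then Sprof g Q χ L k else fun _ _ => 0) b) y
  termination_by n => n

/-- The localized approximate profile `Q̃_b`. -/
def Qtilde (g Q χ : ℝ → ℝ) (L : ℕ) (b : ℕ → ℝ) (y : ℝ) : ℝ :=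
  Q y + ∑ i ∈ Finset.Icc 1 L, b i * (cut χ (B1 (b 1)) y * Tprof Q i y)
    + ∑ i ∈ Finset.Icc 2 (L + 2), cut χ (B1 (b 1)) y * Sprof g Q χ L i b y

/-- `χ_M Λ Q`. -/
def cutLamQ (Q χ : ℝ → ℝ) (M y : ℝ) : ℝ := cut χ M y * scal Q y

/-- The coefficients `c_{k,M}`. -/
def cM (g Q χ : ℝ → ℝ) (M : ℝ) (k : ℕ) : ℝ :=
  if k = 0 then 1 else
    (-1) ^ (k + 1) *
      (∑ p : Fin k, cM g Q χ M p.1 * ip (opHpow g Q p.1 (cutLamQ Q χ M)) (Tprof Q k))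
      / ip (cutLamQ Q χ M) (scal Q)
  termination_by k
  decreasing_by exact p.2

/-- The direction `Φ_M = ∑_{p=0}^L c_{p,M} H^p (χ_M Λ Q)`. -/
def PhiM (g Q χ : ℝ → ℝ) (L : ℕ) (M y : ℝ) : ℝ :=
  ∑ p ∈ Finset.range (L + 1), cM g Q χ M p * opHpow g Q p (cutLamQ Q χ M) y

/-- The sequence `c_k`, `k ≥ 1`, with `c_k = cseq L (k - 1)`. -/
def cseq (L : ℕ) : ℕ → ℝ
  | 0 => (L : ℝ) / (2 * L - 1)
  | n + 1 => -((L : ℝ) - (n + 1)) / (2 * L - 1) * cseq L n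

/-- The sequence `d_k`, `k ≥ 1`, with `d_k = dseq L (k - 1)`. -/
def dseq (L : ℕ) : ℕ → ℝ
  | 0 => -(2 * (L : ℝ)) / (2 * L - 1) ^ 2
  | n + 1 => -((L : ℝ) - (n + 1)) / (2 * L - 1) * dseq L n
      + 4 * (L : ℝ) * ((L : ℝ) - (n + 1)) / (2 * L - 1) ^ 2 * cseq L n

/-- The approximate solution `b_k^e(s) = c_k / s^k + d_k / (s^k log s)`, for `k ≥ 1`. -/
def bexact (L k : ℕ) (s : ℝ) : ℝ :=
  cseq L (k - 1) / s ^ k + dseq L (k - 1) / (s ^ k * Real.log s)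

/-- The matrix `A_L` of the linearization at `b^e`; row and column `i : Fin L` carry the number
`i + 1`. The first column has the entries `-(2k-1) c_k` (for `k = 1` plus the diagonal term). -/
def AL (L : ℕ) : Matrix (Fin L) (Fin L) ℝ := fun i j =>
  (if j.1 = 0 then -(2 * ((i.1 : ℝ) + 1) - 1) * cseq L i.1 else 0)
    + (if i = j then ((L : ℝ) - (i.1 + 1)) / (2 * L - 1) else 0)
    + (if j.1 = i.1 + 1 then 1 else 0)

/-- `D_L = diag(-1, 2/(2L-1), 3/(2L-1), …, L/(2L-1))`. -/
def DL (L : ℕ) : Matrix (Fin L) (Fin L) ℝ :=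
  Matrix.diagonal fun i => if i.1 = 0 then -1 else ((i.1 : ℝ) + 1) / (2 * L - 1)

/-- The matrix `P` diagonalizes `A_L`, that is `A_L = P⁻¹ D_L P`. -/
def Diagonalizes (L : ℕ) (P : Matrix (Fin L) (Fin L) ℝ) : Prop :=
  IsUnit P.det ∧ AL L = P⁻¹ * DL L * P

/-- The variable `V = P U`, where `b_k = b_k^e(s) + U_k / (s^k (log s)^{5/4})`. -/
def Vvar (L : ℕ) (P : Matrix (Fin L) (Fin L) ℝ) (s : ℝ) (b : ℕ → ℝ) : Fin L → ℝ :=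
  P.mulVec fun i =>
    s ^ (i.1 + 1) * Real.log s ^ (5 / 4 : ℝ) * (b (i.1 + 1) - bexact L (i.1 + 1) s)

/-- A smooth corotational solution on `[0, T)` of the flow
`∂_t u - ∂_r² u - ∂_r u / r + f(u) / r² = 0`. Smoothness of the map at the origin means that
`u(t, ·)` extends to a smooth odd function. -/
structure IsFlow (g : ℝ → ℝ) (T : ℝ) (u : ℝ → ℝ → ℝ) : Prop where
  smooth : ContDiffOn ℝ ∞ (fun p : ℝ × ℝ => u p.1 p.2) (Set.Ico 0 T ×ˢ Set.univ)
  odd : ∀ t ∈ Set.Ico 0 T, ∀ r, u t (-r) = -u t r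
  flow : ∀ t ∈ Set.Ico 0 T, ∀ r, 0 < r →
    derivWithin (fun τ => u τ r) (Set.Ico 0 T) t - deriv (deriv (u t)) r - deriv (u t) r / r
      + nonlin g (u t r) / r ^ 2 = 0

/-- The radiation `ε`, defined by `u(t, r) = (Q̃_{b(t)} + ε)(t, r / λ(t))`. -/
def eps (g Q χ : ℝ → ℝ) (L : ℕ) (u : ℝ → ℝ → ℝ) (lam : ℝ → ℝ) (b : ℝ → ℕ → ℝ) (t y : ℝ) : ℝ :=
  u t (lam t * y) - Qtilde g Q χ L (b t) y

/-- Modulation parameters `λ(t) > 0`, `b(t) = (b_1, …, b_L)(t)` of class `C¹` on `[0, T)`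
for which the radiation satisfies the `L + 1` orthogonality conditions. -/
structure IsModulated (g Q χ : ℝ → ℝ) (L : ℕ) (M T : ℝ) (u : ℝ → ℝ → ℝ) (lam : ℝ → ℝ)
    (b : ℝ → ℕ → ℝ) : Prop where
  lam_pos : ∀ t ∈ Set.Ico 0 T, 0 < lam t
  lam_smooth : ContDiffOn ℝ 1 lam (Set.Ico 0 T)
  b_smooth : ∀ k, 1 ≤ k → k ≤ L → ContDiffOn ℝ 1 (fun t => b t k) (Set.Ico 0 T)
  b_conv : ∀ t ∈ Set.Ico 0 T, ∀ k, L < k → b t k = 0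
  ortho : ∀ t ∈ Set.Ico 0 T, ∀ k ≤ L,
    ip (eps g Q χ L u lam b t) (opHpow g Q k (PhiM g Q χ L M)) = 0

/-- The renormalized time `s(t) = s₀ + ∫₀^t dτ / λ(τ)²`. -/
def rtime (s₀ : ℝ) (lam : ℝ → ℝ) (t : ℝ) : ℝ := s₀ + ∫ τ in (0 : ℝ)..t, 1 / lam τ ^ 2

/-- The derivative with respect to the renormalized time, `∂_s = λ² ∂_t`. -/
def sderiv (T : ℝ) (lam F : ℝ → ℝ) (t : ℝ) : ℝ :=
  lam t ^ 2 * derivWithin F (Set.Ico 0 T) t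

/-- The energy `𝓔_{2k} = ∫ |H^k ε|²`. -/
def energy (g Q : ℝ → ℝ) (k : ℕ) (e : ℝ → ℝ) : ℝ :=
  ∫ y in Set.Ioi (0 : ℝ), opHpow g Q k e y ^ 2 * y

/-- The bounds of the bootstrap at time `t`, with `b₁0 = b_1(0)`, `s` the renormalized time,
`b = b(t)` and `e = ε(t)`. -/
structure BootstrapAt (g Q : ℝ → ℝ) (L : ℕ) (P : Matrix (Fin L) (Fin L) ℝ) (K b₁0 s : ℝ)
    (b : ℕ → ℝ) (e : ℝ → ℝ) : Prop where
  grad_int : MeasureTheory.IntegrableOn (fun y => deriv e y ^ 2 * y) (Set.Ioi 0)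
  hardy_int : MeasureTheory.IntegrableOn (fun y => (e y / y) ^ 2 * y) (Set.Ioi 0)
  energy_norm : (∫ y in Set.Ioi (0 : ℝ), deriv e y ^ 2 * y)
      + (∫ y in Set.Ioi (0 : ℝ), (e y / y) ^ 2 * y) ≤ 10 * b₁0 ^ (1 / 4 : ℝ)
  energy_int : ∀ k, 1 ≤ k → k ≤ L + 1 →
    MeasureTheory.IntegrableOn (fun y => opHpow g Q k e y ^ 2 * y) (Set.Ioi 0)
  energy_low : ∀ k : ℕ, 1 ≤ k → k ≤ L →
    energy g Q k e ≤ b 1 ^ ((2 * (k : ℝ) - 1) * (2 * L / (2 * L - 1))) * |Real.log (b 1)| ^ K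
  energy_high : energy g Q (L + 1) e ≤ K * (b 1 ^ (2 * L + 2) / |Real.log (b 1)| ^ 2)
  stable : ∀ i : Fin L, i.1 = 0 → |Vvar L P s b i| ≤ 2
  unstable : Real.sqrt (∑ i : Fin L, if i.1 = 0 then 0 else Vvar L P s b i ^ 2) ≤ 2

end HeatFlow

end

open scoped ContDiff

noncomputable section

namespace HeatFlow

open Set Filter Topology MeasureTheory

variable {g χ Q : ℝ → ℝ}
/-! ### The ground state -/

/-! The modulation equations come from differentiating in time the orthogonality conditions `(ε, H^k
Φ_M) = 0`, `0 ≤ k ≤ L`. Every direction `H^k Φ_M` vanishes for `y ≥ 2M`, whereas all cut-offs of the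
approximate profile act at `y ≥ B₀/4`, with `B₀ = b₁^{-1/2}` as large as desired. Hence only the
profile on a bounded interval `(0, 2M + 1)` matters. There the radiation reduces to `Σ = c_{b₁} T₁`,
and the profile is `Q + α` with `α` a finite sum of terms homogeneous in `b`, where `b_k` has weight
`k`. Since `b_k = O(b₁^k)` in the bootstrap regime, weight `w` means size `b₁^w`.

Let `ℓ = λ_s/λ`, let `d_k = (b_k)_s`, and let the defects be `D_0 = ℓ + b₁` and `D_k = d_k +
(2k-1+c_{b₁}) b₁ b_k - b_{k+1}`. On the interval, the flow equation takes the form `ε_s + H ε +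
(-D_0 T_0 + ∑_{k=1}^L D_k T_k) = remainder` (`velRem_eq`). The recursion defining the `S_i` cancels
every profile error of weight at most `L + 2` (`profErr_eq`, `profBd_profErr`), so the remainder is
`O(b₁ ∑|D_k| + b₁^{L+2})` with an `M`-dependent constant (`exists_velRem_bound`).

Pair with `H^k Φ_M`. The term `ε_s` gives zero (`ip_frameVel_eq_zero`). The coefficients `c_{k,M}`
are chosen so that `(T_i, H^k Φ_M) = (-1)^k N δ_{ik}` with `N = (χ_M ΛQ, ΛQ)`
(`ip_Tprof_opHpow_PhiM`), so each pairing isolates one defect. By symmetry of `H`, `(Hε, H^k Φ_M) =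
(ε, H^{k+1} Φ_M)`, which vanishes for `k < L`. For `k = L` it equals `(H^{L+1} ε, Φ_M)`, at most
`√𝓔_{2L+2} ‖Φ_M‖`. As `ΛQ` decays like `1/y`, one has `‖Φ_M‖² ≲ log M` and `N ≳ log M`
(`exists_PhiM_norm`, `exists_norm_lower`), whence the factor `1/√(log M)`. The terms `b₁ ∑|D_k|` are
absorbed for `b₁` small, and one iteration leaves only `O(b₁^{L+2})` (`exists_defect_bound`). The
spare powers of `b₁` beat all constants depending on `M` and `K`.

The remainder estimate needs pointwise control of `ε` and `Λε` by `√𝓔_{2L+2}` on the bounded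
interval (`exists_coercivity`). Inverting `H` repeatedly writes `ε` as an iterated inverse of
`H^{L+1} ε` plus a combination of `T_0, …, T_L`. Square integrability excludes the singular solution
`Γ`, and the orthogonality conditions bound the coefficients of the `T_i`. -/

theorem IsTarget.differentiable (hg : IsTarget g) : Differentiable ℝ g :=
  hg.smooth.differentiable (by simp)

theorem IsTarget.smooth_deriv (hg : IsTarget g) : ContDiff ℝ ∞ (deriv g) :=
  (contDiff_infty_iff_deriv.1 hg.smooth).2

theorem IsTarget.smooth_nonlin (hg : IsTarget g) : ContDiff ℝ ∞ (nonlin g) :=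
  hg.smooth.mul hg.smooth_deriv

theorem IsTarget.smooth_deriv_nonlin (hg : IsTarget g) : ContDiff ℝ ∞ (deriv (nonlin g)) :=
  (contDiff_infty_iff_deriv.1 hg.smooth_nonlin).2

theorem IsTarget.exists_deriv_bound (hg : IsTarget g) :
    ∃ C : NNReal, ∀ u, ‖deriv g u‖₊ ≤ C := by
  have hper : Function.Periodic (deriv g) (2 * Real.pi) := by
    intro x
    have : (fun u => g (u + 2 * Real.pi)) = g := funext hg.periodic
    rw [← deriv_comp_add_const, this]
  obtain ⟨C, hC⟩ := (isCompact_Icc (a := (0 : ℝ)) (b := 2 * Real.pi)).exists_bound_of_continuousOn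
    hg.smooth_deriv.continuous.continuousOn
  refine ⟨C.toNNReal, fun u => ?_⟩
  obtain ⟨y, hy, hxy⟩ := hper.exists_mem_Ico₀ (by positivity) u
  rw [hxy, ← NNReal.coe_le_coe, coe_nnnorm]
  exact (hC y ⟨hy.1, hy.2.le⟩).trans (Real.le_coe_toNNReal C)

theorem IsTarget.exists_lipschitz (hg : IsTarget g) : ∃ C : NNReal, LipschitzWith C g :=
  let ⟨C, hC⟩ := hg.exists_deriv_bound
  ⟨C, lipschitzWith_of_nnnorm_deriv_le hg.differentiable hC⟩

theorem IsGroundState.continuousOn (hQ : IsGroundState g Q) : ContinuousOn Q (Ioi 0) :=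
  fun y hy => (hQ.ode y hy).continuousAt.continuousWithinAt

/-- In the variable `log y` the equation is autonomous, `q' = g(q)`, with a globally Lipschitz field
because `g'` is continuous and periodic. A solution meeting a zero of `g` is therefore constant. -/
theorem IsGroundState.eq_const (hg : IsTarget g) (hQ : IsGroundState g Q) {a y₀ : ℝ}
    (ha : g a = 0) (hy₀ : 0 < y₀) (h : Q y₀ = a) {y : ℝ} (hy : 0 < y) : Q y = a := by
  obtain ⟨C, hC⟩ := hg.exists_lipschitz
  have key : (fun t => Q (Real.exp t)) = fun _ => a := by
    refine ODE_solution_unique_univ (v := fun _ => g) (s := fun _ => univ) (K := C)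
      (t₀ := Real.log y₀) (fun _ => hC.lipschitzOnWith) (fun t => ⟨?_, mem_univ _⟩)
      (fun t => ⟨?_, mem_univ _⟩) ?_
    · have := (hQ.ode _ (Real.exp_pos t)).comp t (Real.hasDerivAt_exp t)
      rwa [div_mul_cancel₀ _ (Real.exp_pos t).ne'] at this
    · rw [ha]; exact hasDerivAt_const _ _
    · simp [Real.exp_log hy₀, h]
  have := congrFun key (Real.log y)
  simpa [Real.exp_log hy] using this

theorem IsGroundState.ne_zero (hg : IsTarget g) (hQ : IsGroundState g Q) {y : ℝ} (hy : 0 < y) :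
    Q y ≠ 0 := by
  intro h
  have h1 : Tendsto Q atTop (𝓝 0) := by
    refine tendsto_const_nhds.congr' ?_
    filter_upwards [eventually_gt_atTop 0] with z hz
    exact (hQ.eq_const hg hg.zero hy h hz).symm
  exact Real.pi_ne_zero (tendsto_nhds_unique hQ.infinity h1)

theorem IsGroundState.ne_pi (hg : IsTarget g) (hQ : IsGroundState g Q) {y : ℝ} (hy : 0 < y) :
    Q y ≠ Real.pi := by
  intro h
  have h1 : Tendsto Q (𝓝[>] 0) (𝓝 Real.pi) := by
    refine tendsto_const_nhds.congr' ?_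
    filter_upwards [self_mem_nhdsWithin] with z hz
    exact (hQ.eq_const hg hg.pi hy h hz).symm
  exact Real.pi_ne_zero (tendsto_nhds_unique hQ.origin h1).symm

/-- The image of `Q` is an interval. It avoids `0` and `π` by uniqueness, and by the limits at both
ends it contains points below `π` and points above `0`. -/
theorem IsGroundState.mem_Ioo (hg : IsTarget g) (hQ : IsGroundState g Q) {y : ℝ} (hy : 0 < y) :
    Q y ∈ Ioo 0 Real.pi := by
  have hconn : (Q '' Ioi 0).OrdConnected :=
    (isPreconnected_Ioi.image Q hQ.continuousOn).ordConnected
  have hpi := Real.pi_pos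
  obtain ⟨z, hz0, hz⟩ : ∃ z, 0 < z ∧ Q z < Real.pi := by
    have := (hQ.origin.eventually (gt_mem_nhds hpi)).and self_mem_nhdsWithin
    obtain ⟨z, h1, h2⟩ := this.exists
    exact ⟨z, h2, h1⟩
  obtain ⟨w, hw0, hw⟩ : ∃ w, 0 < w ∧ 0 < Q w := by
    have := (hQ.infinity.eventually (lt_mem_nhds hpi)).and (eventually_gt_atTop 0)
    obtain ⟨z, h1, h2⟩ := this.exists
    exact ⟨z, h2, h1⟩
  constructor
  · by_contra! h
    obtain ⟨x, hx, hx0⟩ := hconn.out ⟨y, hy, rfl⟩ ⟨w, hw0, rfl⟩ ⟨h, hw.le⟩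
    exact hQ.ne_zero hg hx hx0
  · by_contra! h
    obtain ⟨x, hx, hx0⟩ := hconn.out ⟨z, hz0, rfl⟩ ⟨y, hy, rfl⟩ ⟨hz.le, h⟩
    exact hQ.ne_pi hg hx hx0

theorem IsGroundState.deriv_eq (hQ : IsGroundState g Q) {y : ℝ} (hy : 0 < y) :
    deriv Q y = g (Q y) / y := (hQ.ode y hy).deriv

theorem IsGroundState.scal_eq (hQ : IsGroundState g Q) {y : ℝ} (hy : 0 < y) :
    scal Q y = g (Q y) := by
  rw [scal, hQ.deriv_eq hy]; field_simp

theorem IsGroundState.scal_pos (hg : IsTarget g) (hQ : IsGroundState g Q) {y : ℝ} (hy : 0 < y) :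
    0 < scal Q y := by
  rw [hQ.scal_eq hy]
  exact hg.pos _ (hQ.mem_Ioo hg hy).1 (hQ.mem_Ioo hg hy).2

theorem IsGroundState.hasDerivAt_comp (hQ : IsGroundState g Q) {h : ℝ → ℝ}
    (hh : Differentiable ℝ h) {y : ℝ} (hy : 0 < y) :
    HasDerivAt (fun x => h (Q x)) (deriv h (Q y) * g (Q y) / y) y := by
  have := (hh (Q y)).hasDerivAt.comp y (hQ.ode y hy)
  rwa [← mul_div_assoc] at this

theorem IsGroundState.scal_comp (hQ : IsGroundState g Q) {h : ℝ → ℝ}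
    (hh : Differentiable ℝ h) {y : ℝ} (hy : 0 < y) :
    scal (fun x => h (Q x)) y = deriv h (Q y) * g (Q y) := by
  rw [scal, (hQ.hasDerivAt_comp hh hy).deriv]; field_simp

/-- The weight `y / (1 + y²)` comparable to `Λ Q`. -/
def wt (y : ℝ) : ℝ := y / (1 + y ^ 2)

theorem wt_pos {y : ℝ} (hy : 0 < y) : 0 < wt y := by unfold wt; positivity

/-- The derivative of `log Q - log y` is `(g(Q) - Q)/(Qy) = O(Q/y)`. Smallness of `Q` alone gives
only `Q = O(√y)`. Inserted once more, this makes the derivative `O(y^{-1/2})`, which is integrable,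
so `log (Q/y)` stays bounded. -/
theorem IsGroundState.exists_near_zero (hg : IsTarget g) (hQ : IsGroundState g Q) :
    ∃ δ > 0, ∃ c > 0, ∃ C > 0, ∀ y ∈ Ioo 0 δ, c * y ≤ Q y ∧ Q y ≤ C * y := by
  have hd : HasDerivAt g 1 0 := by
    have := (hg.differentiable 0).hasDerivAt
    rwa [hg.deriv_zero] at this
  -- quadratic comparison of `g` with the identity near the origin
  obtain ⟨C₁, hC₁⟩ : ∃ C₁, ∀ u ∈ Icc (0 : ℝ) Real.pi, |g u - u| ≤ C₁ * u ^ 2 := by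
    obtain ⟨C, hC⟩ := exists_taylor_mean_remainder_bound (n := 1) Real.pi_pos.le
      (hg.smooth.contDiffOn.of_le (by norm_cast) : ContDiffOn ℝ (1 + 1 : ℕ) g (Icc 0 Real.pi))
    refine ⟨C, fun u hu => ?_⟩
    have h := hC u hu
    have hw : derivWithin g (Icc 0 Real.pi) 0 = 1 :=
      hd.hasDerivWithinAt.derivWithin
        (uniqueDiffOn_Icc Real.pi_pos 0 ⟨le_rfl, Real.pi_pos.le⟩)
    simpa [taylorWithinEval_succ, hg.zero, iteratedDerivWithin_one, hw] using h
  have hC₁0 : 0 ≤ C₁ := by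
    have := (abs_nonneg _).trans (hC₁ Real.pi ⟨Real.pi_pos.le, le_rfl⟩)
    have h2 : 0 < Real.pi ^ 2 := by positivity
    exact nonneg_of_mul_nonneg_left this h2
  -- rough bound `Q ≤ C √y`
  obtain ⟨δ, hδ, hδQ⟩ : ∃ δ > 0, ∀ y ∈ Ioo 0 δ, C₁ * Q y ≤ 1 / 2 := by
    have h1 : Tendsto (fun y => C₁ * Q y) (𝓝[>] 0) (𝓝 0) := by
      simpa using hQ.origin.const_mul C₁
    have h2 := h1.eventually (gt_mem_nhds (show (0 : ℝ) < 1 / 2 by norm_num))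
    obtain ⟨δ, hδ, h⟩ := mem_nhdsGT_iff_exists_Ioo_subset.1 h2
    exact ⟨δ, hδ, fun y hy => (h hy).le⟩
  have hconv : Convex ℝ (Ioo 0 δ) := convex_Ioo 0 δ
  have hint : interior (Ioo 0 δ) = Ioo 0 δ := interior_Ioo
  have hlog : ∀ y ∈ Ioo 0 δ, HasDerivAt (fun x => Real.log (Q x) - Real.log x)
      ((g (Q y) - Q y) / (Q y * y)) y := by
    intro y hy
    have hQp := (hQ.mem_Ioo hg hy.1).1
    have := ((hQ.ode y hy.1).log hQp.ne').sub (Real.hasDerivAt_log hy.1.ne')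
    refine this.congr_deriv ?_
    have h1 : y ≠ 0 := hy.1.ne'
    have h2 : Q y ≠ 0 := hQp.ne'
    field_simp
  have hbd : ∀ y ∈ Ioo 0 δ, |(g (Q y) - Q y) / (Q y * y)| ≤ C₁ * Q y / y := by
    intro y hy
    have hQp := hQ.mem_Ioo hg hy.1
    have h1 := hC₁ (Q y) ⟨hQp.1.le, hQp.2.le⟩
    rw [abs_div, abs_of_pos (mul_pos hQp.1 hy.1), div_le_div_iff₀ (mul_pos hQp.1 hy.1) hy.1]
    have := mul_le_mul_of_nonneg_right h1 hy.1.le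
    calc _ ≤ _ := this
      _ = _ := by ring
  have hsq : ∃ A > 0, ∀ y ∈ Ioo 0 (δ / 2), Q y ≤ A * Real.sqrt y := by
    have hmono : MonotoneOn (fun x => (Real.log (Q x) - Real.log x) + 1 / 2 * Real.log x)
        (Ioo 0 δ) := by
      have hder : ∀ y ∈ Ioo 0 δ, HasDerivAt
          (fun x => (Real.log (Q x) - Real.log x) + 1 / 2 * Real.log x)
          ((g (Q y) - Q y) / (Q y * y) + 1 / 2 * y⁻¹) y := fun y hy =>
        (hlog y hy).add ((Real.hasDerivAt_log hy.1.ne').const_mul _)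
      refine monotoneOn_of_deriv_nonneg hconv
        (fun y hy => (hder y hy).continuousAt.continuousWithinAt)
        (fun y hy => (hder y (hint ▸ hy)).differentiableAt.differentiableWithinAt) ?_
      intro y hy
      rw [hint] at hy
      rw [(hder y hy).deriv]
      have h1 := neg_abs_le ((g (Q y) - Q y) / (Q y * y))
      have h2 := hbd y hy
      have h3 : C₁ * Q y / y ≤ 1 / 2 * y⁻¹ := by
        rw [div_eq_mul_inv]
        exact mul_le_mul_of_nonneg_right (hδQ y hy) (inv_nonneg.2 hy.1.le)
      linarith
    have hm : δ / 2 ∈ Ioo 0 δ := ⟨by positivity, by linarith⟩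
    set E := (Real.log (Q (δ / 2)) - Real.log (δ / 2)) + 1 / 2 * Real.log (δ / 2) with hE
    refine ⟨Real.exp E, Real.exp_pos _, fun y hy => ?_⟩
    have hy' : y ∈ Ioo 0 δ := ⟨hy.1, by linarith [hy.2]⟩
    have h := hmono hy' hm hy.2.le
    have hQp := (hQ.mem_Ioo hg hy.1).1
    rw [← Real.log_le_log_iff hQp (mul_pos (Real.exp_pos _) (Real.sqrt_pos.2 hy.1)),
      Real.log_mul (Real.exp_pos _).ne' (Real.sqrt_pos.2 hy.1).ne', Real.log_exp,
      Real.log_sqrt hy.1.le]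
    simp only at h
    linarith
  obtain ⟨A, hA, hQA⟩ := hsq
  have hδ2 : ∀ y ∈ Ioo 0 (δ / 2), y ∈ Ioo 0 δ := fun y hy => ⟨hy.1, by linarith [hy.2]⟩
  have hint2 : interior (Ioo 0 (δ / 2)) = Ioo 0 (δ / 2) := interior_Ioo
  -- The right side is the derivative of `2 C₁ A √y`. Adding or subtracting this function makes `log
  -- Q - log y` monotone or antitone.
  have hbd2 : ∀ y ∈ Ioo 0 (δ / 2), |(g (Q y) - Q y) / (Q y * y)| ≤
      2 * (C₁ * A) * (1 / (2 * Real.sqrt y)) := by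
    intro y hy
    refine (hbd y (hδ2 y hy)).trans ?_
    have hs := Real.sqrt_pos.2 hy.1
    calc C₁ * Q y / y ≤ C₁ * (A * Real.sqrt y) / y := by
          gcongr
          · exact hy.1.le
          · exact hQA y hy
      _ = 2 * (C₁ * A) * (1 / (2 * Real.sqrt y)) := by
          have : y = Real.sqrt y * Real.sqrt y := (Real.mul_self_sqrt hy.1.le).symm
          have hy0 := hy.1.ne'
          field_simp
          rw [Real.sq_sqrt hy.1.le]
  have hder2 : ∀ σ : ℝ, ∀ y ∈ Ioo 0 (δ / 2), HasDerivAt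
      (fun x => (Real.log (Q x) - Real.log x) + σ * Real.sqrt x)
      ((g (Q y) - Q y) / (Q y * y) + σ * (1 / (2 * Real.sqrt y))) y := fun σ y hy =>
    (hlog y (hδ2 y hy)).add ((Real.hasDerivAt_sqrt hy.1.ne').const_mul _)
  have hmono : MonotoneOn (fun x => (Real.log (Q x) - Real.log x) + 2 * (C₁ * A) * Real.sqrt x)
      (Ioo 0 (δ / 2)) := by
    refine monotoneOn_of_deriv_nonneg (convex_Ioo _ _)
      (fun y hy => (hder2 _ y hy).continuousAt.continuousWithinAt)
      (fun y hy => (hder2 _ y (hint2 ▸ hy)).differentiableAt.differentiableWithinAt) ?_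
    intro y hy
    rw [hint2] at hy
    rw [(hder2 _ y hy).deriv]
    linarith [neg_abs_le ((g (Q y) - Q y) / (Q y * y)), hbd2 y hy]
  have hanti : AntitoneOn
      (fun x => (Real.log (Q x) - Real.log x) + -(2 * (C₁ * A)) * Real.sqrt x)
      (Ioo 0 (δ / 2)) := by
    refine antitoneOn_of_deriv_nonpos (convex_Ioo _ _)
      (fun y hy => (hder2 _ y hy).continuousAt.continuousWithinAt)
      (fun y hy => (hder2 _ y (hint2 ▸ hy)).differentiableAt.differentiableWithinAt) ?_
    intro y hy
    rw [hint2] at hy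
    rw [(hder2 _ y hy).deriv]
    linarith [le_abs_self ((g (Q y) - Q y) / (Q y * y)), hbd2 y hy]
  have hm : δ / 4 ∈ Ioo 0 (δ / 2) := ⟨by positivity, by linarith⟩
  set E := Real.log (Q (δ / 4)) - Real.log (δ / 4)
  set F := 2 * (C₁ * A) * Real.sqrt (δ / 4) with hF
  refine ⟨δ / 4, by positivity, Real.exp (E - F), Real.exp_pos _, Real.exp (E + F),
    Real.exp_pos _, fun y hy => ?_⟩
  have hy' : y ∈ Ioo 0 (δ / 2) := ⟨hy.1, by linarith [hy.2]⟩
  have h1 := hmono hy' hm hy.2.le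
  have h2 := hanti hy' hm hy.2.le
  have hQp := (hQ.mem_Ioo hg hy.1).1
  have hs : 0 ≤ 2 * (C₁ * A) * Real.sqrt y := by positivity
  simp only at h1 h2
  constructor
  · rw [← Real.log_le_log_iff (mul_pos (Real.exp_pos _) hy.1) hQp,
      Real.log_mul (Real.exp_pos _).ne' hy.1.ne', Real.log_exp]
    linarith
  · rw [← Real.log_le_log_iff hQp (mul_pos (Real.exp_pos _) hy.1),
      Real.log_mul (Real.exp_pos _).ne' hy.1.ne', Real.log_exp]
    linarith

theorem IsTarget.exists_comparison_zero (hg : IsTarget g) :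
    ∃ δ > 0, ∀ u ∈ Ioo 0 δ, u / 2 ≤ g u ∧ g u ≤ 2 * u := by
  have hd : HasDerivAt g 1 0 := by
    have := (hg.differentiable 0).hasDerivAt
    rwa [hg.deriv_zero] at this
  have := (hasDerivAt_iff_tendsto_slope_zero.1 hd).mono_left
    (nhdsWithin_mono 0 (fun x (hx : x ∈ Ioi (0 : ℝ)) => (ne_of_gt hx : x ≠ 0)))
  have h2 := this.eventually (Ioo_mem_nhds (show (1 / 2 : ℝ) < 1 by norm_num)
    (show (1 : ℝ) < 2 by norm_num))
  obtain ⟨δ, hδ, h⟩ := mem_nhdsGT_iff_exists_Ioo_subset.1 h2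
  refine ⟨δ, hδ, fun u hu => ?_⟩
  have h3 := h hu
  have hu0 : 0 < u := hu.1
  simp only [mem_ofPred_eq, zero_add, hg.zero, sub_zero, smul_eq_mul] at h3
  rw [inv_mul_eq_div, lt_div_iff₀ hu0, div_lt_iff₀ hu0] at h3
  constructor <;> linarith

theorem IsTarget.exists_comparison_pi (hg : IsTarget g) :
    ∃ δ > 0, ∀ u ∈ Ioo 0 δ, u / 2 ≤ g (Real.pi - u) ∧ g (Real.pi - u) ≤ 2 * u := by
  have hd : HasDerivAt (fun u => g (Real.pi - u)) 1 0 := by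
    have h0 := (hg.differentiable (Real.pi - 0)).hasDerivAt
    have h1 := h0.comp (0 : ℝ) ((hasDerivAt_const (0 : ℝ) Real.pi).sub (hasDerivAt_id 0))
    simp only [sub_zero, hg.deriv_pi, zero_sub, mul_neg, mul_one, neg_neg] at h1
    exact h1
  have := (hasDerivAt_iff_tendsto_slope_zero.1 hd).mono_left
    (nhdsWithin_mono 0 (fun x (hx : x ∈ Ioi (0 : ℝ)) => (ne_of_gt hx : x ≠ 0)))
  have h2 := this.eventually (Ioo_mem_nhds (show (1 / 2 : ℝ) < 1 by norm_num)
    (show (1 : ℝ) < 2 by norm_num))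
  obtain ⟨δ, hδ, h⟩ := mem_nhdsGT_iff_exists_Ioo_subset.1 h2
  refine ⟨δ, hδ, fun u hu => ?_⟩
  have h3 := h hu
  have hu0 : 0 < u := hu.1
  simp only [mem_ofPred_eq, zero_add, hg.pi, sub_zero, smul_eq_mul] at h3
  rw [inv_mul_eq_div, lt_div_iff₀ hu0, div_lt_iff₀ hu0] at h3
  constructor <;> linarith

theorem IsGroundState.continuousOn_scal (hg : IsTarget g) (hQ : IsGroundState g Q) :
    ContinuousOn (scal Q) (Ioi 0) :=
  (hg.differentiable.continuous.comp_continuousOn hQ.continuousOn).congr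
    fun _ hy => hQ.scal_eq hy

/-- `Λ Q` is comparable to `y / (1 + y²)`. -/
theorem IsGroundState.exists_scal_bounds (hg : IsTarget g) (hQ : IsGroundState g Q) :
    ∃ c > 0, ∃ C > 0, ∀ y, 0 < y → c * wt y ≤ scal Q y ∧ scal Q y ≤ C * wt y := by
  obtain ⟨δ, hδ, c, hc, C, hC, h0⟩ := hQ.exists_near_zero hg
  obtain ⟨δ₁, hδ₁, h1⟩ := hg.exists_comparison_zero
  obtain ⟨δ₂, hδ₂, h2⟩ := hg.exists_comparison_pi
  -- near the origin
  obtain ⟨a, ha, hA⟩ : ∃ a > 0, ∀ y ∈ Ioo 0 a, (c / 2) * wt y ≤ scal Q y ∧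
      scal Q y ≤ 4 * C * wt y := by
    have h3 := hQ.origin.eventually (gt_mem_nhds hδ₁)
    obtain ⟨a, ha, h⟩ := mem_nhdsGT_iff_exists_Ioo_subset.1 h3
    have ha : 0 < a := ha
    refine ⟨min a (min δ 1), lt_min ha (lt_min hδ one_pos), fun y hy => ?_⟩
    have hy0 : 0 < y := hy.1
    have hya : y < a := hy.2.trans_le (min_le_left _ _)
    have hyδ : y < δ := hy.2.trans_le ((min_le_right _ _).trans (min_le_left _ _))
    have hy1 : y < 1 := hy.2.trans_le ((min_le_right _ _).trans (min_le_right _ _))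
    have hQ1 := h ⟨hy0, hya⟩
    have hQ2 := h1 (Q y) ⟨(hQ.mem_Ioo hg hy0).1, hQ1⟩
    have hQ3 := h0 y ⟨hy0, hyδ⟩
    rw [hQ.scal_eq hy0]
    have e1 : wt y ≤ y := div_le_self hy0.le (by nlinarith)
    have e2 : y / 2 ≤ wt y := by
      unfold wt; rw [div_le_div_iff₀ (by norm_num) (by positivity)]; nlinarith
    constructor
    · have : c / 2 * wt y ≤ c / 2 * y := by gcongr
      linarith [hQ2.1]
    · have : 4 * C * (y / 2) ≤ 4 * C * wt y := by gcongr
      linarith [hQ2.2]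
  -- near infinity
  obtain ⟨b, hb, hB⟩ : ∃ b > 0, ∀ y, b ≤ y → (1 / 2) * wt y ≤ scal Q y ∧
      scal Q y ≤ 12 * wt y := by
    have e1 := hQ.scaling.eventually (Ioo_mem_nhds (show (1 : ℝ) < 2 by norm_num)
      (show (2 : ℝ) < 3 by norm_num))
    have e2 : ∀ᶠ y in atTop, Real.pi - Q y < δ₂ := by
      have : Tendsto (fun y => Real.pi - Q y) atTop (𝓝 (Real.pi - Real.pi)) :=
        tendsto_const_nhds.sub hQ.infinity
      rw [sub_self] at this
      exact this.eventually (gt_mem_nhds hδ₂)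
    obtain ⟨b, hb⟩ := eventually_atTop.1 ((e1.and e2).and (eventually_ge_atTop 1))
    refine ⟨max b 1, by positivity, fun y hy => ?_⟩
    obtain ⟨⟨k1, k2⟩, k3⟩ := hb y ((le_max_left _ _).trans hy)
    have hy0 : 0 < y := by linarith
    have hm := hQ.mem_Ioo hg hy0
    have k4 := h2 (Real.pi - Q y) ⟨by linarith [hm.2], k2⟩
    rw [sub_sub_cancel] at k4
    rw [hQ.scal_eq hy0]
    have f1 : wt y ≤ 1 / y := by
      unfold wt; rw [div_le_div_iff₀ (by positivity) hy0]; nlinarith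
    have f2 : 1 / y ≤ 2 * wt y := by
      unfold wt; rw [mul_div_assoc', div_le_div_iff₀ hy0 (by positivity)]; nlinarith
    have f3 : 1 / y ≤ Real.pi - Q y := by rw [div_le_iff₀ hy0]; linarith [k1.1]
    have f4 : Real.pi - Q y ≤ 3 * (1 / y) := by
      rw [mul_one_div, le_div_iff₀ hy0]; linarith [k1.2]
    constructor <;> linarith [k4.1, k4.2]
  -- in between
  have hcont : ContinuousOn (fun y => scal Q y / wt y) (Icc a b) := by
    have hsub : Icc a b ⊆ Ioi 0 := fun y hy => ha.trans_le hy.1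
    refine ((hQ.continuousOn_scal hg).mono hsub).div ?_ fun y hy => (wt_pos (hsub hy)).ne'
    exact continuousOn_id.div (by fun_prop) fun y _ => by positivity
  obtain ⟨c₁, hc₁, C₁, hC₁, hAB⟩ : ∃ c₁ > 0, ∃ C₁ > 0, ∀ y ∈ Icc a b,
      c₁ * wt y ≤ scal Q y ∧ scal Q y ≤ C₁ * wt y := by
    rcases (Icc a b).eq_empty_or_nonempty with he | hne
    · exact ⟨1, one_pos, 1, one_pos, fun y hy => by simp [he] at hy⟩
    · obtain ⟨y₁, hy₁, hmin⟩ := isCompact_Icc.exists_isMinOn hne hcont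
      obtain ⟨y₂, hy₂, hmax⟩ := isCompact_Icc.exists_isMaxOn hne hcont
      have p1 : 0 < y₁ := ha.trans_le hy₁.1
      have p2 : 0 < y₂ := ha.trans_le hy₂.1
      refine ⟨_, div_pos (hQ.scal_pos hg p1) (wt_pos p1), _,
        div_pos (hQ.scal_pos hg p2) (wt_pos p2), fun y hy => ?_⟩
      have p : 0 < wt y := wt_pos (ha.trans_le hy.1)
      exact ⟨(le_div_iff₀ p).1 (hmin hy), (div_le_iff₀ p).1 (hmax hy)⟩
  refine ⟨min (c / 2) (min (1 / 2) c₁), by positivity, max (4 * C) (max 12 C₁), by positivity,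
    fun y hy => ?_⟩
  have hw := (wt_pos hy).le
  rcases lt_or_ge y a with hya | hya
  · obtain ⟨k1, k2⟩ := hA y ⟨hy, hya⟩
    exact ⟨(mul_le_mul_of_nonneg_right (min_le_left _ _) hw).trans k1,
      k2.trans (mul_le_mul_of_nonneg_right (le_max_left _ _) hw)⟩
  rcases le_or_gt b y with hyb | hyb
  · obtain ⟨k1, k2⟩ := hB y hyb
    exact ⟨(mul_le_mul_of_nonneg_right ((min_le_right _ _).trans (min_le_left _ _)) hw).trans k1,
      k2.trans (mul_le_mul_of_nonneg_right ((le_max_left _ _).trans (le_max_right _ _)) hw)⟩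
  · obtain ⟨k1, k2⟩ := hAB y ⟨hya, hyb.le⟩
    exact ⟨(mul_le_mul_of_nonneg_right ((min_le_right _ _).trans (min_le_right _ _)) hw).trans k1,
      k2.trans (mul_le_mul_of_nonneg_right ((le_max_right _ _).trans (le_max_right _ _)) hw)⟩

/-! ### The singular solution `Γ` and the formal inverse -/

theorem hasDerivAt_primitive {f : ℝ → ℝ} {s : Set ℝ} (hs : IsOpen s) (hf : ContinuousOn f s)
    {a y : ℝ} (hy : y ∈ s) (hint : IntervalIntegrable f volume a y) :
    HasDerivAt (fun x => ∫ t in a..x, f t) (f y) y :=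
  intervalIntegral.integral_hasDerivAt_right hint (hf.stronglyMeasurableAtFilter hs y hy)
    (hf.continuousAt (hs.mem_nhds hy))

theorem intervalIntegrable_of_bound {f : ℝ → ℝ} {R C y : ℝ} (hf : ContinuousOn f (Ioo 0 R))
    (hC : ∀ x ∈ Ioo 0 R, |f x| ≤ C) (hy : 0 ≤ y) (hyR : y < R) :
    IntervalIntegrable f volume 0 y := by
  rw [intervalIntegrable_iff_integrableOn_Ioc_of_le hy]
  have hsub : Ioc 0 y ⊆ Ioo 0 R := fun x hx => ⟨hx.1, hx.2.trans_lt hyR⟩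
  refine IntegrableOn.of_bound (C := C) (by simp)
    ((hf.mono hsub).aestronglyMeasurable measurableSet_Ioc) ?_
  filter_upwards [ae_restrict_mem measurableSet_Ioc] with x hx
  exact hC x (hsub hx)

/-- The potential `V = f'(Q)`. -/
def pot (g Q : ℝ → ℝ) (y : ℝ) : ℝ := deriv (nonlin g) (Q y)

theorem IsGroundState.hasDerivAt_scal (hg : IsTarget g) (hQ : IsGroundState g Q) {y : ℝ}
    (hy : 0 < y) : HasDerivAt (scal Q) (nonlin g (Q y) / y) y := by
  have h := hQ.hasDerivAt_comp hg.differentiable hy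
  rw [mul_comm] at h
  refine h.congr_of_eventuallyEq ?_
  filter_upwards [lt_mem_nhds hy] with x hx
  exact hQ.scal_eq hx

theorem IsGroundState.scal_scal (hg : IsTarget g) (hQ : IsGroundState g Q) {y : ℝ}
    (hy : 0 < y) : scal (scal Q) y = nonlin g (Q y) := by
  rw [scal, (hQ.hasDerivAt_scal hg hy).deriv]; field_simp

theorem IsGroundState.hasDerivAt_scal_scal (hg : IsTarget g) (hQ : IsGroundState g Q) {y : ℝ}
    (hy : 0 < y) : HasDerivAt (scal (scal Q)) (pot g Q y * scal Q y / y) y := by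
  have h := hQ.hasDerivAt_comp (hg.smooth_nonlin.differentiable (by simp)) hy
  rw [hQ.scal_eq hy]
  refine h.congr_of_eventuallyEq ?_
  filter_upwards [lt_mem_nhds hy] with x hx
  exact hQ.scal_scal hg hx

/-- The primitive entering the definition of `Γ`. -/
def gamInt (Q : ℝ → ℝ) (y : ℝ) : ℝ := ∫ x in (1 : ℝ)..y, 1 / (x * scal Q x ^ 2)

theorem Gam_eq (y : ℝ) : Gam Q y = scal Q y * gamInt Q y := rfl

theorem IsGroundState.continuousOn_gamInt_integrand (hg : IsTarget g) (hQ : IsGroundState g Q) :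
    ContinuousOn (fun x => 1 / (x * scal Q x ^ 2)) (Ioi 0) := by
  refine continuousOn_const.div (continuousOn_id.mul ((hQ.continuousOn_scal hg).pow 2)) ?_
  intro x hx
  have := hQ.scal_pos hg hx
  have hx : 0 < x := hx
  positivity

theorem uIcc_one_subset {y : ℝ} (hy : 0 < y) : uIcc 1 y ⊆ Ioi 0 := by
  intro x hx
  rcases le_total 1 y with h | h
  · rw [uIcc_of_le h] at hx; exact one_pos.trans_le hx.1
  · rw [uIcc_of_ge h] at hx; exact hy.trans_le hx.1

theorem IsGroundState.hasDerivAt_gamInt (hg : IsTarget g) (hQ : IsGroundState g Q) {y : ℝ}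
    (hy : 0 < y) : HasDerivAt (gamInt Q) (1 / (y * scal Q y ^ 2)) y := by
  have hc := hQ.continuousOn_gamInt_integrand hg
  exact hasDerivAt_primitive isOpen_Ioi hc hy
    ((hc.mono (uIcc_one_subset hy)).intervalIntegrable)

theorem IsGroundState.hasDerivAt_Gam (hg : IsTarget g) (hQ : IsGroundState g Q) {y : ℝ}
    (hy : 0 < y) : HasDerivAt (Gam Q)
      ((scal (scal Q) y * gamInt Q y + 1 / scal Q y) / y) y := by
  have h := (hQ.hasDerivAt_scal hg hy).mul (hQ.hasDerivAt_gamInt hg hy)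
  refine h.congr_deriv ?_
  have := (hQ.scal_pos hg hy).ne'
  rw [hQ.scal_scal hg hy]
  field_simp

theorem IsGroundState.scal_Gam (hg : IsTarget g) (hQ : IsGroundState g Q) {y : ℝ}
    (hy : 0 < y) : scal (Gam Q) y = scal (scal Q) y * gamInt Q y + 1 / scal Q y := by
  rw [scal, (hQ.hasDerivAt_Gam hg hy).deriv]; field_simp

theorem IsGroundState.hasDerivAt_Gam' (hg : IsTarget g) (hQ : IsGroundState g Q) {y : ℝ}
    (hy : 0 < y) : HasDerivAt (Gam Q) (scal (Gam Q) y / y) y := by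
  rw [hQ.scal_Gam hg hy]; exact hQ.hasDerivAt_Gam hg hy

theorem IsGroundState.hasDerivAt_scal' (hg : IsTarget g) (hQ : IsGroundState g Q) {y : ℝ}
    (hy : 0 < y) : HasDerivAt (scal Q) (scal (scal Q) y / y) y := by
  rw [hQ.scal_scal hg hy]; exact hQ.hasDerivAt_scal hg hy

theorem IsGroundState.hasDerivAt_scal_Gam (hg : IsTarget g) (hQ : IsGroundState g Q) {y : ℝ}
    (hy : 0 < y) : HasDerivAt (scal (Gam Q)) (pot g Q y * Gam Q y / y) y := by
  have hp := (hQ.scal_pos hg hy).ne'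
  have h := ((hQ.hasDerivAt_scal_scal hg hy).mul (hQ.hasDerivAt_gamInt hg hy)).add
    ((hQ.hasDerivAt_scal' hg hy).inv hp)
  have h2 : scal (Gam Q) =ᶠ[𝓝 y] scal (scal Q) * gamInt Q + (scal Q)⁻¹ := by
    filter_upwards [lt_mem_nhds hy] with x hx
    rw [hQ.scal_Gam hg hx]
    simp [one_div]
  refine (h.congr_of_eventuallyEq h2).congr_deriv ?_
  rw [Gam_eq]
  field_simp
  ring

/-- The normalization of `Γ` by reduction of order. It makes the variation of parameters formula an
exact right inverse of `H`. -/
theorem IsGroundState.wronskian (hg : IsTarget g) (hQ : IsGroundState g Q) {y : ℝ}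
    (hy : 0 < y) : scal (Gam Q) y * scal Q y - Gam Q y * scal (scal Q) y = 1 := by
  have hp := (hQ.scal_pos hg hy).ne'
  rw [hQ.scal_Gam hg hy, Gam_eq]
  field_simp
  ring

/-- Near the origin `ΛQ` is of size `y`, so the integrand is of size `y^{-3}` and the integral from
`1` behaves like `-1/y²`. For `y ≥ 1` the integrand is `O(y)`. -/
theorem IsGroundState.exists_gamInt_bounds (hg : IsTarget g) (hQ : IsGroundState g Q) :
    ∃ A > 0, ∃ k > 0, (∀ y, 0 < y → |gamInt Q y| ≤ A * (1 + y ^ 2) ^ 2 / y ^ 2) ∧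
      ∀ y, 0 < y → y ≤ 1 / 2 → k / y ^ 2 ≤ |gamInt Q y| := by
  obtain ⟨c, hc, C, hC, hb⟩ := hQ.exists_scal_bounds hg
  have hup : ∀ y, 0 < y → 1 / (y * scal Q y ^ 2) ≤ c⁻¹ ^ 2 * (1 + y ^ 2) ^ 2 / y ^ 3 := by
    intro y hy
    have h1 := (hb y hy).1
    have hw := wt_pos hy
    calc 1 / (y * scal Q y ^ 2) ≤ 1 / (y * (c * wt y) ^ 2) := by gcongr
      _ = _ := by unfold wt; field_simp
  have hlow : ∀ y, 0 < y → C⁻¹ ^ 2 / y ^ 3 ≤ 1 / (y * scal Q y ^ 2) := by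
    intro y hy
    have h1 := (hb y hy).2
    have hp := hQ.scal_pos hg hy
    have hw : wt y ≤ y := div_le_self hy.le (by nlinarith)
    calc C⁻¹ ^ 2 / y ^ 3 = 1 / (y * (C * y) ^ 2) := by field_simp
      _ ≤ 1 / (y * scal Q y ^ 2) := by
        gcongr
        exact h1.trans (by gcongr)
  have hone : gamInt Q 1 = 0 := by simp [gamInt]
  -- Adding `σ/(2x²)` subtracts `σ/y³` from the derivative. A large `σ` gives an antitone function,
  -- a small one a monotone function, and these are the two sides of the estimate on `(0, 1]`.
  have hder : ∀ σ : ℝ, ∀ y, 0 < y → HasDerivAt (fun x => gamInt Q x + σ / 2 * (x ^ 2)⁻¹)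
      (1 / (y * scal Q y ^ 2) - σ / y ^ 3) y := by
    intro σ y hy
    have h := (hQ.hasDerivAt_gamInt hg hy).add
      ((((hasDerivAt_pow 2 y).inv (by positivity))).const_mul (σ / 2))
    refine h.congr_deriv ?_
    simp
    field_simp
    ring
  have hint : interior (Ioc (0 : ℝ) 1) = Ioo 0 1 := interior_Ioc
  have hanti : AntitoneOn (fun x => gamInt Q x + 4 * c⁻¹ ^ 2 / 2 * (x ^ 2)⁻¹) (Ioc 0 1) := by
    refine antitoneOn_of_deriv_nonpos (convex_Ioc _ _)
      (fun y hy => (hder _ y hy.1).continuousAt.continuousWithinAt)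
      (fun y hy => (hder _ y (hint ▸ hy).1).differentiableAt.differentiableWithinAt) ?_
    intro y hy
    rw [hint] at hy
    rw [(hder _ y hy.1).deriv]
    have h1 := hup y hy.1
    have h2 : c⁻¹ ^ 2 * (1 + y ^ 2) ^ 2 / y ^ 3 ≤ 4 * c⁻¹ ^ 2 / y ^ 3 := by
      have : 0 < y := hy.1
      rw [mul_comm 4]
      gcongr
      have : (1 + y ^ 2) ≤ 2 := by nlinarith [hy.1, hy.2]
      nlinarith [sq_nonneg y]
    linarith
  have hmono : MonotoneOn (fun x => gamInt Q x + C⁻¹ ^ 2 / 2 * (x ^ 2)⁻¹) (Ioc 0 1) := by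
    refine monotoneOn_of_deriv_nonneg (convex_Ioc _ _)
      (fun y hy => (hder _ y hy.1).continuousAt.continuousWithinAt)
      (fun y hy => (hder _ y (hint ▸ hy).1).differentiableAt.differentiableWithinAt) ?_
    intro y hy
    rw [hint] at hy
    rw [(hder _ y hy.1).deriv]
    linarith [hlow y hy.1]
  have hm1 : (1 : ℝ) ∈ Ioc (0 : ℝ) 1 := ⟨one_pos, le_rfl⟩
  refine ⟨4 * c⁻¹ ^ 2, by positivity, C⁻¹ ^ 2 / 4, by positivity, ?_, ?_⟩
  · intro y hy
    rcases le_total y 1 with h | h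
    · have h1 := hanti ⟨hy, h⟩ hm1 h
      have h2 := hmono ⟨hy, h⟩ hm1 h
      simp only [hone, one_pow, inv_one] at h1 h2
      have e0 : 1 ≤ (y ^ 2)⁻¹ := one_le_inv₀ (by positivity) |>.2 (by nlinarith)
      have e1 : C⁻¹ ^ 2 / 2 * 1 ≤ C⁻¹ ^ 2 / 2 * (y ^ 2)⁻¹ := by gcongr
      have e2 : (y ^ 2)⁻¹ ≤ (1 + y ^ 2) ^ 2 / y ^ 2 := by
        rw [div_eq_mul_inv]
        exact le_mul_of_one_le_left (by positivity) (by nlinarith)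
      have e3 : 4 * c⁻¹ ^ 2 * (y ^ 2)⁻¹ ≤ 4 * c⁻¹ ^ 2 * ((1 + y ^ 2) ^ 2 / y ^ 2) := by gcongr
      have e4 : 0 ≤ 4 * c⁻¹ ^ 2 * (y ^ 2)⁻¹ := by positivity
      have e5 : 0 ≤ c⁻¹ ^ 2 := by positivity
      rw [mul_div_assoc, abs_le]
      constructor <;> linarith
    · have h1 : ∀ x ∈ uIoc 1 y, ‖1 / (x * scal Q x ^ 2)‖ ≤ 4 * c⁻¹ ^ 2 * y := by
        intro x hx
        rw [uIoc_of_le h] at hx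
        have hx0 : 0 < x := one_pos.trans hx.1
        have := hQ.scal_pos hg hx0
        rw [Real.norm_of_nonneg (by positivity)]
        refine (hup x hx0).trans ?_
        rw [div_le_iff₀ (by positivity)]
        have e1 : (1 + x ^ 2) ^ 2 ≤ 4 * (x * x ^ 3) := by
          nlinarith [hx.1, sq_nonneg (x - 1), mul_pos hx0 hx0, mul_pos (mul_pos hx0 hx0) hx0]
        have e2 : x * x ^ 3 ≤ y * x ^ 3 := by gcongr; exact hx.2
        calc c⁻¹ ^ 2 * (1 + x ^ 2) ^ 2 ≤ c⁻¹ ^ 2 * (4 * (y * x ^ 3)) := by gcongr; linarith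
          _ = _ := by ring
      have h2 := intervalIntegral.norm_integral_le_of_norm_le_const h1
      rw [Real.norm_eq_abs, abs_of_nonneg (by linarith : 0 ≤ y - 1)] at h2
      refine h2.trans ?_
      rw [le_div_iff₀ (by positivity)]
      have : y * (y - 1) * y ^ 2 ≤ (1 + y ^ 2) ^ 2 := by
        nlinarith [mul_pos hy hy, mul_pos (mul_pos hy hy) hy]
      calc 4 * c⁻¹ ^ 2 * y * (y - 1) * y ^ 2 = 4 * c⁻¹ ^ 2 * (y * (y - 1) * y ^ 2) := by ring
        _ ≤ _ := by gcongr
  · intro y hy h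
    have h2 := hmono ⟨hy, by linarith⟩ hm1 (by linarith)
    simp only [hone, one_pow, inv_one] at h2
    have e0 : 4 ≤ (y ^ 2)⁻¹ := by
      rw [le_inv_comm₀ (by norm_num) (by positivity)]; norm_num; nlinarith
    have e1 : C⁻¹ ^ 2 / 4 * 4 ≤ C⁻¹ ^ 2 / 4 * (y ^ 2)⁻¹ := by gcongr
    rw [le_abs]
    right
    rw [div_eq_mul_inv]
    have e3 : 0 < C⁻¹ ^ 2 := by positivity
    linarith

/-- `Γ` and `Λ Γ` are bounded by a multiple of `y + 1 / y`. -/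
theorem IsGroundState.exists_Gam_bounds (hg : IsTarget g) (hQ : IsGroundState g Q) :
    ∃ C > 0, ∀ y, 0 < y → |Gam Q y| ≤ C * ((1 + y ^ 2) / y) ∧
      |scal (Gam Q) y| ≤ C * ((1 + y ^ 2) / y) := by
  obtain ⟨c, hc, C, hC, hb⟩ := hQ.exists_scal_bounds hg
  obtain ⟨A, hA, k, hk, hI, -⟩ := hQ.exists_gamInt_bounds hg
  obtain ⟨G, hG⟩ := hg.exists_deriv_bound
  have hprod : ∀ y, 0 < y → |scal Q y * gamInt Q y| ≤ C * A * ((1 + y ^ 2) / y) := by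
    intro y hy
    have hp := hQ.scal_pos hg hy
    rw [abs_mul, abs_of_pos hp]
    calc scal Q y * |gamInt Q y| ≤ (C * wt y) * (A * (1 + y ^ 2) ^ 2 / y ^ 2) := by
          have := wt_pos hy
          gcongr
          · exact (hb y hy).2
          · exact hI y hy
      _ = _ := by unfold wt; field_simp
  refine ⟨C * A + (G * (C * A) + c⁻¹), by positivity, fun y hy => ⟨?_, ?_⟩⟩
  · refine (hprod y hy).trans ?_
    gcongr
    have : 0 ≤ G * (C * A) + c⁻¹ := by positivity
    linarith
  · rw [hQ.scal_Gam hg hy, hQ.scal_scal hg hy, nonlin, ← hQ.scal_eq hy]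
    have h1 : |deriv g (Q y)| ≤ G := by
      have := hG (Q y)
      rw [← NNReal.coe_le_coe, coe_nnnorm] at this
      exact this
    have hp := hQ.scal_pos hg hy
    have h2 : 1 / scal Q y ≤ c⁻¹ * ((1 + y ^ 2) / y) := by
      have hw := wt_pos hy
      calc 1 / scal Q y ≤ 1 / (c * wt y) := by gcongr; exact (hb y hy).1
        _ = _ := by unfold wt; field_simp
    calc |scal Q y * deriv g (Q y) * gamInt Q y + 1 / scal Q y|
        ≤ |scal Q y * deriv g (Q y) * gamInt Q y| + |1 / scal Q y| := abs_add_le _ _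
      _ = |deriv g (Q y)| * |scal Q y * gamInt Q y| + 1 / scal Q y := by
          rw [← abs_mul, abs_of_pos (show 0 < 1 / scal Q y by positivity)]
          congr 2; ring
      _ ≤ G * (C * A * ((1 + y ^ 2) / y)) + c⁻¹ * ((1 + y ^ 2) / y) := by
          gcongr
          exact hprod y hy
      _ ≤ _ := by
          have : 0 ≤ C * A * ((1 + y ^ 2) / y) := by positivity
          linarith

/-- `Γ` is not square integrable at the origin. -/
theorem IsGroundState.exists_Gam_lower (hg : IsTarget g) (hQ : IsGroundState g Q) :
    ∃ c > 0, ∀ y, 0 < y → y ≤ 1 / 2 → c / y ≤ |Gam Q y| := by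
  obtain ⟨c, hc, C, hC, hb⟩ := hQ.exists_scal_bounds hg
  obtain ⟨A, hA, k, hk, -, hI⟩ := hQ.exists_gamInt_bounds hg
  refine ⟨c * k / 2, by positivity, fun y hy h => ?_⟩
  rw [Gam_eq, abs_mul, abs_of_pos (hQ.scal_pos hg hy)]
  have hw : y / 2 ≤ wt y := by
    unfold wt; rw [div_le_div_iff₀ (by norm_num) (by positivity)]; nlinarith
  calc c * k / 2 / y = (c * (y / 2)) * (k / y ^ 2) := by field_simp
    _ ≤ scal Q y * |gamInt Q y| := by
        gcongr
        · exact (hQ.scal_pos hg hy).le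
        · exact (by gcongr : c * (y / 2) ≤ c * wt y).trans (hb y hy).1
        · exact hI y hy h

/-- The inverse of `H` with the second integral based at `a`. -/
def invHFrom (Q : ℝ → ℝ) (a : ℝ) (F : ℝ → ℝ) (y : ℝ) : ℝ :=
  -Gam Q y * (∫ x in (0 : ℝ)..y, F x * scal Q x * x)
    + scal Q y * ∫ x in a..y, F x * Gam Q x * x

/-- The scaling derivative of `invHFrom`. -/
def scalInvHFrom (Q : ℝ → ℝ) (a : ℝ) (F : ℝ → ℝ) (y : ℝ) : ℝ :=
  -scal (Gam Q) y * (∫ x in (0 : ℝ)..y, F x * scal Q x * x)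
    + scal (scal Q) y * ∫ x in a..y, F x * Gam Q x * x

theorem IsGroundState.continuousOn_Gam (hg : IsTarget g) (hQ : IsGroundState g Q) :
    ContinuousOn (Gam Q) (Ioi 0) :=
  fun _ hy => (hQ.hasDerivAt_Gam hg hy).continuousAt.continuousWithinAt

section
variable (hg : IsTarget g) (hQ : IsGroundState g Q) {F : ℝ → ℝ} {R a y : ℝ}
include hg hQ

theorem continuousOn_mul_scal (hF : ContinuousOn F (Ioo 0 R)) :
    ContinuousOn (fun x => F x * scal Q x * x) (Ioo 0 R) :=
  (hF.mul ((hQ.continuousOn_scal hg).mono fun _ hx => hx.1)).mul continuousOn_id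

theorem continuousOn_mul_Gam (hF : ContinuousOn F (Ioo 0 R)) :
    ContinuousOn (fun x => F x * Gam Q x * x) (Ioo 0 R) :=
  (hF.mul ((hQ.continuousOn_Gam hg).mono fun _ hx => hx.1)).mul continuousOn_id

/-- Variation of parameters: the two terms from differentiating the integrals, `∓ F Γ ΛQ y`, cancel,
so one derivative falls only on `Γ` and `ΛQ`. For the second derivative the Wronskian produces the
source. -/
theorem hasDerivAt_invHFrom (hF : ContinuousOn F (Ioo 0 R)) (hy : y ∈ Ioo 0 R)
    (h1 : IntervalIntegrable (fun x => F x * scal Q x * x) volume 0 y)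
    (h2 : IntervalIntegrable (fun x => F x * Gam Q x * x) volume a y) :
    HasDerivAt (invHFrom Q a F) (scalInvHFrom Q a F y / y) y := by
  have e1 := hasDerivAt_primitive isOpen_Ioo (continuousOn_mul_scal hg hQ hF) hy h1
  have e2 := hasDerivAt_primitive isOpen_Ioo (continuousOn_mul_Gam hg hQ hF) hy h2
  have := ((hQ.hasDerivAt_Gam' hg hy.1).neg.mul e1).add ((hQ.hasDerivAt_scal' hg hy.1).mul e2)
  refine this.congr_deriv ?_
  have hy0 := hy.1.ne'
  simp only [scalInvHFrom, Pi.neg_apply]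
  field_simp
  ring

theorem hasDerivAt_scalInvHFrom (hF : ContinuousOn F (Ioo 0 R)) (hy : y ∈ Ioo 0 R)
    (h1 : IntervalIntegrable (fun x => F x * scal Q x * x) volume 0 y)
    (h2 : IntervalIntegrable (fun x => F x * Gam Q x * x) volume a y) :
    HasDerivAt (scalInvHFrom Q a F) ((pot g Q y * invHFrom Q a F y - y ^ 2 * F y) / y) y := by
  have e1 := hasDerivAt_primitive isOpen_Ioo (continuousOn_mul_scal hg hQ hF) hy h1
  have e2 := hasDerivAt_primitive isOpen_Ioo (continuousOn_mul_Gam hg hQ hF) hy h2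
  have := ((hQ.hasDerivAt_scal_Gam hg hy.1).neg.mul e1).add
    ((hQ.hasDerivAt_scal_scal hg hy.1).mul e2)
  refine this.congr_deriv ?_
  have hy0 := hy.1.ne'
  have hw := hQ.wronskian hg hy.1
  simp only [invHFrom, Pi.neg_apply]
  rw [eq_div_iff hy0]
  field_simp
  linear_combination (-(F y * y ^ 2)) * hw

/-- Size of the integrals defining `H⁻¹ F` for `F = O(y ^ n)`. -/
theorem exists_invH_integral_bounds (R : ℝ) : ∃ C > 0, ∀ (n : ℕ) (F : ℝ → ℝ) (A : ℝ), 0 ≤ A →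
    ContinuousOn F (Ioo 0 R) → (∀ x ∈ Ioo 0 R, |F x| ≤ A * x ^ n) → ∀ y ∈ Ioo 0 R,
    IntervalIntegrable (fun x => F x * scal Q x * x) volume 0 y ∧
    IntervalIntegrable (fun x => F x * Gam Q x * x) volume 0 y ∧
    |∫ x in (0 : ℝ)..y, F x * scal Q x * x| ≤ C * A * y ^ (n + 3) ∧
    |∫ x in (0 : ℝ)..y, F x * Gam Q x * x| ≤ C * A * y ^ (n + 1) := by
  obtain ⟨_, _, C, hC, hb⟩ := hQ.exists_scal_bounds hg
  obtain ⟨C', hC', hb'⟩ := hQ.exists_Gam_bounds hg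
  refine ⟨C + C' * (1 + R ^ 2), by positivity, fun n F A hA hF hFA y hy => ?_⟩
  have p1 : ∀ x ∈ Ioo 0 R, |F x * scal Q x * x| ≤ C * A * x ^ (n + 2) := by
    intro x hx
    have hx0 : 0 < x := hx.1
    have hw : wt x ≤ x := div_le_self hx0.le (by nlinarith)
    have hp := hQ.scal_pos hg hx0
    rw [abs_mul, abs_mul, abs_of_pos hp, abs_of_pos hx0]
    calc |F x| * scal Q x * x ≤ (A * x ^ n) * (C * x) * x := by
          gcongr
          · exact hFA x hx
          · exact (hb x hx0).2.trans (by gcongr)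
      _ = _ := by ring
  have p2 : ∀ x ∈ Ioo 0 R, |F x * Gam Q x * x| ≤ C' * (1 + R ^ 2) * A * x ^ n := by
    intro x hx
    have hx0 : 0 < x := hx.1
    rw [abs_mul, abs_mul, abs_of_pos hx0]
    calc |F x| * |Gam Q x| * x ≤ (A * x ^ n) * (C' * ((1 + x ^ 2) / x)) * x := by
          gcongr
          · exact hFA x hx
          · exact (hb' x hx0).1
      _ = C' * (1 + x ^ 2) * A * x ^ n := by field_simp
      _ ≤ _ := by gcongr; exact hx.2.le
  have hR : 0 < R := hy.1.trans hy.2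
  have q1 : ∀ x ∈ Ioo 0 R, ∀ z, x ≤ z → |F x * scal Q x * x| ≤ C * A * z ^ (n + 2) :=
    fun x hx z hz => (p1 x hx).trans (by have := hx.1.le; gcongr)
  have q2 : ∀ x ∈ Ioo 0 R, ∀ z, x ≤ z → |F x * Gam Q x * x| ≤ C' * (1 + R ^ 2) * A * z ^ n :=
    fun x hx z hz => (p2 x hx).trans (by have := hx.1.le; gcongr)
  refine ⟨intervalIntegrable_of_bound (continuousOn_mul_scal hg hQ hF)
      (fun x hx => q1 x hx R hx.2.le) hy.1.le hy.2,
    intervalIntegrable_of_bound (continuousOn_mul_Gam hg hQ hF)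
      (fun x hx => q2 x hx R hx.2.le) hy.1.le hy.2, ?_, ?_⟩
  · have := intervalIntegral.norm_integral_le_of_norm_le_const (a := 0) (b := y)
      (f := fun x => F x * scal Q x * x) (C := C * A * y ^ (n + 2)) (fun x hx => by
        rw [uIoc_of_le hy.1.le] at hx
        exact q1 x ⟨hx.1, hx.2.trans_lt hy.2⟩ y hx.2)
    rw [Real.norm_eq_abs, sub_zero, abs_of_pos hy.1] at this
    refine this.trans ?_
    have hy0 := hy.1.le
    have : 0 ≤ C' * (1 + R ^ 2) * A * y ^ (n + 3) := by positivity
    calc C * A * y ^ (n + 2) * y = C * A * y ^ (n + 3) := by ring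
      _ ≤ _ := by linarith
  · have := intervalIntegral.norm_integral_le_of_norm_le_const (a := 0) (b := y)
      (f := fun x => F x * Gam Q x * x) (C := C' * (1 + R ^ 2) * A * y ^ n) (fun x hx => by
        rw [uIoc_of_le hy.1.le] at hx
        exact q2 x ⟨hx.1, hx.2.trans_lt hy.2⟩ y hx.2)
    rw [Real.norm_eq_abs, sub_zero, abs_of_pos hy.1] at this
    refine this.trans ?_
    have hy0 := hy.1.le
    have : 0 ≤ C * A * y ^ (n + 1) := by positivity
    calc C' * (1 + R ^ 2) * A * y ^ n * y = C' * (1 + R ^ 2) * A * y ^ (n + 1) := by ring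
      _ ≤ _ := by linarith

/-- `H⁻¹` gains two powers of `y`. -/
theorem exists_invH_bounds (R : ℝ) : ∃ C > 0, ∀ (n : ℕ) (F : ℝ → ℝ) (A : ℝ), 0 ≤ A →
    ContinuousOn F (Ioo 0 R) → (∀ x ∈ Ioo 0 R, |F x| ≤ A * x ^ n) → ∀ y ∈ Ioo 0 R,
    |invH Q F y| ≤ C * A * y ^ (n + 2) ∧ |scalInvHFrom Q 0 F y| ≤ C * A * y ^ (n + 2) := by
  obtain ⟨_, _, C, hC, hb⟩ := hQ.exists_scal_bounds hg
  obtain ⟨C', hC', hb'⟩ := hQ.exists_Gam_bounds hg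
  obtain ⟨D, hD, hi⟩ := exists_invH_integral_bounds hg hQ R
  obtain ⟨G, hG⟩ := hg.exists_deriv_bound
  -- `invH` and its scaling derivative are the same bilinear expression, in `(Γ, ΛQ)` and in `(ΛΓ,
  -- Λ²Q)`. Both pairs satisfy the same bounds, so one estimate covers both.
  have key : ∀ (A y u v p q : ℝ) (n : ℕ), 0 ≤ A → y ∈ Ioo 0 R → |u| ≤ C' * ((1 + y ^ 2) / y) →
      |v| ≤ (C + G * C) * y → |p| ≤ D * A * y ^ (n + 3) → |q| ≤ D * A * y ^ (n + 1) →
      |-u * p + v * q| ≤ (C' * (1 + R ^ 2) * D + (C + G * C) * D) * A * y ^ (n + 2) := by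
    intro A y u v p q n hA hy hu hv hp hq
    have hy0 : 0 < y := hy.1
    calc |-u * p + v * q| ≤ |-u * p| + |v * q| := abs_add_le _ _
      _ = |u| * |p| + |v| * |q| := by rw [abs_mul, abs_mul, abs_neg]
      _ ≤ (C' * ((1 + y ^ 2) / y)) * (D * A * y ^ (n + 3)) +
          ((C + G * C) * y) * (D * A * y ^ (n + 1)) := by gcongr
      _ = C' * (1 + y ^ 2) * D * A * y ^ (n + 2) + (C + G * C) * D * A * y ^ (n + 2) := by
          field_simp
          ring
      _ ≤ C' * (1 + R ^ 2) * D * A * y ^ (n + 2) + (C + G * C) * D * A * y ^ (n + 2) := by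
          gcongr; exact hy.2.le
      _ = _ := by ring
  refine ⟨C' * (1 + R ^ 2) * D + (C + G * C) * D, by positivity,
    fun n F A hA hF hFA y hy => ?_⟩
  obtain ⟨-, -, b1, b2⟩ := hi n F A hA hF hFA y hy
  have hy0 : 0 < y := hy.1
  have hw : wt y ≤ y := div_le_self hy0.le (by nlinarith)
  have hs : |scal Q y| ≤ C * y := by
    rw [abs_of_pos (hQ.scal_pos hg hy0)]
    exact (hb y hy0).2.trans (by gcongr)
  constructor
  · refine key A y _ _ _ _ n hA hy (hb' y hy0).1 (hs.trans ?_) b1 b2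
    have : 0 ≤ G * C * y := by positivity
    linarith
  · refine key A y _ _ _ _ n hA hy (hb' y hy0).2 ?_ b1 b2
    rw [hQ.scal_scal hg hy0, nonlin, ← hQ.scal_eq hy0, abs_mul]
    have h1 : |deriv g (Q y)| ≤ G := by
      have := hG (Q y)
      rw [← NNReal.coe_le_coe, coe_nnnorm] at this
      exact this
    have : |scal Q y| * |deriv g (Q y)| ≤ (C * y) * G := by gcongr
    have : 0 ≤ C * y := by positivity
    linarith

theorem hasDerivAt_invH {n : ℕ} {A : ℝ} (hA : 0 ≤ A) (hF : ContinuousOn F (Ioo 0 R))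
    (hFA : ∀ x ∈ Ioo 0 R, |F x| ≤ A * x ^ n) (hy : y ∈ Ioo 0 R) :
    HasDerivAt (invH Q F) (scalInvHFrom Q 0 F y / y) y ∧
    HasDerivAt (scalInvHFrom Q 0 F) ((pot g Q y * invH Q F y - y ^ 2 * F y) / y) y := by
  obtain ⟨_, _, hi⟩ := exists_invH_integral_bounds hg hQ R
  obtain ⟨h1, h2, -⟩ := hi n F A hA hF hFA y hy
  exact ⟨hasDerivAt_invHFrom hg hQ hF hy h1 h2, hasDerivAt_scalInvHFrom hg hQ hF hy h1 h2⟩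

end

/-- `H F` in terms of the scaling derivative. -/
theorem opH_eq_of_hasDerivAt {F F₁ : ℝ → ℝ} {d y : ℝ} (hy : 0 < y)
    (h1 : ∀ᶠ x in 𝓝 y, HasDerivAt F (F₁ x / x) x) (h2 : HasDerivAt F₁ (d / y) y) :
    opH g Q F y = (pot g Q y * F y - d) / y ^ 2 := by
  have e1 : deriv F =ᶠ[𝓝 y] fun x => F₁ x / x := h1.mono fun x hx => hx.deriv
  have e2 : deriv (deriv F) y = (d / y * y - F₁ y * 1) / y ^ 2 := by
    rw [e1.deriv_eq]
    exact (h2.div (hasDerivAt_id y) hy.ne').deriv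
  rw [opH, lap, e2, e1.self_of_nhds, pot]
  field_simp
  ring

theorem opH_invHFrom (hg : IsTarget g) (hQ : IsGroundState g Q) {F : ℝ → ℝ} {R a y : ℝ}
    (hF : ContinuousOn F (Ioo 0 R)) (hy : y ∈ Ioo 0 R)
    (h1 : ∀ y ∈ Ioo 0 R, IntervalIntegrable (fun x => F x * scal Q x * x) volume 0 y)
    (h2 : ∀ y ∈ Ioo 0 R, IntervalIntegrable (fun x => F x * Gam Q x * x) volume a y) :
    opH g Q (invHFrom Q a F) y = F y := by
  rw [opH_eq_of_hasDerivAt hy.1 (F₁ := scalInvHFrom Q a F)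
    (d := pot g Q y * invHFrom Q a F y - y ^ 2 * F y)]
  · have := hy.1.ne'
    field_simp
    ring
  · filter_upwards [isOpen_Ioo.mem_nhds hy] with x hx
    exact hasDerivAt_invHFrom hg hQ hF hx (h1 x hx) (h2 x hx)
  · exact hasDerivAt_scalInvHFrom hg hQ hF hy (h1 y hy) (h2 y hy)

theorem opH_invH (hg : IsTarget g) (hQ : IsGroundState g Q) {F : ℝ → ℝ} {R y A : ℝ} {n : ℕ}
    (hA : 0 ≤ A) (hF : ContinuousOn F (Ioo 0 R)) (hFA : ∀ x ∈ Ioo 0 R, |F x| ≤ A * x ^ n)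
    (hy : y ∈ Ioo 0 R) : opH g Q (invH Q F) y = F y := by
  obtain ⟨_, _, hi⟩ := exists_invH_integral_bounds hg hQ R
  exact opH_invHFrom hg hQ hF hy (fun y hy => (hi n F A hA hF hFA y hy).1)
    fun y hy => (hi n F A hA hF hFA y hy).2.1

theorem opH_scal (hg : IsTarget g) (hQ : IsGroundState g Q) {y : ℝ} (hy : 0 < y) :
    opH g Q (scal Q) y = 0 := by
  rw [opH_eq_of_hasDerivAt hy (F₁ := scal (scal Q)) (d := pot g Q y * scal Q y)]
  · simp
  · filter_upwards [lt_mem_nhds hy] with x hx using hQ.hasDerivAt_scal' hg hx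
  · exact hQ.hasDerivAt_scal_scal hg hy

/-! ### Functions with symbol bounds in the scaling derivative -/

/-- The scaling derivatives of `F` of order at most `n` are `O(y ^ a)` on `(0, R)`. -/
def SymOn (R : ℝ) : ℕ → ℤ → (ℝ → ℝ) → Prop
  | 0, a, F => ContinuousOn F (Ioo 0 R) ∧ ∃ C, ∀ y ∈ Ioo 0 R, |F y| ≤ C * y ^ a
  | n + 1, a, F => (∀ y ∈ Ioo 0 R, DifferentiableAt ℝ F y) ∧
      (ContinuousOn F (Ioo 0 R) ∧ ∃ C, ∀ y ∈ Ioo 0 R, |F y| ≤ C * y ^ a) ∧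
      SymOn R n a (scal F)

theorem scal_congr {F G : ℝ → ℝ} {s : Set ℝ} (hs : IsOpen s) (h : EqOn F G s) :
    EqOn (scal F) (scal G) s := fun y hy => by
  rw [scal, scal, (h.eventuallyEq_of_mem (hs.mem_nhds hy)).deriv_eq]

theorem opH_congr {F G : ℝ → ℝ} {s : Set ℝ} (hs : IsOpen s) (h : EqOn F G s) :
    EqOn (opH g Q F) (opH g Q G) s := fun y hy => by
  have h1 : deriv F =ᶠ[𝓝 y] deriv G :=
    (h.eventuallyEq_of_mem (hs.mem_nhds hy)).deriv
  rw [opH, opH, lap, lap, h1.deriv_eq, h1.self_of_nhds, h hy]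

theorem hasDerivAt_of_scal {F : ℝ → ℝ} {y : ℝ} (hy : y ≠ 0) (h : DifferentiableAt ℝ F y) :
    HasDerivAt F (scal F y / y) y := by
  have := h.hasDerivAt
  rwa [show deriv F y = scal F y / y by rw [scal]; field_simp] at this

theorem scal_eq_of_hasDerivAt {F : ℝ → ℝ} {y d : ℝ} (hy : y ≠ 0) (h : HasDerivAt F (d / y) y) :
    scal F y = d := by rw [scal, h.deriv]; field_simp

theorem scal_add {F G : ℝ → ℝ} {y : ℝ} (hF : DifferentiableAt ℝ F y)
    (hG : DifferentiableAt ℝ G y) : scal (fun x => F x + G x) y = scal F y + scal G y := by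
  rw [scal, deriv_fun_add hF hG, scal, scal]; ring

theorem scal_mul {F G : ℝ → ℝ} {y : ℝ} (hF : DifferentiableAt ℝ F y)
    (hG : DifferentiableAt ℝ G y) :
    scal (fun x => F x * G x) y = scal F y * G y + F y * scal G y := by
  rw [scal, deriv_fun_mul hF hG, scal, scal]; ring

theorem scal_const_mul (c : ℝ) (F : ℝ → ℝ) (y : ℝ) :
    scal (fun x => c * F x) y = c * scal F y := by
  rw [scal, deriv_const_mul_field, scal]; ring

namespace SymOn
variable {R : ℝ} {n : ℕ} {a b : ℤ} {F G : ℝ → ℝ}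

theorem zero : ∀ {n : ℕ} {F : ℝ → ℝ}, SymOn R n a F → SymOn R 0 a F
  | 0, _, h => h
  | _ + 1, _, h => h.2.1

theorem pred : ∀ {n : ℕ} {F : ℝ → ℝ}, SymOn R (n + 1) a F → SymOn R n a F
  | 0, _, h => h.2.1
  | _ + 1, _, h => ⟨h.1, h.2.1, pred h.2.2⟩

theorem congr : ∀ {n : ℕ} {F G : ℝ → ℝ}, SymOn R n a F → EqOn F G (Ioo 0 R) → SymOn R n a G
  | 0, _, _, h, e => ⟨h.1.congr e.symm, h.2.imp fun _ hC y hy => by rw [← e hy]; exact hC y hy⟩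
  | _ + 1, _, _, h, e => ⟨fun y hy => (h.1 y hy).congr_of_eventuallyEq
      (e.symm.eventuallyEq_of_mem (isOpen_Ioo.mem_nhds hy)), congr (n := 0) h.2.1 e,
      congr h.2.2 (scal_congr isOpen_Ioo e)⟩

theorem exists_bound (h : SymOn R n a F) : ∃ C ≥ 0, ∀ y ∈ Ioo 0 R, |F y| ≤ C * y ^ a := by
  obtain ⟨C, hC⟩ := h.zero.2
  refine ⟨|C|, abs_nonneg _, fun y hy => (hC y hy).trans ?_⟩
  have := zpow_pos hy.1 a
  gcongr
  exact le_abs_self C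

theorem continuousOn (h : SymOn R n a F) : ContinuousOn F (Ioo 0 R) := h.zero.1

theorem add : ∀ {n : ℕ} {F G : ℝ → ℝ}, SymOn R n a F → SymOn R n a G →
    SymOn R n a (fun y => F y + G y)
  | 0, F, G, hF, hG => by
      obtain ⟨C, hC⟩ := hF.2
      obtain ⟨D, hD⟩ := hG.2
      refine ⟨hF.1.add hG.1, C + D, fun y hy => ?_⟩
      have := abs_add_le (F y) (G y)
      linarith [hC y hy, hD y hy]
  | n + 1, F, G, hF, hG => ⟨fun y hy => (hF.1 y hy).add (hG.1 y hy), add (n := 0) hF.2.1 hG.2.1,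
      (add hF.2.2 hG.2.2).congr fun y hy => (scal_add (hF.1 y hy) (hG.1 y hy)).symm⟩

theorem const_mul (c : ℝ) : ∀ {n : ℕ} {F : ℝ → ℝ}, SymOn R n a F →
    SymOn R n a (fun y => c * F y)
  | 0, F, hF => by
      obtain ⟨C, hC⟩ := hF.2
      refine ⟨continuousOn_const.mul hF.1, |c| * C, fun y hy => ?_⟩
      rw [abs_mul, mul_assoc]
      exact mul_le_mul_of_nonneg_left (hC y hy) (abs_nonneg c)
  | n + 1, F, hF => ⟨fun y hy => (hF.1 y hy).const_mul c, const_mul c (n := 0) hF.2.1,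
      (const_mul c hF.2.2).congr fun y _ => (scal_const_mul c F y).symm⟩

theorem neg (h : SymOn R n a F) : SymOn R n a (fun y => -F y) :=
  (h.const_mul (-1)).congr fun _ _ => by simp

theorem sub (hF : SymOn R n a F) (hG : SymOn R n a G) : SymOn R n a (fun y => F y - G y) :=
  (hF.add hG.neg).congr fun _ _ => by simp [sub_eq_add_neg]

theorem mul : ∀ {n : ℕ} {F G : ℝ → ℝ}, SymOn R n a F → SymOn R n b G →
    SymOn R n (a + b) (fun y => F y * G y)
  | 0, F, G, hF, hG => by
      obtain ⟨C, hC0, hC⟩ := hF.exists_bound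
      obtain ⟨D, hD0, hD⟩ := hG.exists_bound
      refine ⟨hF.1.mul hG.1, C * D, fun y hy => ?_⟩
      have hy0 : 0 < y := hy.1
      rw [abs_mul, zpow_add₀ hy0.ne']
      calc |F y| * |G y| ≤ (C * y ^ a) * (D * y ^ b) := by
            gcongr
            · exact hC y hy
            · exact hD y hy
        _ = _ := by ring
  | n + 1, F, G, hF, hG => ⟨fun y hy => (hF.1 y hy).mul (hG.1 y hy), mul (n := 0) hF.2.1 hG.2.1,
      ((mul hF.2.2 hG.pred).add (mul hF.pred hG.2.2)).congr fun y hy =>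
        (scal_mul (hF.1 y hy) (hG.1 y hy)).symm⟩

theorem zpow (a : ℤ) : ∀ n : ℕ, SymOn R n a (fun y => y ^ a)
  | 0 => ⟨continuousOn_id.zpow₀ a fun y hy => Or.inl hy.1.ne', 1, fun y hy => by
      rw [one_mul, abs_of_pos (zpow_pos hy.1 a)]⟩
  | n + 1 => ⟨fun y hy => differentiableAt_zpow.2 (Or.inl hy.1.ne'), zpow a 0,
      ((zpow a n).const_mul a).congr fun y hy => by
        have : y ≠ 0 := hy.1.ne'
        rw [scal, deriv_zpow, zpow_sub_one₀ this]
        field_simp⟩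

theorem const (c : ℝ) (n : ℕ) : SymOn R n 0 (fun _ => c) :=
  ((zpow 0 n).const_mul c).congr fun y _ => by simp

/-- On the bounded interval `(0, R)` the function `y^k` is also a symbol of order `0`. Writing `F =
y^{-k} F y^k` lowers the order by `k`. -/
theorem weaken (h : SymOn R n a F) (hab : b ≤ a) : SymOn R n b F := by
  obtain ⟨k, rfl⟩ := Int.le.dest hab
  have hk : SymOn R n 0 (fun y : ℝ => y ^ (k : ℤ)) := by
    clear h hab
    have : ∀ n : ℕ, SymOn R n 0 (fun y : ℝ => y ^ (k : ℤ)) := by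
      intro n
      induction n with
      | zero =>
        refine ⟨(zpow (k : ℤ) 0).1, R ^ k, fun y hy => ?_⟩
        rw [abs_of_pos (zpow_pos hy.1 _), zpow_zero, mul_one, zpow_natCast]
        exact pow_le_pow_left₀ hy.1.le hy.2.le k
      | succ n ih =>
        refine ⟨(zpow (k : ℤ) 1).1, ih.zero, (ih.const_mul k).congr fun y hy => ?_⟩
        have : y ≠ 0 := hy.1.ne'
        rw [scal, deriv_zpow, zpow_sub_one₀ this]
        push_cast
        field_simp
    exact this n
  have h2 := ((zpow (R := R) (-(k : ℤ)) n).mul h).mul hk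
  rw [show -(k : ℤ) + (b + k) + 0 = b by ring] at h2
  refine h2.congr fun y hy => ?_
  have : y ≠ 0 := hy.1.ne'
  simp only [zpow_neg, zpow_natCast]
  field_simp

theorem sum {ι : Type*} (s : Finset ι) {F : ι → ℝ → ℝ} (h : ∀ i ∈ s, SymOn R n a (F i)) :
    SymOn R n a (fun y => ∑ i ∈ s, F i y) := by
  classical
  induction s using Finset.induction_on with
  | empty => exact ((zpow a n).const_mul 0).congr fun y _ => by simp
  | insert i s hi ih =>
    refine ((h i (Finset.mem_insert_self _ _)).add
      (ih fun j hj => h j (Finset.mem_insert_of_mem hj))).congr fun y _ => ?_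
    simp [Finset.sum_insert hi]

theorem contDiffOn : ∀ {n : ℕ} {F : ℝ → ℝ}, SymOn R n a F → ContDiffOn ℝ n F (Ioo 0 R)
  | 0, F, h => by
      rw [Nat.cast_zero]; exact contDiffOn_zero.2 h.1
  | n + 1, F, h => by
      rw [Nat.cast_add, Nat.cast_one, contDiffOn_succ_iff_deriv_of_isOpen isOpen_Ioo]
      refine ⟨fun y hy => (h.1 y hy).differentiableWithinAt, by simp, ?_⟩
      have h1 : ContDiffOn ℝ n (fun y => scal F y / y) (Ioo 0 R) :=
        (contDiffOn h.2.2).div contDiffOn_id fun y hy => hy.1.ne'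
      refine h1.congr fun y hy => ?_
      have : y ≠ 0 := hy.1.ne'
      rw [scal]; field_simp

end SymOn

/-- Smooth functions of `Q` are stable under `Λ`, since `Λ(h(Q)) = (h' g)(Q)`, and each is bounded
because `Q` stays in `[0, π]`. -/
theorem symOn_comp (hQ : IsGroundState g Q) (hg : IsTarget g) (R : ℝ) (n : ℕ) :
    ∀ {h : ℝ → ℝ}, ContDiff ℝ ∞ h → SymOn R n 0 (fun y => h (Q y)) := by
  induction n with
  | zero =>
    intro h hh
    obtain ⟨C, hC⟩ := (isCompact_Icc (a := (0 : ℝ)) (b := Real.pi)).exists_bound_of_continuousOn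
      hh.continuous.continuousOn
    refine ⟨hh.continuous.comp_continuousOn (hQ.continuousOn.mono fun y hy => hy.1), C,
      fun y hy => ?_⟩
    rw [zpow_zero, mul_one]
    have := hQ.mem_Ioo hg hy.1
    exact hC _ ⟨this.1.le, this.2.le⟩
  | succ n ih =>
    intro h hh
    have hd : Differentiable ℝ h := hh.differentiable (by simp)
    refine ⟨fun y hy => (hQ.hasDerivAt_comp hd hy.1).differentiableAt, (ih hh).zero, ?_⟩
    refine (ih (h := fun u => deriv h u * g u)
      ((contDiff_infty_iff_deriv.1 hh).2.mul hg.smooth)).congr fun y hy => ?_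
    exact (hQ.scal_comp hd hy.1).symm

theorem symOn_pot (hQ : IsGroundState g Q) (hg : IsTarget g) (R : ℝ) (n : ℕ) :
    SymOn R n 0 (pot g Q) :=
  symOn_comp hQ hg R n hg.smooth_deriv_nonlin

/-- The induction runs over all multiples `g(Q) h(Q)`: the factor `g(Q) = ΛQ = O(y)` survives `Λ`,
because `Λ(φ(Q)) = φ'(Q) g(Q)`. -/
theorem symOn_scal (hQ : IsGroundState g Q) (hg : IsTarget g) (R : ℝ) (n : ℕ) :
    SymOn R n 1 (scal Q) := by
  have key : ∀ n : ℕ, ∀ h : ℝ → ℝ, ContDiff ℝ ∞ h →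
      SymOn R n 1 (fun y => g (Q y) * h (Q y)) := by
    intro n
    induction n with
    | zero =>
      intro h hh
      obtain ⟨C, hC0, hC⟩ := (symOn_comp hQ hg R 0 hh).exists_bound
      obtain ⟨_, _, C', hC', hb⟩ := hQ.exists_scal_bounds hg
      refine ⟨((symOn_comp hQ hg R 0 hg.smooth).mul (symOn_comp hQ hg R 0 hh)).1, C' * C,
        fun y hy => ?_⟩
      have hy0 : 0 < y := hy.1
      have hw : wt y ≤ y := div_le_self hy0.le (by nlinarith)
      have h1 := hC y hy
      rw [zpow_zero, mul_one] at h1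
      rw [abs_mul, ← hQ.scal_eq hy0, abs_of_pos (hQ.scal_pos hg hy0), zpow_one]
      calc scal Q y * |h (Q y)| ≤ (C' * y) * C := by
            gcongr
            exact (hb y hy0).2.trans (by gcongr)
        _ = _ := by ring
    | succ n ih =>
      intro h hh
      have hd : Differentiable ℝ (fun u => g u * h u) :=
        hg.differentiable.mul (hh.differentiable (by simp))
      refine ⟨fun y hy => (hQ.hasDerivAt_comp hd hy.1).differentiableAt, (ih h hh).zero, ?_⟩
      refine (ih (deriv fun u => g u * h u)
        (contDiff_infty_iff_deriv.1 (hg.smooth.mul hh)).2).congr fun y hy => ?_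
      rw [hQ.scal_comp hd hy.1, mul_comm]
  refine (key n (fun _ => 1) contDiff_const).congr fun y hy => ?_
  simp [hQ.scal_eq hy.1]

/-- With `w = H⁻¹F`, the pair `(w, Λw)` is closed under `Λ`, as `Λ²w = V w - y² F`. Hence the symbol
bounds of both are proved together, starting from the pointwise bounds. -/
theorem symOn_invH (hQ : IsGroundState g Q) (hg : IsTarget g) {R : ℝ} {n a : ℕ} {F : ℝ → ℝ}
    (hF : SymOn R n a F) : SymOn R n ((a : ℤ) + 2) (invH Q F) := by
  obtain ⟨A, hA, hFA⟩ := hF.exists_bound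
  simp only [zpow_natCast] at hFA
  have hD := fun y hy => hasDerivAt_invH hg hQ hA hF.continuousOn hFA (y := y) hy
  obtain ⟨C, hC, hb⟩ := exists_invH_bounds hg hQ R
  have hb := hb a F A hA hF.continuousOn hFA
  have e : ∀ y : ℝ, y ^ ((a : ℤ) + 2) = y ^ (a + 2) := fun y => by
    rw [← zpow_natCast]; norm_cast
  have z1 : SymOn R 0 ((a : ℤ) + 2) (invH Q F) :=
    ⟨fun y hy => (hD y hy).1.continuousAt.continuousWithinAt, C * A, fun y hy => by
      rw [e]; exact (hb y hy).1⟩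
  have z2 : SymOn R 0 ((a : ℤ) + 2) (scalInvHFrom Q 0 F) :=
    ⟨fun y hy => (hD y hy).2.continuousAt.continuousWithinAt, C * A, fun y hy => by
      rw [e]; exact (hb y hy).2⟩
  have s1 : EqOn (scalInvHFrom Q 0 F) (scal (invH Q F)) (Ioo 0 R) := fun y hy =>
    (scal_eq_of_hasDerivAt hy.1.ne' (hD y hy).1).symm
  have s2 : EqOn (fun y => pot g Q y * invH Q F y - y ^ (2 : ℤ) * F y) (scal (scalInvHFrom Q 0 F))
      (Ioo 0 R) := fun y hy => (scal_eq_of_hasDerivAt hy.1.ne' (hD y hy).2).symm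
  have key : ∀ m ≤ n, SymOn R m ((a : ℤ) + 2) (invH Q F) ∧
      SymOn R m ((a : ℤ) + 2) (scalInvHFrom Q 0 F) := by
    intro m
    induction m with
    | zero => exact fun _ => ⟨z1, z2⟩
    | succ m ih =>
      intro hm
      obtain ⟨i1, i2⟩ := ih (by omega)
      refine ⟨⟨fun y hy => (hD y hy).1.differentiableAt, z1, i2.congr s1⟩,
        ⟨fun y hy => (hD y hy).2.differentiableAt, z2, ?_⟩⟩
      refine SymOn.congr ?_ s2
      have hFm : SymOn R m a F := by
        obtain ⟨k, rfl⟩ := Nat.exists_eq_add_of_le (show m ≤ n by omega)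
        clear * - hF
        induction k with
        | zero => exact hF
        | succ k ih => exact ih hF.pred
      have h1 := (symOn_pot hQ hg R m).mul i1
      have h2 := (SymOn.zpow (R := R) 2 m).mul hFm
      rw [zero_add] at h1
      rw [add_comm] at h2
      exact h1.sub h2
  exact (key n le_rfl).1

/-- Since `Λ(1/D) = -(1/D)² ΛD`, only `ΛD` has to be a bounded symbol. `D` itself may be unbounded,
as is the logarithmically growing denominator of `c_{b₁}`. -/
theorem SymOn.inv {R d : ℝ} {D : ℝ → ℝ} (hd : 0 < d) (hD : ∀ y ∈ Ioo 0 R, d ≤ D y)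
    (hdiff : ∀ y ∈ Ioo 0 R, DifferentiableAt ℝ D y) (hs : ∀ n, SymOn R n 0 (scal D)) (n : ℕ) :
    SymOn R n 0 (fun y => (D y)⁻¹) := by
  have hne : ∀ y ∈ Ioo 0 R, D y ≠ 0 := fun y hy => (hd.trans_le (hD y hy)).ne'
  induction n with
  | zero =>
    refine ⟨fun y hy => ((hdiff y hy).continuousAt.inv₀ (hne y hy)).continuousWithinAt, d⁻¹,
      fun y hy => ?_⟩
    rw [abs_of_pos (inv_pos.2 (hd.trans_le (hD y hy))), zpow_zero, mul_one]
    exact inv_anti₀ hd (hD y hy)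
  | succ n ih =>
    refine ⟨fun y hy => (hdiff y hy).inv (hne y hy), ih.zero, ?_⟩
    refine (((ih.mul ih).mul (hs n)).const_mul (-1)).congr fun y hy => ?_
    have := hne y hy
    simp only [scal]; rw [deriv_fun_inv'' (hdiff y hy) (hne y hy)]
    field_simp

/-! ### The profiles `T_i` -/

theorem Tprof_zero : Tprof Q 0 = scal Q := by funext y; simp [Tprof]

theorem invH_const_mul (c : ℝ) (F : ℝ → ℝ) (y : ℝ) :
    invH Q (fun x => c * F x) y = c * invH Q F y := by
  simp only [invH, mul_assoc, intervalIntegral.integral_const_mul]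
  ring

theorem invH_congr {F G : ℝ → ℝ} {R y : ℝ} (h : EqOn F G (Ioo 0 R)) (hy : y ∈ Ioo 0 R) :
    invH Q F y = invH Q G y := by
  rw [invH, invH]
  congr 2
  · refine intervalIntegral.integral_congr_ae (Eventually.of_forall fun x hx => ?_)
    rw [uIoc_of_le hy.1.le] at hx
    rw [h ⟨hx.1, hx.2.trans_lt hy.2⟩]
  · refine intervalIntegral.integral_congr_ae (Eventually.of_forall fun x hx => ?_)
    rw [uIoc_of_le hy.1.le] at hx
    rw [h ⟨hx.1, hx.2.trans_lt hy.2⟩]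

theorem invH_iterate_congr {F G : ℝ → ℝ} {R : ℝ} (h : EqOn F G (Ioo 0 R)) (k : ℕ) :
    EqOn ((invH Q)^[k] F) ((invH Q)^[k] G) (Ioo 0 R) := by
  induction k with
  | zero => exact h
  | succ k ih =>
    intro y hy
    rw [Function.iterate_succ_apply', Function.iterate_succ_apply', invH_congr ih hy]

theorem invH_iterate_const_mul (c : ℝ) (F : ℝ → ℝ) (k : ℕ) :
    (invH Q)^[k] (fun x => c * F x) = fun y => c * (invH Q)^[k] F y := by
  induction k with
  | zero => rfl
  | succ k ih =>
    funext y
    rw [Function.iterate_succ_apply', Function.iterate_succ_apply', ih, invH_const_mul]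

theorem Tprof_succ (i : ℕ) : Tprof Q (i + 1) = fun y => -invH Q (Tprof Q i) y := by
  funext y
  have : Tprof Q i = fun y => (-1) ^ i * (invH Q)^[i] (scal Q) y := rfl
  rw [this, invH_const_mul, Tprof, Function.iterate_succ_apply', pow_succ]
  ring

theorem symOn_Tprof (hQ : IsGroundState g Q) (hg : IsTarget g) (R : ℝ) (i n : ℕ) :
    SymOn R n (1 + 2 * i) (Tprof Q i) := by
  induction i with
  | zero => rw [Tprof_zero]; exact symOn_scal hQ hg R n
  | succ i ih =>
    rw [Tprof_succ]
    have e : ((1 + 2 * i : ℕ) : ℤ) + 2 = 1 + 2 * ((i + 1 : ℕ) : ℤ) := by push_cast; ring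
    rw [← e]
    refine (symOn_invH hQ hg ?_).neg
    push_cast
    exact ih

/-- Smooth functions on `(0, ∞)` all of whose scaling derivatives are `O(y²)` at the origin. -/
def Nice (F : ℝ → ℝ) : Prop := ∀ R n, SymOn R n 2 F

theorem nice_Tprof (hQ : IsGroundState g Q) (hg : IsTarget g) {i : ℕ} (hi : 1 ≤ i) :
    Nice (Tprof Q i) := fun R n =>
  (symOn_Tprof hQ hg R i n).weaken (by omega)

theorem opH_neg (F : ℝ → ℝ) (y : ℝ) : opH g Q (fun x => -F x) y = -opH g Q F y := by
  have h1 : deriv (fun x => -F x) = fun x => -deriv F x := by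
    funext x; exact deriv.fun_neg
  simp only [opH, lap, h1]
  rw [show deriv (fun x => -deriv F x) y = -deriv (deriv F) y from deriv.fun_neg]
  ring

theorem SymOn.opH_invH (hQ : IsGroundState g Q) (hg : IsTarget g) {R y : ℝ} {n a : ℕ}
    {F : ℝ → ℝ} (hF : SymOn R n a F) (hy : y ∈ Ioo 0 R) : opH g Q (invH Q F) y = F y := by
  obtain ⟨A, hA, hFA⟩ := hF.exists_bound
  simp only [zpow_natCast] at hFA
  exact HeatFlow.opH_invH hg hQ hA hF.continuousOn hFA hy

theorem opH_Tprof_succ (hQ : IsGroundState g Q) (hg : IsTarget g) (i : ℕ) {y : ℝ} (hy : 0 < y) :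
    opH g Q (Tprof Q (i + 1)) y = -Tprof Q i y := by
  rw [Tprof_succ, opH_neg]
  have h := symOn_Tprof hQ hg (y + 1) i 0
  rw [SymOn.opH_invH (a := 1 + 2 * i) hQ hg (by push_cast; exact h) ⟨hy, by linarith⟩]

namespace Nice
variable {F G : ℝ → ℝ}

theorem differentiableAt (h : Nice F) {y : ℝ} (hy : 0 < y) : DifferentiableAt ℝ F y :=
  (h (y + 1) 1).1 y ⟨hy, by linarith⟩

theorem continuousOn (h : Nice F) : ContinuousOn F (Ioi 0) := fun _ hy =>
  (h.differentiableAt hy).continuousAt.continuousWithinAt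

theorem congr (h : Nice F) (e : EqOn F G (Ioi 0)) : Nice G := fun R n =>
  (h R n).congr fun _ hy => e hy.1

theorem add (hF : Nice F) (hG : Nice G) : Nice (fun y => F y + G y) := fun R n =>
  (hF R n).add (hG R n)

theorem const_mul (c : ℝ) (hF : Nice F) : Nice (fun y => c * F y) := fun R n =>
  (hF R n).const_mul c

theorem scal (hF : Nice F) : Nice (scal F) := fun R n => (hF R (n + 1)).2.2

/-- The reason for the order `2` in `Nice`: as `2 + 2 - 2 = 2`, the class absorbs the singular
factor `1/y²` in front of the nonlinear terms of the profile recursion. -/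
theorem mul_div (hF : Nice F) (hG : Nice G) : Nice (fun y => F y * G y / y ^ 2) := fun R n => by
  have h := ((hF R n).mul (hG R n)).mul (SymOn.zpow (R := R) (-2) n)
  exact h.congr fun y _ => by simp [div_eq_mul_inv, zpow_neg]

theorem mul_pow (hF : Nice F) : Nice (fun y => F y * y ^ 2) := fun R n => by
  have h := ((hF R n).mul (SymOn.zpow (R := R) 2 n)).weaken (show (2 : ℤ) ≤ 2 + 2 by norm_num)
  exact h

theorem comp_mul (hQ : IsGroundState g Q) (hg : IsTarget g) {h : ℝ → ℝ} (hh : ContDiff ℝ ∞ h)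
    (hF : Nice F) : Nice (fun y => h (Q y) * F y) := fun R n => by
  have := (symOn_comp hQ hg R n hh).mul (hF R n)
  rwa [zero_add] at this

theorem invH (hQ : IsGroundState g Q) (hg : IsTarget g) (hF : Nice F) : Nice (invH Q F) :=
  fun R n => (symOn_invH hQ hg (a := 2) (by exact_mod_cast hF R n)).weaken (by norm_num)

theorem opH_invH (hQ : IsGroundState g Q) (hg : IsTarget g) (hF : Nice F) {y : ℝ} (hy : 0 < y) :
    opH g Q (HeatFlow.invH Q F) y = F y :=
  SymOn.opH_invH (R := y + 1) (a := 2) hQ hg (by exact_mod_cast hF (y + 1) 0)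
    ⟨hy, by linarith⟩

theorem contDiffOn (hF : Nice F) (R : ℝ) : ContDiffOn ℝ ∞ F (Ioo 0 R) :=
  contDiffOn_infty.2 fun n => (hF R n).contDiffOn

theorem intervalIntegrable (hQ : IsGroundState g Q) (hg : IsTarget g) (hF : Nice F) {y : ℝ}
    (hy : 0 < y) : IntervalIntegrable (fun x => F x * HeatFlow.scal Q x * x) volume 0 y ∧
      IntervalIntegrable (fun x => F x * Gam Q x * x) volume 0 y := by
  obtain ⟨A, hA, hFA⟩ := (hF (y + 1) 0).exists_bound
  obtain ⟨_, _, hi⟩ := exists_invH_integral_bounds hg hQ (y + 1)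
  obtain ⟨h1, h2, -⟩ := hi 2 F A hA (hF (y + 1) 0).continuousOn (by exact_mod_cast hFA) y
    ⟨hy, by linarith⟩
  exact ⟨h1, h2⟩

theorem invH_add (hQ : IsGroundState g Q) (hg : IsTarget g) (hF : Nice F) (hG : Nice G) {y : ℝ}
    (hy : 0 < y) : HeatFlow.invH Q (fun x => F x + G x) y
      = HeatFlow.invH Q F y + HeatFlow.invH Q G y := by
  obtain ⟨f1, f2⟩ := hF.intervalIntegrable hQ hg hy
  obtain ⟨g1, g2⟩ := hG.intervalIntegrable hQ hg hy
  simp only [HeatFlow.invH, add_mul]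
  rw [intervalIntegral.integral_add f1 g1, intervalIntegral.integral_add f2 g2]
  ring

end Nice

/-! ### Test functions and integration by parts -/

theorem deriv_eq_zero_of_Ici {f : ℝ → ℝ} {Y : ℝ} (hd : ∀ y ≥ Y, DifferentiableAt ℝ f y)
    (h : ∀ y ≥ Y, f y = 0) : ∀ y ≥ Y, deriv f y = 0 := by
  intro y hy
  have h1 : derivWithin f (Ici Y) y = deriv f y :=
    (hd y hy).derivWithin (uniqueDiffOn_Ici Y y hy)
  rw [← h1, derivWithin_congr (s := Ici Y) (f := fun _ => (0 : ℝ)) (fun x hx => h x hx) (h y hy)]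
  simp

theorem contDiffOn_pot (hQ : IsGroundState g Q) (hg : IsTarget g) :
    ContDiffOn ℝ ∞ (pot g Q) (Ioi 0) := fun y hy =>
  ((contDiffOn_infty.2 fun n => (symOn_pot hQ hg (y + 1) n).contDiffOn).contDiffAt
    (isOpen_Ioo.mem_nhds ⟨hy, by linarith⟩)).contDiffWithinAt

theorem contDiffOn_scalQ (hQ : IsGroundState g Q) (hg : IsTarget g) :
    ContDiffOn ℝ ∞ (scal Q) (Ioi 0) := fun y hy =>
  ((contDiffOn_infty.2 fun n => (symOn_scal hQ hg (y + 1) n).contDiffOn).contDiffAt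
    (isOpen_Ioo.mem_nhds ⟨hy, by linarith⟩)).contDiffWithinAt

theorem contDiffOn_Tprof (hQ : IsGroundState g Q) (hg : IsTarget g) (i : ℕ) :
    ContDiffOn ℝ ∞ (Tprof Q i) (Ioi 0) := fun y hy =>
  ((contDiffOn_infty.2 fun n => (symOn_Tprof hQ hg (y + 1) i n).contDiffOn).contDiffAt
    (isOpen_Ioo.mem_nhds ⟨hy, by linarith⟩)).contDiffWithinAt

theorem ContDiffOn.deriv_infty {F : ℝ → ℝ} {s : Set ℝ} (hs : IsOpen s)
    (h : ContDiffOn ℝ ∞ F s) : ContDiffOn ℝ ∞ (deriv F) s :=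
  h.deriv_of_isOpen hs (by simp)

theorem contDiffOn_opH (hQ : IsGroundState g Q) (hg : IsTarget g) {F : ℝ → ℝ} {s : Set ℝ}
    (hs : IsOpen s) (hs0 : s ⊆ Ioi 0) (h : ContDiffOn ℝ ∞ F s) :
    ContDiffOn ℝ ∞ (opH g Q F) s := by
  have h1 := ContDiffOn.deriv_infty hs h
  have h2 := ContDiffOn.deriv_infty hs h1
  have hne : ∀ y ∈ s, y ≠ 0 := fun y hy => (ne_of_gt (hs0 hy))
  exact (h2.add (h1.div contDiffOn_id hne)).neg.add
    ((((contDiffOn_pot hQ hg).mono hs0).div (contDiffOn_id.pow 2)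
      fun y hy => pow_ne_zero 2 (hne y hy)).mul h)

theorem opHpow_succ (k : ℕ) (F : ℝ → ℝ) : opHpow g Q (k + 1) F = opH g Q (opHpow g Q k F) := by
  rw [opHpow, Function.iterate_succ_apply']; rfl

theorem opHpow_zero (F : ℝ → ℝ) : opHpow g Q 0 F = F := rfl

theorem contDiffOn_opHpow (hQ : IsGroundState g Q) (hg : IsTarget g) {F : ℝ → ℝ} {s : Set ℝ}
    (hs : IsOpen s) (hs0 : s ⊆ Ioi 0) (h : ContDiffOn ℝ ∞ F s) (k : ℕ) :
    ContDiffOn ℝ ∞ (opHpow g Q k F) s := by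
  induction k with
  | zero => exact h
  | succ k ih => rw [opHpow_succ]; exact contDiffOn_opH hQ hg hs hs0 ih

theorem opH_const_mul (c : ℝ) (F : ℝ → ℝ) (y : ℝ) :
    opH g Q (fun x => c * F x) y = c * opH g Q F y := by
  have h1 : deriv (fun x => c * F x) = fun x => c * deriv F x := by
    funext x; exact deriv_const_mul_field c
  rw [opH, lap, h1, deriv_const_mul_field, opH, lap]
  ring

theorem opH_add {F G : ℝ → ℝ} {s : Set ℝ} (hs : IsOpen s) (hF : ContDiffOn ℝ 2 F s)
    (hG : ContDiffOn ℝ 2 G s) {y : ℝ} (hy : y ∈ s) :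
    opH g Q (fun x => F x + G x) y = opH g Q F y + opH g Q G y := by
  have dF := fun x hx => (hF.differentiableOn (by simp)).differentiableAt (hs.mem_nhds (x := x) hx)
  have dG := fun x hx => (hG.differentiableOn (by simp)).differentiableAt (hs.mem_nhds (x := x) hx)
  have d2F := ((hF.deriv_of_isOpen (m := 1) hs (by norm_num)).differentiableOn
    (by simp)).differentiableAt (hs.mem_nhds hy)
  have d2G := ((hG.deriv_of_isOpen (m := 1) hs (by norm_num)).differentiableOn
    (by simp)).differentiableAt (hs.mem_nhds hy)
  have e : deriv (fun x => F x + G x) =ᶠ[𝓝 y] fun x => deriv F x + deriv G x := by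
    filter_upwards [hs.mem_nhds hy] with x hx
    exact deriv_fun_add (dF x hx) (dG x hx)
  rw [opH, lap, e.deriv_eq, e.self_of_nhds, deriv_fun_add d2F d2G, opH, opH, lap, lap]
  ring

theorem opH_zero_of_eqOn {F : ℝ → ℝ} {s : Set ℝ} (hs : IsOpen s) (h : ∀ y ∈ s, F y = 0) :
    ∀ y ∈ s, opH g Q F y = 0 := fun y hy => by
  rw [opH_congr (G := fun x => 0 * F x) hs (fun x hx => by simp [h x hx]) hy, opH_const_mul,
    zero_mul]

/-- Smooth functions on `(0, ∞)` that vanish beyond `Y` and are a multiple of `Λ Q` near the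
origin. -/
structure IsTest (Q : ℝ → ℝ) (Y : ℝ) (w : ℝ → ℝ) : Prop where
  smooth : ContDiffOn ℝ ∞ w (Ioi 0)
  supp : ∀ y ≥ Y, w y = 0
  near : ∃ δ > 0, ∃ c : ℝ, ∀ y ∈ Ioo 0 δ, w y = c * scal Q y

namespace IsTest
variable {Y R A : ℝ} {v w : ℝ → ℝ}

theorem add (hv : IsTest Q Y v) (hw : IsTest Q Y w) : IsTest Q Y (fun y => v y + w y) := by
  obtain ⟨δ, hδ, c, hc⟩ := hv.near
  obtain ⟨δ', hδ', c', hc'⟩ := hw.near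
  refine ⟨hv.smooth.add hw.smooth, fun y hy => by simp [hv.supp y hy, hw.supp y hy],
    min δ δ', lt_min hδ hδ', c + c', fun y hy => ?_⟩
  rw [hc y ⟨hy.1, hy.2.trans_le (min_le_left _ _)⟩,
    hc' y ⟨hy.1, hy.2.trans_le (min_le_right _ _)⟩]
  ring

theorem const_mul (a : ℝ) (hw : IsTest Q Y w) : IsTest Q Y (fun y => a * w y) := by
  obtain ⟨δ, hδ, c, hc⟩ := hw.near
  refine ⟨contDiffOn_const.mul hw.smooth, fun y hy => by simp [hw.supp y hy],
    δ, hδ, a * c, fun y hy => ?_⟩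
  rw [hc y hy]; ring

theorem sum {ι : Type*} (s : Finset ι) {w : ι → ℝ → ℝ} (h : ∀ i ∈ s, IsTest Q Y (w i)) :
    IsTest Q Y (fun y => ∑ i ∈ s, w i y) := by
  classical
  induction s using Finset.induction_on with
  | empty =>
    simp only [Finset.sum_empty]
    exact ⟨contDiffOn_const, fun _ _ => rfl, 1, one_pos, 0, fun _ _ => by simp⟩
  | insert i s hi ih =>
    simp only [Finset.sum_insert hi]
    exact (h i (Finset.mem_insert_self _ _)).add
      (ih fun j hj => h j (Finset.mem_insert_of_mem hj))

/-- `H` annihilates `ΛQ`, so `Hw` vanishes identically near the origin and the singular coefficients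
of `H` do no harm. -/
theorem opH (hQ : IsGroundState g Q) (hg : IsTarget g) (hY : 0 < Y) (hw : IsTest Q Y w) :
    IsTest Q Y (opH g Q w) := by
  obtain ⟨δ, hδ, c, hc⟩ := hw.near
  refine ⟨contDiffOn_opH hQ hg isOpen_Ioi Subset.rfl hw.smooth, ?_, δ, hδ, 0, fun y hy => ?_⟩
  · have d1 : ∀ y ≥ Y, DifferentiableAt ℝ w y := fun y hy =>
      (hw.smooth.differentiableOn (by simp)).differentiableAt (isOpen_Ioi.mem_nhds (hY.trans_le hy))
    have d2 : ∀ y ≥ Y, DifferentiableAt ℝ (deriv w) y := fun y hy =>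
      ((ContDiffOn.deriv_infty isOpen_Ioi hw.smooth).differentiableOn (by simp)).differentiableAt
        (isOpen_Ioi.mem_nhds (hY.trans_le hy))
    have z1 := deriv_eq_zero_of_Ici d1 hw.supp
    have z2 := deriv_eq_zero_of_Ici d2 z1
    intro y hy
    simp [HeatFlow.opH, lap, z2 y hy, z1 y hy, hw.supp y hy]
  · rw [zero_mul, opH_congr (G := fun x => c * scal Q x) isOpen_Ioo hc hy, opH_const_mul,
      opH_scal hg hQ hy.1, mul_zero]

theorem opHpow (hQ : IsGroundState g Q) (hg : IsTarget g) (hY : 0 < Y) (hw : IsTest Q Y w)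
    (k : ℕ) : IsTest Q Y (opHpow g Q k w) := by
  induction k with
  | zero => exact hw
  | succ k ih => rw [opHpow_succ]; exact ih.opH hQ hg hY

theorem _root_.HeatFlow.exists_linear_bound {v : ℝ → ℝ} (hv : ContinuousOn v (Ioi 0))
    (hs : ∀ y ≥ Y, v y = 0) {δ c : ℝ} (hδ : 0 < δ) (h : ∀ y ∈ Ioo 0 δ, |v y| ≤ c * y) :
    ∃ W ≥ 0, ∀ y, 0 < y → |v y| ≤ W * y := by
  have hc : ContinuousOn (fun y => v y / y) (Icc (δ / 2) Y) := by
    have hsub : Icc (δ / 2) Y ⊆ Ioi 0 := fun y hy => lt_of_lt_of_le (by positivity) hy.1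
    exact (hv.mono hsub).div continuousOn_id fun y hy => (ne_of_gt (hsub hy))
  obtain ⟨C, hC⟩ := isCompact_Icc.exists_bound_of_continuousOn hc
  refine ⟨max 0 (max c C), le_max_left _ _, fun y hy => ?_⟩
  rcases lt_or_ge y δ with h1 | h1
  · exact (h y ⟨hy, h1⟩).trans (by gcongr; exact (le_max_left _ _).trans (le_max_right _ _))
  rcases le_total y Y with h2 | h2
  · have := hC y ⟨by linarith, h2⟩
    rw [Real.norm_eq_abs, abs_div, abs_of_pos hy, div_le_iff₀ hy] at this
    exact this.trans (by gcongr; exact (le_max_right _ _).trans (le_max_right _ _))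
  · rw [hs y h2, abs_zero]
    have : 0 ≤ max 0 (max c C) := le_max_left _ _
    positivity

theorem exists_bounds (hQ : IsGroundState g Q) (hg : IsTarget g) (hY : 0 < Y)
    (hw : IsTest Q Y w) : ∃ W ≥ 0, ∀ y, 0 < y → |w y| ≤ W * y ∧ |scal w y| ≤ W * y := by
  obtain ⟨δ, hδ, c, hc⟩ := hw.near
  obtain ⟨C, hC, hCb⟩ := (symOn_scal hQ hg δ 1).exists_bound
  obtain ⟨C', hC', hCb'⟩ := (symOn_scal hQ hg δ 1).2.2.exists_bound
  simp only [zpow_one] at hCb hCb'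
  have d1 : ∀ y ≥ Y, DifferentiableAt ℝ w y := fun y hy =>
    (hw.smooth.differentiableOn (by simp)).differentiableAt (isOpen_Ioi.mem_nhds (hY.trans_le hy))
  obtain ⟨W, hW, h1⟩ := exists_linear_bound (c := |c| * C) hw.smooth.continuousOn hw.supp hδ
    fun y hy => by
      rw [hc y hy, abs_mul, mul_assoc]
      exact mul_le_mul_of_nonneg_left (hCb y hy) (abs_nonneg c)
  obtain ⟨W', hW', h2⟩ := exists_linear_bound (v := scal w) (c := |c| * C')
    (continuousOn_id.mul (ContDiffOn.deriv_infty isOpen_Ioi hw.smooth).continuousOn)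
    (fun y hy => by rw [scal, deriv_eq_zero_of_Ici d1 hw.supp y hy, mul_zero]) hδ
    fun y hy => by
      rw [scal_congr isOpen_Ioo (G := fun x => c * scal Q x) hc hy, scal_const_mul, abs_mul,
        mul_assoc]
      exact mul_le_mul_of_nonneg_left (hCb' y hy) (abs_nonneg c)
  refine ⟨W + W', by positivity, fun y hy => ⟨(h1 y hy).trans ?_, (h2 y hy).trans ?_⟩⟩
  · gcongr; linarith
  · gcongr; linarith

theorem integrableOn_of_Ioo (hw : IsTest Q Y w) (hYR : Y < R) {F : ℝ → ℝ}
    (h : IntegrableOn (fun y => F y * w y * y) (Ioo 0 R)) :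
    IntegrableOn (fun y => F y * w y * y) (Ioi 0) := by
  refine h.of_forall_sdiff_eq_zero measurableSet_Ioi fun y hy => ?_
  have : Y ≤ y := by
    by_contra! hlt
    exact hy.2 ⟨hy.1, hlt.trans hYR⟩
  simp [hw.supp y this]

theorem integrableOn (hQ : IsGroundState g Q) (hg : IsTarget g) (hY : 0 < Y)
    (hw : IsTest Q Y w) (hYR : Y < R) {F : ℝ → ℝ} (hF : ContinuousOn F (Ioo 0 R))
    (hA : ∀ y ∈ Ioo 0 R, |F y| ≤ A) : IntegrableOn (fun y => F y * w y * y) (Ioi 0) := by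
  obtain ⟨W, hW, hb⟩ := hw.exists_bounds hQ hg hY
  refine hw.integrableOn_of_Ioo hYR ?_
  refine IntegrableOn.of_bound (C := A * (W * R) * R) (by simp)
    (((hF.mul (hw.smooth.continuousOn.mono fun y hy => hy.1)).mul
      continuousOn_id).aestronglyMeasurable measurableSet_Ioo) ?_
  filter_upwards [ae_restrict_mem measurableSet_Ioo] with y hy
  have h0 : 0 ≤ A := (abs_nonneg _).trans (hA y hy)
  have hy0 : 0 < y := hy.1
  rw [Real.norm_eq_abs, abs_mul, abs_mul, abs_of_pos hy0]
  have := (hb y hy0).1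
  have h3 := hA y hy
  have h4 : W * y ≤ W * R := by gcongr; exact hy.2.le
  have h5 : 0 ≤ W * R := le_trans (by positivity) h4
  exact mul_le_mul (mul_le_mul h3 (this.trans h4) (abs_nonneg _) h0) hy.2.le hy0.le
    (by positivity)

theorem exists_ip_bound (hQ : IsGroundState g Q) (hg : IsTarget g) (hY : 0 < Y)
    (hw : IsTest Q Y w) : ∃ W ≥ 0, ∀ (F : ℝ → ℝ) (A : ℝ), (∀ y ∈ Ioo 0 Y, |F y| ≤ A) →
      |ip F w| ≤ W * A := by
  obtain ⟨W, hW, hb⟩ := hw.exists_bounds hQ hg hY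
  refine ⟨W * Y * Y * Y, by positivity, fun F A hA => ?_⟩
  have h1 : ip F w = ∫ y in Ioo 0 Y, F y * w y * y := by
    rw [ip]
    refine (setIntegral_eq_of_subset_of_forall_sdiff_eq_zero measurableSet_Ioi
      (fun y hy => hy.1) fun y hy => ?_)
    have : Y ≤ y := by
      by_contra! hlt
      exact hy.2 ⟨hy.1, hlt⟩
    simp [hw.supp y this]
  have h0 : 0 ≤ A := (abs_nonneg _).trans (hA (Y / 2) ⟨by positivity, by linarith⟩)
  rw [h1]
  have := norm_setIntegral_le_of_norm_le_const (μ := volume) (s := Ioo 0 Y)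
    (f := fun y => F y * w y * y) (C := A * (W * Y) * Y) (by simp) fun y hy => by
      have hy0 : 0 < y := hy.1
      rw [Real.norm_eq_abs, abs_mul, abs_mul, abs_of_pos hy0]
      have h4 : W * y ≤ W * Y := by gcongr; exact hy.2.le
      exact mul_le_mul (mul_le_mul (hA y hy) ((hb y hy0).1.trans h4) (abs_nonneg _) h0) hy.2.le
        hy0.le (by positivity)
  rw [Real.norm_eq_abs, measureReal_def, Real.volume_Ioo, ENNReal.toReal_ofReal (by linarith)] at this
  refine this.trans (le_of_eq ?_)
  ring

/-- `H` is symmetric. -/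
theorem green (hQ : IsGroundState g Q) (hg : IsTarget g) (hY : 0 < Y) (hw : IsTest Q Y w)
    (hYR : Y < R) {F : ℝ → ℝ} (hF : ContDiffOn ℝ 2 F (Ioo 0 R)) (hA : ∀ y ∈ Ioo 0 R, |F y| ≤ A)
    (hA' : ∀ y ∈ Ioo 0 R, |scal F y| ≤ A)
    (hint : IntegrableOn (fun y => HeatFlow.opH g Q F y * w y * y) (Ioi 0)) :
    ip (HeatFlow.opH g Q F) w = ip F (HeatFlow.opH g Q w) := by
  have hw' := hw.opH hQ hg hY
  have hint2 := hw'.integrableOn hQ hg hY hYR hF.continuousOn hA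
  obtain ⟨W, hW, hWb⟩ := hw.exists_bounds hQ hg hY
  obtain ⟨b, hYb, hbR⟩ := exists_between hYR
  have hb0 : 0 < b := hY.trans hYb
  rw [← sub_eq_zero, ip, ip, ← integral_sub hint hint2]
  have hz : ∀ y ≥ Y, HeatFlow.opH g Q F y * w y * y - F y * HeatFlow.opH g Q w y * y = 0 :=
    fun y hy => by simp [hw.supp y hy, hw'.supp y hy]
  have h1 : ∫ y in Ioi (0 : ℝ), (HeatFlow.opH g Q F y * w y * y - F y * HeatFlow.opH g Q w y * y)
      = ∫ y in (0 : ℝ)..b,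
        (HeatFlow.opH g Q F y * w y * y - F y * HeatFlow.opH g Q w y * y) := by
    rw [intervalIntegral.integral_of_le hb0.le]
    refine setIntegral_eq_of_subset_of_forall_sdiff_eq_zero measurableSet_Ioi
      (fun y hy => hy.1) fun y hy => hz y ?_
    by_contra! hlt
    exact hy.2 ⟨hy.1, hlt.le.trans hYb.le⟩
  rw [h1]
  -- Lagrange's identity. The boundary term at `0` vanishes because `F` and `ΛF` are bounded while
  -- `w` and `Λw` are `O(y)`; the other one vanishes beyond the support of `w`.
  have hder : ∀ y ∈ Ioo 0 R, HasDerivAt (fun x => F x * scal w x - scal F x * w x)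
      (HeatFlow.opH g Q F y * w y * y - F y * HeatFlow.opH g Q w y * y) y := by
    intro y hy
    have hn := isOpen_Ioo.mem_nhds hy
    have hn' := isOpen_Ioi.mem_nhds (show y ∈ Ioi 0 from hy.1)
    have dF := ((hF.differentiableOn (by simp)).differentiableAt hn).hasDerivAt
    have d2F := (((hF.deriv_of_isOpen (m := 1) isOpen_Ioo (by norm_num)).differentiableOn
      (by simp)).differentiableAt hn).hasDerivAt
    have dw := ((hw.smooth.differentiableOn (by simp)).differentiableAt hn').hasDerivAt
    have d2w := (((ContDiffOn.deriv_infty isOpen_Ioi hw.smooth).differentiableOn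
      (by simp)).differentiableAt hn').hasDerivAt
    have := (dF.mul ((hasDerivAt_id y).mul d2w)).sub (((hasDerivAt_id y).mul d2F).mul dw)
    refine this.congr_deriv ?_
    have hy0 : y ≠ 0 := hy.1.ne'
    simp only [HeatFlow.opH, lap, id, Pi.mul_apply]
    field_simp
    ring
  have hlim : Tendsto (fun x => F x * scal w x - scal F x * w x) (𝓝[>] 0) (𝓝 0) := by
    have hsq : Tendsto (fun y : ℝ => 2 * A * W * y) (𝓝[>] 0) (𝓝 0) := by
      have : Tendsto (fun y : ℝ => 2 * A * W * y) (𝓝 0) (𝓝 (2 * A * W * 0)) :=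
        (continuous_const.mul continuous_id).tendsto 0
      rw [mul_zero] at this
      exact this.mono_left nhdsWithin_le_nhds
    refine squeeze_zero_norm' ?_ hsq
    filter_upwards [Ioo_mem_nhdsGT (hY.trans hYR)] with y hy
    have hy0 : 0 < y := hy.1
    have h0 : 0 ≤ A := (abs_nonneg _).trans (hA y hy)
    calc ‖F y * scal w y - scal F y * w y‖ ≤ |F y * scal w y| + |scal F y * w y| := by
          rw [Real.norm_eq_abs]; exact abs_sub _ _
      _ ≤ A * (W * y) + A * (W * y) := by
          rw [abs_mul, abs_mul]
          gcongr
          · exact hA y hy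
          · exact (hWb y hy0).2
          · exact hA' y hy
          · exact (hWb y hy0).1
      _ = _ := by ring
  have hlim2 : Tendsto (fun x => F x * scal w x - scal F x * w x) (𝓝[<] b) (𝓝 0) := by
    refine tendsto_const_nhds.congr' ?_
    filter_upwards [Ioo_mem_nhdsLT hYb] with y hy
    have d1 : ∀ y ≥ Y, DifferentiableAt ℝ w y := fun y hy =>
      (hw.smooth.differentiableOn (by simp)).differentiableAt
        (isOpen_Ioi.mem_nhds (hY.trans_le hy))
    have := deriv_eq_zero_of_Ici d1 hw.supp y hy.1.le
    rw [hw.supp y hy.1.le, show scal w y = 0 by rw [scal, this, mul_zero]]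
    ring
  rw [intervalIntegral.integral_eq_sub_of_hasDerivAt_of_tendsto hb0
    (fun y hy => hder y ⟨hy.1, hy.2.trans hbR⟩) ?_ hlim hlim2, sub_zero]
  rw [intervalIntegrable_iff_integrableOn_Ioc_of_le hb0.le]
  exact (hint.sub hint2).mono_set fun y hy => hy.1

end IsTest

/-! ### Growth of the profiles `T_i` -/

theorem integral_id_div_one_add_sq {y : ℝ} :
    IntervalIntegrable (fun x : ℝ => x / (1 + x ^ 2)) volume 0 y ∧
    ∫ x in (0 : ℝ)..y, x / (1 + x ^ 2) = 1 / 2 * Real.log (1 + y ^ 2) := by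
  have hc : Continuous fun x : ℝ => x / (1 + x ^ 2) :=
    continuous_id.div (by fun_prop) fun x => by positivity
  refine ⟨hc.intervalIntegrable _ _, ?_⟩
  rw [intervalIntegral.integral_eq_sub_of_hasDerivAt
    (f := fun x => 1 / 2 * Real.log (1 + x ^ 2)) (fun x _ => ?_) (hc.intervalIntegrable _ _)]
  · simp
  · have := (((hasDerivAt_pow 2 x).const_add 1).log (by positivity)).const_mul (1 / 2)
    refine this.congr_deriv ?_
    norm_num
    field_simp

theorem wt_le_self {y : ℝ} (hy : 0 < y) : wt y ≤ y := div_le_self hy.le (by nlinarith)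

theorem wt_sq_mul_le {y : ℝ} (hy : 0 < y) : wt y * wt y * y ≤ y / (1 + y ^ 2) := by
  have h : wt y * y ≤ 1 := by
    unfold wt; rw [div_mul_eq_mul_div, div_le_one (by positivity)]; nlinarith
  calc wt y * wt y * y = wt y * (wt y * y) := by ring
    _ ≤ wt y * 1 := by have := (wt_pos hy).le; gcongr
    _ = _ := by rw [mul_one, wt]

/-- The growth rate of `T_{k+1}`. -/
def growth (k : ℕ) (y : ℝ) : ℝ := y * (1 + y ^ 2) ^ k * (1 + Real.log (1 + y ^ 2))

theorem one_le_one_add_log (y : ℝ) : 1 ≤ 1 + Real.log (1 + y ^ 2) := by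
  have := Real.log_nonneg (show (1 : ℝ) ≤ 1 + y ^ 2 by nlinarith)
  linarith

theorem growth_mono (k : ℕ) {x y : ℝ} (hx : 0 < x) (hxy : x ≤ y) : growth k x ≤ growth k y := by
  have h1 := one_le_one_add_log x
  have h2 : Real.log (1 + x ^ 2) ≤ Real.log (1 + y ^ 2) :=
    Real.log_le_log (by positivity) (by gcongr)
  unfold growth
  have : 0 < y := hx.trans_le hxy
  gcongr

theorem abs_invH_le (hg : IsTarget g) (hQ : IsGroundState g Q) : ∃ C > 0, ∀ (F : ℝ → ℝ)
    (y p q : ℝ), 0 < y → |∫ x in (0 : ℝ)..y, F x * scal Q x * x| ≤ p →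
    |∫ x in (0 : ℝ)..y, F x * Gam Q x * x| ≤ q →
    |invH Q F y| ≤ C * ((1 + y ^ 2) / y * p + wt y * q) := by
  obtain ⟨_, _, C, hC, hb⟩ := hQ.exists_scal_bounds hg
  obtain ⟨C', hC', hb'⟩ := hQ.exists_Gam_bounds hg
  refine ⟨C + C', by positivity, fun F y p q hy hp hq => ?_⟩
  have h1 := (hb' y hy).1
  have h2 := (hb y hy).2
  have hs := hQ.scal_pos hg hy
  have hw := wt_pos hy
  have hp0 := (abs_nonneg _).trans hp
  have hq0 := (abs_nonneg _).trans hq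
  calc |invH Q F y| ≤ |Gam Q y| * |∫ x in (0 : ℝ)..y, F x * scal Q x * x|
        + scal Q y * |∫ x in (0 : ℝ)..y, F x * Gam Q x * x| := by
        rw [invH]
        refine (abs_add_le _ _).trans ?_
        rw [abs_mul, abs_mul, abs_neg, abs_of_pos hs]
    _ ≤ (C' * ((1 + y ^ 2) / y)) * p + (C * wt y) * q := by gcongr
    _ ≤ _ := by
        have e1 : 0 ≤ C * ((1 + y ^ 2) / y * p) := by positivity
        have e2 : 0 ≤ C' * (wt y * q) := by positivity
        linarith

/-- The logarithm is created once, for `T_1`, by `∫ (ΛQ)² x dx ≲ log(1 + y²)`. Every further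
application of `H⁻¹` costs a factor `1 + y²`, the growth rate being monotone and hence extractable
from the integrals. -/
theorem exists_Tprof_growth (hg : IsTarget g) (hQ : IsGroundState g Q) (k : ℕ) :
    ∃ C > 0, ∀ y, 0 < y → |Tprof Q (k + 1) y| ≤ C * growth k y := by
  obtain ⟨_, _, C, hC, hb⟩ := hQ.exists_scal_bounds hg
  obtain ⟨C', hC', hb'⟩ := hQ.exists_Gam_bounds hg
  obtain ⟨D, hD, hinv⟩ := abs_invH_le hg hQ
  induction k with
  | zero =>
    refine ⟨D * (C ^ 2 + C * C'), by positivity, fun y hy => ?_⟩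
    rw [Tprof_succ, Tprof_zero, abs_neg]
    obtain ⟨hi, he⟩ := integral_id_div_one_add_sq (y := y)
    have h1 : |∫ x in (0 : ℝ)..y, scal Q x * scal Q x * x| ≤
        C ^ 2 * Real.log (1 + y ^ 2) := by
      have := intervalIntegral.norm_integral_le_of_norm_le (f := fun x => scal Q x * scal Q x * x)
        (g := fun x => C ^ 2 * (x / (1 + x ^ 2))) (μ := volume) hy.le
        (Eventually.of_forall fun x hx => ?_) (hi.const_mul _)
      · rw [intervalIntegral.integral_const_mul, he] at this
        refine this.trans ?_
        have : 0 ≤ Real.log (1 + y ^ 2) := by linarith [one_le_one_add_log y]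
        have : 0 ≤ C ^ 2 * Real.log (1 + y ^ 2) := by positivity
        linarith
      · have hx0 : 0 < x := hx.1
        have hs := hQ.scal_pos hg hx0
        have hw := wt_pos hx0
        rw [Real.norm_of_nonneg (by positivity)]
        calc scal Q x * scal Q x * x ≤ (C * wt x) * (C * wt x) * x := by
              gcongr
              · exact (hb x hx0).2
              · exact (hb x hx0).2
          _ = C ^ 2 * (wt x * wt x * x) := by ring
          _ ≤ _ := by gcongr; exact wt_sq_mul_le hx0
    have h2 : |∫ x in (0 : ℝ)..y, scal Q x * Gam Q x * x| ≤ C * C' * y * y := by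
      have := intervalIntegral.norm_integral_le_of_norm_le_const (a := 0) (b := y)
        (f := fun x => scal Q x * Gam Q x * x) (C := C * C' * y) (fun x hx => ?_)
      · rwa [sub_zero, abs_of_pos hy] at this
      · rw [uIoc_of_le hy.le] at hx
        have hx0 : 0 < x := hx.1
        rw [Real.norm_eq_abs, abs_mul, abs_mul, abs_of_pos (hQ.scal_pos hg hx0), abs_of_pos hx0]
        have hw := wt_pos hx0
        calc scal Q x * |Gam Q x| * x ≤ (C * wt x) * (C' * ((1 + x ^ 2) / x)) * x := by
              gcongr
              · exact (hb x hx0).2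
              · exact (hb' x hx0).1
          _ = C * C' * x := by unfold wt; field_simp
          _ ≤ _ := by gcongr; exact hx.2
    refine (hinv _ y _ _ hy h1 h2).trans ?_
    have hl : Real.log (1 + y ^ 2) ≤ y ^ 2 := by
      have := Real.log_le_sub_one_of_pos (show 0 < 1 + y ^ 2 by positivity)
      linarith
    set l := Real.log (1 + y ^ 2) with hldef
    have hl0 : 0 ≤ l := by linarith [one_le_one_add_log y]
    have e1 : (1 + y ^ 2) / y * (C ^ 2 * l) ≤ C ^ 2 * (y * (1 + l)) := by
      rw [div_mul_eq_mul_div, div_le_iff₀ hy]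
      have : (1 + y ^ 2) * l ≤ y * (1 + l) * y := by nlinarith
      nlinarith [sq_nonneg C]
    have e2 : wt y * (C * C' * y * y) ≤ C * C' * (y * (1 + l)) := by
      have : wt y * (y * y) ≤ y := by
        unfold wt
        rw [div_mul_eq_mul_div, div_le_iff₀ (by positivity)]
        nlinarith [mul_pos hy hy]
      have h3 : 0 ≤ C * C' := by positivity
      have h4 : y ≤ y * (1 + l) := by nlinarith
      calc wt y * (C * C' * y * y) = C * C' * (wt y * (y * y)) := by ring
        _ ≤ _ := mul_le_mul_of_nonneg_left (this.trans h4) h3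
    have e3 : growth 0 y = y * (1 + l) := by simp [growth, hldef]
    rw [e3]
    calc D * ((1 + y ^ 2) / y * (C ^ 2 * l) + wt y * (C * C' * y * y)) ≤
        D * (C ^ 2 * (y * (1 + l)) + C * C' * (y * (1 + l))) := by gcongr
      _ = _ := by ring
  | succ k ih =>
    obtain ⟨A, hA, ih⟩ := ih
    refine ⟨D * (A * C + A * C'), by positivity, fun y hy => ?_⟩
    rw [Tprof_succ, abs_neg]
    have hg0 : 0 < growth k y := by
      have := one_le_one_add_log y
      unfold growth; positivity
    have h1 : |∫ x in (0 : ℝ)..y, Tprof Q (k + 1) x * scal Q x * x| ≤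
        A * C * growth k y * (y ^ 2 / (1 + y ^ 2)) * y := by
      have := intervalIntegral.norm_integral_le_of_norm_le_const (a := 0) (b := y)
        (f := fun x => Tprof Q (k + 1) x * scal Q x * x)
        (C := A * C * growth k y * (y ^ 2 / (1 + y ^ 2))) (fun x hx => ?_)
      · rwa [sub_zero, abs_of_pos hy] at this
      · rw [uIoc_of_le hy.le] at hx
        have hx0 : 0 < x := hx.1
        rw [Real.norm_eq_abs, abs_mul, abs_mul, abs_of_pos (hQ.scal_pos hg hx0), abs_of_pos hx0]
        have hw := wt_pos hx0
        have hs := hQ.scal_pos hg hx0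
        have e : x ^ 2 / (1 + x ^ 2) ≤ y ^ 2 / (1 + y ^ 2) := by
          rw [div_le_div_iff₀ (by positivity) (by positivity)]
          nlinarith [hx.2, mul_le_mul hx.2 hx.2 hx0.le hy.le]
        calc |Tprof Q (k + 1) x| * scal Q x * x ≤ (A * growth k y) * (C * wt x) * x := by
              gcongr
              · exact (ih x hx0).trans (by gcongr; exact growth_mono k hx0 hx.2)
              · exact (hb x hx0).2
          _ = A * C * growth k y * (x ^ 2 / (1 + x ^ 2)) := by unfold wt; ring
          _ ≤ _ := by gcongr
    have h2 : |∫ x in (0 : ℝ)..y, Tprof Q (k + 1) x * Gam Q x * x| ≤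
        A * C' * growth k y * (1 + y ^ 2) * y := by
      have := intervalIntegral.norm_integral_le_of_norm_le_const (a := 0) (b := y)
        (f := fun x => Tprof Q (k + 1) x * Gam Q x * x)
        (C := A * C' * growth k y * (1 + y ^ 2)) (fun x hx => ?_)
      · rwa [sub_zero, abs_of_pos hy] at this
      · rw [uIoc_of_le hy.le] at hx
        have hx0 : 0 < x := hx.1
        rw [Real.norm_eq_abs, abs_mul, abs_mul, abs_of_pos hx0]
        calc |Tprof Q (k + 1) x| * |Gam Q x| * x
            ≤ (A * growth k y) * (C' * ((1 + x ^ 2) / x)) * x := by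
              gcongr
              · exact (ih x hx0).trans (by gcongr; exact growth_mono k hx0 hx.2)
              · exact (hb' x hx0).1
          _ = A * C' * growth k y * (1 + x ^ 2) := by field_simp
          _ ≤ _ := by gcongr; exact hx.2
    refine (hinv _ y _ _ hy h1 h2).trans ?_
    have e : growth (k + 1) y = growth k y * (1 + y ^ 2) := by unfold growth; ring
    rw [e]
    have e1 : (1 + y ^ 2) / y * (A * C * growth k y * (y ^ 2 / (1 + y ^ 2)) * y) ≤
        A * C * (growth k y * (1 + y ^ 2)) := by
      calc (1 + y ^ 2) / y * (A * C * growth k y * (y ^ 2 / (1 + y ^ 2)) * y)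
          = A * C * (growth k y * y ^ 2) := by field_simp
        _ ≤ _ := by gcongr; linarith
    have e2 : wt y * (A * C' * growth k y * (1 + y ^ 2) * y) ≤
        A * C' * (growth k y * (1 + y ^ 2)) := by
      calc wt y * (A * C' * growth k y * (1 + y ^ 2) * y) = A * C' * (growth k y * y ^ 2) := by
            unfold wt; field_simp
        _ ≤ _ := by gcongr; linarith
    calc _ ≤ D * (A * C * (growth k y * (1 + y ^ 2)) + A * C' * (growth k y * (1 + y ^ 2))) := by
          gcongr
      _ = _ := by ring

theorem one_le_log_of_three_le {M : ℝ} (hM : 3 ≤ M) : 1 ≤ Real.log M := by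
  rw [Real.le_log_iff_exp_le (by linarith)]
  exact Real.exp_one_lt_d9.le.trans (by linarith)

theorem log_one_add_sq_le {M y : ℝ} (hM : 3 ≤ M) (hy : 0 < y) (hyM : y ≤ 2 * M) :
    Real.log (1 + y ^ 2) ≤ 4 * Real.log M := by
  have : Real.log (1 + y ^ 2) ≤ Real.log (M ^ 4) := by
    refine Real.log_le_log (by positivity) ?_
    have h1 : y ^ 2 ≤ (2 * M) ^ 2 := by gcongr
    have h2 : (9 : ℝ) ≤ M ^ 2 := by nlinarith
    nlinarith [sq_nonneg M]
  rw [Real.log_pow] at this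
  exact_mod_cast this

theorem exists_Tprof_bound (hg : IsTarget g) (hQ : IsGroundState g Q) (k : ℕ) :
    ∃ C > 0, ∀ M y, 3 ≤ M → 0 < y → y ≤ 2 * M →
      |Tprof Q (k + 1) y| ≤ C * (M ^ (2 * k + 1) * Real.log M) := by
  obtain ⟨C, hC, h⟩ := exists_Tprof_growth hg hQ k
  refine ⟨C * (2 * 5 ^ k * 5), by positivity, fun M y hM hy hyM => (h y hy).trans ?_⟩
  have hM0 : 0 < M := by linarith
  have h1 := one_le_log_of_three_le hM
  have h2 := log_one_add_sq_le hM hy hyM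
  have h0 := one_le_one_add_log y
  have h3 : 1 + y ^ 2 ≤ 5 * M ^ 2 := by
    have h1 : y ^ 2 ≤ (2 * M) ^ 2 := by gcongr
    nlinarith
  calc C * growth k y ≤ C * ((2 * M) * (5 * M ^ 2) ^ k * (5 * Real.log M)) := by
        unfold growth
        gcongr
        linarith
    _ = _ := by rw [mul_pow, ← pow_mul]; ring

/-! ### The directions `H^p (χ_M Λ Q)` -/

/-- Finite sums of products of a function of `y / M` supported in `y ≤ 2 M` with a smooth
multiple of `g(Q)`. -/
inductive CutFamily (g Q : ℝ → ℝ) : (ℝ → ℝ → ℝ) → Prop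
  | base {a h : ℝ → ℝ} : ContDiff ℝ ∞ a → (∀ z ≥ 2, a z = 0) → ContDiff ℝ ∞ h →
      CutFamily g Q (fun M y => a (y / M) * (g (Q y) * h (Q y)))
  | add {F G : ℝ → ℝ → ℝ} : CutFamily g Q F → CutFamily g Q G →
      CutFamily g Q (fun M y => F M y + G M y)
  | congr {F G : ℝ → ℝ → ℝ} : CutFamily g Q F → (∀ M y, 0 < M → 0 < y → F M y = G M y) →
      CutFamily g Q G

theorem scal_comp_div (a : ℝ → ℝ) {M : ℝ} (ha : Differentiable ℝ a) (y : ℝ) :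
    HasDerivAt (fun y => a (y / M)) (deriv a (y / M) / M) y ∧
      scal (fun y => a (y / M)) y = scal a (y / M) := by
  have h := (ha (y / M)).hasDerivAt.comp y ((hasDerivAt_id y).div_const M)
  have h' : HasDerivAt (fun y => a (y / M)) (deriv a (y / M) / M) y := by
    rw [mul_one_div] at h; exact h
  refine ⟨h', ?_⟩
  rw [scal, h'.deriv, scal]
  ring

theorem contDiff_scal {a : ℝ → ℝ} (ha : ContDiff ℝ ∞ a) : ContDiff ℝ ∞ (scal a) :=
  contDiff_id.mul (contDiff_infty_iff_deriv.1 ha).2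

theorem scal_eq_zero_of_ge {a : ℝ → ℝ} (ha : ContDiff ℝ ∞ a) (h : ∀ z ≥ 2, a z = 0) :
    ∀ z ≥ 2, scal a z = 0 := fun z hz => by
  rw [scal, deriv_eq_zero_of_Ici (fun y _ => (ha.differentiable (by simp)) y) h z hz, mul_zero]

theorem IsGroundState.contDiffOn_comp (hQ : IsGroundState g Q) (hg : IsTarget g) {h : ℝ → ℝ}
    (hh : ContDiff ℝ ∞ h) : ContDiffOn ℝ ∞ (fun y => h (Q y)) (Ioi 0) := fun y hy =>
  ((contDiffOn_infty.2 fun n => (symOn_comp hQ hg (y + 1) n hh).contDiffOn).contDiffAt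
    (isOpen_Ioo.mem_nhds ⟨hy, by linarith⟩)).contDiffWithinAt

namespace CutFamily
variable {F G : ℝ → ℝ → ℝ}

theorem contDiffOn (hQ : IsGroundState g Q) (hg : IsTarget g) (hF : CutFamily g Q F) {M : ℝ}
    (hM : 0 < M) : ContDiffOn ℝ ∞ (F M) (Ioi 0) := by
  induction hF with
  | base ha _ hh =>
    exact (ha.comp (contDiff_id.div_const M)).contDiffOn.mul
      ((hQ.contDiffOn_comp hg hg.smooth).mul (hQ.contDiffOn_comp hg hh))
  | add _ _ h1 h2 => exact h1.add h2
  | congr _ e h => exact h.congr fun y hy => (e M y hM hy).symm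

theorem differentiableAt (hQ : IsGroundState g Q) (hg : IsTarget g) (hF : CutFamily g Q F)
    {M y : ℝ} (hM : 0 < M) (hy : 0 < y) : DifferentiableAt ℝ (F M) y :=
  ((hF.contDiffOn hQ hg hM).differentiableOn (by simp)).differentiableAt (isOpen_Ioi.mem_nhds hy)

/-- The bound does not depend on `M`: the cut-off enters only through a bounded function of `y/M`,
and `Λ` preserves this form. -/
theorem exists_bound (hQ : IsGroundState g Q) (hg : IsTarget g) (hF : CutFamily g Q F) :
    ∃ C ≥ 0, ∀ M y, 0 < M → 0 < y → |F M y| ≤ C * scal Q y := by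
  induction hF with
  | @base a h ha hz hh =>
    obtain ⟨C, hC⟩ := (isCompact_Icc (a := (0 : ℝ)) (b := 2)).exists_bound_of_continuousOn
      ha.continuous.continuousOn
    obtain ⟨D, hD⟩ := (isCompact_Icc (a := (0 : ℝ)) (b := Real.pi)).exists_bound_of_continuousOn
      hh.continuous.continuousOn
    refine ⟨|C| * |D|, by positivity, fun M y hM hy => ?_⟩
    have hs := hQ.scal_pos hg hy
    have hm := hQ.mem_Ioo hg hy
    have h1 : |a (y / M)| ≤ |C| := by
      rcases le_total (y / M) 2 with h2 | h2
      · exact (hC _ ⟨by positivity, h2⟩).trans (le_abs_self C)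
      · rw [hz _ h2, abs_zero]; exact abs_nonneg C
    have h2 : |h (Q y)| ≤ |D| := (hD _ ⟨hm.1.le, hm.2.le⟩).trans (le_abs_self D)
    simp only [← hQ.scal_eq hy, abs_mul, abs_of_pos hs]
    calc |a (y / M)| * (scal Q y * |h (Q y)|) ≤ |C| * (scal Q y * |D|) := by gcongr
      _ = _ := by ring
  | add _ _ h1 h2 =>
    obtain ⟨C, hC, h1⟩ := h1
    obtain ⟨D, hD, h2⟩ := h2
    refine ⟨C + D, by positivity, fun M y hM hy => (abs_add_le _ _).trans ?_⟩
    linarith [h1 M y hM hy, h2 M y hM hy]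
  | congr _ e h =>
    obtain ⟨C, hC, h⟩ := h
    exact ⟨C, hC, fun M y hM hy => by rw [← e M y hM hy]; exact h M y hM hy⟩

theorem const_mul (c : ℝ) (hF : CutFamily g Q F) : CutFamily g Q (fun M y => c * F M y) := by
  induction hF with
  | @base a h ha hz hh =>
    exact (base (a := fun z => c * a z) (contDiff_const.mul ha)
      (fun z hz' => by simp [hz z hz']) hh).congr fun M y _ _ => by ring
  | add _ _ h1 h2 => exact (h1.add h2).congr fun M y _ _ => by ring
  | congr _ e h => exact h.congr fun M y hM hy => by rw [e M y hM hy]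

theorem pot_mul (hg : IsTarget g) (hF : CutFamily g Q F) :
    CutFamily g Q (fun M y => pot g Q y * F M y) := by
  induction hF with
  | @base a h ha hz hh =>
    exact (base (h := fun u => deriv (nonlin g) u * h u) ha hz
      (hg.smooth_deriv_nonlin.mul hh)).congr fun M y _ _ => by rw [pot]; ring
  | add _ _ h1 h2 => exact (h1.add h2).congr fun M y _ _ => by ring
  | congr _ e h => exact h.congr fun M y hM hy => by rw [e M y hM hy]

theorem scal (hQ : IsGroundState g Q) (hg : IsTarget g) (hF : CutFamily g Q F) :
    CutFamily g Q (fun M y => scal (F M) y) := by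
  induction hF with
  | @base a h ha hz hh =>
    have hd : ContDiff ℝ ∞ (fun u => g u * h u) := hg.smooth.mul hh
    have hd' := (contDiff_infty_iff_deriv.1 hd).2
    refine ((base (contDiff_scal ha) (scal_eq_zero_of_ge ha hz) hh).add
      (base ha hz hd')).congr fun M y hM hy => ?_
    obtain ⟨h1, h2⟩ := scal_comp_div a (M := M) (ha.differentiable (by simp)) y
    have h3 := hQ.hasDerivAt_comp (hd.differentiable (by simp)) hy
    rw [scal_mul h1.differentiableAt h3.differentiableAt, h2,
      hQ.scal_comp (hd.differentiable (by simp)) hy]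
    ring
  | @add F G hF hG h1 h2 =>
    exact (h1.add h2).congr fun M y hM hy => (scal_add (hF.differentiableAt hQ hg hM hy)
      (hG.differentiableAt hQ hg hM hy)).symm
  | congr _ e h =>
    exact h.congr fun M y hM hy => scal_congr isOpen_Ioi (fun x hx => e M x hM hx) hy

end CutFamily

/-- One has `H = y^{-2}(V - Λ²)`, and conjugation by `y^m` replaces `Λ` by `Λ + m`. Thus `H` acts on
`y^m F` through the operations under which `CutFamily` is closed, at the price of two powers of `y`.
-/
theorem opH_zpow_mul {F : ℝ → ℝ} (hF : ContDiffOn ℝ ∞ F (Ioi 0)) (m : ℤ) {y : ℝ} (hy : 0 < y) :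
    opH g Q (fun x => x ^ m * F x) y =
      y ^ (m - 2) * (pot g Q y * F y - (scal (scal F) y + 2 * m * scal F y + m ^ 2 * F y)) := by
  have hd : ∀ x, 0 < x → DifferentiableAt ℝ F x := fun x hx =>
    (hF.differentiableOn (by simp)).differentiableAt (isOpen_Ioi.mem_nhds hx)
  have hd2 : DifferentiableAt ℝ (scal F) y := differentiableAt_id.mul
    (((ContDiffOn.deriv_infty isOpen_Ioi hF).differentiableOn (by simp)).differentiableAt
      (isOpen_Ioi.mem_nhds hy))
  have key : ∀ (G : ℝ → ℝ) (x : ℝ), 0 < x → DifferentiableAt ℝ G x →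
      HasDerivAt (fun x => x ^ m * G x) (x ^ m * (m * G x + scal G x) / x) x := by
    intro G x hx hG
    have := (hasDerivAt_zpow m x (Or.inl hx.ne')).mul (hasDerivAt_of_scal hx.ne' hG)
    refine this.congr_deriv ?_
    rw [zpow_sub_one₀ hx.ne']
    field_simp
  rw [opH_eq_of_hasDerivAt hy (F₁ := fun x => x ^ m * (m * F x + scal F x))
    (d := y ^ m * (m * (m * F y + scal F y) + scal (fun x => m * F x + scal F x) y))]
  · rw [scal_add ((hd y hy).const_mul _) hd2, scal_const_mul, zpow_sub₀ hy.ne']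
    have : y ^ (2 : ℤ) = y ^ 2 := zpow_ofNat y 2
    rw [this]
    field_simp
    ring
  · filter_upwards [lt_mem_nhds hy] with x hx using key F x hx (hd x hx)
  · exact key _ y hy (((hd y hy).const_mul _).add hd2)

theorem IsCutoff.le_one (hχ : IsCutoff χ) (y : ℝ) : χ y ≤ 1 := by
  rcases le_total y 1 with h | h
  · rw [hχ.one y h]
  · rw [← hχ.one 1 le_rfl]; exact hχ.antitone h

theorem exists_cutFamily (hQ : IsGroundState g Q) (hg : IsTarget g) (hχ : IsCutoff χ) (p : ℕ) :
    ∃ F, CutFamily g Q F ∧ ∀ M y, 0 < M → 0 < y →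
      opHpow g Q p (cutLamQ Q χ M) y = y ^ (-(2 * p : ℤ)) * F M y := by
  induction p with
  | zero =>
    refine ⟨_, CutFamily.base hχ.smooth hχ.zero (contDiff_const (c := (1 : ℝ))),
      fun M y hM hy => ?_⟩
    simp [opHpow_zero, cutLamQ, cut, hQ.scal_eq hy]
  | succ p ih =>
    obtain ⟨F, hF, h⟩ := ih
    refine ⟨_, (hF.pot_mul hg).add ((((hF.scal hQ hg).scal hQ hg).add (((hF.scal hQ hg).const_mul
      (2 * (-(2 * p) : ℝ))).add (hF.const_mul ((-(2 * p) : ℝ) ^ 2)))).const_mul (-1)),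
      fun M y hM hy => ?_⟩
    rw [opHpow_succ, opH_congr isOpen_Ioi (fun x hx => h M x hM hx) hy,
      opH_zpow_mul (hF.contDiffOn hQ hg hM) _ hy]
    congr 1
    · congr 1; push_cast; ring
    · push_cast; ring

theorem opHpow_cutLamQ_eq_zero (hQ : IsGroundState g Q) (hg : IsTarget g) (hχ : IsCutoff χ)
    (p : ℕ) {M y : ℝ} (hM : 0 < M) (hy : y ∈ Ioo 0 M) :
    opHpow g Q (p + 1) (cutLamQ Q χ M) y = 0 := by
  induction p generalizing y with
  | zero =>
    rw [opHpow_succ, opHpow_zero, opH_congr (G := scal Q) isOpen_Ioo (fun x hx => ?_) hy,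
      opH_scal hg hQ hy.1]
    simp [cutLamQ, cut, hχ.one _ ((div_le_one hM).2 hx.2.le)]
  | succ p ih =>
    rw [opHpow_succ]
    exact opH_zero_of_eqOn isOpen_Ioo (fun x hx => ih hx) y hy

theorem isTest_cutLamQ (hQ : IsGroundState g Q) (hg : IsTarget g) (hχ : IsCutoff χ) {M : ℝ}
    (hM : 0 < M) : IsTest Q (2 * M) (cutLamQ Q χ M) := by
  refine ⟨(hχ.smooth.comp (contDiff_id.div_const M)).contDiffOn.mul (contDiffOn_scalQ hQ hg),
    fun y hy => ?_, M, hM, 1, fun y hy => ?_⟩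
  · simp [cutLamQ, cut, hχ.zero _ ((le_div_iff₀ hM).2 hy)]
  · simp [cutLamQ, cut, hχ.one _ ((div_le_one hM).2 hy.2.le)]

theorem isTest_PhiM (hQ : IsGroundState g Q) (hg : IsTarget g) (hχ : IsCutoff χ) (L : ℕ) {M : ℝ}
    (hM : 0 < M) : IsTest Q (2 * M) (PhiM g Q χ L M) :=
  IsTest.sum _ fun p _ => ((isTest_cutLamQ hQ hg hχ hM).opHpow hQ hg (by positivity) p).const_mul _

/-- For `p ≥ 1` the function vanishes on `(0, M)`, where the cut-off is `1` and `H ΛQ = 0`. On the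
remaining region `y^{-2p} ≤ M^{-2p}`. -/
theorem exists_opHpow_cutLamQ_bound (hQ : IsGroundState g Q) (hg : IsTarget g) (hχ : IsCutoff χ)
    (p : ℕ) : ∃ C > 0, ∀ M y, 0 < M → 0 < y →
      |opHpow g Q p (cutLamQ Q χ M) y| * M ^ (2 * p) ≤ C * wt y := by
  obtain ⟨F, hF, h⟩ := exists_cutFamily hQ hg hχ p
  obtain ⟨C, hC, hb⟩ := hF.exists_bound hQ hg
  obtain ⟨_, _, D, hD, hd⟩ := hQ.exists_scal_bounds hg
  refine ⟨C * D + 1, by positivity, fun M y hM hy => ?_⟩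
  have hw := wt_pos hy
  have h1 : |F M y| ≤ C * D * wt y := (hb M y hM hy).trans (by
    rw [mul_assoc]; gcongr; exact (hd y hy).2)
  have h2 : C * D * wt y ≤ (C * D + 1) * wt y := by nlinarith
  have key : ∀ _ : p = 0 ∨ M ≤ y,
      |opHpow g Q p (cutLamQ Q χ M) y| * M ^ (2 * p) ≤ (C * D + 1) * wt y := by
    intro hp
    rw [h M y hM hy, abs_mul, abs_of_pos (zpow_pos hy _), zpow_neg]
    have h3 : (y ^ (2 * p : ℤ))⁻¹ * M ^ (2 * p) ≤ 1 := by
      have e : y ^ (2 * p : ℤ) = y ^ (2 * p) := by rw [← zpow_natCast]; norm_cast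
      rw [e, inv_mul_le_one₀ (by positivity)]
      rcases hp with rfl | hp
      · simp
      · gcongr
    calc (y ^ (2 * p : ℤ))⁻¹ * |F M y| * M ^ (2 * p)
        = ((y ^ (2 * p : ℤ))⁻¹ * M ^ (2 * p)) * |F M y| := by ring
      _ ≤ 1 * |F M y| := by gcongr
      _ ≤ _ := by linarith
  rcases le_or_gt M y with hMy | hMy
  · exact key (Or.inr hMy)
  · cases p with
    | zero => exact key (Or.inl rfl)
    | succ p =>
      rw [opHpow_cutLamQ_eq_zero hQ hg hχ p hM ⟨hy, hMy⟩, abs_zero, zero_mul]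
      positivity

theorem ip_comm (F G : ℝ → ℝ) : ip F G = ip G F := by
  simp only [ip]
  congr 1; funext y; ring

theorem exists_bdd_Tprof (hQ : IsGroundState g Q) (hg : IsTarget g) (i : ℕ) (R : ℝ) :
    ∃ A ≥ 0, ∀ y ∈ Ioo 0 R, |Tprof Q i y| ≤ A ∧ |scal (Tprof Q i) y| ≤ A := by
  have h := (symOn_Tprof hQ hg R i 1).weaken (show (0 : ℤ) ≤ 1 + 2 * i by positivity)
  obtain ⟨A, hA, h1⟩ := h.exists_bound
  obtain ⟨B, hB, h2⟩ := h.2.2.exists_bound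
  refine ⟨A + B, by positivity, fun y hy => ?_⟩
  have := h1 y hy
  have := h2 y hy
  simp only [zpow_zero, mul_one] at *
  constructor <;> linarith

/-- On `[1, M]` the integrand `(ΛQ)² y` is at least a multiple of `1/y`: the mass of `ΛQ` diverges
logarithmically. This lower bound is the denominator of the final estimate. -/
theorem exists_norm_lower (hQ : IsGroundState g Q) (hg : IsTarget g) (hχ : IsCutoff χ) :
    ∃ c > 0, ∀ M, 3 ≤ M → c * Real.log M ≤ ip (cutLamQ Q χ M) (scal Q) := by
  obtain ⟨c, hc, _, _, hb⟩ := hQ.exists_scal_bounds hg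
  refine ⟨c ^ 2 / 4, by positivity, fun M hM => ?_⟩
  have hM0 : 0 < M := by linarith
  obtain ⟨A, hA, hbd⟩ := exists_bdd_Tprof hQ hg 0 (2 * M + 1)
  rw [Tprof_zero] at hbd
  have hint := (isTest_cutLamQ hQ hg hχ hM0).integrableOn hQ hg (by positivity)
    (show 2 * M < 2 * M + 1 by linarith) ((contDiffOn_scalQ hQ hg).continuousOn.mono
      fun y hy => hy.1) (fun y hy => (hbd y hy).1)
  rw [ip_comm, ip]
  have h1 : c ^ 2 / 4 * Real.log M = ∫ y in Ioc (1 : ℝ) M, c ^ 2 / 4 * y⁻¹ := by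
    rw [← intervalIntegral.integral_of_le (by linarith), intervalIntegral.integral_const_mul,
      integral_inv_of_pos one_pos hM0, div_one]
  rw [h1]
  have hint1 : IntegrableOn (fun y : ℝ => c ^ 2 / 4 * y⁻¹) (Ioc 1 M) := by
    rw [← intervalIntegrable_iff_integrableOn_Ioc_of_le (by linarith)]
    refine ContinuousOn.intervalIntegrable_of_Icc (by linarith) ?_
    exact continuousOn_const.mul (continuousOn_id.inv₀ fun y hy => by
      have : (1 : ℝ) ≤ y := hy.1
      simp only [id]; positivity)
  have hsub : Ioc (1 : ℝ) M ⊆ Ioi 0 := fun y hy => one_pos.trans hy.1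
  calc ∫ y in Ioc (1 : ℝ) M, c ^ 2 / 4 * y⁻¹
      ≤ ∫ y in Ioc (1 : ℝ) M, scal Q y * cutLamQ Q χ M y * y := by
        refine setIntegral_mono_on hint1 (hint.mono_set hsub) measurableSet_Ioc fun y hy => ?_
        have hy0 : 0 < y := hsub hy
        have e : cutLamQ Q χ M y = scal Q y := by
          simp [cutLamQ, cut, hχ.one _ ((div_le_one hM0).2 hy.2)]
        rw [e]
        have h2 : 1 / (2 * y) ≤ wt y := by
          unfold wt; rw [div_le_div_iff₀ (by positivity) (by positivity)]; nlinarith [hy.1]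
        have h3 : c * (1 / (2 * y)) ≤ scal Q y :=
          le_trans (by gcongr) (hb y hy0).1
        calc c ^ 2 / 4 * y⁻¹ = (c * (1 / (2 * y))) * (c * (1 / (2 * y))) * y := by
              field_simp; norm_num
          _ ≤ _ := by
              have : 0 ≤ c * (1 / (2 * y)) := by positivity
              have := hQ.scal_pos hg hy0
              gcongr
    _ ≤ _ := by
        refine setIntegral_mono_set hint ?_ hsub.eventuallyLE
        filter_upwards [ae_restrict_mem measurableSet_Ioi] with y hy
        have hy0 : 0 < y := hy
        have := hQ.scal_pos hg hy0
        have h2 := hχ.nonneg (y / M)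
        simp only [cutLamQ, cut, Pi.zero_apply]
        positivity

theorem cM_zero (M : ℝ) : cM g Q χ M 0 = 1 := by rw [cM]; simp

theorem cM_succ (M : ℝ) (k : ℕ) : cM g Q χ M (k + 1) = (-1) ^ (k + 1 + 1) *
    (∑ p ∈ Finset.range (k + 1), cM g Q χ M p *
      ip (opHpow g Q p (cutLamQ Q χ M)) (Tprof Q (k + 1)))
      / ip (cutLamQ Q χ M) (scal Q) := by
  rw [cM, Finset.sum_range]; simp

theorem abs_ip_le {F G : ℝ → ℝ} {Y A : ℝ} (hY : 0 < Y) (hs : ∀ y ≥ Y, F y * G y * y = 0)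
    (hA : ∀ y ∈ Ioo 0 Y, |F y * G y * y| ≤ A) : |ip F G| ≤ A * Y := by
  have h1 : ip F G = ∫ y in Ioo 0 Y, F y * G y * y := by
    rw [ip]
    refine (setIntegral_eq_of_subset_of_forall_sdiff_eq_zero measurableSet_Ioi
      (fun y hy => hy.1) fun y hy => hs y ?_)
    by_contra! hlt
    exact hy.2 ⟨hy.1, hlt⟩
  rw [h1]
  have := norm_setIntegral_le_of_norm_le_const (μ := volume) (s := Ioo 0 Y)
    (f := fun y => F y * G y * y) (C := A) (by simp) hA
  rwa [measureReal_def, Real.volume_Ioo, ENNReal.toReal_ofReal (by linarith), sub_zero] at this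

/-- The pairing of `H^p(χ_M ΛQ)` with `T_k` is `O(M^{2k-2p} log M)`. The earlier coefficients
contribute `M^{2p}`, and the logarithm is removed by dividing by `(χ_M ΛQ, ΛQ) ≳ log M`. -/
theorem exists_cM_bound (hQ : IsGroundState g Q) (hg : IsTarget g) (hχ : IsCutoff χ) (k : ℕ) :
    ∃ C > 0, ∀ M, 3 ≤ M → |cM g Q χ M k| ≤ C * M ^ (2 * k) := by
  induction k using Nat.strong_induction_on with
  | _ k ih =>
  cases k with
  | zero => exact ⟨1, one_pos, fun M _ => by rw [cM_zero]; simp⟩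
  | succ k =>
    choose! C hC hCb using ih
    choose D hD hDb using exists_opHpow_cutLamQ_bound hQ hg hχ
    obtain ⟨E, hE, hEb⟩ := exists_Tprof_bound hg hQ k
    obtain ⟨c, hc, hcb⟩ := exists_norm_lower hQ hg hχ
    have hsum : 0 ≤ ∑ p ∈ Finset.range (k + 1), C p * (D p * E * 2) :=
      Finset.sum_nonneg fun p hp => by
        have := hC p (Finset.mem_range.1 hp)
        have := hD p
        positivity
    refine ⟨(∑ p ∈ Finset.range (k + 1), C p * (D p * E * 2)) / c + 1, by positivity,
      fun M hM => ?_⟩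
    have hM0 : 0 < M := by linarith
    have hlog := one_le_log_of_three_le hM
    have hN := hcb M hM
    have hN0 : 0 < ip (cutLamQ Q χ M) (scal Q) := lt_of_lt_of_le (by positivity) hN
    have hterm : ∀ p ∈ Finset.range (k + 1),
        |cM g Q χ M p * ip (opHpow g Q p (cutLamQ Q χ M)) (Tprof Q (k + 1))| ≤
          C p * (D p * E * 2) * (M ^ (2 * (k + 1)) * Real.log M) := by
      intro p hp
      have hp' := Finset.mem_range.1 hp
      have h1 : |ip (opHpow g Q p (cutLamQ Q χ M)) (Tprof Q (k + 1))| * M ^ (2 * p) ≤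
          D p * E * 2 * (M ^ (2 * (k + 1)) * Real.log M) := by
        have htest := (isTest_cutLamQ hQ hg hχ hM0).opHpow hQ hg (by positivity) p
        have := abs_ip_le (F := opHpow g Q p (cutLamQ Q χ M)) (G := Tprof Q (k + 1))
          (Y := 2 * M) (A := D p * (M ^ (2 * p))⁻¹ * (E * (M ^ (2 * k + 1) * Real.log M)))
          (by positivity) (fun y hy => by rw [htest.supp y hy]; ring) (fun y hy => ?_)
        · calc _ ≤ D p * (M ^ (2 * p))⁻¹ * (E * (M ^ (2 * k + 1) * Real.log M)) * (2 * M)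
                * M ^ (2 * p) := by gcongr
            _ = _ := by field_simp; ring
        · have hy0 : 0 < y := hy.1
          have e1 := hDb p M y hM0 hy0
          have e2 := hEb M y hM hy0 hy.2.le
          have e3 : wt y * y ≤ 1 := by
            unfold wt; rw [div_mul_eq_mul_div, div_le_one (by positivity)]; nlinarith
          have hDp := hD p
          have hw := wt_pos hy0
          rw [← le_div_iff₀ (by positivity)] at e1
          rw [abs_mul, abs_mul, abs_of_pos hy0]
          calc _ ≤ (D p * wt y / M ^ (2 * p)) * (E * (M ^ (2 * k + 1) * Real.log M)) * y := by
                gcongr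
            _ = D p * (M ^ (2 * p))⁻¹ * (E * (M ^ (2 * k + 1) * Real.log M)) * (wt y * y) := by
                field_simp
            _ ≤ D p * (M ^ (2 * p))⁻¹ * (E * (M ^ (2 * k + 1) * Real.log M)) * 1 := by
                gcongr
            _ = _ := mul_one _
      have := hC p hp'
      rw [abs_mul]
      calc _ ≤ C p * M ^ (2 * p) *
            |ip (opHpow g Q p (cutLamQ Q χ M)) (Tprof Q (k + 1))| := by
            gcongr; exact hCb p hp' M hM
        _ = C p * (|ip (opHpow g Q p (cutLamQ Q χ M)) (Tprof Q (k + 1))| * M ^ (2 * p)) := by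
            ring
        _ ≤ C p * (D p * E * 2 * (M ^ (2 * (k + 1)) * Real.log M)) := by gcongr
        _ = _ := by ring
    rw [cM_succ, abs_div, abs_mul, abs_pow, abs_neg, abs_one, one_pow, one_mul, abs_of_pos hN0,
      div_le_iff₀ hN0]
    calc _ ≤ ∑ p ∈ Finset.range (k + 1), C p * (D p * E * 2) *
          (M ^ (2 * (k + 1)) * Real.log M) :=
          (Finset.abs_sum_le_sum_abs _ _).trans (Finset.sum_le_sum hterm)
      _ = (∑ p ∈ Finset.range (k + 1), C p * (D p * E * 2)) / c * M ^ (2 * (k + 1)) *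
          (c * Real.log M) := by
          rw [← Finset.sum_mul, div_mul_eq_mul_div, div_mul_eq_mul_div, eq_div_iff hc.ne']; ring
      _ ≤ ((∑ p ∈ Finset.range (k + 1), C p * (D p * E * 2)) / c + 1) * M ^ (2 * (k + 1)) *
          ip (cutLamQ Q χ M) (scal Q) := by gcongr; linarith

/-- The growth `M^{2p}` of the coefficients exactly compensates the decay `M^{-2p}` of `H^p(χ_M
ΛQ)`. So `Φ_M` is no larger than `ΛQ`, uniformly in `M`. -/
theorem exists_PhiM_bound (hQ : IsGroundState g Q) (hg : IsTarget g) (hχ : IsCutoff χ) (L : ℕ) :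
    ∃ C > 0, ∀ M y, 3 ≤ M → 0 < y → |PhiM g Q χ L M y| ≤ C * wt y := by
  choose C hC hCb using exists_cM_bound hQ hg hχ
  choose D hD hDb using exists_opHpow_cutLamQ_bound hQ hg hχ
  refine ⟨∑ p ∈ Finset.range (L + 1), C p * D p, Finset.sum_pos (fun p _ =>
    mul_pos (hC p) (hD p)) (by simp), fun M y hM hy => ?_⟩
  have hM0 : 0 < M := by linarith
  rw [PhiM, Finset.sum_mul]
  refine (Finset.abs_sum_le_sum_abs _ _).trans (Finset.sum_le_sum fun p _ => ?_)
  rw [abs_mul]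
  have := hC p
  calc _ ≤ C p * M ^ (2 * p) * |opHpow g Q p (cutLamQ Q χ M) y| := by
        gcongr; exact hCb p M hM
    _ = C p * (|opHpow g Q p (cutLamQ Q χ M) y| * M ^ (2 * p)) := by ring
    _ ≤ C p * (D p * wt y) := mul_le_mul_of_nonneg_left (hDb p M y hM0 hy) this.le
    _ = _ := by ring

/-- `‖Φ_M‖² ≲ log M`. -/
theorem exists_PhiM_norm (hQ : IsGroundState g Q) (hg : IsTarget g) (hχ : IsCutoff χ) (L : ℕ) :
    ∃ C > 0, ∀ M, 3 ≤ M → IntegrableOn (fun y => PhiM g Q χ L M y ^ 2 * y) (Ioi 0) ∧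
      ∫ y in Ioi (0 : ℝ), PhiM g Q χ L M y ^ 2 * y ≤ C * Real.log M := by
  obtain ⟨C, hC, hb⟩ := exists_PhiM_bound hQ hg hχ L
  refine ⟨C ^ 2 * 2, by positivity, fun M hM => ?_⟩
  have hM0 : 0 < M := by linarith
  have htest := isTest_PhiM hQ hg hχ L hM0
  have hcont := htest.smooth.continuousOn
  have hbd : ∀ y ∈ Ioo 0 (2 * M + 1), |PhiM g Q χ L M y| ≤ C * (2 * M + 1) := fun y hy =>
    (hb M y hM hy.1).trans (by gcongr; exact (wt_le_self hy.1).trans hy.2.le)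
  have hint := htest.integrableOn hQ hg (by positivity) (show 2 * M < 2 * M + 1 by linarith)
    (hcont.mono fun y hy => hy.1) hbd
  have e : (fun y => PhiM g Q χ L M y * PhiM g Q χ L M y * y) =
      fun y => PhiM g Q χ L M y ^ 2 * y := by funext y; ring
  rw [e] at hint
  refine ⟨hint, ?_⟩
  have h1 : ∫ y in Ioi (0 : ℝ), PhiM g Q χ L M y ^ 2 * y =
      ∫ y in Ioc (0 : ℝ) (2 * M), PhiM g Q χ L M y ^ 2 * y := by
    refine setIntegral_eq_of_subset_of_forall_sdiff_eq_zero measurableSet_Ioi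
      (fun y hy => hy.1) fun y hy => ?_
    rw [htest.supp y]
    · ring
    · by_contra! hlt
      exact hy.2 ⟨hy.1, hlt.le⟩
  obtain ⟨hi, he⟩ := integral_id_div_one_add_sq (y := 2 * M)
  rw [intervalIntegrable_iff_integrableOn_Ioc_of_le (by positivity)] at hi
  rw [intervalIntegral.integral_of_le (by positivity)] at he
  rw [h1]
  calc _ ≤ ∫ y in Ioc (0 : ℝ) (2 * M), C ^ 2 * (y / (1 + y ^ 2)) := by
        refine setIntegral_mono_on (hint.mono_set fun y hy => hy.1) (hi.const_mul _)
          measurableSet_Ioc fun y hy => ?_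
        have hy0 : 0 < y := hy.1
        have h2 := hb M y hM hy0
        have hw := wt_pos hy0
        calc PhiM g Q χ L M y ^ 2 * y = |PhiM g Q χ L M y| * |PhiM g Q χ L M y| * y := by
              rw [← sq, sq_abs]
          _ ≤ (C * wt y) * (C * wt y) * y := by gcongr
          _ = C ^ 2 * (wt y * wt y * y) := by ring
          _ ≤ _ := by gcongr; exact wt_sq_mul_le hy0
    _ = C ^ 2 * (1 / 2 * Real.log (1 + (2 * M) ^ 2)) := by rw [integral_const_mul, he]
    _ ≤ C ^ 2 * (1 / 2 * (4 * Real.log M)) := by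
        gcongr; exact log_one_add_sq_le hM (by positivity) le_rfl
    _ = _ := by ring

/-! ### Duality between the profiles `T_i` and the directions `H^k Φ_M` -/

theorem IsTest.ip_Tprof_opH (hQ : IsGroundState g Q) (hg : IsTarget g) {Y : ℝ} (hY : 0 < Y)
    {w : ℝ → ℝ} (hw : IsTest Q Y w) (i : ℕ) :
    ip (Tprof Q i) (HeatFlow.opH g Q w) = ip (HeatFlow.opH g Q (Tprof Q i)) w := by
  obtain ⟨A, hA, hb⟩ := exists_bdd_Tprof hQ hg i (Y + 1)
  refine (hw.green hQ hg hY (lt_add_one Y) (((contDiffOn_Tprof hQ hg i).mono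
    fun y hy => hy.1).of_le (by norm_cast)) (fun y hy => (hb y hy).1)
    (fun y hy => (hb y hy).2) ?_).symm
  cases i with
  | zero =>
    refine (integrableOn_zero (s := Ioi (0 : ℝ))).congr_fun (fun y hy => ?_) measurableSet_Ioi
    rw [Tprof_zero, opH_scal hg hQ hy]; simp
  | succ i =>
    obtain ⟨A, hA, hb⟩ := exists_bdd_Tprof hQ hg i (Y + 1)
    refine (hw.integrableOn hQ hg hY (lt_add_one Y) (((contDiffOn_Tprof hQ hg i).continuousOn.mono
      fun y hy => hy.1)) (fun y hy => (hb y hy).1)).neg.congr_fun (fun y hy => ?_)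
      measurableSet_Ioi
    rw [opH_Tprof_succ hQ hg i hy]
    simp

theorem ip_congr {F G w : ℝ → ℝ} (h : EqOn F G (Ioi 0)) : ip F w = ip G w :=
  setIntegral_congr_fun measurableSet_Ioi fun y hy => by simp only [h hy]

theorem ip_neg (F w : ℝ → ℝ) : ip (fun y => -F y) w = -ip F w := by
  simp only [ip, neg_mul, integral_neg]

theorem ip_const_mul (c : ℝ) (F w : ℝ → ℝ) : ip (fun y => c * F y) w = c * ip F w := by
  simp only [ip, mul_assoc, integral_const_mul]

/-- Each `H` moved to the other side lowers the index, `H T_{i+1} = -T_i`, and the chain ends with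
`H T_0 = 0`. -/
theorem IsTest.ip_Tprof_opHpow (hQ : IsGroundState g Q) (hg : IsTarget g) {Y : ℝ} (hY : 0 < Y)
    {w : ℝ → ℝ} (hw : IsTest Q Y w) (k i : ℕ) :
    ip (Tprof Q i) (HeatFlow.opHpow g Q k w) = if k ≤ i then (-1) ^ k * ip (Tprof Q (i - k)) w else 0 := by
  induction k generalizing i with
  | zero => simp [opHpow_zero]
  | succ k ih =>
    rw [opHpow_succ, (hw.opHpow hQ hg hY k).ip_Tprof_opH hQ hg hY]
    cases i with
    | zero =>
      rw [ip_congr (G := fun y => 0 * 0) fun y hy => by rw [Tprof_zero, opH_scal hg hQ hy, zero_mul]]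
      simp [ip]
    | succ i =>
      rw [ip_congr fun y hy => opH_Tprof_succ hQ hg i hy, ip_neg, ih]
      simp only [Nat.add_le_add_iff_right, Nat.add_sub_add_right]
      split_ifs <;> ring

theorem IsTest.ip_sum (hQ : IsGroundState g Q) (hg : IsTarget g) {Y R : ℝ} (hY : 0 < Y)
    (hYR : Y < R) {w : ℝ → ℝ} (hw : IsTest Q Y w) {ι : Type*} (s : Finset ι) {F : ι → ℝ → ℝ}
    (hF : ∀ i ∈ s, SymOn R 0 0 (F i)) :
    ip (fun y => ∑ i ∈ s, F i y) w = ∑ i ∈ s, ip (F i) w := by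
  simp only [ip, Finset.sum_mul]
  refine integral_finsetSum s fun i hi => ?_
  obtain ⟨C, -, hC⟩ := (hF i hi).exists_bound
  exact hw.integrableOn hQ hg hY hYR (hF i hi).continuousOn
    (fun y hy => by simpa using hC y hy)

theorem IsTest.ip_add (hQ : IsGroundState g Q) (hg : IsTarget g) {Y R : ℝ} (hY : 0 < Y)
    (hYR : Y < R) {w : ℝ → ℝ} (hw : IsTest Q Y w) {F G : ℝ → ℝ}
    (hF : SymOn R 0 0 F) (hG : SymOn R 0 0 G) :
    ip (fun y => F y + G y) w = ip F w + ip G w := by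
  simp only [ip, add_mul]
  obtain ⟨C, -, hC⟩ := hF.exists_bound
  obtain ⟨D, -, hD⟩ := hG.exists_bound
  exact integral_add
    (hw.integrableOn hQ hg hY hYR hF.continuousOn (fun y hy => by simpa using hC y hy))
    (hw.integrableOn hQ hg hY hYR hG.continuousOn (fun y hy => by simpa using hD y hy))

theorem symOn_zero_Tprof (hQ : IsGroundState g Q) (hg : IsTarget g) (R : ℝ) (i n : ℕ) :
    SymOn R n 0 (Tprof Q i) :=
  (symOn_Tprof hQ hg R i n).weaken (by positivity)

/-- `(T_i, Φ_M) = 0` for `1 ≤ i ≤ L`. -/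
theorem ip_Tprof_PhiM (hQ : IsGroundState g Q) (hg : IsTarget g) (hχ : IsCutoff χ) {L : ℕ}
    {M : ℝ} (hM : 3 ≤ M) {i : ℕ} (hi : i ≤ L) : ip (Tprof Q i) (PhiM g Q χ L M) =
      if i = 0 then ip (cutLamQ Q χ M) (scal Q) else 0 := by
  have hM0 : 0 < M := by linarith
  have hY : 0 < 2 * M := by positivity
  have htest := isTest_cutLamQ hQ hg hχ hM0
  have h1 : ip (Tprof Q i) (PhiM g Q χ L M) = ∑ p ∈ Finset.range (L + 1),
      cM g Q χ M p * ip (Tprof Q i) (opHpow g Q p (cutLamQ Q χ M)) := by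
    simp only [ip, PhiM, Finset.mul_sum, Finset.sum_mul]
    rw [integral_finsetSum]
    · refine Finset.sum_congr rfl fun p _ => ?_
      rw [← integral_const_mul]
      congr 1; funext y; ring
    · intro p _
      obtain ⟨A, hA, hb⟩ := exists_bdd_Tprof hQ hg i (2 * M + 1)
      exact ((htest.opHpow hQ hg hY p).const_mul (cM g Q χ M p)).integrableOn hQ hg hY
        (lt_add_one _) ((contDiffOn_Tprof hQ hg i).continuousOn.mono fun y hy => hy.1)
        fun y hy => (hb y hy).1
  have h2 : ∀ p, i < p → ip (Tprof Q i) (opHpow g Q p (cutLamQ Q χ M)) = 0 := fun p hp => by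
    rw [htest.ip_Tprof_opHpow hQ hg hY, if_neg (by omega)]
  have h3 : ip (Tprof Q i) (PhiM g Q χ L M) = ∑ p ∈ Finset.range (i + 1),
      cM g Q χ M p * ip (Tprof Q i) (opHpow g Q p (cutLamQ Q χ M)) := by
    rw [h1]
    refine (Finset.sum_subset (fun p hp => ?_) fun p hp hp' => ?_).symm
    · simp only [Finset.mem_range] at *; omega
    · rw [h2 p (by simp only [Finset.mem_range] at *; omega), mul_zero]
  rw [h3]
  obtain ⟨c, hc, hcb⟩ := exists_norm_lower hQ hg hχ
  have hN0 : 0 < ip (cutLamQ Q χ M) (scal Q) := lt_of_lt_of_le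
    (by have := one_le_log_of_three_le hM; positivity) (hcb M hM)
  cases i with
  | zero =>
    simp [cM_zero, opHpow_zero, Tprof_zero, ip_comm (scal Q)]
  | succ i =>
    rw [Finset.sum_range_succ, cM_succ, htest.ip_Tprof_opHpow hQ hg hY (i + 1) (i + 1),
      if_pos le_rfl, Nat.sub_self, Tprof_zero, ip_comm (scal Q), if_neg (by omega)]
    have : ∀ p, ip (Tprof Q (i + 1)) (opHpow g Q p (cutLamQ Q χ M)) =
      ip (opHpow g Q p (cutLamQ Q χ M)) (Tprof Q (i + 1)) := fun p => ip_comm _ _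
    simp only [this]
    -- The last term of the sum is `c_{i+1,M} (-1)^{i+1} (χ_M ΛQ, ΛQ)`. By the choice of `c_{i+1,M}`
    -- it is minus the sum of all the previous terms.
    have e : ((-1 : ℝ) ^ (i + 1 + 1)) * (-1) ^ (i + 1) = -1 := by
      rw [← pow_add, show i + 1 + 1 + (i + 1) = 2 * (i + 1) + 1 by ring, pow_succ, pow_mul]
      simp
    rw [div_mul_eq_mul_div, add_div' _ _ _ hN0.ne', div_eq_zero_iff]
    left
    linear_combination (ip (cutLamQ Q χ M) (scal Q) * ∑ p ∈ Finset.range (i + 1), cM g Q χ M p *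
      ip (opHpow g Q p (cutLamQ Q χ M)) (Tprof Q (i + 1))) * e

/-- The matrix of pairings is diagonal: testing a combination of `T_0, …, T_L` against `H^k Φ_M`
reads off its `k`-th coefficient. This serves both the coercivity estimate and the modulation
equations. -/
theorem ip_Tprof_opHpow_PhiM (hQ : IsGroundState g Q) (hg : IsTarget g) (hχ : IsCutoff χ) {L : ℕ}
    {M : ℝ} (hM : 3 ≤ M) {i k : ℕ} (hi : i ≤ L) :
    ip (Tprof Q i) (opHpow g Q k (PhiM g Q χ L M)) =
      if i = k then (-1) ^ k * ip (cutLamQ Q χ M) (scal Q) else 0 := by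
  have hM0 : 0 < M := by linarith
  rw [(isTest_PhiM hQ hg hχ L hM0).ip_Tprof_opHpow hQ hg (by positivity) k i,
    ip_Tprof_PhiM hQ hg hχ hM (by omega)]
  by_cases h : k ≤ i
  · rw [if_pos h]
    by_cases h2 : i = k
    · rw [if_pos (by omega), if_pos h2]
    · rw [if_neg (by omega), if_neg h2, mul_zero]
  · rw [if_neg h, if_neg (by omega)]

/-! ### Weighted square integrable functions -/

theorem weighted_cauchy_schwarz {s : Set ℝ} (hs : MeasurableSet s) (hs0 : s ⊆ Ioi 0) {f h : ℝ → ℝ}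
    (hf : IntegrableOn (fun y => f y ^ 2 * y) s) (hh : IntegrableOn (fun y => h y ^ 2 * y) s)
    (hm : AEStronglyMeasurable (fun y => f y * h y * y) (volume.restrict s)) :
    IntegrableOn (fun y => f y * h y * y) s ∧ |∫ y in s, f y * h y * y| ≤
      Real.sqrt (∫ y in s, f y ^ 2 * y) * Real.sqrt (∫ y in s, h y ^ 2 * y) := by
  have hint : IntegrableOn (fun y => f y * h y * y) s := by
    refine Integrable.mono' (hf.add hh) hm ?_
    filter_upwards [ae_restrict_mem hs] with y hy
    have hy0 : 0 < y := hs0 hy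
    rw [Real.norm_eq_abs, abs_mul, abs_mul, abs_of_pos hy0, Pi.add_apply, ← add_mul]
    gcongr
    nlinarith [sq_abs (f y), sq_abs (h y), sq_nonneg (|f y| - |h y|), sq_nonneg (|f y| + |h y|)]
  refine ⟨hint, ?_⟩
  have hf0 : 0 ≤ ∫ y in s, f y ^ 2 * y := setIntegral_nonneg hs fun y hy => by
    have : 0 < y := hs0 hy
    positivity
  have hq : ∀ t : ℝ, 0 ≤ (∫ y in s, h y ^ 2 * y) * (t * t) +
      (-2 * ∫ y in s, f y * h y * y) * t + ∫ y in s, f y ^ 2 * y := by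
    intro t
    have e : ∫ y in s, (f y - t * h y) ^ 2 * y = (∫ y in s, h y ^ 2 * y) * (t * t) +
      (-2 * ∫ y in s, f y * h y * y) * t + ∫ y in s, f y ^ 2 * y := by
      have : (fun y => (f y - t * h y) ^ 2 * y) = fun y =>
          (t * t) * (h y ^ 2 * y) + (-2 * t) * (f y * h y * y) + f y ^ 2 * y := by
        funext y; ring
      have i1 : IntegrableOn (fun y => (t * t) * (h y ^ 2 * y) + (-2 * t) * (f y * h y * y)) s :=
        (hh.const_mul _).add (hint.const_mul _)
      rw [this, integral_add i1 hf,
        integral_add (hh.const_mul _) (hint.const_mul _), integral_const_mul, integral_const_mul]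
      ring
    rw [← e]
    exact setIntegral_nonneg hs fun y hy => by
      have : 0 < y := hs0 hy
      positivity
  have hd := discrim_le_zero hq
  rw [discrim] at hd
  rw [← Real.sqrt_mul hf0]
  exact Real.abs_le_sqrt (by nlinarith)

/-- For sources that are merely square integrable, the integral against `Γ` cannot in general start
at `0`, since `Γ² x` is of size `1/x` there. It is based at `1` instead. By Cauchy–Schwarz it grows
at most like `y^{-1/2}` at the origin, which the factor `ΛQ = O(y)` absorbs. -/
theorem exists_invHFrom_bounds (hQ : IsGroundState g Q) (hg : IsTarget g) {R : ℝ} (hR : 1 < R) :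
    ∃ C > 0, ∀ (h : ℝ → ℝ) (E : ℝ), 0 ≤ E → ContinuousOn h (Ioo 0 R) →
    IntegrableOn (fun y => h y ^ 2 * y) (Ioo 0 R) → ∫ y in Ioo 0 R, h y ^ 2 * y ≤ E ^ 2 →
    ∀ y ∈ Ioo 0 R, IntervalIntegrable (fun x => h x * scal Q x * x) volume 0 y ∧
      IntervalIntegrable (fun x => h x * Gam Q x * x) volume 1 y ∧
      |invHFrom Q 1 h y| ≤ C * E ∧ |scalInvHFrom Q 1 h y| ≤ C * E := by
  obtain ⟨C₁, hC₁, hb₁⟩ := (symOn_scal hQ hg R 1).exists_bound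
  obtain ⟨C₂, hC₂, hb₂⟩ := (symOn_scal hQ hg R 1).2.2.exists_bound
  obtain ⟨C₃, hC₃, hb₃⟩ := hQ.exists_Gam_bounds hg
  simp only [zpow_one] at hb₁ hb₂
  have hR0 : 0 < R := by linarith
  set D := C₃ * (1 + R ^ 2) with hD
  have hG : ∀ y ∈ Ioo 0 R, |Gam Q y| ≤ D / y ∧ |scal (Gam Q) y| ≤ D / y := by
    intro y hy
    have hy0 : 0 < y := hy.1
    have e : C₃ * ((1 + y ^ 2) / y) ≤ D / y := by
      rw [hD, mul_div_assoc]
      have := hy.2.le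
      gcongr
    exact ⟨(hb₃ y hy0).1.trans e, (hb₃ y hy0).2.trans e⟩
  have hD0 : 0 < D := by positivity
  refine ⟨D * C₁ * R + (C₁ + C₂) * D * R ^ 2 + 1, by positivity, fun h E hE hc hi hiE y hy => ?_⟩
  have hy0 : 0 < y := hy.1
  have hnorm : ∀ s ⊆ Ioo 0 R, MeasurableSet s → ∫ y in s, h y ^ 2 * y ≤ E ^ 2 := fun s hs hms =>
    (setIntegral_mono_set hi (by
      filter_upwards [ae_restrict_mem measurableSet_Ioo] with y hy
      have : 0 < y := hy.1
      simp only [Pi.zero_apply]; positivity) hs.eventuallyLE).trans hiE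
  have key : ∀ (s : Set ℝ) (w : ℝ → ℝ) (B : ℝ), MeasurableSet s → s ⊆ Ioo 0 R → 0 ≤ B →
      ContinuousOn w (Ioo 0 R) → (∀ x ∈ s, w x ^ 2 * x ≤ B) →
      IntegrableOn (fun x => h x * w x * x) s ∧
        |∫ x in s, h x * w x * x| ≤ E * Real.sqrt (B * R) := by
    intro s w B hs hsR hB hw hwB
    have hfin : volume s < ⊤ := (measure_mono hsR).trans_lt (by simp)
    have hwi : IntegrableOn (fun y => w y ^ 2 * y) s := by
      refine IntegrableOn.of_bound (C := B) hfin
        (((hw.mono hsR).pow 2).mul continuousOn_id |>.aestronglyMeasurable hs) ?_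
      filter_upwards [ae_restrict_mem hs] with x hx
      have : 0 < x := (hsR hx).1
      rw [Real.norm_of_nonneg (by positivity)]
      exact hwB x hx
    obtain ⟨k1, k2⟩ := weighted_cauchy_schwarz hs (fun x hx => (hsR hx).1) (hi.mono_set hsR) hwi
      ((((hc.mono hsR).mul (hw.mono hsR)).mul continuousOn_id).aestronglyMeasurable hs)
    refine ⟨k1, k2.trans ?_⟩
    have e1 : Real.sqrt (∫ y in s, h y ^ 2 * y) ≤ E := by
      rw [← Real.sqrt_sq hE]; exact Real.sqrt_le_sqrt (hnorm s hsR hs)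
    have e2 : ∫ y in s, w y ^ 2 * y ≤ B * R := by
      have hv : ∫ _ in s, B = volume.real s * B := by simp
      calc ∫ y in s, w y ^ 2 * y ≤ ∫ y in s, B :=
            setIntegral_mono_on hwi (integrableOn_const hfin.ne) hs hwB
        _ = volume.real s * B := hv
        _ ≤ R * B := by
            gcongr
            have : volume.real s ≤ volume.real (Ioo 0 R) := measureReal_mono hsR (by simp)
            refine this.trans (le_of_eq ?_)
            rw [measureReal_def, Real.volume_Ioo, ENNReal.toReal_ofReal (by linarith), sub_zero]
        _ = _ := mul_comm _ _
    gcongr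
  have hsub1 : Ioc 0 y ⊆ Ioo 0 R := fun x hx => ⟨hx.1, hx.2.trans_lt hy.2⟩
  have hsub2 : uIoc 1 y ⊆ Ioo 0 R := fun x hx => by
    rcases le_total 1 y with h1 | h1
    · rw [uIoc_of_le h1] at hx; exact ⟨one_pos.trans hx.1, hx.2.trans_lt hy.2⟩
    · rw [uIoc_of_ge h1] at hx; exact ⟨hy0.trans hx.1, hx.2.trans_lt hR⟩
  have hcs : ContinuousOn (scal Q) (Ioo 0 R) := (hQ.continuousOn_scal hg).mono fun x hx => hx.1
  have hcG : ContinuousOn (Gam Q) (Ioo 0 R) := (hQ.continuousOn_Gam hg).mono fun x hx => hx.1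
  obtain ⟨p1, p2⟩ := key (Ioc 0 y) (scal Q) (C₁ ^ 2 * y ^ 2 * R) measurableSet_Ioc hsub1
    (by positivity) hcs fun x hx => by
      have hx0 : 0 < x := hx.1
      have h1 := hb₁ x (hsub1 hx)
      have h2 : |scal Q x| ≤ C₁ * y := h1.trans (by gcongr; exact hx.2)
      have h3 : scal Q x ^ 2 ≤ (C₁ * y) ^ 2 := by rw [← sq_abs]; gcongr
      rw [← mul_pow]
      have := (hsub1 hx).2.le
      gcongr
  -- Every point between `1` and `y` is at least `min 1 y`, hence this bound for `Γ² x ≤ D²/x`.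
  obtain ⟨q1, q2⟩ := key (uIoc 1 y) (Gam Q) (D ^ 2 / min 1 y) measurableSet_uIoc hsub2
    (by positivity) hcG fun x hx => by
      have hx0 : 0 < x := (hsub2 hx).1
      have h1 := (hG x (hsub2 hx)).1
      have h3 : Gam Q x ^ 2 ≤ (D / x) ^ 2 := by rw [← sq_abs]; gcongr
      have h4 : min 1 y ≤ x := by
        rw [uIoc, mem_Ioc] at hx; exact hx.1.le
      have h5 : 0 < min 1 y := lt_min one_pos hy0
      calc Gam Q x ^ 2 * x ≤ (D / x) ^ 2 * x := by gcongr
        _ = D ^ 2 / x := by field_simp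
        _ ≤ _ := by gcongr
  have hP : |∫ x in (0 : ℝ)..y, h x * scal Q x * x| ≤ E * (C₁ * R) * y := by
    rw [intervalIntegral.integral_of_le hy0.le]
    refine p2.trans (le_of_eq ?_)
    rw [show C₁ ^ 2 * y ^ 2 * R * R = (C₁ * y * R) ^ 2 by ring, Real.sqrt_sq (by positivity)]
    ring
  have hN : y * |∫ x in (1 : ℝ)..y, h x * Gam Q x * x| ≤ E * D * R ^ 2 := by
    rw [intervalIntegral.abs_integral_eq_abs_integral_uIoc]
    have h5 : 0 < min 1 y := lt_min one_pos hy0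
    have h6 : y * Real.sqrt (D ^ 2 / min 1 y * R) ≤ D * R ^ 2 := by
      have e : y * Real.sqrt (D ^ 2 / min 1 y * R) = Real.sqrt (y ^ 2 * (D ^ 2 / min 1 y * R)) := by
        rw [Real.sqrt_mul (sq_nonneg y), Real.sqrt_sq hy0.le]
      rw [e, Real.sqrt_le_left (by positivity)]
      have h7 : y ^ 2 / min 1 y ≤ R ^ 2 := by
        rw [div_le_iff₀ h5]
        rcases le_total 1 y with h1 | h1
        · rw [min_eq_left h1, mul_one]; have := hy.2.le; gcongr
        · rw [min_eq_right h1, sq y]; have : y ≤ R ^ 2 := by nlinarith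
          gcongr
      calc y ^ 2 * (D ^ 2 / min 1 y * R) = D ^ 2 * (y ^ 2 / min 1 y) * R := by ring
        _ ≤ D ^ 2 * R ^ 2 * R := by gcongr
        _ ≤ D ^ 2 * R ^ 2 * R ^ 2 := by gcongr; nlinarith
        _ = _ := by ring
    calc _ ≤ y * (E * Real.sqrt (D ^ 2 / min 1 y * R)) := by gcongr
      _ = E * (y * Real.sqrt (D ^ 2 / min 1 y * R)) := by ring
      _ ≤ E * (D * R ^ 2) := by gcongr
      _ = _ := by ring
  refine ⟨?_, ?_, ?_, ?_⟩
  · rwa [intervalIntegrable_iff_integrableOn_Ioc_of_le hy0.le]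
  · rwa [intervalIntegrable_iff]
  · have h1 := hb₁ y hy
    calc |invHFrom Q 1 h y| ≤ |Gam Q y| * |∫ x in (0 : ℝ)..y, h x * scal Q x * x|
          + |scal Q y| * |∫ x in (1 : ℝ)..y, h x * Gam Q x * x| := by
          rw [invHFrom]; refine (abs_add_le _ _).trans ?_
          rw [abs_mul, abs_mul, abs_neg]
      _ ≤ D / y * (E * (C₁ * R) * y) + (C₁ * y) * |∫ x in (1 : ℝ)..y, h x * Gam Q x * x| := by
          gcongr
          exact (hG y hy).1
      _ = D * C₁ * R * E + C₁ * (y * |∫ x in (1 : ℝ)..y, h x * Gam Q x * x|) := by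
          field_simp
      _ ≤ D * C₁ * R * E + C₁ * (E * D * R ^ 2) := by gcongr
      _ ≤ _ := by
          have : 0 ≤ C₂ * D * R ^ 2 * E := by positivity
          linarith
  · have h1 := hb₂ y hy
    calc |scalInvHFrom Q 1 h y| ≤ |scal (Gam Q) y| * |∫ x in (0 : ℝ)..y, h x * scal Q x * x|
          + |scal (scal Q) y| * |∫ x in (1 : ℝ)..y, h x * Gam Q x * x| := by
          rw [scalInvHFrom]; refine (abs_add_le _ _).trans ?_
          rw [abs_mul, abs_mul, abs_neg]
      _ ≤ D / y * (E * (C₁ * R) * y) + (C₂ * y) * |∫ x in (1 : ℝ)..y, h x * Gam Q x * x| := by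
          gcongr
          exact (hG y hy).2
      _ = D * C₁ * R * E + C₂ * (y * |∫ x in (1 : ℝ)..y, h x * Gam Q x * x|) := by
          field_simp
      _ ≤ D * C₁ * R * E + C₂ * (E * D * R ^ 2) := by gcongr
      _ ≤ _ := by
          have : 0 ≤ C₁ * D * R ^ 2 * E := by positivity
          linarith

/-- A square integrable solution of `H w = h` has no component along `Γ`. -/
theorem eq_invHFrom_add (hQ : IsGroundState g Q) (hg : IsTarget g) {R : ℝ} (hR : 1 < R)
    {w : ℝ → ℝ} (hw : ContDiffOn ℝ ∞ w (Ioo 0 R))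
    (hi : IntegrableOn (fun y => w y ^ 2 * y) (Ioo 0 R))
    (hi' : IntegrableOn (fun y => opH g Q w y ^ 2 * y) (Ioo 0 R)) :
    ∃ a, ∀ y ∈ Ioo 0 R, w y = invHFrom Q 1 (opH g Q w) y + a * scal Q y := by
  set h := opH g Q w with hh
  have hR0 : 0 < R := by linarith
  have hc : ContinuousOn h (Ioo 0 R) :=
    (contDiffOn_opH hQ hg isOpen_Ioo (fun y hy => hy.1) hw).continuousOn
  obtain ⟨C, hC, hb⟩ := exists_invHFrom_bounds hQ hg hR
  have h0 : 0 ≤ ∫ y in Ioo 0 R, h y ^ 2 * y := setIntegral_nonneg measurableSet_Ioo fun y hy => by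
    have : 0 < y := hy.1
    positivity
  have hb := hb h _ (Real.sqrt_nonneg _) hc hi' (Real.sq_sqrt h0).ge
  set E := Real.sqrt (∫ y in Ioo 0 R, h y ^ 2 * y)
  have hdw : ∀ y ∈ Ioo 0 R, HasDerivAt w (scal w y / y) y := fun y hy =>
    hasDerivAt_of_scal hy.1.ne' ((hw.differentiableOn (by simp)).differentiableAt
      (isOpen_Ioo.mem_nhds hy))
  have hdw2 : ∀ y ∈ Ioo 0 R, HasDerivAt (scal w) ((pot g Q y * w y - y ^ 2 * h y) / y) y := by
    intro y hy
    have h1 := ((ContDiffOn.deriv_infty isOpen_Ioo hw).differentiableOn (by simp)).differentiableAt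
      (isOpen_Ioo.mem_nhds hy)
    have := (hasDerivAt_id y).mul h1.hasDerivAt
    refine this.congr_deriv ?_
    have hy0 : y ≠ 0 := hy.1.ne'
    simp only [hh, opH, lap, id, pot]
    field_simp
    ring
  have hW1 : ∀ y ∈ Ioo 0 R, HasDerivAt (fun x => w x * scal (Gam Q) x - scal w x * Gam Q x)
      (h y * Gam Q y * y) y := by
    intro y hy
    have := ((hdw y hy).mul (hQ.hasDerivAt_scal_Gam hg hy.1)).sub
      ((hdw2 y hy).mul (hQ.hasDerivAt_Gam' hg hy.1))
    refine this.congr_deriv ?_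
    have hy0 : y ≠ 0 := hy.1.ne'
    field_simp
    ring
  have hW2 : ∀ y ∈ Ioo 0 R, HasDerivAt (fun x => w x * scal (scal Q) x - scal w x * scal Q x)
      (h y * scal Q y * y) y := by
    intro y hy
    have := ((hdw y hy).mul (hQ.hasDerivAt_scal_scal hg hy.1)).sub
      ((hdw2 y hy).mul (hQ.hasDerivAt_scal' hg hy.1))
    refine this.congr_deriv ?_
    have hy0 : y ≠ 0 := hy.1.ne'
    field_simp
    ring
  have h1R : (1 : ℝ) ∈ Ioo 0 R := ⟨one_pos, hR⟩
  have hu : ∀ y ∈ Ioo 0 R, uIcc 1 y ⊆ Ioo 0 R := fun y hy =>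
    (ordConnected_Ioo).uIcc_subset h1R hy
  set a := w 1 * scal (Gam Q) 1 - scal w 1 * Gam Q 1 with ha
  set c := w 1 * scal (scal Q) 1 - scal w 1 * scal Q 1 -
    ∫ x in (0 : ℝ)..1, h x * scal Q x * x with hcdef
  -- Integrating the derivatives of the Wronskians of `w` with `Γ` and with `ΛQ` from `1` to `y`,
  -- and solving for `w` with the Wronskian identity, gives the general solution; `a` and `c` are
  -- the two free constants.
  have hrep : ∀ y ∈ Ioo 0 R, w y = invHFrom Q 1 h y + a * scal Q y - c * Gam Q y := by
    intro y hy
    have e1 := intervalIntegral.integral_eq_sub_of_hasDerivAt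
      (fun x hx => hW1 x (hu y hy hx)) (hb y hy).2.1
    have i2 : IntervalIntegrable (fun x => h x * scal Q x * x) volume 1 y :=
      (hb 1 h1R).1.symm.trans (hb y hy).1
    have e2 := intervalIntegral.integral_eq_sub_of_hasDerivAt
      (fun x hx => hW2 x (hu y hy hx)) i2
    have e3 := intervalIntegral.integral_add_adjacent_intervals (hb 1 h1R).1 i2
    have hwr := hQ.wronskian hg hy.1
    rw [invHFrom, ← e3, e1, e2, hcdef, ha]
    linear_combination (-w y) * hwr
  -- If `c ≠ 0`, the lower bound `|Γ| ≥ k/y` and the boundedness of the other terms dominate `1/y`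
  -- by a constant plus a multiple of `w² y` on `(0, 1/2]`. Then `1/y` would be integrable there.
  have hc0 : c = 0 := by
    by_contra hne
    obtain ⟨k, hk, hkb⟩ := hQ.exists_Gam_lower hg
    obtain ⟨C₁, hC₁, hb₁⟩ := (symOn_zero_Tprof hQ hg R 0 0).exists_bound
    simp only [Tprof_zero, zpow_zero, mul_one] at hb₁
    set A := C * E + |a| * C₁ with hA
    have hE0 : 0 ≤ E := Real.sqrt_nonneg _
    have hsub : Ioc (0 : ℝ) (1 / 2) ⊆ Ioo 0 R := fun x hx => ⟨hx.1, by linarith [hx.2]⟩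
    have hint : IntegrableOn (fun y : ℝ => y⁻¹) (Ioc 0 (1 / 2)) := by
      have hdom : IntegrableOn (fun y => (c ^ 2 * k ^ 2)⁻¹ * (2 * (A ^ 2) * R + 2 * (w y ^ 2 * y)))
          (Ioc 0 (1 / 2)) :=
        ((integrableOn_const (by simp)).add ((hi.mono_set hsub).const_mul 2)).const_mul _
      refine Integrable.mono' hdom
        measurable_inv.aestronglyMeasurable ?_
      filter_upwards [ae_restrict_mem measurableSet_Ioc] with y hy
      have hy0 : 0 < y := hy.1
      have hyR := hsub hy
      have h1 := hkb y hy0 hy.2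
      have h2 : |c * Gam Q y| ≤ A + |w y| := by
        have e : c * Gam Q y = invHFrom Q 1 h y + a * scal Q y - w y := by
          rw [hrep y hyR]; ring
        rw [e]
        refine (abs_sub _ _).trans ?_
        have h3 := abs_add_le (invHFrom Q 1 h y) (a * scal Q y)
        have h4 := (hb y hyR).2.2.1
        have h5 : |a * scal Q y| ≤ |a| * C₁ := by
          rw [abs_mul]; gcongr; exact hb₁ y hyR
        linarith
      have h3 : (c * Gam Q y) ^ 2 ≤ 2 * A ^ 2 + 2 * w y ^ 2 := by
        rw [← sq_abs, ← sq_abs (w y)]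
        have : |c * Gam Q y| ^ 2 ≤ (A + |w y|) ^ 2 := by gcongr
        nlinarith [sq_nonneg (A - |w y|)]
      have h4 : c ^ 2 * k ^ 2 * y⁻¹ ≤ (c * Gam Q y) ^ 2 * y := by
        have : (k / y) ^ 2 ≤ Gam Q y ^ 2 := by rw [← sq_abs (Gam Q y)]; gcongr
        calc c ^ 2 * k ^ 2 * y⁻¹ = c ^ 2 * (k / y) ^ 2 * y := by field_simp
          _ ≤ c ^ 2 * Gam Q y ^ 2 * y := by gcongr
          _ = _ := by ring
      rw [Real.norm_of_nonneg (inv_nonneg.2 hy0.le), inv_mul_eq_div, le_div_iff₀ (by positivity)]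
      have h5 : (c * Gam Q y) ^ 2 * y ≤ (2 * A ^ 2 + 2 * w y ^ 2) * y := by gcongr
      have h6 : 2 * A ^ 2 * y ≤ 2 * A ^ 2 * R := by gcongr; exact hyR.2.le
      linarith
    rw [← intervalIntegrable_iff_integrableOn_Ioc_of_le (by norm_num),
      intervalIntegrable_inv_iff] at hint
    rcases hint with h1 | h1
    · norm_num at h1
    · exact h1 left_mem_uIcc
  refine ⟨a, fun y hy => ?_⟩
  rw [hrep y hy, hc0]; ring

/-! ### Coercivity under the orthogonality conditions -/

theorem exists_invH_iterate_bound (hQ : IsGroundState g Q) (hg : IsTarget g) (R : ℝ) (j : ℕ) :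
    ∃ C > 0, ∀ (z : ℝ → ℝ) (B : ℝ), 0 ≤ B → ContinuousOn z (Ioo 0 R) →
      (∀ y ∈ Ioo 0 R, |z y| ≤ B) → ContinuousOn ((invH Q)^[j] z) (Ioo 0 R) ∧
      ∀ y ∈ Ioo 0 R, |(invH Q)^[j] z y| ≤ C * B := by
  obtain ⟨D, hD, hb⟩ := exists_invH_bounds hg hQ R
  induction j with
  | zero => exact ⟨1, one_pos, fun z B _ hc hz => ⟨hc, by simpa using hz⟩⟩
  | succ j ih =>
    obtain ⟨C, hC, ih⟩ := ih
    refine ⟨D * C * R ^ 2 + 1, by positivity, fun z B hB hc hz => ?_⟩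
    obtain ⟨h1, h2⟩ := ih z B hB hc hz
    have h2' : ∀ y ∈ Ioo 0 R, |(invH Q)^[j] z y| ≤ C * B * y ^ 0 := by simpa using h2
    rw [Function.iterate_succ']
    refine ⟨fun y hy => (hasDerivAt_invH hg hQ (by positivity) h1 h2'
      hy).1.continuousAt.continuousWithinAt, fun y hy => ?_⟩
    refine ((hb 0 _ _ (by positivity) h1 h2' y hy).1).trans ?_
    have : y ^ (0 + 2) ≤ R ^ 2 := by rw [zero_add]; have := hy.1.le; have := hy.2.le; gcongr
    calc D * (C * B) * y ^ (0 + 2) ≤ D * (C * B) * R ^ 2 := by gcongr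
      _ ≤ _ := by nlinarith

theorem exists_scal_invH_iterate_bound (hQ : IsGroundState g Q) (hg : IsTarget g) (R : ℝ)
    (j : ℕ) : ∃ C > 0, ∀ (z : ℝ → ℝ) (B : ℝ), 0 ≤ B → ContinuousOn z (Ioo 0 R) →
      (∀ y ∈ Ioo 0 R, |z y| ≤ B) →
      ∀ y ∈ Ioo 0 R, |(invH Q)^[j + 1] z y| ≤ C * B ∧ |scal ((invH Q)^[j + 1] z) y| ≤ C * B := by
  obtain ⟨D, hD, hb⟩ := exists_invH_bounds hg hQ R
  obtain ⟨C, hC, hj⟩ := exists_invH_iterate_bound hQ hg R j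
  refine ⟨D * C * R ^ 2 + 1, by positivity, fun z B hB hc hz y hy => ?_⟩
  obtain ⟨h1, h2⟩ := hj z B hB hc hz
  have h2' : ∀ y ∈ Ioo 0 R, |(invH Q)^[j] z y| ≤ C * B * y ^ 0 := by simpa using h2
  have h3 := hb 0 _ _ (by positivity) h1 h2' y hy
  have h4 := (hasDerivAt_invH hg hQ (by positivity) h1 h2' hy).1
  have h5 : D * (C * B) * y ^ (0 + 2) ≤ (D * C * R ^ 2 + 1) * B := by
    have : y ^ (0 + 2) ≤ R ^ 2 := by rw [zero_add]; have := hy.1.le; have := hy.2.le; gcongr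
    calc D * (C * B) * y ^ (0 + 2) ≤ D * (C * B) * R ^ 2 := by gcongr
      _ ≤ _ := by nlinarith
  rw [Function.iterate_succ']
  refine ⟨h3.1.trans h5, ?_⟩
  rw [Function.comp_def, scal_eq_of_hasDerivAt hy.1.ne' h4]
  exact h3.2.trans h5

theorem symOn_invH_iterate (hQ : IsGroundState g Q) (hg : IsTarget g) {R : ℝ} {n : ℕ}
    {z : ℝ → ℝ} (hz : SymOn R n 0 z) (j : ℕ) : SymOn R n 0 ((invH Q)^[j] z) := by
  induction j with
  | zero => exact hz
  | succ j ih =>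
    rw [Function.iterate_succ']
    exact (symOn_invH hQ hg (a := 0) (by exact_mod_cast ih)).weaken (by norm_num)

theorem SymOn.intervalIntegrable (hQ : IsGroundState g Q) (hg : IsTarget g) {R : ℝ} {n : ℕ}
    {F : ℝ → ℝ} (hF : SymOn R n 0 F) {y : ℝ} (hy : y ∈ Ioo 0 R) :
    IntervalIntegrable (fun x => F x * scal Q x * x) volume 0 y ∧
      IntervalIntegrable (fun x => F x * Gam Q x * x) volume 0 y := by
  obtain ⟨A, hA, hFA⟩ := hF.exists_bound
  obtain ⟨_, _, hi⟩ := exists_invH_integral_bounds hg hQ R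
  obtain ⟨h1, h2, -⟩ := hi 0 F A hA hF.continuousOn (by simpa using hFA) y hy
  exact ⟨h1, h2⟩

theorem SymOn.invH_add (hQ : IsGroundState g Q) (hg : IsTarget g) {R : ℝ} {n : ℕ}
    {F G : ℝ → ℝ} (hF : SymOn R n 0 F) (hG : SymOn R n 0 G) {y : ℝ} (hy : y ∈ Ioo 0 R) :
    invH Q (fun x => F x + G x) y = invH Q F y + invH Q G y := by
  obtain ⟨f1, f2⟩ := hF.intervalIntegrable hQ hg hy
  obtain ⟨g1, g2⟩ := hG.intervalIntegrable hQ hg hy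
  simp only [invH, add_mul]
  rw [intervalIntegral.integral_add f1 g1, intervalIntegral.integral_add f2 g2]
  ring

theorem invH_sum_Tprof (hQ : IsGroundState g Q) (hg : IsTarget g) (α : ℕ → ℝ) (n : ℕ) {y : ℝ}
    (hy : 0 < y) : invH Q (fun x => ∑ i ∈ Finset.range n, α i * Tprof Q i x) y =
      ∑ i ∈ Finset.range n, -α i * Tprof Q (i + 1) y := by
  induction n with
  | zero => simp [invH]
  | succ n ih =>
    simp only [Finset.sum_range_succ]
    have hy' : y ∈ Ioo 0 (y + 1) := ⟨hy, by linarith⟩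
    rw [SymOn.invH_add (R := y + 1) (n := 0) hQ hg (SymOn.sum _ fun i _ =>
      (symOn_zero_Tprof hQ hg _ i 0).const_mul _) ((symOn_zero_Tprof hQ hg _ n 0).const_mul _) hy',
      ih, invH_const_mul, Tprof_succ]
    ring

/-- Functions with square integrable iterates `H^k e` are a combination of the profiles `T_i` and
of iterated inverses of `H^{L+1} e`. -/
theorem exists_representation (hQ : IsGroundState g Q) (hg : IsTarget g) {R : ℝ} (hR : 1 < R)
    (L : ℕ) {e : ℝ → ℝ} (he : ContDiffOn ℝ ∞ e (Ioo 0 R))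
    (hi : ∀ k ≤ L + 1, IntegrableOn (fun y => opHpow g Q k e y ^ 2 * y) (Ioo 0 R))
    (hz : SymOn R 1 0 (invHFrom Q 1 (opHpow g Q (L + 1) e))) (j : ℕ) (hj : j ≤ L) :
    ∃ α : ℕ → ℝ, ∀ y ∈ Ioo 0 R, opHpow g Q (L - j) e y =
      (invH Q)^[j] (invHFrom Q 1 (opHpow g Q (L + 1) e)) y
        + ∑ i ∈ Finset.range (j + 1), α i * Tprof Q i y := by
  set z := invHFrom Q 1 (opHpow g Q (L + 1) e) with hzdef
  have hsm := contDiffOn_opHpow hQ hg isOpen_Ioo (fun y hy => hy.1) he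
  induction j with
  | zero =>
    obtain ⟨a, ha⟩ := eq_invHFrom_add hQ hg hR (hsm L) (hi L (by omega))
      (by rw [← opHpow_succ]; exact hi (L + 1) le_rfl)
    refine ⟨fun _ => a, fun y hy => ?_⟩
    rw [Nat.sub_zero, ha y hy, ← opHpow_succ]
    simp [Tprof_zero, hzdef]
  | succ j ih =>
    obtain ⟨α, hα⟩ := ih (by omega)
    set w := opHpow g Q (L - (j + 1)) e with hw
    have hop : opH g Q w = opHpow g Q (L - j) e := by
      rw [hw, ← opHpow_succ]; congr 1; omega
    obtain ⟨a, ha⟩ := eq_invHFrom_add hQ hg hR (hsm (L - (j + 1))) (hi _ (by omega))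
      (by rw [← hw, hop]; exact hi (L - j) (by omega))
    rw [← hw, hop] at ha
    have hz' := symOn_invH_iterate hQ hg hz j
    have hT : SymOn R 1 0 (fun y => ∑ i ∈ Finset.range (j + 1), α i * Tprof Q i y) :=
      SymOn.sum _ fun i _ => (symOn_zero_Tprof hQ hg R i 1).const_mul _
    have hsym : SymOn R 1 0 (opHpow g Q (L - j) e) :=
      (hz'.add hT).congr fun y hy => (hα y hy).symm
    set h := opHpow g Q (L - j) e with hh
    set m := ∫ x in (0 : ℝ)..1, h x * Gam Q x * x with hm
    -- By the previous step `h` is bounded, so the integral against `Γ` may now start at `0`; the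
    -- change of base point costs a multiple of `ΛQ = T_0`.
    have hbase : ∀ y ∈ Ioo 0 R, invHFrom Q 1 h y = invH Q h y - m * scal Q y := by
      intro y hy
      have e1 := (hsym.intervalIntegrable hQ hg hy).2
      have e2 := (hsym.intervalIntegrable hQ hg (y := 1) ⟨one_pos, hR⟩).2
      have e3 := intervalIntegral.integral_interval_sub_left e1 e2
      rw [invHFrom, invH, ← e3]
      ring
    -- `H⁻¹ T_i = -T_{i+1}` shifts the old coefficients with a change of sign, and the new kernel
    -- element gives the coefficient of `T_0`.
    refine ⟨fun i => if i = 0 then a - m else -α (i - 1), fun y hy => ?_⟩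
    rw [ha y hy, hbase y hy, invH_congr (R := R) (fun x hx => hα x hx) hy,
      SymOn.invH_add hQ hg hz' hT hy, invH_sum_Tprof hQ hg α _ hy.1,
      Function.iterate_succ_apply', Finset.sum_range_succ' _ (j + 1)]
    simp [Tprof_zero]
    ring

/-- The part of `e` obtained by inverting `H^{L+1} e` is bounded by `E`. The rest lies in the span
of `T_0, …, T_L`, and the `L + 1` orthogonality conditions determine its coefficients in terms of
the first part. The constant depends on `M`, which is harmless because it only enters higher order
terms. -/
theorem exists_coercivity (hQ : IsGroundState g Q) (hg : IsTarget g) (hχ : IsCutoff χ) {L : ℕ}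
    (hL : 1 ≤ L) {M : ℝ} (hM : 3 ≤ M) : ∃ C > 0, ∀ (e : ℝ → ℝ) (E : ℝ), 0 ≤ E →
      ContDiffOn ℝ ∞ e (Ioo 0 (2 * M + 1)) →
      (∀ k ≤ L + 1, IntegrableOn (fun y => opHpow g Q k e y ^ 2 * y) (Ioo 0 (2 * M + 1))) →
      ∫ y in Ioo 0 (2 * M + 1), opHpow g Q (L + 1) e y ^ 2 * y ≤ E ^ 2 →
      (∀ k ≤ L, ip e (opHpow g Q k (PhiM g Q χ L M)) = 0) →
      (∀ y ∈ Ioo 0 (2 * M + 1), |e y| ≤ C * E ∧ |scal e y| ≤ C * E) ∧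
      ∀ j ≤ L, SymOn (2 * M + 1) 1 0 (opHpow g Q j e) := by
  set R := 2 * M + 1 with hRdef
  have hR : 1 < R := by linarith
  have hM0 : 0 < M := by linarith
  have hY : 0 < 2 * M := by positivity
  have hYR : 2 * M < R := by linarith
  obtain ⟨C₁, hC₁, hb₁⟩ := exists_invHFrom_bounds hQ hg hR
  obtain ⟨j, rfl⟩ : ∃ j, L = j + 1 := ⟨L - 1, by omega⟩
  obtain ⟨C₂, hC₂, hb₂⟩ := exists_scal_invH_iterate_bound hQ hg R j
  set N := ip (cutLamQ Q χ M) (scal Q) with hN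
  have hN0 : 0 < N := by
    obtain ⟨c, hc, hcb⟩ := exists_norm_lower hQ hg hχ
    exact lt_of_lt_of_le (by have := one_le_log_of_three_le hM; positivity) (hcb M hM)
  have htest := fun k => (isTest_PhiM hQ hg hχ (j + 1) hM0).opHpow hQ hg hY k
  choose W hW hWb using fun k => (htest k).exists_ip_bound hQ hg hY
  choose B hB hBb using fun i => exists_bdd_Tprof hQ hg i R
  refine ⟨C₂ * C₁ + ∑ i ∈ Finset.range (j + 2), W i * (C₂ * C₁) / N * B i,
    add_pos_of_pos_of_nonneg (by positivity) (Finset.sum_nonneg fun i _ => by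
      have := hW i; have := hB i; positivity), fun e E hE he hi hiE ho => ?_⟩
  have hsm := contDiffOn_opHpow hQ hg isOpen_Ioo (fun y (hy : y ∈ Ioo 0 R) => hy.1) he
  have hb₁ := hb₁ _ E hE (hsm (j + 1 + 1)).continuousOn (hi _ le_rfl) hiE
  set z := invHFrom Q 1 (opHpow g Q (j + 1 + 1) e) with hzdef
  have hdz : ∀ y ∈ Ioo 0 R, HasDerivAt z (scalInvHFrom Q 1 (opHpow g Q (j + 1 + 1) e) y / y) y :=
    fun y hy => hasDerivAt_invHFrom hg hQ (hsm (j + 1 + 1)).continuousOn hy (hb₁ y hy).1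
      (hb₁ y hy).2.1
  have hcz : ContinuousOn z (Ioo 0 R) := fun y hy =>
    (hdz y hy).continuousAt.continuousWithinAt
  have hcz' : ContinuousOn (scal z) (Ioo 0 R) := by
    have : ContinuousOn (scalInvHFrom Q 1 (opHpow g Q (j + 1 + 1) e)) (Ioo 0 R) := fun y hy =>
      (hasDerivAt_scalInvHFrom hg hQ (hsm (j + 1 + 1)).continuousOn hy (hb₁ y hy).1
        (hb₁ y hy).2.1).continuousAt.continuousWithinAt
    exact this.congr fun y hy => scal_eq_of_hasDerivAt hy.1.ne' (hdz y hy)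
  have hz : SymOn R 1 0 z := ⟨fun y hy => (hdz y hy).differentiableAt,
    ⟨hcz, C₁ * E, fun y hy => by simpa using (hb₁ y hy).2.2.1⟩,
    ⟨hcz', C₁ * E, fun y hy => by
      rw [scal_eq_of_hasDerivAt hy.1.ne' (hdz y hy)]; simpa using (hb₁ y hy).2.2.2⟩⟩
  have hrep := exists_representation hQ hg hR (j + 1) he hi hz
  have hTs : ∀ (α : ℕ → ℝ) (n : ℕ),
      SymOn R 1 0 (fun y => ∑ i ∈ Finset.range n, α i * Tprof Q i y) := fun α n =>
    SymOn.sum _ fun i _ => (symOn_zero_Tprof hQ hg R i 1).const_mul _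
  constructor
  swap
  · intro k hk
    obtain ⟨α, hα⟩ := hrep (j + 1 - k) (by omega)
    rw [show j + 1 - (j + 1 - k) = k by omega] at hα
    exact ((symOn_invH_iterate hQ hg hz _).add (hTs α _)).congr fun y hy => (hα y hy).symm
  · obtain ⟨α, hα⟩ := hrep (j + 1) le_rfl
    rw [Nat.sub_self, opHpow_zero] at hα
    have hzj := hb₂ z (C₁ * E) (by positivity) hcz fun y hy => (hb₁ y hy).2.2.1
    have hαb : ∀ k ∈ Finset.range (j + 2), |α k| ≤ W k * (C₂ * C₁) / N * E := by
      intro k hk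
      have hk' : k ≤ j + 1 := by simp only [Finset.mem_range] at hk; omega
      -- By duality only `α k` survives in the sum. The vanishing of the left side then bounds `α k`
      -- by the pairing with the iterated inverse.
      have h1 : ip e (opHpow g Q k (PhiM g Q χ (j + 1) M)) =
          ip ((invH Q)^[j + 1] z) (opHpow g Q k (PhiM g Q χ (j + 1) M)) + α k * ((-1) ^ k * N) := by
        have e1 : ip e (opHpow g Q k (PhiM g Q χ (j + 1) M)) =
            ip (fun y => (invH Q)^[j + 1] z y + ∑ i ∈ Finset.range (j + 1 + 1), α i * Tprof Q i y)
              (opHpow g Q k (PhiM g Q χ (j + 1) M)) := by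
          refine setIntegral_congr_fun measurableSet_Ioi fun y hy => ?_
          by_cases hyR : y < R
          · simp only [hα y ⟨hy, hyR⟩]; rfl
          · simp only [(htest k).supp y (by linarith)]; ring
        rw [e1, (htest k).ip_add hQ hg hY hYR (symOn_invH_iterate hQ hg hz _).zero (hTs α _).zero,
          (htest k).ip_sum hQ hg hY hYR _ fun i _ =>
            ((symOn_zero_Tprof hQ hg R i 0).const_mul _)]
        congr 1
        rw [Finset.sum_eq_single k]
        · rw [ip_const_mul, ip_Tprof_opHpow_PhiM hQ hg hχ hM hk', if_pos rfl]
        · intro i hi hik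
          rw [ip_const_mul, ip_Tprof_opHpow_PhiM hQ hg hχ hM
            (by simp only [Finset.mem_range] at hi; omega), if_neg hik, mul_zero]
        · intro h; exact absurd hk h
      rw [ho k hk'] at h1
      have h2 := hWb k ((invH Q)^[j + 1] z) (C₂ * (C₁ * E)) fun y hy =>
        (hzj y ⟨hy.1, hy.2.trans hYR⟩).1
      have h3 : |α k| * N = |ip ((invH Q)^[j + 1] z) (opHpow g Q k (PhiM g Q χ (j + 1) M))| := by
        rw [show ip ((invH Q)^[j + 1] z) (opHpow g Q k (PhiM g Q χ (j + 1) M)) =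
          -(α k * ((-1) ^ k * N)) by linarith, abs_neg, abs_mul, abs_mul, abs_pow, abs_neg, abs_one,
          one_pow, one_mul, abs_of_pos hN0]
      rw [div_mul_eq_mul_div, le_div_iff₀ hN0, h3]
      refine h2.trans (le_of_eq ?_)
      ring
    have hsum : ∀ F : ℕ → ℝ, (∀ i, |F i| ≤ B i) → |∑ i ∈ Finset.range (j + 2), α i * F i| ≤
        (∑ i ∈ Finset.range (j + 2), W i * (C₂ * C₁) / N * B i) * E := by
      intro F hF
      rw [Finset.sum_mul]
      refine (Finset.abs_sum_le_sum_abs _ _).trans (Finset.sum_le_sum fun i hi => ?_)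
      rw [abs_mul]
      have h0 : 0 ≤ W i * (C₂ * C₁) / N * E := (abs_nonneg _).trans (hαb i hi)
      calc |α i| * |F i| ≤ (W i * (C₂ * C₁) / N * E) * B i :=
            mul_le_mul (hαb i hi) (hF i) (abs_nonneg _) h0
        _ = _ := by ring
    intro y hy
    have hd1 : DifferentiableAt ℝ ((invH Q)^[j + 1] z) y :=
      (symOn_invH_iterate hQ hg hz (j + 1)).1 y hy
    have hd2 : DifferentiableAt ℝ (fun y => ∑ i ∈ Finset.range (j + 1 + 1), α i * Tprof Q i y) y :=
      (hTs α _).1 y hy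
    constructor
    · rw [hα y hy, add_mul]
      refine (abs_add_le _ _).trans (add_le_add ?_ (hsum (fun i => Tprof Q i y)
        fun i => (hBb i y hy).1))
      exact (hzj y hy).1.trans (le_of_eq (by ring))
    · rw [scal_congr isOpen_Ioo (fun x hx => hα x hx) hy, scal_add hd1 hd2, add_mul]
      have e2 : scal (fun y => ∑ i ∈ Finset.range (j + 1 + 1), α i * Tprof Q i y) y =
          ∑ i ∈ Finset.range (j + 2), α i * scal (Tprof Q i) y := by
        rw [scal, deriv_fun_sum fun i _ =>
          ((symOn_zero_Tprof hQ hg R i 1).1 y hy).const_mul _, Finset.mul_sum]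
        refine Finset.sum_congr rfl fun i _ => ?_
        rw [deriv_const_mul_field, scal]; ring
      rw [e2]
      refine (abs_add_le _ _).trans (add_le_add ?_ (hsum (fun i => scal (Tprof Q i) y)
        fun i => (hBb i y hy).2))
      exact (hzj y hy).2.trans (le_of_eq (by ring))

/-! ### Smooth coefficients depending on `b₁` -/

/-- Functions of `b₁ ∈ (0, 1/16)` all of whose scaling derivatives are bounded. -/
def Coef (κ : ℝ → ℝ) : Prop := ∀ n, SymOn (1 / 16) n 0 κ

namespace Coef
variable {κ μ : ℝ → ℝ}

theorem const (c : ℝ) : Coef fun _ => c := fun n => SymOn.const c n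

theorem add (h : Coef κ) (h' : Coef μ) : Coef fun x => κ x + μ x := fun n => (h n).add (h' n)

theorem const_mul (c : ℝ) (h : Coef κ) : Coef fun x => c * κ x := fun n => (h n).const_mul c

theorem mul (h : Coef κ) (h' : Coef μ) : Coef fun x => κ x * μ x := fun n => by
  simpa using (h n).mul (h' n)

theorem scal (h : Coef κ) : Coef (scal κ) := fun n => (h (n + 1)).2.2

theorem differentiableAt (h : Coef κ) {x : ℝ} (hx : x ∈ Ioo (0 : ℝ) (1 / 16)) :
    DifferentiableAt ℝ κ x := (h 1).1 x hx

theorem exists_bound (h : Coef κ) : ∃ C ≥ 0, ∀ x ∈ Ioo (0 : ℝ) (1 / 16), |κ x| ≤ C := by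
  simpa using (h 0).exists_bound

end Coef

/-- `∫ a(4 √b y) (Λ Q)²`, the scaling family of which the normalization of `c_b` is a member. -/
def cutMass (Q a : ℝ → ℝ) (b : ℝ) : ℝ :=
  ∫ y in Ioi (0 : ℝ), a (4 * Real.sqrt b * y) * scal Q y ^ 2 * y

theorem cutMass_eq_of_le {a : ℝ → ℝ} (ha : ∀ z ≥ 2, a z = 0) {b Y : ℝ}
    (hY : 2 ≤ 4 * Real.sqrt b * Y) :
    cutMass Q a b = ∫ y in Ioo (0 : ℝ) Y, a (4 * Real.sqrt b * y) * scal Q y ^ 2 * y := by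
  refine setIntegral_eq_of_subset_of_forall_sdiff_eq_zero measurableSet_Ioi
    (fun y hy => hy.1) fun y hy => ?_
  have hy1 : Y ≤ y := by
    by_contra h
    exact hy.2 ⟨hy.1, not_le.1 h⟩
  rw [ha _ (hY.trans (by gcongr))]
  ring

theorem exists_abs_le_of_zero {a : ℝ → ℝ} (ha : Continuous a) (h : ∀ z ≥ 2, a z = 0) :
    ∃ C ≥ 0, ∀ z > 0, |a z| ≤ C := by
  obtain ⟨C, hC⟩ := (isCompact_Icc (a := (0 : ℝ)) (b := 2)).exists_bound_of_continuousOn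
    ha.continuousOn
  refine ⟨|C|, abs_nonneg _, fun z hz => ?_⟩
  rcases le_total z 2 with h2 | h2
  · exact (hC z ⟨hz.le, h2⟩).trans (le_abs_self C)
  · simp [h z h2]

theorem exists_scal_sq_bound (hQ : IsGroundState g Q) (hg : IsTarget g) :
    ∃ C > 0, ∀ y > 0, scal Q y ^ 2 * y ≤ C * y ∧ scal Q y ^ 2 * y ≤ C / y := by
  obtain ⟨_, _, C, hC, hb⟩ := hQ.exists_scal_bounds hg
  refine ⟨C ^ 2, by positivity, fun y hy => ?_⟩
  have h0 := (hQ.scal_pos hg hy).le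
  have h1 := (hb y hy).2
  have w0 := (wt_pos hy).le
  have w1 : wt y ≤ 1 := by
    rw [wt, div_le_one (by positivity)]; nlinarith [sq_nonneg (y - 1)]
  have w2 : wt y ≤ 1 / y := by
    rw [wt, div_le_div_iff₀ (by positivity) hy]; nlinarith
  constructor
  · have : scal Q y ≤ C := h1.trans (by nlinarith)
    gcongr
  · have : scal Q y ≤ C * (1 / y) := h1.trans (by gcongr)
    calc scal Q y ^ 2 * y ≤ (C * (1 / y)) ^ 2 * y := by gcongr
      _ = C ^ 2 / y := by field_simp

/-- Differentiation under the integral: `b ∂_b` acts on `a(4 √b y)` as `½ Λ` acts on `a`. The family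
is thus stable under the scaling derivative in `b`. -/
theorem hasDerivAt_cutMass (hQ : IsGroundState g Q) (hg : IsTarget g) {a : ℝ → ℝ}
    (ha : ContDiff ℝ ∞ a) (h0 : ∀ z ≥ 2, a z = 0) {b : ℝ} (hb : 0 < b) :
    HasDerivAt (cutMass Q a) (1 / 2 * cutMass Q (scal a) b / b) b := by
  have hsa := contDiff_scal ha
  have hs0 := scal_eq_zero_of_ge ha h0
  obtain ⟨C, hC, hCa⟩ := exists_abs_le_of_zero ha.continuous h0
  obtain ⟨D, hD, hDa⟩ := exists_abs_le_of_zero hsa.continuous hs0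
  obtain ⟨E, hE, hEb⟩ := exists_scal_sq_bound hQ hg
  -- A bounded region containing the support of the integrand for every parameter larger than `b/2`,
  -- so that domination is uniform near `b`.
  set Y : ℝ := 2 / (4 * Real.sqrt (b / 2)) with hYdef
  have hsq : 0 < Real.sqrt (b / 2) := Real.sqrt_pos.2 (by positivity)
  have hY0 : 0 < Y := by positivity
  have hY : ∀ x ∈ Ioi (b / 2), 2 ≤ 4 * Real.sqrt x * Y := by
    intro x hx
    have : Real.sqrt (b / 2) ≤ Real.sqrt x := Real.sqrt_le_sqrt (le_of_lt hx)
    calc (2 : ℝ) = 4 * Real.sqrt (b / 2) * Y := by rw [hYdef]; field_simp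
      _ ≤ _ := by gcongr
  have hmem : Ioi (b / 2) ∈ 𝓝 b := Ioi_mem_nhds (by linarith)
  have hcont : ∀ {c : ℝ → ℝ}, Continuous c → ∀ x : ℝ, AEStronglyMeasurable
      (fun y => c (4 * Real.sqrt x * y) * scal Q y ^ 2 * y) (volume.restrict (Ioo 0 Y)) := by
    intro c hc x
    refine ContinuousOn.aestronglyMeasurable ?_ measurableSet_Ioo
    refine ((hc.comp (by fun_prop : Continuous fun y => 4 * Real.sqrt x * y)).continuousOn.mul
      ((ContinuousOn.pow ?_ 2))).mul continuousOn_id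
    exact (hQ.continuousOn_scal hg).mono fun y hy => hy.1
  have hbd : ∀ y ∈ Ioo 0 Y, scal Q y ^ 2 * y ≤ E * Y ∧ 0 ≤ scal Q y ^ 2 * y := fun y hy =>
    ⟨(hEb y hy.1).1.trans (by have := hy.2.le; gcongr), by have := hy.1; positivity⟩
  have key := hasDerivAt_integral_of_dominated_loc_of_deriv_le (𝕜 := ℝ)
    (μ := volume.restrict (Ioo 0 Y)) (F := fun x y => a (4 * Real.sqrt x * y) * scal Q y ^ 2 * y)
    (F' := fun x y => 1 / (2 * x) * (scal a (4 * Real.sqrt x * y) * scal Q y ^ 2 * y))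
    (bound := fun _ => 1 / b * (D * (E * Y))) hmem (Eventually.of_forall (hcont ha.continuous))
    ?_ ((hcont hsa.continuous b).const_mul _) ?_ (integrable_const _) ?_
  · have h2 := key.2.congr_of_eventuallyEq (f₁ := cutMass Q a) (Filter.eventuallyEq_of_mem hmem
      fun x hx => cutMass_eq_of_le h0 (hY x hx))
    refine h2.congr_deriv ?_
    rw [integral_const_mul, ← cutMass_eq_of_le hs0 (hY b (by simp; linarith))]
    field_simp
  · refine ⟨hcont ha.continuous b, HasFiniteIntegral.of_bounded (C := C * (E * Y))
      ((ae_restrict_iff' measurableSet_Ioo).2 (Eventually.of_forall fun y hy => ?_))⟩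
    obtain ⟨e1, e2⟩ := hbd y hy
    have := hy.1
    have e3 := hCa (4 * Real.sqrt b * y) (by have := Real.sqrt_pos.2 hb; positivity)
    rw [mul_assoc, Real.norm_eq_abs, abs_mul, abs_of_nonneg e2]
    gcongr
  · refine (ae_restrict_iff' measurableSet_Ioo).2 (Eventually.of_forall fun y hy x hx => ?_)
    have hx' : b / 2 < x := hx
    have hx0 : 0 < x := by linarith
    obtain ⟨e1, e2⟩ := hbd y hy
    have := hy.1
    have e3 := hDa (4 * Real.sqrt x * y) (by have := Real.sqrt_pos.2 hx0; positivity)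
    rw [mul_assoc (scal a _), Real.norm_eq_abs, abs_mul, abs_mul, abs_of_nonneg e2,
      abs_of_pos (by positivity)]
    have e4 : 1 / (2 * x) ≤ 1 / b := by gcongr; linarith
    gcongr
  · refine (ae_restrict_iff' measurableSet_Ioo).2 (Eventually.of_forall fun y hy x hx => ?_)
    have hx0 : 0 < x := lt_trans (by positivity) hx
    have hsx := Real.sqrt_pos.2 hx0
    have d1 : HasDerivAt (fun x => 4 * Real.sqrt x * y) (4 * (1 / (2 * Real.sqrt x)) * y) x :=
      ((Real.hasDerivAt_sqrt hx0.ne').const_mul 4).mul_const y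
    have d2 := ((((ha.differentiable (by simp)) _).hasDerivAt.comp x d1).mul_const
      (scal Q y ^ 2)).mul_const y
    refine d2.congr_deriv ?_
    rw [show scal a (4 * Real.sqrt x * y) =
      4 * Real.sqrt x * y * deriv a (4 * Real.sqrt x * y) from rfl]
    have hxx : x = Real.sqrt x ^ 2 := (Real.sq_sqrt hx0.le).symm
    have e : (1 / (2 * x)) * (4 * Real.sqrt x * y) = 4 * (1 / (2 * Real.sqrt x)) * y := by
      rw [show 1 / (2 * x) = 1 / (2 * Real.sqrt x ^ 2) by rw [← hxx]]
      field_simp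
    rw [← e]
    ring

theorem scal_cutMass (hQ : IsGroundState g Q) (hg : IsTarget g) {a : ℝ → ℝ}
    (ha : ContDiff ℝ ∞ a) (h0 : ∀ z ≥ 2, a z = 0) {b : ℝ} (hb : 0 < b) :
    scal (cutMass Q a) b = 1 / 2 * cutMass Q (scal a) b :=
  scal_eq_of_hasDerivAt hb.ne' (hasDerivAt_cutMass hQ hg ha h0 hb)

/-- When `a` lives on `[1, 2]` the integral runs over one dyadic annulus `[B, 2B)`. There `(ΛQ)² y =
O(1/y)` has bounded mass, uniformly in `b`. -/
theorem coef_cutMass (hQ : IsGroundState g Q) (hg : IsTarget g) {a : ℝ → ℝ}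
    (ha : ContDiff ℝ ∞ a) (h0 : ∀ z ≥ 2, a z = 0) (h1 : ∀ z < 1, a z = 0) :
    Coef (cutMass Q a) := by
  have base : ∀ {a : ℝ → ℝ}, ContDiff ℝ ∞ a → (∀ z ≥ 2, a z = 0) → (∀ z < 1, a z = 0) →
      SymOn (1 / 16) 0 0 (cutMass Q a) := by
    intro a ha h0 h1
    obtain ⟨C, hC, hCa⟩ := exists_abs_le_of_zero ha.continuous h0
    obtain ⟨E, hE, hEb⟩ := exists_scal_sq_bound hQ hg
    refine ⟨fun b hb => (hasDerivAt_cutMass hQ hg ha h0 hb.1).continuousAt.continuousWithinAt,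
      C * E, fun b hb => ?_⟩
    have hs := Real.sqrt_pos.2 hb.1
    set B := 1 / (4 * Real.sqrt b) with hB
    have hB0 : 0 < B := by positivity
    have hBs : 4 * Real.sqrt b * B = 1 := by rw [hB]; field_simp
    have e : cutMass Q a b = ∫ y in Ico B (2 * B), a (4 * Real.sqrt b * y) * scal Q y ^ 2 * y := by
      refine setIntegral_eq_of_subset_of_forall_sdiff_eq_zero measurableSet_Ioi
        (fun y hy => hB0.trans_le hy.1) fun y hy => ?_
      rcases lt_or_ge y B with h | h
      · rw [h1 _ (by rw [← hBs]; gcongr)]; ring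
      · have h' : 2 * B ≤ y := by
          by_contra h'
          exact hy.2 ⟨h, not_le.1 h'⟩
        rw [h0 _ (by calc (2 : ℝ) = 4 * Real.sqrt b * (2 * B) := by linarith
                       _ ≤ _ := by gcongr)]
        ring
    rw [e, zpow_zero, mul_one, ← Real.norm_eq_abs]
    refine le_trans (norm_setIntegral_le_of_norm_le_const (C := C * (E / B)) measure_Ico_lt_top
      fun y hy => ?_) (le_of_eq ?_)
    · have hy0 : 0 < y := hB0.trans_le hy.1
      have e2 : 0 ≤ scal Q y ^ 2 * y := by positivity
      rw [mul_assoc, Real.norm_eq_abs, abs_mul, abs_of_nonneg e2]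
      have := hCa (4 * Real.sqrt b * y) (by positivity)
      have h3 := (hEb y hy0).2.trans (show E / y ≤ E / B by have := hy.1; gcongr)
      gcongr
    · rw [Real.volume_real_Ico_of_le (by linarith)]
      field_simp; ring
  intro n
  induction n generalizing a with
  | zero => exact base ha h0 h1
  | succ n ih =>
    refine ⟨fun b hb => (hasDerivAt_cutMass hQ hg ha h0 hb.1).differentiableAt, base ha h0 h1, ?_⟩
    refine ((ih (contDiff_scal ha) (scal_eq_zero_of_ge ha h0) fun z hz => ?_).const_mul
      (1 / 2)).congr fun b hb => (scal_cutMass hQ hg ha h0 hb.1).symm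
    have : a =ᶠ[𝓝 z] fun _ => 0 := Filter.eventuallyEq_of_mem (Iio_mem_nhds hz) fun x hx => h1 x hx
    rw [scal, this.deriv_eq]
    simp

theorem exists_cutMass_lower (hQ : IsGroundState g Q) (hg : IsTarget g) (hχ : IsCutoff χ) :
    ∃ d > 0, ∀ b ∈ Ioo (0 : ℝ) (1 / 16), d ≤ cutMass Q χ b := by
  obtain ⟨E, hE, hEb⟩ := exists_scal_sq_bound hQ hg
  have hint : ∀ (c : ℝ → ℝ) (Y : ℝ), Continuous c → (∀ y > 0, |c y| ≤ 1) →
      IntegrableOn (fun y => c y * scal Q y ^ 2 * y) (Ioo 0 Y) := by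
    intro c Y hc hc1
    refine ⟨ContinuousOn.aestronglyMeasurable ((hc.continuousOn.mul (ContinuousOn.pow
      ((hQ.continuousOn_scal hg).mono fun y hy => hy.1) 2)).mul continuousOn_id)
      measurableSet_Ioo, HasFiniteIntegral.of_bounded (C := E * Y)
      ((ae_restrict_iff' measurableSet_Ioo).2 (Eventually.of_forall fun y hy => ?_))⟩
    have e2 : 0 ≤ scal Q y ^ 2 * y := by have := hy.1; positivity
    rw [mul_assoc, Real.norm_eq_abs, abs_mul, abs_of_nonneg e2]
    have h1 := hc1 y hy.1
    have h2 := (hEb y hy.1).1.trans (show E * y ≤ E * Y by have := hy.2.le; gcongr)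
    nlinarith
  have hpos : 0 < ∫ y in Ioo (0 : ℝ) 1, scal Q y ^ 2 * y := by
    rw [← integral_Ioc_eq_integral_Ioo, ← intervalIntegral.integral_of_le zero_le_one]
    refine intervalIntegral.intervalIntegral_pos_of_pos_on ?_ (fun y hy => ?_) zero_lt_one
    · rw [intervalIntegrable_iff_integrableOn_Ioo_of_le zero_le_one]
      simpa using hint (fun _ => 1) 1 continuous_const (by simp)
    · have := hQ.scal_pos hg hy.1
      have := hy.1
      positivity
  refine ⟨_, hpos, fun b hb => ?_⟩
  have hs := Real.sqrt_pos.2 hb.1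
  -- This is where the threshold `1/16` for `b₁` comes from: below it the cut-off equals `1` on `(0,
  -- 1)`, which gives a fixed amount of mass.
  have hs1 : 4 * Real.sqrt b ≤ 1 := by
    have : Real.sqrt b ≤ 1 / 4 := Real.sqrt_le_iff.2 ⟨by norm_num, by linarith [hb.2]⟩
    linarith
  set Y := 2 / (4 * Real.sqrt b) with hY
  have hY1 : 1 ≤ Y := by rw [hY, le_div_iff₀ (by positivity)]; linarith
  rw [cutMass_eq_of_le (Y := Y) hχ.zero (by rw [hY]; field_simp; norm_num)]
  have hi := hint (fun y => χ (4 * Real.sqrt b * y)) Y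
    (hχ.smooth.continuous.comp (by fun_prop)) fun y _ => by
      rw [abs_of_nonneg (hχ.nonneg _)]; exact hχ.le_one _
  refine le_trans (le_of_eq ?_) (setIntegral_mono_set (s := Ioo 0 1) hi ?_
    (LE.le.eventuallyLE (Ioo_subset_Ioo le_rfl hY1)))
  · refine setIntegral_congr_fun measurableSet_Ioo fun y hy => ?_
    rw [hχ.one _ (by nlinarith [hy.1, hy.2]), one_mul]
  · refine (ae_restrict_iff' measurableSet_Ioo).2 (Eventually.of_forall fun y hy => ?_)
    have h1 := hχ.nonneg (4 * Real.sqrt b * y)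
    have h2 := hy.1
    exact mul_nonneg (mul_nonneg h1 (sq_nonneg _)) h2.le

/-- The denominator `cutMass Q χ` of `c_b` is bounded below, and its scaling derivative involves
`Λχ`, which is supported in `[1, 2]`. So `c_b` and all its derivatives `(b ∂_b)^n c_b` are bounded.
-/
theorem coef_cb (hQ : IsGroundState g Q) (hg : IsTarget g) (hχ : IsCutoff χ) :
    Coef (cb Q χ) := fun n => by
  obtain ⟨d, hd, hdl⟩ := exists_cutMass_lower hQ hg hχ
  have h1 : ∀ n, SymOn (1 / 16) n 0 (scal (cutMass Q χ)) := fun n =>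
    ((coef_cutMass hQ hg (contDiff_scal hχ.smooth) (scal_eq_zero_of_ge hχ.smooth hχ.zero)
      (fun z hz => by
        have : χ =ᶠ[𝓝 z] fun _ => 1 :=
          Filter.eventuallyEq_of_mem (Iio_mem_nhds hz) fun x hx => hχ.one x (le_of_lt hx)
        rw [scal, this.deriv_eq]; simp)).const_mul (1 / 2) n).congr fun b hb =>
      (scal_cutMass hQ hg hχ.smooth hχ.zero hb.1).symm
  refine ((SymOn.inv hd hdl (fun b hb => (hasDerivAt_cutMass hQ hg hχ.smooth hχ.zero
    hb.1).differentiableAt) h1 n).const_mul 4).congr fun b hb => ?_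
  have : ∀ y, y / (B0 b / 4) = 4 * Real.sqrt b * y := fun y => by
    have hs := Real.sqrt_pos.2 hb.1
    rw [B0]; field_simp
  simp only [cb, cutMass, cut, this]
  rw [div_eq_mul_inv]

/-! ### Homogeneous profiles -/

/-- Finite sums of `κ(b₁) b₁^m b_{j₁} ⋯ b_{jₙ} F(y)` with `m + j₁ + ⋯ + jₙ` equal to the weight
and `1 ≤ jᵢ ≤ q`, up to changes outside of `0 < b₁ < 1/16`, `0 < y`. -/
inductive Prof (q : ℕ) : ℤ → ((ℕ → ℝ) → ℝ → ℝ) → Prop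
  | base {κ F : ℝ → ℝ} (m : ℤ) (hκ : Coef κ) (hF : Nice F) :
      Prof q m fun b y => κ (b 1) * b 1 ^ m * F y
  | mulb {w : ℤ} {S : (ℕ → ℝ) → ℝ → ℝ} (j : ℕ) (hj : 1 ≤ j) (hjq : j ≤ q) (hS : Prof q w S) :
      Prof q (w + j) fun b y => b j * S b y
  | add {w : ℤ} {S S' : (ℕ → ℝ) → ℝ → ℝ} (hS : Prof q w S) (hS' : Prof q w S') :
      Prof q w fun b y => S b y + S' b y
  | congr {w : ℤ} {S S' : (ℕ → ℝ) → ℝ → ℝ} (hS : Prof q w S)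
      (h : ∀ b : ℕ → ℝ, b 1 ∈ Ioo (0 : ℝ) (1 / 16) → ∀ y > 0, S b y = S' b y) : Prof q w S'

namespace Prof
variable {q : ℕ} {w w' : ℤ} {S S' : (ℕ → ℝ) → ℝ → ℝ}

theorem cast (h : Prof q w S) (e : w = w') : Prof q w' S := e ▸ h

theorem mono {q' : ℕ} (h : Prof q w S) (hq : q ≤ q') : Prof q' w S := by
  induction h with
  | base m hκ hF => exact base m hκ hF
  | mulb j hj hjq _ ih => exact mulb j hj (hjq.trans hq) ih
  | add _ _ ih ih' => exact add ih ih'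
  | congr _ h ih => exact congr ih h

theorem nice (h : Prof q w S) {b : ℕ → ℝ} (hb : b 1 ∈ Ioo (0 : ℝ) (1 / 16)) : Nice (S b) := by
  induction h with
  | base m _ hF => exact hF.const_mul _
  | mulb j _ _ _ ih => exact ih.const_mul _
  | add _ _ ih ih' => exact ih.add ih'
  | congr _ h ih => exact ih.congr (h b hb)

/-- The purpose of the weights: under `b_k = O(b₁^k)` every monomial of weight `w` has size `b₁^w`.
-/
theorem exists_bound (h : Prof q w S) (A R : ℝ) : ∃ C ≥ 0, ∀ b : ℕ → ℝ,
    b 1 ∈ Ioo (0 : ℝ) (1 / 16) → (∀ k, 1 ≤ k → k ≤ q → |b k| ≤ A * b 1 ^ k) →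
    ∀ y ∈ Ioo 0 R, |S b y| ≤ C * b 1 ^ w * y ^ 2 := by
  induction h with
  | @base κ F m hκ hF =>
    obtain ⟨C, hC, hb⟩ := hκ.exists_bound
    obtain ⟨D, hD, hF⟩ := (hF R 0).exists_bound
    refine ⟨C * D, by positivity, fun b h1 _ y hy => ?_⟩
    have h3 := hF y hy
    have h2 := hb _ h1
    rw [abs_mul, abs_mul, abs_of_pos (zpow_pos h1.1 m)]
    have := zpow_pos h1.1 m
    calc |κ (b 1)| * b 1 ^ m * |F y| ≤ C * b 1 ^ m * (D * y ^ (2 : ℤ)) := by gcongr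
      _ = _ := by rw [zpow_ofNat]; ring
  | @mulb w S j hj hjq hS ih =>
    obtain ⟨C, hC, hS⟩ := ih
    refine ⟨|A| * C, by positivity, fun b h1 h2 y hy => ?_⟩
    have h3 := hS b h1 h2 y hy
    have h4 := (h2 j hj hjq).trans (mul_le_mul_of_nonneg_right (le_abs_self A)
      (pow_nonneg h1.1.le j))
    have := zpow_pos h1.1 w
    have := pow_pos h1.1 j
    rw [abs_mul, zpow_add₀ h1.1.ne', zpow_natCast]
    calc |b j| * |S b y| ≤ |A| * b 1 ^ j * (C * b 1 ^ w * y ^ 2) := by gcongr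
      _ = _ := by ring
  | @add w S S' _ _ ih ih' =>
    obtain ⟨C, hC, hS⟩ := ih
    obtain ⟨D, hD, hS'⟩ := ih'
    refine ⟨C + D, by positivity, fun b h1 h2 y hy => (abs_add_le _ _).trans ?_⟩
    linarith [hS b h1 h2 y hy, hS' b h1 h2 y hy]
  | congr _ h ih =>
    obtain ⟨C, hC, hS⟩ := ih
    exact ⟨C, hC, fun b h1 h2 y hy => by rw [← h b h1 y hy.1]; exact hS b h1 h2 y hy⟩

theorem const_mul (c : ℝ) (h : Prof q w S) : Prof q w fun b y => c * S b y := by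
  induction h with
  | base m hκ hF =>
    exact (base m (hκ.const_mul c) hF).congr fun b _ y _ => by ring
  | mulb j hj hjq _ ih => exact (mulb j hj hjq ih).congr fun b _ y _ => by ring
  | add _ _ ih ih' => exact (add ih ih').congr fun b _ y _ => by ring
  | congr _ h ih => exact congr ih fun b hb y hy => by rw [h b hb y hy]

theorem neg (h : Prof q w S) : Prof q w fun b y => -S b y :=
  (h.const_mul (-1)).congr fun b _ y _ => by ring

theorem sub (h : Prof q w S) (h' : Prof q w S') : Prof q w fun b y => S b y - S' b y :=
  (h.add h'.neg).congr fun b _ y _ => by ring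

theorem zero (q : ℕ) (w : ℤ) : Prof q w fun _ _ => 0 :=
  (base (F := fun _ => 0) w (Coef.const 0) fun R n =>
    ((SymOn.zpow 2 n).const_mul 0).congr fun y _ => by simp).congr fun b _ y _ => by ring

theorem sum {ι : Type*} (s : Finset ι) {F : ι → (ℕ → ℝ) → ℝ → ℝ}
    (h : ∀ i ∈ s, Prof q w (F i)) : Prof q w fun b y => ∑ i ∈ s, F i b y := by
  classical
  induction s using Finset.induction_on with
  | empty => simpa using zero q w
  | insert i s hi ih =>
    refine ((h i (Finset.mem_insert_self _ _)).add
      (ih fun j hj => h j (Finset.mem_insert_of_mem hj))).congr fun b _ y _ => ?_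
    rw [Finset.sum_insert hi]

theorem coef_mul {κ : ℝ → ℝ} (hκ : Coef κ) (m : ℤ) (h : Prof q w S) :
    Prof q (m + w) fun b y => κ (b 1) * b 1 ^ m * S b y := by
  induction h with
  | base m' hκ' hF =>
    exact (base (m + m') (hκ.mul hκ') hF).congr fun b hb y _ => by
      rw [zpow_add₀ hb.1.ne']; ring
  | mulb j hj hjq _ ih =>
    exact ((mulb j hj hjq ih).congr fun b _ y _ => by ring).cast (by ring)
  | add _ _ ih ih' => exact (add ih ih').congr fun b _ y _ => by ring
  | congr _ h ih => exact congr ih fun b hb y hy => by rw [h b hb y hy]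

/-- An operator which is linear in the variable `y` acts only on the last factor of each monomial,
so it preserves the weight. Linearity is required on `Nice` functions only, since `invH` is additive
just for integrable sources. -/
theorem map (Φ : (ℝ → ℝ) → ℝ → ℝ) (hN : ∀ F, Nice F → Nice (Φ F))
    (hadd : ∀ F G, Nice F → Nice G → ∀ y > 0, Φ (fun x => F x + G x) y = Φ F y + Φ G y)
    (hmul : ∀ (c : ℝ) F, Nice F → ∀ y > 0, Φ (fun x => c * F x) y = c * Φ F y)
    (hcongr : ∀ F G, EqOn F G (Ioi 0) → EqOn (Φ F) (Φ G) (Ioi 0)) (h : Prof q w S) :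
    Prof q w fun b => Φ (S b) := by
  induction h with
  | base m hκ hF => exact (base m hκ (hN _ hF)).congr fun b _ y hy => (hmul _ _ hF y hy).symm
  | mulb j hj hjq hS ih =>
    exact (mulb j hj hjq ih).congr fun b hb y hy => (hmul _ _ (hS.nice hb) y hy).symm
  | add hS hS' ih ih' =>
    exact (add ih ih').congr fun b hb y hy => (hadd _ _ (hS.nice hb) (hS'.nice hb) y hy).symm
  | congr _ h ih => exact congr ih fun b hb y hy => hcongr _ _ (fun x hx => h b hb x hx) hy

theorem scal (h : Prof q w S) : Prof q w fun b => scal (S b) :=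
  h.map HeatFlow.scal (fun _ hF => hF.scal)
    (fun _ _ hF hG _ hy => scal_add (hF.differentiableAt hy) (hG.differentiableAt hy))
    (fun c F _ y _ => scal_const_mul c F y) fun _ _ e => scal_congr isOpen_Ioi e

theorem invH (hQ : IsGroundState g Q) (hg : IsTarget g) (h : Prof q w S) :
    Prof q w fun b => invH Q (S b) :=
  h.map (HeatFlow.invH Q) (fun _ hF => hF.invH hQ hg)
    (fun _ _ hF hG _ hy => hF.invH_add hQ hg hG hy)
    (fun c F _ y _ => invH_const_mul c F y) fun _ _ e y hy =>
      invH_congr (R := y + 1) (fun x hx => e hx.1) ⟨hy, by linarith⟩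

theorem comp_mul (hQ : IsGroundState g Q) (hg : IsTarget g) {φ : ℝ → ℝ} (hφ : ContDiff ℝ ∞ φ)
    (h : Prof q w S) : Prof q w fun b y => φ (Q y) * S b y :=
  h.map (fun F y => φ (Q y) * F y) (fun _ hF => hF.comp_mul hQ hg hφ)
    (fun _ _ _ _ _ _ => by ring) (fun _ _ _ _ _ => by ring)
    fun _ _ e y hy => by simp only [e hy]

theorem mul_sq (h : Prof q w S) : Prof q w fun b y => S b y * y ^ 2 :=
  h.map (fun F y => F y * y ^ 2) (fun _ hF => hF.mul_pow)
    (fun _ _ _ _ _ _ => by ring) (fun _ _ _ _ _ => by ring)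
    fun _ _ e y hy => by simp only [e hy]

theorem mul_div (h : Prof q w S) (h' : Prof q w' S') :
    Prof q (w + w') fun b y => S b y * S' b y / y ^ 2 := by
  induction h with
  | @base κ F m hκ hF =>
    refine (coef_mul hκ m (h'.map (fun G y => F y * G y / y ^ 2) (fun _ hG => hF.mul_div hG)
      (fun _ _ _ _ _ _ => by ring) (fun _ _ _ _ _ => by ring)
      fun _ _ e y hy => by simp only [e hy])).congr fun b _ y _ => by ring
  | mulb j hj hjq _ ih =>
    exact ((mulb j hj hjq ih).congr fun b _ y _ => by ring).cast (by ring)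
  | add _ _ ih ih' => exact (add ih ih').congr fun b _ y _ => by ring
  | congr _ h ih => exact congr ih fun b hb y hy => by rw [h b hb y hy]

theorem mul (h : Prof q w S) (h' : Prof q w' S') :
    Prof q (w + w') fun b y => S b y * S' b y :=
  (h.mul_div h').mul_sq.congr fun b _ y hy => by
    have : y ≠ 0 := (show (0 : ℝ) < y from hy).ne'
    field_simp

/-- The chain rule along an arbitrary path of parameters. In this form it yields both the partial
derivatives in `b_j` and the time derivative, including the one-sided derivative at `t = 0`. A
derivative in `b_j` lowers the weight by `j`, which is why the power of `b₁` may be any integer. -/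
theorem exists_hasDerivWithinAt (h : Prof q w S) (hq : 1 ≤ q) :
    ∃ S' : ℕ → (ℕ → ℝ) → ℝ → ℝ, (∀ j : ℕ, Prof q (w - j) (S' j)) ∧
      ∀ (s : Set ℝ) (β : ℝ → ℕ → ℝ) (d : ℕ → ℝ), ∀ t ∈ s,
        (∀ j, 1 ≤ j → j ≤ q → HasDerivWithinAt (fun τ => β τ j) (d j) s t) →
        β t 1 ∈ Ioo (0 : ℝ) (1 / 16) → ∀ y > 0,
        HasDerivWithinAt (fun τ => S (β τ) y)
          (∑ j ∈ Finset.Icc 1 q, d j * S' j (β t) y) s t := by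
  induction h with
  | @base κ F m hκ hF =>
    refine ⟨fun j => if j = 1 then
      fun b y => (HeatFlow.scal κ (b 1) + m * κ (b 1)) * b 1 ^ (m - 1) * F y else fun _ _ => 0,
      fun j => ?_, fun s β d t ht hd hb y hy => ?_⟩
    · by_cases hj : j = 1
      · subst hj
        simp only [if_true, Nat.cast_one]
        exact base (m - 1) (hκ.scal.add (hκ.const_mul m)) hF
      · simp only [hj, if_false]
        exact zero q _
    · have e1 := (hκ.differentiableAt hb).hasDerivAt.comp_hasDerivWithinAt t (hd 1 le_rfl hq)
      have e2 := (hasDerivAt_zpow m (β t 1) (Or.inl hb.1.ne')).comp_hasDerivWithinAt t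
        (hd 1 le_rfl hq)
      refine ((e1.mul e2).mul_const (F y)).congr_deriv ?_
      rw [Finset.sum_eq_single 1]
      · simp only [if_true, Function.comp_def]
        have hne := hb.1.ne'
        rw [show HeatFlow.scal κ (β t 1) = β t 1 * deriv κ (β t 1) from rfl,
          show β t 1 ^ m = β t 1 ^ (m - 1) * β t 1 by rw [zpow_sub_one₀ hne]; field_simp]
        ring
      · intro j _ hj; simp [hj]
      · intro h; simp at h; omega
  | @mulb w S i hi hiq hS ih =>
    obtain ⟨S', hS', hd'⟩ := ih
    refine ⟨fun j => fun b y => b i * S' j b y + (if j = i then S b y else 0), fun j => ?_,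
      fun s β d t ht hd hb y hy => ?_⟩
    · refine ((mulb i hi hiq (hS' j)).cast (by ring)).add ?_
      by_cases hj : j = i
      · subst hj
        simp only [if_true]
        exact hS.cast (by ring)
      · simp only [hj, if_false]
        exact zero q _
    · refine ((hd i hi hiq).mul (hd' s β d t ht hd hb y hy)).congr_deriv ?_
      simp only [mul_add, Finset.sum_add_distrib, mul_ite, mul_zero]
      rw [Finset.sum_ite_eq' (Finset.Icc 1 q) i, if_pos (Finset.mem_Icc.2 ⟨hi, hiq⟩), Finset.mul_sum,
        add_comm]
      congr 1
      exact Finset.sum_congr rfl fun j _ => by ring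
  | @add w S₁ S₂ _ _ ih ih' =>
    obtain ⟨S', hS', hd'⟩ := ih
    obtain ⟨S'', hS'', hd''⟩ := ih'
    refine ⟨fun j b y => S' j b y + S'' j b y, fun j => (hS' j).add (hS'' j),
      fun s β d t ht hd hb y hy => ?_⟩
    refine ((hd' s β d t ht hd hb y hy).add (hd'' s β d t ht hd hb y hy)).congr_deriv ?_
    simp only [mul_add, Finset.sum_add_distrib]
  | congr _ h ih =>
    obtain ⟨S', hS', hd'⟩ := ih
    refine ⟨S', hS', fun s β d t ht hd hb y hy => ?_⟩
    -- The two profiles agree only for `b₁` in an open interval; the path stays there near `t` by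
    -- continuity.
    refine (hd' s β d t ht hd hb y hy).congr_of_eventuallyEq ?_ (h _ hb y hy).symm
    have := (hd 1 le_rfl hq).continuousWithinAt (isOpen_Ioo.mem_nhds hb)
    filter_upwards [this] with τ hτ
    exact (h _ hτ y hy).symm

/-- Along the path moving the single coordinate `b_j`, the chain rule identifies the abstract
coefficients with the partial derivatives `dparam`. -/
theorem dparam_spec (h : Prof q w S) (hq : 1 ≤ q) :
    ((∀ j : ℕ, 1 ≤ j → Prof q (w - j) (dparam S j)) ∧
      ∀ j, q < j → ∀ b : ℕ → ℝ, b 1 ∈ Ioo (0 : ℝ) (1 / 16) → ∀ y > 0, dparam S j b y = 0) ∧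
      ∀ (s : Set ℝ) (β : ℝ → ℕ → ℝ) (d : ℕ → ℝ), ∀ t ∈ s,
        (∀ j, 1 ≤ j → j ≤ q → HasDerivWithinAt (fun τ => β τ j) (d j) s t) →
        β t 1 ∈ Ioo (0 : ℝ) (1 / 16) → ∀ y > 0,
        HasDerivWithinAt (fun τ => S (β τ) y)
          (∑ j ∈ Finset.Icc 1 q, d j * dparam S j (β t) y) s t := by
  obtain ⟨S', hS', hd'⟩ := h.exists_hasDerivWithinAt hq
  have key : ∀ j (b : ℕ → ℝ), b 1 ∈ Ioo (0 : ℝ) (1 / 16) → ∀ y > 0,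
      dparam S j b y = ∑ i ∈ Finset.Icc 1 q, (if i = j then 1 else 0) * S' i b y := by
    intro j b hb y hy
    have := hd' univ (fun τ => Function.update b j τ) (fun i => if i = j then 1 else 0) (b j)
      (mem_univ _) (fun i _ _ => ?_) (by simpa using hb) y hy
    · rw [hasDerivWithinAt_univ] at this
      rw [dparam, this.deriv]
      simp
    · by_cases hij : i = j
      · subst hij
        simpa [id_def] using hasDerivAt_id' (b i)
      · simp only [Function.update_of_ne hij, hij, if_false]
        exact hasDerivWithinAt_const _ _ _
  have key' : ∀ j, 1 ≤ j → j ≤ q → ∀ (b : ℕ → ℝ), b 1 ∈ Ioo (0 : ℝ) (1 / 16) → ∀ y > 0,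
      dparam S j b y = S' j b y := by
    intro j hj hjq b hb y hy
    rw [key j b hb y hy]
    simp only [ite_mul, one_mul, zero_mul]
    rw [Finset.sum_ite_eq' (Finset.Icc 1 q) j, if_pos (Finset.mem_Icc.2 ⟨hj, hjq⟩)]
  have key0 : ∀ j, q < j → ∀ (b : ℕ → ℝ), b 1 ∈ Ioo (0 : ℝ) (1 / 16) → ∀ y > 0,
      dparam S j b y = 0 := by
    intro j hj b hb y hy
    rw [key j b hb y hy]
    refine Finset.sum_eq_zero fun i hi => ?_
    rw [Finset.mem_Icc] at hi
    rw [if_neg (by omega), zero_mul]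
  refine ⟨⟨fun j hj => ?_, key0⟩, fun s β d t ht hd hb y hy => ?_⟩
  · rcases le_or_gt j q with hjq | hjq
    · exact (hS' j).congr fun b hb y hy => (key' j hj hjq b hb y hy).symm
    · exact (zero q _).congr fun b hb y hy => (key0 j hjq b hb y hy).symm
  · refine (hd' s β d t ht hd hb y hy).congr_deriv (Finset.sum_congr rfl fun j hj => ?_)
    rw [Finset.mem_Icc] at hj
    rw [key' j hj.1 hj.2 _ hb y hy]

end Prof

/-! ### Weighted polynomials -/

/-- The polynomial in which the coefficient of weight `k` multiplies the `k`-th power. -/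
def wtPoly (a : ℕ → ℝ) (N : ℕ) : Polynomial ℝ :=
  ∑ k ∈ Finset.Icc 1 N, Polynomial.C (a k) * (Polynomial.X : Polynomial ℝ) ^ k

theorem coeff_wtPoly (a : ℕ → ℝ) (N n : ℕ) :
    (wtPoly a N).coeff n = if n ∈ Finset.Icc 1 N then a n else 0 := by
  rw [wtPoly, Polynomial.finsetSum_coeff]
  simp only [Polynomial.coeff_C_mul_X_pow]
  rw [Finset.sum_ite_eq]

theorem X_dvd_wtPoly (a : ℕ → ℝ) (N : ℕ) : Polynomial.X ∣ wtPoly a N := by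
  rw [Polynomial.X_dvd_iff, coeff_wtPoly, if_neg (by simp)]

theorem coeff_wtPoly_pow_of_lt (a : ℕ → ℝ) (N : ℕ) {j n : ℕ} (h : n < j) :
    (wtPoly a N ^ j).coeff n = 0 :=
  Polynomial.X_pow_dvd_iff.1 (pow_dvd_pow_of_dvd (X_dvd_wtPoly a N) j) n h

/-- In a product of at least two factors without constant term, a term of weight above `i`
contributes only to weights above `i + 1`. So truncating the sum at `k ≤ i` does not change the part
of weight `i + 1`. -/
theorem coeff_wtPoly_pow_trunc (a : ℕ → ℝ) {i N j : ℕ} (hi : i ≤ N) (hj : 2 ≤ j) :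
    (wtPoly a i ^ j).coeff (i + 1) = (wtPoly a N ^ j).coeff (i + 1) := by
  obtain ⟨m, rfl⟩ := Nat.exists_eq_add_of_le hj
  have h1 : Polynomial.X ^ (i + 1) ∣ wtPoly a N - wtPoly a i := by
    refine Polynomial.X_pow_dvd_iff.2 fun d hd => ?_
    rw [Polynomial.coeff_sub, coeff_wtPoly, coeff_wtPoly]
    simp only [Finset.mem_Icc]
    have : (1 ≤ d ∧ d ≤ N) ↔ (1 ≤ d ∧ d ≤ i) := by omega
    simp [this]
  have h2 : Polynomial.X ^ (i + 2) ∣ wtPoly a N ^ (2 + m) - wtPoly a i ^ (2 + m) := by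
    have e : wtPoly a N ^ (2 + m) - wtPoly a i ^ (2 + m) =
        (wtPoly a N - wtPoly a i) * wtPoly a N ^ (m + 1) +
          (wtPoly a N ^ (m + 1) - wtPoly a i ^ (m + 1)) * wtPoly a i := by ring
    rw [e, pow_succ (Polynomial.X : Polynomial ℝ) (i + 1)]
    refine dvd_add (mul_dvd_mul h1 ?_) (mul_dvd_mul (h1.trans (sub_dvd_pow_sub_pow _ _ _))
      (X_dvd_wtPoly a i))
    exact (X_dvd_wtPoly a N).trans (dvd_pow_self _ (by omega))
  have h3 := Polynomial.X_pow_dvd_iff.1 h2 (i + 1) (by omega)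
  rw [Polynomial.coeff_sub] at h3
  linarith

theorem wtPoly_sum_pow (a : ℕ → ℝ) (N j : ℕ) :
    (∑ k ∈ Finset.Icc 1 N, a k) ^ j =
      ∑ n ∈ Finset.range (j * N + 1), (wtPoly a N ^ j).coeff n := by
  have h1 : (wtPoly a N).natDegree ≤ N := by
    refine Polynomial.natDegree_sum_le_of_forall_le _ _ fun k hk => ?_
    exact (Polynomial.natDegree_C_mul_X_pow_le _ _).trans (Finset.mem_Icc.1 hk).2
  have h2 : (wtPoly a N ^ j).natDegree < j * N + 1 :=
    Nat.lt_succ_of_le (Polynomial.natDegree_pow_le.trans (Nat.mul_le_mul_left j h1))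
  have h3 := Polynomial.eval_eq_sum_range' h2 (1 : ℝ)
  simp only [one_pow, mul_one] at h3
  rw [← h3, Polynomial.eval_pow, wtPoly, Polynomial.eval_finsetSum]
  simp

namespace Prof
variable {q N : ℕ} {w : ℤ} {S : (ℕ → ℝ) → ℝ → ℝ} {a : ℕ → (ℕ → ℝ) → ℝ → ℝ}

theorem coeff_wtPoly (ha : ∀ k, 1 ≤ k → k ≤ N → Prof q k (a k)) (n : ℕ) :
    Prof q n fun b y => (wtPoly (fun k => a k b y) N).coeff n := by
  simp only [HeatFlow.coeff_wtPoly, Finset.mem_Icc]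
  by_cases h : 1 ≤ n ∧ n ≤ N
  · simp only [h, and_self, if_true]
    exact ha n h.1 h.2
  · simp only [h, if_false]
    exact zero q _

theorem coeff_wtPoly_pow (ha : ∀ k, 1 ≤ k → k ≤ N → Prof q k (a k)) (j n : ℕ) :
    Prof q n fun b y => (wtPoly (fun k => a k b y) N ^ (j + 1)).coeff n := by
  induction j generalizing n with
  | zero => simpa using coeff_wtPoly ha n
  | succ j ih =>
    simp only [pow_succ _ (j + 1), Polynomial.coeff_mul]
    refine sum _ fun p hp => ((ih p.1).mul (coeff_wtPoly ha p.2)).cast ?_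
    rw [← Finset.HasAntidiagonal.mem_antidiagonal.1 hp]
    push_cast
    ring

/-- A power `j ≥ 2` has a second factor `O(y²)` available to absorb the division by `y²`. -/
theorem coeff_wtPoly_pow_div (ha : ∀ k, 1 ≤ k → k ≤ N → Prof q k (a k)) {j : ℕ} (hj : 2 ≤ j)
    (n : ℕ) : Prof q n fun b y => (wtPoly (fun k => a k b y) N ^ j).coeff n / y ^ 2 := by
  obtain ⟨m, rfl⟩ := Nat.exists_eq_add_of_le' hj
  simp only [pow_succ _ (m + 1), Polynomial.coeff_mul, Finset.sum_div]
  refine sum _ fun p hp => ((coeff_wtPoly_pow ha m p.1).mul_div (coeff_wtPoly ha p.2)).cast ?_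
  rw [← Finset.HasAntidiagonal.mem_antidiagonal.1 hp]
  push_cast
  ring

end Prof

/-! ### The profiles below the radiation zone -/

/-- The rate `(2j - 1 + c_{b₁}) b₁ b_j - b_{j+1}` of the approximate modulation equations. -/
def rate (Q χ : ℝ → ℝ) (j : ℕ) (b : ℕ → ℝ) : ℝ :=
  (2 * (j : ℝ) - 1 + cb Q χ (b 1)) * b 1 * b j - b (j + 1)

theorem Prof.rate_mul (hc : Coef (cb Q χ)) {q : ℕ} {w : ℤ} {S : (ℕ → ℝ) → ℝ → ℝ} {j : ℕ}
    (hj : 1 ≤ j) (hjq : j + 1 ≤ q) (h : Prof q w S) :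
    Prof q (w + j + 1) fun b y => rate Q χ j b * S b y := by
  have h1 := (coef_mul ((Coef.const (2 * (j : ℝ) - 1)).add hc) 1 h).mulb j hj (by omega)
  have h2 := h.mulb (j + 1) (by omega) hjq
  refine ((h1.cast (w' := w + j + 1) (by ring)).sub (h2.cast (by push_cast; ring))).congr
    fun b _ y _ => ?_
  rw [rate, zpow_one]
  ring

/-- The sum `b_k T_k + S_k` of the terms of weight `k`. -/
def layer (Q : ℝ → ℝ) (L : ℕ) (S : ℕ → (ℕ → ℝ) → ℝ → ℝ) (k : ℕ) (b : ℕ → ℝ) (y : ℝ) : ℝ :=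
  (if k ≤ L then b k * Tprof Q k y else 0) + S k b y

theorem Ppart_eq (L i : ℕ) (S : ℕ → (ℕ → ℝ) → ℝ → ℝ) (b : ℕ → ℝ) (y : ℝ) :
    Ppart g Q L i S b y = ∑ j ∈ Finset.Icc 2 (L + 2),
      iteratedDeriv j (nonlin g) (Q y) / (j.factorial : ℝ) *
        (wtPoly (fun k => layer Q L S k b y) i ^ j).coeff (i + 1) := rfl

/-- The source `Φ_{i+1}` with the value which `Θ_i` has in the region `y < B₀ / 4`. -/
def PhiLoc (g Q χ : ℝ → ℝ) (L i : ℕ) (S : ℕ → (ℕ → ℝ) → ℝ → ℝ) (b : ℕ → ℝ) (y : ℝ) : ℝ :=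
  (if i ≤ L then b 1 * b i *
      (scal (Tprof Q i) y - (2 * (i : ℝ) - 1 + cb Q χ (b 1)) * Tprof Q i y) else 0)
    + b 1 * scal (S i b) y
    + Ppart g Q L i S b y / y ^ 2
    - ∑ j ∈ Finset.Icc 1 (i - 1), rate Q χ j b * dparam (S i) j b y

/-- The profiles `S_i` computed from `PhiLoc`. -/
def Sloc (g Q χ : ℝ → ℝ) (L : ℕ) : ℕ → (ℕ → ℝ) → ℝ → ℝ
  | 0 => fun _ _ => 0
  | 1 => fun _ _ => 0
  | n + 2 => fun b y =>
      -invH Q (PhiLoc g Q χ L (n + 1)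
        (fun k => if _h : k < n + 2 then Sloc g Q χ L k else fun _ _ => 0) b) y
  termination_by n => n

theorem Ppart_congr {L i : ℕ} {S S' : ℕ → (ℕ → ℝ) → ℝ → ℝ} {b : ℕ → ℝ} {y : ℝ}
    (h : ∀ k ≤ i, S k b y = S' k b y) : Ppart g Q L i S b y = Ppart g Q L i S' b y := by
  rw [Ppart, Ppart]
  refine Finset.sum_congr rfl fun j _ => ?_
  congr 3
  refine Finset.sum_congr rfl fun k hk => ?_
  rw [h k (Finset.mem_Icc.1 hk).2]

theorem Phi_congr {L i : ℕ} {S S' : ℕ → (ℕ → ℝ) → ℝ → ℝ} (h : ∀ k ≤ i, S k = S' k) :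
    Phi g Q χ L i S = Phi g Q χ L i S' := by
  funext b y
  rw [Phi, Phi, Ppart_congr fun k hk => by rw [h k hk], h i le_rfl]

theorem PhiLoc_congr {L i : ℕ} {S S' : ℕ → (ℕ → ℝ) → ℝ → ℝ} (h : ∀ k ≤ i, S k = S' k) :
    PhiLoc g Q χ L i S = PhiLoc g Q χ L i S' := by
  funext b y
  rw [PhiLoc, PhiLoc, Ppart_congr fun k hk => by rw [h k hk], h i le_rfl]

theorem Sprof_zero (L : ℕ) : Sprof g Q χ L 0 = fun _ _ => 0 := by rw [Sprof]
theorem Sprof_one (L : ℕ) : Sprof g Q χ L 1 = fun _ _ => 0 := by rw [Sprof]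
theorem Sloc_zero (L : ℕ) : Sloc g Q χ L 0 = fun _ _ => 0 := by rw [Sloc]
theorem Sloc_one (L : ℕ) : Sloc g Q χ L 1 = fun _ _ => 0 := by rw [Sloc]

theorem Sprof_add_two (L n : ℕ) : Sprof g Q χ L (n + 2) =
    fun b y => -invH Q (Phi g Q χ L (n + 1) (Sprof g Q χ L) b) y := by
  rw [Sprof, Phi_congr (S' := Sprof g Q χ L) fun k hk => by
    rw [dif_pos (show k < n + 2 by omega)]]

theorem Sloc_add_two (L n : ℕ) : Sloc g Q χ L (n + 2) =
    fun b y => -invH Q (PhiLoc g Q χ L (n + 1) (Sloc g Q χ L) b) y := by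
  rw [Sloc, PhiLoc_congr (S' := Sloc g Q χ L) fun k hk => by
    rw [dif_pos (show k < n + 2 by omega)]]

theorem prof_layer (hQ : IsGroundState g Q) (hg : IsTarget g) (L : ℕ)
    {S : ℕ → (ℕ → ℝ) → ℝ → ℝ} {q k : ℕ} (hk : 1 ≤ k) (hkq : k ≤ L → k ≤ q)
    (hS : Prof q k (S k)) : Prof q k (layer Q L S k) := by
  refine Prof.add ?_ hS
  by_cases h : k ≤ L
  · simp only [h, if_true]
    refine (((Prof.base 0 (Coef.const 1) (nice_Tprof hQ hg hk)).mulb k hk (hkq h)).cast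
      (by ring)).congr fun b _ y _ => ?_
    simp
  · simp only [h, if_false]
    exact Prof.zero q _

theorem contDiff_iteratedDeriv_nonlin (hg : IsTarget g) (j : ℕ) :
    ContDiff ℝ ∞ (iteratedDeriv j (nonlin g)) := by
  induction j with
  | zero => rw [iteratedDeriv_zero]; exact hg.smooth_nonlin
  | succ j ih => rw [iteratedDeriv_succ]; exact (contDiff_infty_iff_deriv.1 ih).2

/-- All four contributions have weight `n + 2`: `rate` for index `j` has weight `j + 1`, and
`∂/∂b_j` removes `j`. Only `b_1, …, b_{n+1}` occur, so `S_k` depends on `b_1, …, b_{k-1}` alone. -/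
theorem prof_PhiLoc (hQ : IsGroundState g Q) (hg : IsTarget g) (hc : Coef (cb Q χ)) (L n : ℕ)
    {S : ℕ → (ℕ → ℝ) → ℝ → ℝ} (hS : ∀ k, k ≤ n + 1 → Prof (k - 1) k (S k)) :
    Prof (n + 1) (n + 2 : ℕ) (PhiLoc g Q χ L (n + 1) S) := by
  refine (((Prof.add ?_ ?_).add ?_).sub (Prof.sum _ fun j hj => ?_))
  · by_cases h : n + 1 ≤ L
    · simp only [h, if_true]
      have hT := nice_Tprof hQ hg (i := n + 1) (by omega)
      have h1 := (Prof.base (q := n + 1) 1 (Coef.const 1)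
        (hT.scal.add (hT.const_mul (-(2 * ((n + 1 : ℕ) : ℝ) - 1))))).mulb (n + 1) (by omega) le_rfl
      have h2 := (Prof.base (q := n + 1) 1 hc hT).mulb (n + 1) (by omega) le_rfl
      refine ((h1.sub h2).cast (by push_cast; ring)).congr fun b _ y _ => ?_
      rw [zpow_one]
      ring
    · simp only [h, if_false]
      exact Prof.zero _ _
  · refine ((Prof.coef_mul (Coef.const 1) 1 ((hS (n + 1) le_rfl).mono (q' := n + 1)
      (by omega)).scal).cast (by push_cast; ring)).congr fun b _ y _ => ?_
    rw [one_mul, zpow_one]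
  · simp only [Ppart_eq, Finset.sum_div]
    refine Prof.sum _ fun j hj => ?_
    have h1 := Prof.coeff_wtPoly_pow_div (N := n + 1) (q := n + 1) (a := layer Q L S)
      (fun k hk hkn => prof_layer hQ hg L hk (fun _ => hkn) ((hS k hkn).mono (by omega)))
      (Finset.mem_Icc.1 hj).1 (n + 1 + 1)
    refine ((h1.comp_mul hQ hg (contDiff_iteratedDeriv_nonlin hg j)).const_mul
      (1 / (j.factorial : ℝ))).congr fun b _ y _ => ?_
    ring
  · simp only [Finset.mem_Icc, Nat.add_sub_cancel] at hj
    have h1 := (((hS (n + 1) le_rfl).dparam_spec (by omega)).1.1 j hj.1).mono (q' := n + 1)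
      (by omega)
    exact (h1.rate_mul hc hj.1 (by omega)).cast (by push_cast; ring)

theorem prof_Sloc (hQ : IsGroundState g Q) (hg : IsTarget g) (hc : Coef (cb Q χ)) (L : ℕ) :
    ∀ i, Prof (i - 1) i (Sloc g Q χ L i) := by
  intro i
  induction i using Nat.strong_induction_on with
  | _ i ih =>
    match i with
    | 0 => rw [Sloc_zero]; exact Prof.zero _ _
    | 1 => rw [Sloc_one]; exact Prof.zero _ _
    | n + 2 =>
      rw [Sloc_add_two]
      exact ((prof_PhiLoc hQ hg hc L n fun k hk => ih k (by omega)).invH hQ hg).neg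

theorem opH_Sloc (hQ : IsGroundState g Q) (hg : IsTarget g) (hc : Coef (cb Q χ)) (L n : ℕ)
    {b : ℕ → ℝ} (hb : b 1 ∈ Ioo (0 : ℝ) (1 / 16)) {y : ℝ} (hy : 0 < y) :
    opH g Q (Sloc g Q χ L (n + 2) b) y = -PhiLoc g Q χ L (n + 1) (Sloc g Q χ L) b y := by
  rw [Sloc_add_two, opH_neg, Nice.opH_invH hQ hg
    ((prof_PhiLoc hQ hg hc L n fun k _ => prof_Sloc hQ hg hc L k).nice hb) hy]

/-- Before the radiation zone the first cut-off is `1` and `1 - χ_{B₀}` vanishes, and `H⁻¹`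
integrates from `0`, so it only sees this region. Hence `Σ = c_{b₁} T_1`, and `Θ_i` acquires the
term `-c_{b₁} T_i` that corrects the modulation equations. -/
theorem radSigma_eq {b₁ y : ℝ} (hχ : IsCutoff χ) (hb : 0 < b₁) (hy : y ∈ Ioo 0 (B0 b₁ / 4)) :
    radSigma g Q χ b₁ y = -cb Q χ b₁ * invH Q (scal Q) y := by
  have hB : 0 < B0 b₁ := by rw [B0]; have := Real.sqrt_pos.2 hb; positivity
  rw [radSigma, ← invH_const_mul]
  refine invH_congr (R := B0 b₁ / 4) (fun x hx => ?_) hy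
  have h1 : cut χ (B0 b₁ / 4) x = 1 := hχ.one _ (by
    rw [div_le_one (by positivity)]; exact hx.2.le)
  have h2 : EqOn (fun x => (1 - cut χ (B0 b₁) x) * scal Q x) (fun _ => 0) (Ioo 0 (B0 b₁)) := by
    intro z hz
    have : cut χ (B0 b₁) z = 1 := hχ.one _ (by rw [div_le_one hB]; exact hz.2.le)
    simp [this]
  have h3 := opH_congr (g := g) (Q := Q) isOpen_Ioo h2 (x := x) ⟨hx.1, by linarith [hx.2]⟩
  have h4 : opH g Q (fun _ => 0) x = 0 := by simp [opH, lap]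
  simp only [h1, h3, h4]
  ring

theorem Theta_eq {b₁ y : ℝ} (hχ : IsCutoff χ) (hb : 0 < b₁) (n : ℕ)
    (hy : y ∈ Ioo 0 (B0 b₁ / 4)) :
    Theta g Q χ b₁ (n + 1) y = scal (Tprof Q (n + 1)) y
      - (2 * ((n + 1 : ℕ) : ℝ) - 1 + cb Q χ b₁) * Tprof Q (n + 1) y := by
  have h1 := invH_iterate_congr (Q := Q) (F := radSigma g Q χ b₁)
    (fun y hy => radSigma_eq (g := g) (Q := Q) hχ hb hy) n hy
  rw [Theta, Nat.add_sub_cancel, h1, invH_iterate_const_mul]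
  simp only [Tprof, Function.iterate_succ_apply]
  have : ((-1 : ℝ) ^ (n + 1 + 1)) = (-1) ^ n := by rw [pow_add, pow_add]; ring
  rw [this, pow_succ]
  ring_nf

/-- Every operation in the recursion, including `H⁻¹`, is local to `(0, y)`, so the agreement of the
`Θ_i` propagates to all the profiles. The local ones are homogeneous in `b`, which the original ones
are not once the cut-offs act. -/
theorem Sprof_eq_Sloc (hχ : IsCutoff χ) (L : ℕ) :
    ∀ i, ∀ b : ℕ → ℝ, 0 < b 1 →
      EqOn (Sprof g Q χ L i b) (Sloc g Q χ L i b) (Ioo 0 (B0 (b 1) / 4)) := by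
  intro i
  induction i using Nat.strong_induction_on with
  | _ i ih =>
    match i with
    | 0 => intro b _ y _; rw [Sprof_zero, Sloc_zero]
    | 1 => intro b _ y _; rw [Sprof_one, Sloc_one]
    | n + 2 =>
      intro b hb y hy
      rw [Sprof_add_two, Sloc_add_two]
      simp only
      rw [invH_congr (R := B0 (b 1) / 4) (fun x hx => ?_) hy]
      have hS := ih (n + 1) (by omega)
      rw [Phi, PhiLoc, Ppart_congr fun k hk => ih k (by omega) b hb hx,
        scal_congr isOpen_Ioo (hS b hb) hx, Theta_eq hχ hb n hx]
      refine congrArg₂ _ rfl (Finset.sum_congr rfl fun j _ => ?_)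
      rw [rate, dparam, dparam]
      congr 1
      refine Filter.EventuallyEq.deriv_eq ?_
      -- The region `y < B₀(b₁)/4` moves with `b₁`. For fixed `x` inside it, the inequality persists
      -- for nearby parameters, which is what comparing the derivatives in `b_j` requires.
      have hc : ContinuousAt (fun x : ℝ => Function.update b j x 1) (b j) := by
        by_cases h : j = 1
        · subst h; simp only [Function.update_self]; exact continuousAt_id
        · simp only [Function.update_of_ne (Ne.symm h)]; exact continuousAt_const
      have h0 : Function.update b j (b j) = b := Function.update_eq_self j b
      have e1 : ∀ᶠ z in 𝓝 (b j), 0 < Function.update b j z 1 :=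
        hc.eventually_const_lt (by simpa only [h0] using hb)
      have hc2 : ContinuousAt (fun z : ℝ => B0 (Function.update b j z 1) / 4) (b j) := by
        have hs := Real.sqrt_pos.2 hb
        exact (continuousAt_const.div (Real.continuous_sqrt.continuousAt.comp hc)
          (by simpa [h0] using hs.ne')).div_const 4
      have e2 : ∀ᶠ z in 𝓝 (b j), x < B0 (Function.update b j z 1) / 4 :=
        hc2.eventually_const_lt (by simpa only [h0] using hx.2)
      filter_upwards [e1, e2] with z h1 h2
      exact hS _ h1 ⟨hx.1, h2⟩

/-! ### The error of the approximate profile -/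

/-- Induction on the order: the remainder of `f` vanishes at `h = 0` and its derivative in `h` is
the remainder of `f'` of one order less. -/
theorem exists_taylor_bound (A : ℝ) (n : ℕ) : ∀ f : ℝ → ℝ, ContDiff ℝ ∞ f →
    ∃ C ≥ 0, ∀ x ∈ Icc 0 Real.pi, ∀ h, |h| ≤ A →
      |f (x + h) - ∑ j ∈ Finset.range n, iteratedDeriv j f x / (j.factorial : ℝ) * h ^ j|
        ≤ C * |h| ^ n := by
  induction n with
  | zero =>
    intro f hf
    obtain ⟨C, hC⟩ := (isCompact_Icc (a := -A) (b := Real.pi + A)).exists_bound_of_continuousOn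
      hf.continuous.continuousOn
    refine ⟨|C|, abs_nonneg _, fun x hx h hh => ?_⟩
    have := abs_le.1 hh
    simpa using (hC (x + h) ⟨by linarith [hx.1], by linarith [hx.2]⟩).trans (le_abs_self C)
  | succ n ih =>
    intro f hf
    obtain ⟨C, hC, hb⟩ := ih (deriv f) (contDiff_infty_iff_deriv.1 hf).2
    refine ⟨C, hC, fun x hx h hh => ?_⟩
    set r : ℝ → ℝ := fun z => f (x + z) -
      ∑ j ∈ Finset.range (n + 1), iteratedDeriv j f x / (j.factorial : ℝ) * z ^ j with hr
    have hd : ∀ z, HasDerivAt r (deriv f (x + z) - ∑ j ∈ Finset.range n,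
        iteratedDeriv j (deriv f) x / (j.factorial : ℝ) * z ^ j) z := by
      intro z
      have h1 : HasDerivAt (fun z => f (x + z)) (deriv f (x + z)) z := 
        (hf.differentiable (by simp) (x + z)).hasDerivAt.comp_const_add x z
      refine h1.sub ?_
      simp only [Finset.sum_range_succ' _ n, pow_zero]
      refine (HasDerivAt.fun_sum fun j _ => ?_).add_const _
      have h2 := (hasDerivAt_pow (j + 1) z).const_mul
        (iteratedDeriv (j + 1) f x / ((j + 1).factorial : ℝ))
      refine h2.congr_deriv ?_
      rw [iteratedDeriv_succ', Nat.factorial_succ, Nat.add_sub_cancel]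
      push_cast
      field_simp
    have hr0 : r 0 = 0 := by
      simp only [hr, Finset.sum_range_succ' _ n]
      simp
    have key := (convex_Icc (-|h|) |h|).norm_image_sub_le_of_norm_hasDerivWithin_le
      (f := r) (C := C * |h| ^ n) (fun z _ => (hd z).hasDerivWithinAt) (fun z hz => ?_)
      (x := 0) (y := h) ⟨by simp, by simp⟩ ⟨neg_abs_le h, le_abs_self h⟩
    · rw [hr0, sub_zero, sub_zero] at key
      calc |r h| ≤ C * |h| ^ n * |h| := key
        _ = _ := by ring
    · have hz' : |z| ≤ |h| := abs_le.2 hz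
      exact (hb x hx z (hz'.trans hh)).trans (by gcongr)

theorem sum_Icc_one_eq (F : ℕ → ℝ) (n : ℕ) :
    ∑ k ∈ Finset.Icc 1 n, F k = ∑ k ∈ Finset.range n, F (k + 1) := by
  induction n with
  | zero => simp
  | succ n ih => rw [Finset.sum_Icc_succ_top (by omega), ih, Finset.sum_range_succ]

theorem sum_Icc_two_eq (F : ℕ → ℝ) (n : ℕ) :
    ∑ k ∈ Finset.Icc 2 (n + 1), F k = ∑ k ∈ Finset.range n, F (k + 2) := by
  induction n with
  | zero => simp
  | succ n ih => rw [Finset.sum_Icc_succ_top (by omega), ih, Finset.sum_range_succ]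

namespace Nice
variable {F G : ℝ → ℝ}

theorem sum {ι : Type*} (s : Finset ι) {F : ι → ℝ → ℝ} (h : ∀ i ∈ s, Nice (F i)) :
    Nice fun y => ∑ i ∈ s, F i y := fun R n => SymOn.sum s fun i hi => h i hi R n

theorem scal_sum {ι : Type*} (s : Finset ι) {F : ι → ℝ → ℝ} (h : ∀ i ∈ s, Nice (F i)) {y : ℝ}
    (hy : 0 < y) : HeatFlow.scal (fun y => ∑ i ∈ s, F i y) y = ∑ i ∈ s, HeatFlow.scal (F i) y := by
  simp only [HeatFlow.scal]
  rw [deriv_fun_sum fun i hi => (h i hi).differentiableAt hy, Finset.mul_sum]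

theorem opH_add (hF : Nice F) (hG : Nice G) {y : ℝ} (hy : 0 < y) :
    opH g Q (fun x => F x + G x) y = opH g Q F y + opH g Q G y :=
  HeatFlow.opH_add (isOpen_Ioo (a := 0) (b := y + 1)) ((hF.contDiffOn _).of_le (by norm_cast))
    ((hG.contDiffOn _).of_le (by norm_cast)) ⟨hy, by linarith⟩

theorem opH_sum {ι : Type*} (s : Finset ι) {F : ι → ℝ → ℝ} (h : ∀ i ∈ s, Nice (F i)) {y : ℝ}
    (hy : 0 < y) : opH g Q (fun y => ∑ i ∈ s, F i y) y = ∑ i ∈ s, opH g Q (F i) y := by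
  classical
  induction s using Finset.induction_on with
  | empty => simp [opH, lap]
  | insert i s hi ih =>
    have hs : ∀ j ∈ s, Nice (F j) := fun j hj => h j (Finset.mem_insert_of_mem hj)
    simp only [Finset.sum_insert hi]
    rw [opH_add (h i (Finset.mem_insert_self _ _)) (sum s hs) hy, ih hs]

end Nice

/-- The correction `∑ b_k T_k + ∑ S_k` to the ground state below the radiation zone. -/
def corr (g Q χ : ℝ → ℝ) (L : ℕ) (b : ℕ → ℝ) (y : ℝ) : ℝ :=
  (∑ k ∈ Finset.range L, b (k + 1) * Tprof Q (k + 1) y)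
    + ∑ n ∈ Finset.range (L + 1), Sloc g Q χ L (n + 2) b y

/-- The tangent direction `∂(corr)/∂b_j = T_j + ∑ ∂S_i/∂b_j`. -/
def tang (g Q χ : ℝ → ℝ) (L j : ℕ) (b : ℕ → ℝ) (y : ℝ) : ℝ :=
  Tprof Q j y + ∑ n ∈ Finset.range (L + 1), dparam (Sloc g Q χ L (n + 2)) j b y

/-- The error of `Q + corr` as a solution of the renormalized flow. -/
def profErr (g Q χ : ℝ → ℝ) (L : ℕ) (b : ℕ → ℝ) (y : ℝ) : ℝ :=
  -b 1 * (scal Q y + scal (corr g Q χ L b) y) - opH g Q (corr g Q χ L b) y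
    - (nonlin g (Q y + corr g Q χ L b y) - nonlin g (Q y)
        - deriv (nonlin g) (Q y) * corr g Q χ L b y) / y ^ 2
    + ∑ j ∈ Finset.range L, rate Q χ (j + 1) b * tang g Q χ L (j + 1) b y

theorem corr_eq_sum_layer (L : ℕ) (b : ℕ → ℝ) (y : ℝ) :
    corr g Q χ L b y = ∑ k ∈ Finset.Icc 1 (L + 2), layer Q L (Sloc g Q χ L) k b y := by
  rw [sum_Icc_one_eq]
  simp only [layer, Finset.sum_add_distrib]
  rw [corr]
  congr 1
  · rw [Finset.sum_range_succ, Finset.sum_range_succ, if_neg (by omega), if_neg (by omega),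
      add_zero, add_zero]
    exact Finset.sum_congr rfl fun k hk => (if_pos (by rw [Finset.mem_range] at hk; omega)).symm
  · rw [Finset.sum_range_succ' _ (L + 1), Sloc_one, add_zero]

theorem dparam_Sloc_of_le (hQ : IsGroundState g Q) (hg : IsTarget g) (hc : Coef (cb Q χ)) (L : ℕ)
    {i j : ℕ} (hi : 1 ≤ i) (hij : i ≤ j) {b : ℕ → ℝ} (hb : b 1 ∈ Ioo (0 : ℝ) (1 / 16)) {y : ℝ}
    (hy : 0 < y) : dparam (Sloc g Q χ L i) j b y = 0 := by
  obtain ⟨n, rfl⟩ := Nat.exists_eq_add_of_le' hi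
  cases n with
  | zero => rw [zero_add, Sloc_one]; simp [dparam]
  | succ n =>
    exact ((prof_Sloc hQ hg hc L (n + 1 + 1)).dparam_spec (by omega)).1.2 j (by omega) b hb y hy

/-- The Taylor polynomial is sorted by weight. The weights `2, …, L + 2` are the terms `P_i` built
into the recursion, and what is left has weight at least `L + 3`. -/
theorem taylor_split (L : ℕ) (b : ℕ → ℝ) (y : ℝ) :
    ∑ j ∈ Finset.range (L + 3), iteratedDeriv j (nonlin g) (Q y) / (j.factorial : ℝ)
        * corr g Q χ L b y ^ j =
      nonlin g (Q y) + deriv (nonlin g) (Q y) * corr g Q χ L b y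
        + ∑ n ∈ Finset.range (L + 1), Ppart g Q L (n + 1) (Sloc g Q χ L) b y
        + ∑ j ∈ Finset.Icc 2 (L + 2), iteratedDeriv j (nonlin g) (Q y) / (j.factorial : ℝ) *
          ∑ n ∈ Finset.Ico (L + 3) (j * (L + 2) + 1),
            (wtPoly (fun k => layer Q L (Sloc g Q χ L) k b y) (L + 2) ^ j).coeff n := by
  have h1 : ∑ n ∈ Finset.range (L + 1), Ppart g Q L (n + 1) (Sloc g Q χ L) b y =
      ∑ j ∈ Finset.Icc 2 (L + 2), iteratedDeriv j (nonlin g) (Q y) / (j.factorial : ℝ) *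
        ∑ n ∈ Finset.range (L + 3),
          (wtPoly (fun k => layer Q L (Sloc g Q χ L) k b y) (L + 2) ^ j).coeff n := by
    simp only [Ppart_eq]
    rw [Finset.sum_comm]
    refine Finset.sum_congr rfl fun j hj => ?_
    have hj2 := (Finset.mem_Icc.1 hj).1
    rw [← Finset.mul_sum, Finset.sum_range_succ' _ (L + 2), Finset.sum_range_succ' _ (L + 1),
      coeff_wtPoly_pow_of_lt _ _ (by omega), coeff_wtPoly_pow_of_lt _ _ (by omega), add_zero,
      add_zero]
    congr 1
    refine Finset.sum_congr rfl fun n hn => ?_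
    rw [Finset.mem_range] at hn
    exact coeff_wtPoly_pow_trunc _ (by omega) hj2
  rw [h1, add_assoc, ← Finset.sum_add_distrib, Finset.sum_range_succ' _ (L + 2),
    Finset.sum_range_succ' _ (L + 1), sum_Icc_two_eq _ (L + 1)]
  simp only [← mul_add]
  have h2 : ∀ j ∈ Finset.range (L + 1), corr g Q χ L b y ^ (j + 1 + 1) =
      ∑ n ∈ Finset.range (L + 3),
          (wtPoly (fun k => layer Q L (Sloc g Q χ L) k b y) (L + 2) ^ (j + 2)).coeff n
        + ∑ n ∈ Finset.Ico (L + 3) ((j + 2) * (L + 2) + 1),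
          (wtPoly (fun k => layer Q L (Sloc g Q χ L) k b y) (L + 2) ^ (j + 2)).coeff n := by
    intro j _
    rw [Finset.sum_range_add_sum_Ico _ (by nlinarith), ← wtPoly_sum_pow, ← corr_eq_sum_layer]
  rw [Finset.sum_congr rfl fun j hj => by rw [h2 j hj]]
  simp only [zero_add, iteratedDeriv_one, iteratedDeriv_zero, Nat.factorial_zero,
    Nat.factorial_one, pow_zero, pow_one, Nat.cast_one, div_one, mul_one]
  ring

theorem nice_Tsum (hQ : IsGroundState g Q) (hg : IsTarget g) (L : ℕ) (b : ℕ → ℝ) :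
    Nice fun y => ∑ k ∈ Finset.range L, b (k + 1) * Tprof Q (k + 1) y :=
  Nice.sum _ fun _ _ => (nice_Tprof hQ hg (by omega)).const_mul _

theorem nice_Ssum (hQ : IsGroundState g Q) (hg : IsTarget g) (hc : Coef (cb Q χ)) (L : ℕ)
    {b : ℕ → ℝ} (hb : b 1 ∈ Ioo (0 : ℝ) (1 / 16)) :
    Nice fun y => ∑ n ∈ Finset.range (L + 1), Sloc g Q χ L (n + 2) b y :=
  Nice.sum _ fun _ _ => (prof_Sloc hQ hg hc L _).nice hb

theorem nice_corr (hQ : IsGroundState g Q) (hg : IsTarget g) (hc : Coef (cb Q χ)) (L : ℕ)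
    {b : ℕ → ℝ} (hb : b 1 ∈ Ioo (0 : ℝ) (1 / 16)) : Nice (corr g Q χ L b) :=
  (nice_Tsum hQ hg L b).add (nice_Ssum hQ hg hc L hb)

/-- `H S_{i+1} = -Φ_{i+1}` cancels the error of weight `i + 1` for each `i ≤ L + 1`. There remain
the linear contributions of the last profile `S_{L+2}`, the heavy part of the Taylor polynomial and
the Taylor remainder. -/
theorem profErr_eq (hQ : IsGroundState g Q) (hg : IsTarget g) (hc : Coef (cb Q χ)) (L : ℕ)
    {b : ℕ → ℝ} (hb : b 1 ∈ Ioo (0 : ℝ) (1 / 16)) (hbL : b (L + 1) = 0) {y : ℝ} (hy : 0 < y) :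
    profErr g Q χ L b y =
      -(b 1 * scal (Sloc g Q χ L (L + 2) b) y)
        + ∑ j ∈ Finset.range L, rate Q χ (j + 1) b * dparam (Sloc g Q χ L (L + 2)) (j + 1) b y
        - (∑ j ∈ Finset.Icc 2 (L + 2), iteratedDeriv j (nonlin g) (Q y) / (j.factorial : ℝ) *
          ∑ n ∈ Finset.Ico (L + 3) (j * (L + 2) + 1),
            (wtPoly (fun k => layer Q L (Sloc g Q χ L) k b y) (L + 2) ^ j).coeff n) / y ^ 2
        - (nonlin g (Q y + corr g Q χ L b y) -
          ∑ j ∈ Finset.range (L + 3), iteratedDeriv j (nonlin g) (Q y) / (j.factorial : ℝ)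
            * corr g Q χ L b y ^ j) / y ^ 2 := by
  have nT := nice_Tsum hQ hg L b
  have nS := nice_Ssum hQ hg hc L hb
  have eΛ : scal (corr g Q χ L b) y = (∑ k ∈ Finset.range L, b (k + 1) * scal (Tprof Q (k + 1)) y)
      + ∑ n ∈ Finset.range (L + 1), scal (Sloc g Q χ L (n + 2) b) y := by
    rw [← Nice.scal_sum (F := fun n => Sloc g Q χ L (n + 2) b) _
      (fun n _ => (prof_Sloc hQ hg hc L _).nice hb) hy]
    have : ∑ k ∈ Finset.range L, b (k + 1) * scal (Tprof Q (k + 1)) y =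
        scal (fun y => ∑ k ∈ Finset.range L, b (k + 1) * Tprof Q (k + 1) y) y := by
      rw [Nice.scal_sum (F := fun k y => b (k + 1) * Tprof Q (k + 1) y) _
        (fun _ _ => (nice_Tprof hQ hg (by omega)).const_mul _) hy]
      exact Finset.sum_congr rfl fun k _ => (scal_const_mul _ _ _).symm
    rw [this]
    exact scal_add (nT.differentiableAt hy) (nS.differentiableAt hy)
  have eH : opH g Q (corr g Q χ L b) y = -(∑ k ∈ Finset.range L, b (k + 1) * Tprof Q k y)
      - ∑ n ∈ Finset.range (L + 1), PhiLoc g Q χ L (n + 1) (Sloc g Q χ L) b y := by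
    have e1 : opH g Q (corr g Q χ L b) y = _ := Nice.opH_add nT nS hy
    rw [e1, Nice.opH_sum (F := fun n => Sloc g Q χ L (n + 2) b) _
      (fun n _ => (prof_Sloc hQ hg hc L _).nice hb) hy,
      Nice.opH_sum (F := fun k y => b (k + 1) * Tprof Q (k + 1) y) _
        (fun _ _ => (nice_Tprof hQ hg (by omega)).const_mul _) hy, sub_eq_add_neg,
        ← Finset.sum_neg_distrib, ← Finset.sum_neg_distrib]
    congr 1
    · refine Finset.sum_congr rfl fun k _ => ?_
      rw [opH_const_mul, opH_Tprof_succ hQ hg k hy]; ring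
    · exact Finset.sum_congr rfl fun n _ => opH_Sloc hQ hg hc L n hb hy
  have eP : ∑ n ∈ Finset.range (L + 1), PhiLoc g Q χ L (n + 1) (Sloc g Q χ L) b y =
      (∑ n ∈ Finset.range L, b 1 * b (n + 1) * (scal (Tprof Q (n + 1)) y
          - (2 * ((n + 1 : ℕ) : ℝ) - 1 + cb Q χ (b 1)) * Tprof Q (n + 1) y))
        + b 1 * (∑ n ∈ Finset.range (L + 1), scal (Sloc g Q χ L (n + 2) b) y
          - scal (Sloc g Q χ L (L + 2) b) y)
        + (∑ n ∈ Finset.range (L + 1), Ppart g Q L (n + 1) (Sloc g Q χ L) b y) / y ^ 2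
        - ∑ j ∈ Finset.range L, rate Q χ (j + 1) b *
          (∑ n ∈ Finset.range (L + 1), dparam (Sloc g Q χ L (n + 2)) (j + 1) b y
            - dparam (Sloc g Q χ L (L + 2)) (j + 1) b y) := by
    simp only [PhiLoc, Finset.sum_add_distrib, Finset.sum_sub_distrib]
    have h0 : scal (Sloc g Q χ L 1 b) y = 0 := by rw [Sloc_one]; simp [scal]
    have h1 : ∑ n ∈ Finset.range (L + 1), b 1 * scal (Sloc g Q χ L (n + 1) b) y =
        b 1 * (∑ n ∈ Finset.range (L + 1), scal (Sloc g Q χ L (n + 2) b) y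
          - scal (Sloc g Q χ L (L + 2) b) y) := by
      rw [← Finset.mul_sum, Finset.sum_range_succ' _ L, h0,
        Finset.sum_range_succ (fun n => scal (Sloc g Q χ L (n + 2) b) y) L]
      ring
    have h2 : ∑ n ∈ Finset.range (L + 1), ∑ j ∈ Finset.Icc 1 (n + 1 - 1),
        rate Q χ j b * dparam (Sloc g Q χ L (n + 1)) j b y =
        ∑ j ∈ Finset.range L, rate Q χ (j + 1) b *
          (∑ n ∈ Finset.range (L + 1), dparam (Sloc g Q χ L (n + 2)) (j + 1) b y
            - dparam (Sloc g Q χ L (L + 2)) (j + 1) b y) := by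
      have h3 : ∀ n ∈ Finset.range (L + 1), ∑ j ∈ Finset.Icc 1 (n + 1 - 1),
          rate Q χ j b * dparam (Sloc g Q χ L (n + 1)) j b y =
          ∑ j ∈ Finset.range L, rate Q χ (j + 1) b * dparam (Sloc g Q χ L (n + 1)) (j + 1) b y := by
        intro n hn
        rw [Finset.mem_range] at hn
        rw [← sum_Icc_one_eq (fun j => rate Q χ j b * dparam (Sloc g Q χ L (n + 1)) j b y)]
        refine Finset.sum_subset (Finset.Icc_subset_Icc_right (by omega)) fun j hj hj' => ?_
        rw [Finset.mem_Icc] at hj hj'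
        rw [dparam_Sloc_of_le hQ hg hc L (by omega) (by omega) hb hy, mul_zero]
      rw [Finset.sum_congr rfl h3, Finset.sum_comm]
      refine Finset.sum_congr rfl fun j _ => ?_
      rw [← Finset.mul_sum, Finset.sum_range_succ' _ L,
        dparam_Sloc_of_le hQ hg hc L le_rfl (by omega) hb hy,
        Finset.sum_range_succ (fun n => dparam (Sloc g Q χ L (n + 2)) (j + 1) b y) L]
      ring
    rw [h1, h2, Finset.sum_range_succ _ L, if_neg (by omega), add_zero, Finset.sum_div]
    congr 3
    refine Finset.sum_congr rfl fun n hn => ?_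
    rw [Finset.mem_range] at hn
    rw [if_pos (by omega)]
  -- As `H T_{k+1} = -T_k`, the term `b_1 T_0` cancels `-b_1 ΛQ`, and the others cancel the
  -- `b_{j+1}` part of the rates. The sum closes because `b_{L+1} = 0`.
  have eT : ∑ k ∈ Finset.range L, b (k + 1) * Tprof Q k y
      - ∑ k ∈ Finset.range L, b (k + 1 + 1) * Tprof Q (k + 1) y = b 1 * scal Q y := by
    have h1 := Finset.sum_range_succ' (fun k => b (k + 1) * Tprof Q k y) L
    have h2 := Finset.sum_range_succ (fun k => b (k + 1) * Tprof Q k y) L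
    rw [hbL] at h2
    rw [Tprof_zero] at h1
    simp only [zero_add] at h1
    linarith
  have hsplit := taylor_split (g := g) (Q := Q) (χ := χ) L b y
  have eR : ∑ j ∈ Finset.range L, rate Q χ (j + 1) b * tang g Q χ L (j + 1) b y =
      ∑ j ∈ Finset.range L, rate Q χ (j + 1) b * Tprof Q (j + 1) y
      + ∑ j ∈ Finset.range L, rate Q χ (j + 1) b *
        ∑ n ∈ Finset.range (L + 1), dparam (Sloc g Q χ L (n + 2)) (j + 1) b y := by
    rw [← Finset.sum_add_distrib]
    exact Finset.sum_congr rfl fun j _ => by rw [tang]; ring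
  have eR1 : ∑ j ∈ Finset.range L, rate Q χ (j + 1) b * Tprof Q (j + 1) y =
      ∑ j ∈ Finset.range L, (2 * ((j + 1 : ℕ) : ℝ) - 1 + cb Q χ (b 1)) * b 1 * b (j + 1)
        * Tprof Q (j + 1) y - ∑ k ∈ Finset.range L, b (k + 1 + 1) * Tprof Q (k + 1) y := by
    rw [← Finset.sum_sub_distrib]
    exact Finset.sum_congr rfl fun j _ => by rw [rate]; ring
  have eP1 : ∑ n ∈ Finset.range L, b 1 * b (n + 1) * (scal (Tprof Q (n + 1)) y
          - (2 * ((n + 1 : ℕ) : ℝ) - 1 + cb Q χ (b 1)) * Tprof Q (n + 1) y) =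
      b 1 * ∑ k ∈ Finset.range L, b (k + 1) * scal (Tprof Q (k + 1)) y
      - ∑ j ∈ Finset.range L, (2 * ((j + 1 : ℕ) : ℝ) - 1 + cb Q χ (b 1)) * b 1 * b (j + 1)
        * Tprof Q (j + 1) y := by
    rw [Finset.mul_sum, ← Finset.sum_sub_distrib]
    exact Finset.sum_congr rfl fun j _ => by ring
  rw [profErr, eΛ, eH, eP, eP1, eR, eR1, hsplit]
  simp only [mul_sub, Finset.sum_sub_distrib]
  have hy2 : y ^ 2 ≠ 0 := by positivity
  simp only [sub_div, add_div]
  linear_combination eT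

/-! ### Bounds of the approximate profile -/

/-- The parameters are small and of size `b_k = O(b₁^k)`. -/
def ParBd (A : ℝ) (L : ℕ) (b : ℕ → ℝ) : Prop :=
  b 1 ∈ Ioo (0 : ℝ) (1 / 16) ∧ b (L + 1) = 0 ∧ ∀ k, 1 ≤ k → k ≤ L → |b k| ≤ A * b 1 ^ k

/-- `S` is `O(b₁^m y²)` on `(0, R)`, uniformly in the admissible parameters. -/
def ProfBd (A R : ℝ) (L m : ℕ) (S : (ℕ → ℝ) → ℝ → ℝ) : Prop :=
  ∃ C ≥ 0, ∀ b, ParBd A L b → ∀ y ∈ Ioo 0 R, |S b y| ≤ C * b 1 ^ m * y ^ 2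

namespace ProfBd
variable {A R : ℝ} {L m : ℕ} {S S' : (ℕ → ℝ) → ℝ → ℝ}

theorem of_prof (hA : 0 ≤ A) {w : ℕ} (h : Prof (L + 1) w S) (hm : m ≤ w) :
    ProfBd A R L m S := by
  obtain ⟨C, hC, hb⟩ := h.exists_bound A R
  refine ⟨C, hC, fun b h1 y hy => (hb b h1.1 (fun k hk hkL => ?_) y hy).trans ?_⟩
  · rcases Nat.lt_or_ge L k with h | h
    · rw [show k = L + 1 by omega, h1.2.1, abs_zero]
      exact mul_nonneg hA (pow_nonneg h1.1.1.le _)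
    · exact h1.2.2 k hk h
  · have : b 1 ^ w ≤ b 1 ^ m := pow_le_pow_of_le_one h1.1.1.le (by linarith [h1.1.2]) hm
    rw [zpow_natCast]
    gcongr

theorem add (h : ProfBd A R L m S) (h' : ProfBd A R L m S') :
    ProfBd A R L m fun b y => S b y + S' b y := by
  obtain ⟨C, hC, h⟩ := h
  obtain ⟨D, hD, h'⟩ := h'
  refine ⟨C + D, by positivity, fun b h1 y hy => (abs_add_le _ _).trans ?_⟩
  linarith [h b h1 y hy, h' b h1 y hy]

theorem neg (h : ProfBd A R L m S) : ProfBd A R L m fun b y => -S b y := by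
  obtain ⟨C, hC, h⟩ := h
  exact ⟨C, hC, fun b h1 y hy => by rw [abs_neg]; exact h b h1 y hy⟩

theorem congr (h : ProfBd A R L m S)
    (e : ∀ b, ParBd A L b → ∀ y ∈ Ioo 0 R, S b y = S' b y) : ProfBd A R L m S' := by
  obtain ⟨C, hC, h⟩ := h
  exact ⟨C, hC, fun b h1 y hy => by rw [← e b h1 y hy]; exact h b h1 y hy⟩

theorem sum {ι : Type*} (s : Finset ι) {F : ι → (ℕ → ℝ) → ℝ → ℝ}
    (h : ∀ i ∈ s, ProfBd A R L m (F i)) : ProfBd A R L m fun b y => ∑ i ∈ s, F i b y := by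
  classical
  induction s using Finset.induction_on with
  | empty => exact ⟨0, le_rfl, fun b _ y _ => by simp⟩
  | insert i s hi ih =>
    refine ((h i (Finset.mem_insert_self _ _)).add
      (ih fun j hj => h j (Finset.mem_insert_of_mem hj))).congr fun b _ y _ => ?_
    rw [Finset.sum_insert hi]

end ProfBd

theorem prof_mul_Tprof (hQ : IsGroundState g Q) (hg : IsTarget g) {q k : ℕ} (hk : 1 ≤ k)
    (hkq : k ≤ q) : Prof q k fun b y => b k * Tprof Q k y :=
  (((Prof.base 0 (Coef.const 1) (nice_Tprof hQ hg hk)).mulb k hk hkq).cast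
    (by ring)).congr fun b _ y _ => by simp

theorem profBd_corr (hQ : IsGroundState g Q) (hg : IsTarget g) (hc : Coef (cb Q χ)) (L : ℕ)
    {A : ℝ} (hA : 0 ≤ A) (R : ℝ) : ProfBd A R L 1 (corr g Q χ L) := by
  refine (ProfBd.sum _ fun k hk => ?_).add (ProfBd.sum _ fun n hn => ?_)
  · rw [Finset.mem_range] at hk
    exact ProfBd.of_prof hA (prof_mul_Tprof hQ hg (by omega) (by omega)) (by omega)
  · rw [Finset.mem_range] at hn
    exact ProfBd.of_prof hA ((prof_Sloc hQ hg hc L (n + 2)).mono (by omega)) (by omega)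

theorem profBd_scal_corr (hQ : IsGroundState g Q) (hg : IsTarget g) (hc : Coef (cb Q χ)) (L : ℕ)
    {A : ℝ} (hA : 0 ≤ A) (R : ℝ) : ProfBd A R L 1 fun b => scal (corr g Q χ L b) := by
  refine ((ProfBd.sum (Finset.range L) (F := fun k b => scal fun y => b (k + 1) * Tprof Q (k + 1) y)
    fun k hk => ?_).add (ProfBd.sum (Finset.range (L + 1))
      (F := fun n b => scal (Sloc g Q χ L (n + 2) b)) fun n hn => ?_)).congr fun b hb y hy => ?_
  · rw [Finset.mem_range] at hk
    exact ProfBd.of_prof hA (prof_mul_Tprof hQ hg (q := L + 1) (k := k + 1) (by omega)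
      (by omega)).scal (by omega)
  · rw [Finset.mem_range] at hn
    exact ProfBd.of_prof hA ((prof_Sloc hQ hg hc L (n + 2)).mono (by omega)).scal (by omega)
  · have e := scal_add ((nice_Tsum hQ hg L b).differentiableAt hy.1)
      ((nice_Ssum hQ hg hc L hb.1).differentiableAt hy.1)
    refine Eq.trans ?_ e.symm
    rw [Nice.scal_sum (F := fun n => Sloc g Q χ L (n + 2) b) _
      (fun n _ => (prof_Sloc hQ hg hc L _).nice hb.1) hy.1,
      Nice.scal_sum (F := fun k y => b (k + 1) * Tprof Q (k + 1) y) _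
        (fun _ _ => (nice_Tprof hQ hg (by omega)).const_mul _) hy.1]

/-- `∂S_i/∂b_j` has weight `i - j ≥ 1` if `j < i` and is zero otherwise. So the tangent directions
are `T_j` up to `O(b₁)`. -/
theorem profBd_tang (hQ : IsGroundState g Q) (hg : IsTarget g) (hc : Coef (cb Q χ)) (L : ℕ)
    {A : ℝ} (hA : 0 ≤ A) (R : ℝ) {j : ℕ} (hj : 1 ≤ j) :
    ProfBd A R L 1 fun b y => tang g Q χ L j b y - Tprof Q j y := by
  refine (ProfBd.sum (Finset.range (L + 1)) (F := fun n => dparam (Sloc g Q χ L (n + 2)) j)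
    fun n hn => ?_).congr fun b _ y _ => by rw [tang]; ring
  rw [Finset.mem_range] at hn
  rcases Nat.lt_or_ge j (n + 2) with h | h
  · have h1 := (((prof_Sloc hQ hg hc L (n + 2)).dparam_spec (by omega)).1.1 j hj).mono
      (q' := L + 1) (by omega)
    exact ProfBd.of_prof hA (w := n + 2 - j) (h1.cast (by omega)) (by omega)
  · exact ⟨0, le_rfl, fun b hb y hy => by
      rw [dparam_Sloc_of_le hQ hg hc L (by omega) h hb.1 hy.1]; simp⟩

theorem profBd_profErr (hQ : IsGroundState g Q) (hg : IsTarget g) (hc : Coef (cb Q χ)) (L : ℕ)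
    {A : ℝ} (hA : 0 ≤ A) (R : ℝ) : ProfBd A R L (L + 3) (profErr g Q χ L) := by
  have pS := prof_Sloc hQ hg hc L (L + 2)
  have h1 : ProfBd A R L (L + 3) fun b y => b 1 * scal (Sloc g Q χ L (L + 2) b) y :=
    ProfBd.of_prof hA (w := L + 3) (((Prof.coef_mul (Coef.const 1) 1 pS.scal).cast
      (by push_cast; ring)).congr fun b _ y _ => by rw [zpow_one, one_mul]) le_rfl
  have h2 : ProfBd A R L (L + 3) fun b y => ∑ j ∈ Finset.range L,
      rate Q χ (j + 1) b * dparam (Sloc g Q χ L (L + 2)) (j + 1) b y := by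
    refine ProfBd.sum _ fun j hj => ?_
    rw [Finset.mem_range] at hj
    exact ProfBd.of_prof hA (w := L + 3) (((pS.dparam_spec (by omega)).1.1 (j + 1)
      (by omega)).rate_mul hc (by omega) (by omega) |>.cast (by push_cast; ring)) le_rfl
  have h3 : ProfBd A R L (L + 3) fun b y =>
      (∑ j ∈ Finset.Icc 2 (L + 2), iteratedDeriv j (nonlin g) (Q y) / (j.factorial : ℝ) *
          ∑ n ∈ Finset.Ico (L + 3) (j * (L + 2) + 1),
            (wtPoly (fun k => layer Q L (Sloc g Q χ L) k b y) (L + 2) ^ j).coeff n) / y ^ 2 := by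
    simp only [Finset.sum_div, Finset.mul_sum]
    refine ProfBd.sum _ fun j hj => ProfBd.sum _ fun n hn => ?_
    have h := Prof.coeff_wtPoly_pow_div (N := L + 2) (q := L + 1) (a := layer Q L (Sloc g Q χ L))
      (fun k hk hkn => prof_layer hQ hg L hk (by omega) ((prof_Sloc hQ hg hc L k).mono (by omega)))
      (Finset.mem_Icc.1 hj).1 n
    refine ProfBd.of_prof hA (w := n) (((h.comp_mul hQ hg (contDiff_iteratedDeriv_nonlin hg
      j)).const_mul (1 / (j.factorial : ℝ))).congr fun b _ y _ => ?_) (Finset.mem_Ico.1 hn).1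
    ring
  -- The remainder is `O(α^{L+3})` with `α = O(b₁ y²)`; two of the factors `y²` suffice for the
  -- division by `y²` and for the bound `O(y²)`.
  have h4 : ProfBd A R L (L + 3) fun b y => (nonlin g (Q y + corr g Q χ L b y) -
          ∑ j ∈ Finset.range (L + 3), iteratedDeriv j (nonlin g) (Q y) / (j.factorial : ℝ)
            * corr g Q χ L b y ^ j) / y ^ 2 := by
    obtain ⟨C, hC, hα⟩ := profBd_corr hQ hg hc L hA R
    obtain ⟨D, hD, hT⟩ := exists_taylor_bound (C * R ^ 2) (L + 3) (nonlin g) hg.smooth_nonlin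
    refine ⟨D * C ^ (L + 3) * R ^ (2 * (L + 1)), by
      rw [pow_mul]; positivity, fun b hb y hy => ?_⟩
    have h5 := hα b hb y hy
    rw [pow_one] at h5
    have hb0 := hb.1.1
    have hy0 := hy.1
    have hyR := hy.2.le
    have h6 : |corr g Q χ L b y| ≤ C * R ^ 2 := h5.trans (by
      have : b 1 ≤ 1 := by linarith [hb.1.2]
      calc C * b 1 * y ^ 2 ≤ C * 1 * R ^ 2 := by gcongr
        _ = _ := by ring)
    have hQm := hQ.mem_Ioo hg hy.1
    have h7 := hT (Q y) ⟨hQm.1.le, hQm.2.le⟩ _ h6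
    rw [abs_div, abs_of_pos (show (0 : ℝ) < y ^ 2 by positivity), div_le_iff₀ (by positivity)]
    refine h7.trans ?_
    calc D * |corr g Q χ L b y| ^ (L + 3) ≤ D * (C * b 1 * y ^ 2) ^ (L + 3) := by gcongr
      _ = D * C ^ (L + 3) * y ^ (2 * (L + 1)) * b 1 ^ (L + 3) * y ^ 2 * y ^ 2 := by ring
      _ ≤ _ := by gcongr
  exact ((((h1.neg).add h2).add h3.neg).add h4.neg).congr fun b hb y hy => by
    rw [profErr_eq hQ hg hc L hb.1 hb.2.1 hy.1]
    ring

/-! ### Differentiation of the orthogonality conditions in time -/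

theorem IsTest.ip_eq_Ioo {Y : ℝ} {w : ℝ → ℝ} (hw : IsTest Q Y w) (F : ℝ → ℝ) :
    ip F w = ∫ y in Ioo 0 Y, F y * w y * y := by
  rw [ip]
  refine setIntegral_eq_of_subset_of_forall_sdiff_eq_zero measurableSet_Ioi (fun y hy => hy.1)
    fun y hy => ?_
  have : Y ≤ y := by
    by_contra! hlt
    exact hy.2 ⟨hy.1, hlt⟩
  simp [hw.supp y this]

/-- Difference quotients along a sequence decreasing to `t` have zero pairing with `w`. The mean
value inequality bounds them by `B`, and dominated convergence passes to the limit. Only times after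
`t` are used, so `t = 0` is covered. -/
theorem IsTest.ip_deriv_eq_zero (hQ : IsGroundState g Q) (hg : IsTarget g) {Y R : ℝ} (hY : 0 < Y)
    (hYR : Y < R) {w : ℝ → ℝ} (hw : IsTest Q Y w) {φ φ' : ℝ → ℝ → ℝ} {t t₂ B : ℝ} (ht : t < t₂)
    (hφ : ∀ τ ∈ Icc t t₂, SymOn R 0 0 (φ τ)) (h0 : ∀ τ ∈ Icc t t₂, ip (φ τ) w = 0)
    (hd : ∀ τ ∈ Icc t t₂, ∀ y ∈ Ioo 0 R,
      HasDerivWithinAt (fun τ => φ τ y) (φ' τ y) (Icc t t₂) τ)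
    (hB : ∀ τ ∈ Icc t t₂, ∀ y ∈ Ioo 0 R, |φ' τ y| ≤ B) : ip (φ' t) w = 0 := by
  obtain ⟨W, hW, hWb⟩ := hw.exists_bounds hQ hg hY
  set τ : ℕ → ℝ := fun n => t + (t₂ - t) / (n + 1) with hτ
  have hpos : ∀ n : ℕ, 0 < (t₂ - t) / (n + 1) := fun n => by
    have : 0 < t₂ - t := by linarith
    positivity
  have hτm : ∀ n, τ n ∈ Icc t t₂ := fun n => by
    refine ⟨by simp only [hτ]; linarith [hpos n], ?_⟩
    have : (t₂ - t) / ((n : ℝ) + 1) ≤ t₂ - t := div_le_self (by linarith) (by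
      have := n.cast_nonneg (α := ℝ); linarith)
    simp only [hτ]; linarith
  have hτne : ∀ n, τ n ≠ t := fun n => by simp only [hτ]; linarith [hpos n]
  have hτt : Tendsto τ atTop (𝓝[Icc t t₂ \ {t}] t) := by
    refine tendsto_nhdsWithin_iff.2 ⟨?_, Eventually.of_forall fun n => ⟨hτm n, hτne n⟩⟩
    have := (tendsto_one_div_add_atTop_nhds_zero_nat (𝕜 := ℝ)).const_mul (t₂ - t)
    have := this.const_add t
    simp only [mul_zero, add_zero] at this
    refine this.congr fun n => ?_
    simp only [hτ]; ring
  have htm : t ∈ Icc t t₂ := ⟨le_rfl, ht.le⟩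
  have hq0 : ∀ n, ip (fun y => slope (fun σ => φ σ y) t (τ n)) w = 0 := fun n => by
    have e : (fun y => slope (fun σ => φ σ y) t (τ n)) =
        fun y => (τ n - t)⁻¹ * (φ (τ n) y + (-1) * φ t y) := by
      funext y
      rw [slope_def_field]; ring
    rw [e, ip_const_mul, hw.ip_add hQ hg hY hYR (hφ _ (hτm n)) ((hφ _ htm).const_mul _),
      ip_const_mul, h0 _ (hτm n), h0 _ htm]
    simp
  have hslope : ∀ n, ∀ y ∈ Ioo 0 R, |slope (fun σ => φ σ y) t (τ n)| ≤ B := fun n y hy => by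
    have := (convex_Icc t t₂).norm_image_sub_le_of_norm_hasDerivWithin_le
      (fun σ hσ => hd σ hσ y hy) (fun σ hσ => hB σ hσ y hy) htm (hτm n)
    have h1 : 0 < |τ n - t| := abs_pos.2 (sub_ne_zero.2 (hτne n))
    rw [slope_def_field, abs_div, div_le_iff₀ h1]
    exact this
  have key := tendsto_integral_of_dominated_convergence (μ := volume.restrict (Ioo 0 Y))
    (F := fun n y => slope (fun σ => φ σ y) t (τ n) * w y * y) (f := fun y => φ' t y * w y * y)
    (fun _ => B * (W * Y) * Y) (fun n => ?_) (integrable_const _) (fun n => ?_) ?_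
  · have h1 : ∀ n, ∫ y in Ioo 0 Y, slope (fun σ => φ σ y) t (τ n) * w y * y = 0 := fun n => by
      rw [← hw.ip_eq_Ioo (fun y => slope (fun σ => φ σ y) t (τ n)), hq0]
    simp only [h1] at key
    rw [hw.ip_eq_Ioo]
    exact (tendsto_nhds_unique key tendsto_const_nhds)
  · refine ContinuousOn.aestronglyMeasurable ?_ measurableSet_Ioo
    have hsub : Ioo 0 Y ⊆ Ioo 0 R := Ioo_subset_Ioo le_rfl hYR.le
    refine (ContinuousOn.mul ?_ (hw.smooth.continuousOn.mono fun y hy => hy.1)).mul continuousOn_id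
    have : ContinuousOn (fun y => (φ (τ n) y - φ t y) / (τ n - t)) (Ioo 0 Y) :=
      (((hφ _ (hτm n)).continuousOn.mono hsub).sub ((hφ _ htm).continuousOn.mono hsub)).div_const _
    exact this.congr fun y _ => slope_def_field _ _ _
  · refine (ae_restrict_iff' measurableSet_Ioo).2 (Eventually.of_forall fun y hy => ?_)
    have h1 := hslope n y ⟨hy.1, hy.2.trans hYR⟩
    have h2 := (hWb y hy.1).1.trans (show W * y ≤ W * Y by have := hy.2.le; gcongr)
    have h3 := hy.2.le
    have hB0 := (abs_nonneg _).trans h1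
    rw [Real.norm_eq_abs, abs_mul, abs_mul, abs_of_pos hy.1]
    have := hy.1
    gcongr
  · refine (ae_restrict_iff' measurableSet_Ioo).2 (Eventually.of_forall fun y hy => ?_)
    exact ((((hasDerivWithinAt_iff_tendsto_slope).1 (hd t htm y ⟨hy.1, hy.2.trans hYR⟩)).comp
      hτt).mul_const _).mul_const _

theorem hasDerivWithinAt_Sloc (hQ : IsGroundState g Q) (hg : IsTarget g) (hc : Coef (cb Q χ))
    {L n : ℕ} (hn : n ≤ L) {s : Set ℝ} {β : ℝ → ℕ → ℝ} {d : ℕ → ℝ} {t : ℝ} (ht : t ∈ s)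
    (hd : ∀ j, 1 ≤ j → j ≤ L → HasDerivWithinAt (fun τ => β τ j) (d j) s t)
    (h0 : ∀ τ ∈ s, β τ (L + 1) = 0) (hb : β t 1 ∈ Ioo (0 : ℝ) (1 / 16)) {y : ℝ} (hy : 0 < y) :
    HasDerivWithinAt (fun τ => Sloc g Q χ L (n + 2) (β τ) y)
      (∑ j ∈ Finset.range L, d (j + 1) * dparam (Sloc g Q χ L (n + 2)) (j + 1) (β t) y) s t := by
  -- The last profile formally depends on `b_{L+1}`, which vanishes along the path; its velocity is
  -- set to `0`.
  have h := (((prof_Sloc hQ hg hc L (n + 2)).mono (q' := L + 1) (by omega)).dparam_spec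
    (by omega)).2 s β (fun j => if j ≤ L then d j else 0) t ht (fun j h1 h2 => ?_) hb y hy
  · refine h.congr_deriv ?_
    rw [sum_Icc_one_eq, Finset.sum_range_succ, if_neg (by omega), zero_mul, add_zero]
    refine Finset.sum_congr rfl fun j hj => ?_
    rw [Finset.mem_range] at hj
    rw [if_pos (by omega)]
  · by_cases hj : j ≤ L
    · simp only [hj, if_true]
      exact hd j h1 hj
    · simp only [hj, if_false]
      rw [show j = L + 1 by omega]
      exact (hasDerivWithinAt_const t s (0 : ℝ)).congr h0 (h0 t ht)

theorem hasDerivWithinAt_corr (hQ : IsGroundState g Q) (hg : IsTarget g) (hc : Coef (cb Q χ))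
    {L : ℕ} {s : Set ℝ} {β : ℝ → ℕ → ℝ} {d : ℕ → ℝ} {t : ℝ} (ht : t ∈ s)
    (hd : ∀ j, 1 ≤ j → j ≤ L → HasDerivWithinAt (fun τ => β τ j) (d j) s t)
    (h0 : ∀ τ ∈ s, β τ (L + 1) = 0) (hb : β t 1 ∈ Ioo (0 : ℝ) (1 / 16)) {y : ℝ} (hy : 0 < y) :
    HasDerivWithinAt (fun τ => corr g Q χ L (β τ) y)
      (∑ j ∈ Finset.range L, d (j + 1) * tang g Q χ L (j + 1) (β t) y) s t := by
  have h1 : HasDerivWithinAt (fun τ => ∑ k ∈ Finset.range L, β τ (k + 1) * Tprof Q (k + 1) y)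
      (∑ k ∈ Finset.range L, d (k + 1) * Tprof Q (k + 1) y) s t :=
    HasDerivWithinAt.fun_sum fun k hk => (hd (k + 1) (by omega)
      (by rw [Finset.mem_range] at hk; omega)).mul_const _
  have h2 : HasDerivWithinAt (fun τ => ∑ n ∈ Finset.range (L + 1), Sloc g Q χ L (n + 2) (β τ) y)
      (∑ n ∈ Finset.range (L + 1), ∑ j ∈ Finset.range L,
        d (j + 1) * dparam (Sloc g Q χ L (n + 2)) (j + 1) (β t) y) s t :=
    HasDerivWithinAt.fun_sum fun n hn => hasDerivWithinAt_Sloc hQ hg hc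
      (by rw [Finset.mem_range] at hn; omega) ht hd h0 hb hy
  refine (h1.add h2).congr_deriv ?_
  rw [Finset.sum_comm, ← Finset.sum_add_distrib]
  refine Finset.sum_congr rfl fun j _ => ?_
  rw [tang, mul_add, Finset.mul_sum]

/-- For `b₁ < 1/16` one has `|log b₁| ≥ 1`, hence `B₀/4 ≤ B₁`, and the outer cut-off equals `1` on
the region considered. -/
theorem Qtilde_eq (hχ : IsCutoff χ) (L : ℕ) {b : ℕ → ℝ} (hb : b 1 ∈ Ioo (0 : ℝ) (1 / 16)) {y : ℝ}
    (hy : y ∈ Ioo 0 (B0 (b 1) / 4)) : Qtilde g Q χ L b y = Q y + corr g Q χ L b y := by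
  have hs := Real.sqrt_pos.2 hb.1
  have hlog : 1 ≤ |Real.log (b 1)| := by
    have h1 : b 1 ≤ Real.exp (-1) := by
      have := Real.exp_neg_one_gt_d9
      linarith [hb.2]
    have h2 : Real.log (b 1) ≤ -1 := (Real.log_le_iff_le_exp hb.1).2 h1
    rw [abs_of_neg (by linarith)]; linarith
  have hB : y / B1 (b 1) ≤ 1 := by
    have h1 : B0 (b 1) / 4 ≤ B1 (b 1) := by
      rw [B0, B1]
      have : 1 / Real.sqrt (b 1) ≤ |Real.log (b 1)| / Real.sqrt (b 1) := by gcongr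
      have h0 : 0 < 1 / Real.sqrt (b 1) := by positivity
      linarith
    exact div_le_one_of_le₀ (hy.2.le.trans h1) ((hy.1.trans hy.2).le.trans h1)
  have hcut : cut χ (B1 (b 1)) y = 1 := hχ.one _ hB
  rw [Qtilde, corr, sum_Icc_one_eq, sum_Icc_two_eq _ (L + 1)]
  simp only [hcut, one_mul]
  rw [add_assoc]
  congr 2
  exact Finset.sum_congr rfl fun n _ => Sprof_eq_Sloc hχ L (n + 2) b hb.1 hy

/-! ### Joint space-time derivative of the flow -/

section Flow
variable {T : ℝ} {u : ℝ → ℝ → ℝ}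

theorem IsFlow.contDiff (hu : IsFlow g T u) {t : ℝ} (ht : t ∈ Ico 0 T) : ContDiff ℝ ∞ (u t) := by
  rw [← contDiffOn_univ]
  exact hu.smooth.comp (f := fun r : ℝ => (t, r)) (contDiff_prodMk_right t).contDiffOn
    fun r _ => ⟨ht, mem_univ _⟩

theorem uniqueDiffOn_flow (T : ℝ) : UniqueDiffOn ℝ (Ico 0 T ×ˢ (univ : Set ℝ)) :=
  (uniqueDiffOn_Ico 0 T).prod uniqueDiffOn_univ

theorem IsFlow.hasFDerivWithinAt (hu : IsFlow g T u) {t : ℝ} (ht : t ∈ Ico 0 T) (r : ℝ) :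
    HasFDerivWithinAt (fun p : ℝ × ℝ => u p.1 p.2)
      (fderivWithin ℝ (fun p : ℝ × ℝ => u p.1 p.2) (Ico 0 T ×ˢ univ) (t, r))
      (Ico 0 T ×ˢ univ) (t, r) :=
  ((hu.smooth.differentiableOn (by simp)) (t, r) ⟨ht, mem_univ _⟩).hasFDerivWithinAt

theorem IsFlow.fderivWithin_apply (hu : IsFlow g T u) {t : ℝ} (ht : t ∈ Ico 0 T) (r a c : ℝ) :
    fderivWithin ℝ (fun p : ℝ × ℝ => u p.1 p.2) (Ico 0 T ×ˢ univ) (t, r) (a, c) =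
      a * derivWithin (fun τ => u τ r) (Ico 0 T) t + c * deriv (u t) r := by
  have hD := hu.hasFDerivWithinAt ht r
  set D := fderivWithin ℝ (fun p : ℝ × ℝ => u p.1 p.2) (Ico 0 T ×ˢ univ) (t, r) with hDdef
  have h1 : derivWithin (fun τ => u τ r) (Ico 0 T) t = D (1, 0) := by
    have h := hD.comp_hasDerivWithinAt (f := fun τ : ℝ => (τ, r)) (s := Ico 0 T) t
      ((hasDerivWithinAt_id t _).prodMk (hasDerivWithinAt_const t _ r))
      fun τ hτ => ⟨hτ, mem_univ _⟩
    exact h.derivWithin (uniqueDiffOn_Ico 0 T t ht)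
  have h2 : deriv (u t) r = D (0, 1) := by
    have h := hD.comp_hasDerivWithinAt (f := fun x : ℝ => (t, x)) (s := univ) r
      ((hasDerivWithinAt_const r _ t).prodMk (hasDerivWithinAt_id r _))
      fun x _ => ⟨ht, mem_univ _⟩
    exact (hasDerivWithinAt_univ.1 h).deriv
  have h3 : ((a, c) : ℝ × ℝ) = a • ((1, 0) : ℝ × ℝ) + c • ((0, 1) : ℝ × ℝ) := by simp
  rw [h3, map_add, map_smul, map_smul, ← h1, ← h2, smul_eq_mul, smul_eq_mul]

end Flow

/-! ### The renormalized velocity -/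

theorem symOn_of_continuous {R : ℝ} {v : ℝ → ℝ} (hv : Continuous v) : SymOn R 0 0 v := by
  obtain ⟨C, hC⟩ := (isCompact_Icc (a := (0 : ℝ)) (b := R)).exists_bound_of_continuousOn
    hv.continuousOn
  exact ⟨hv.continuousOn, C, fun y hy => by simpa using hC y ⟨hy.1.le, hy.2.le⟩⟩

theorem nice_tang (hQ : IsGroundState g Q) (hg : IsTarget g) (hc : Coef (cb Q χ)) (L : ℕ)
    {b : ℕ → ℝ} (hb : b 1 ∈ Ioo (0 : ℝ) (1 / 16)) {j : ℕ} (hj : 1 ≤ j) :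
    Nice (tang g Q χ L j b) :=
  (nice_Tprof hQ hg hj).add (Nice.sum _ fun n _ =>
    (((prof_Sloc hQ hg hc L (n + 2)).dparam_spec (by omega)).1.1 j hj).nice hb)

/-- The time derivative of the radiation, multiplied by `λ²`, for a solution with renormalized
profile `v` and with parameters moving at the velocities `ℓ` and `d`. -/
def frameVel (g Q χ : ℝ → ℝ) (L : ℕ) (v : ℝ → ℝ) (ℓ : ℝ) (b d : ℕ → ℝ) (y : ℝ) : ℝ :=
  lap v y - nonlin g (v y) / y ^ 2 + ℓ * scal v y
    - ∑ j ∈ Finset.range L, d (j + 1) * tang g Q χ L (j + 1) b y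

theorem continuousOn_frameVel (hQ : IsGroundState g Q) (hg : IsTarget g) (hc : Coef (cb Q χ))
    (L : ℕ) {b : ℕ → ℝ} (hb : b 1 ∈ Ioo (0 : ℝ) (1 / 16)) {v : ℝ → ℝ} (hv : ContDiff ℝ ∞ v)
    (ℓ : ℝ) (d : ℕ → ℝ) : ContinuousOn (frameVel g Q χ L v ℓ b d) (Ioi 0) := by
  have h1 := (contDiff_infty_iff_deriv.1 hv).2
  have h2 := (contDiff_infty_iff_deriv.1 h1).2
  have hne : ∀ y ∈ Ioi (0 : ℝ), y ≠ 0 := fun y hy => (show (0 : ℝ) < y from hy).ne'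
  have hne2 : ∀ y ∈ Ioi (0 : ℝ), y ^ 2 ≠ 0 := fun y hy => pow_ne_zero 2 (hne y hy)
  have c1 : ContinuousOn (lap v) (Ioi 0) :=
    h2.continuous.continuousOn.add (h1.continuous.continuousOn.div continuousOn_id hne)
  have c2 : ContinuousOn (fun y => nonlin g (v y) / y ^ 2) (Ioi 0) :=
    (hg.smooth_nonlin.continuous.comp hv.continuous).continuousOn.div (by fun_prop) hne2
  have c3 : ContinuousOn (fun y => ℓ * scal v y) (Ioi 0) :=
    ((contDiff_scal hv).continuous.const_smul ℓ).continuousOn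
  exact ((c1.sub c2).add c3).sub (continuousOn_finsetSum _ fun j _ =>
    continuousOn_const.mul (nice_tang hQ hg hc L hb (by omega)).continuousOn)

section Modulated
variable {L : ℕ} {M T A R : ℝ} {u : ℝ → ℝ → ℝ} {lam : ℝ → ℝ} {b : ℝ → ℕ → ℝ}

theorem eps_eq (hχ : IsCutoff χ) (u : ℝ → ℝ → ℝ) (lam : ℝ → ℝ) {t : ℝ}
    (hb : b t 1 ∈ Ioo (0 : ℝ) (1 / 16)) {y : ℝ} (hy : y ∈ Ioo 0 (B0 (b t 1) / 4)) :
    eps g Q χ L u lam b t y = u t (lam t * y) - (Q y + corr g Q χ L (b t) y) := by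
  rw [eps, Qtilde_eq hχ L hb hy]

theorem symOn_eps (hQ : IsGroundState g Q) (hg : IsTarget g) (hχ : IsCutoff χ)
    (hu : IsFlow g T u) (lam : ℝ → ℝ) {t : ℝ} (ht : t ∈ Ico 0 T)
    (hb : b t 1 ∈ Ioo (0 : ℝ) (1 / 16)) (hR : R ≤ B0 (b t 1) / 4) :
    SymOn R 0 0 (eps g Q χ L u lam b t) := by
  have h1 : SymOn R 0 0 fun y => u t (lam t * y) :=
    symOn_of_continuous ((hu.contDiff ht).continuous.comp (by fun_prop))
  have h2 : SymOn R 0 0 Q := symOn_comp hQ hg R 0 contDiff_id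
  have h3 : SymOn R 0 0 (corr g Q χ L (b t)) :=
    (nice_corr hQ hg (coef_cb hQ hg hχ) L hb R 0).weaken (by norm_num)
  exact (h1.sub (h2.add h3)).congr fun y hy => (eps_eq hχ u lam hb ⟨hy.1, hy.2.trans_le hR⟩).symm

theorem contDiffOn_eps (hQ : IsGroundState g Q) (hg : IsTarget g) (hχ : IsCutoff χ)
    (hu : IsFlow g T u) (lam : ℝ → ℝ) {t : ℝ} (ht : t ∈ Ico 0 T)
    (hb : b t 1 ∈ Ioo (0 : ℝ) (1 / 16)) (hR : R ≤ B0 (b t 1) / 4) :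
    ContDiffOn ℝ ∞ (eps g Q χ L u lam b t) (Ioo 0 R) := by
  have h1 : ContDiffOn ℝ ∞ (fun y => u t (lam t * y)) (Ioo 0 R) :=
    ((hu.contDiff ht).comp (contDiff_const.mul contDiff_id)).contDiffOn
  have h2 : ContDiffOn ℝ ∞ Q (Ioo 0 R) :=
    (hQ.contDiffOn_comp hg contDiff_id).mono fun y hy => hy.1
  exact (h1.sub (h2.add ((nice_corr hQ hg (coef_cb hQ hg hχ) L hb).contDiffOn R))).congr
    fun y hy => eps_eq hχ u lam hb ⟨hy.1, hy.2.trans_le hR⟩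

theorem frameVel_eq (hu : IsFlow g T u) {t : ℝ} (ht : t ∈ Ico 0 T) (hlam : 0 < lam t) {y : ℝ}
    (hy : 0 < y) : frameVel g Q χ L (fun x => u t (lam t * x)) (sderiv T lam lam t / lam t) (b t)
      (fun j => sderiv T lam (fun τ => b τ j) t) y =
    lam t ^ 2 * (fderivWithin ℝ (fun p : ℝ × ℝ => u p.1 p.2) (Ico 0 T ×ˢ univ) (t, lam t * y)
        (1, derivWithin lam (Ico 0 T) t * y)
      - ∑ j ∈ Finset.range L, derivWithin (fun τ => b τ (j + 1)) (Ico 0 T) t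
        * tang g Q χ L (j + 1) (b t) y) := by
  have d1 : deriv (fun x => u t (lam t * x)) = fun x => lam t * deriv (u t) (lam t * x) := by
    funext x
    rw [deriv_comp_mul_left, smul_eq_mul]
  have d2 : deriv (deriv fun x => u t (lam t * x)) y =
      lam t * (lam t * deriv (deriv (u t)) (lam t * y)) := by
    rw [d1, deriv_const_mul_field, deriv_comp_mul_left, smul_eq_mul]
  have hfl := hu.flow t ht (lam t * y) (by positivity)
  have hs : ∑ j ∈ Finset.range L, sderiv T lam (fun τ => b τ (j + 1)) t
      * tang g Q χ L (j + 1) (b t) y = lam t ^ 2 * ∑ j ∈ Finset.range L,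
        derivWithin (fun τ => b τ (j + 1)) (Ico 0 T) t * tang g Q χ L (j + 1) (b t) y := by
    rw [Finset.mul_sum]
    exact Finset.sum_congr rfl fun j _ => by rw [sderiv]; ring
  rw [frameVel, hs, hu.fderivWithin_apply ht, lap, d2, scal, d1, sderiv]
  have e : derivWithin (fun τ => u τ (lam t * y)) (Ico 0 T) t =
      deriv (deriv (u t)) (lam t * y) + deriv (u t) (lam t * y) / (lam t * y)
        - nonlin g (u t (lam t * y)) / (lam t * y) ^ 2 := by linarith
  rw [e]
  field_simp

/-- For fixed `y` the time derivative of `ε`, multiplied by `λ²`, is `frameVel`, by the chain rule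
and the flow equation. The test functions do not depend on time, so differentiating the
orthogonality conditions gives the vanishing of the pairings. -/
theorem ip_frameVel_eq_zero (hQ : IsGroundState g Q) (hg : IsTarget g) (hχ : IsCutoff χ)
    (hu : IsFlow g T u) (hm : IsModulated g Q χ L M T u lam b) (hA : 0 ≤ A) (hM : 0 < M)
    (hMR : 2 * M < R)
    (hb : ∀ τ ∈ Ico 0 T, ParBd A L (b τ) ∧ R ≤ B0 (b τ 1) / 4) {t : ℝ} (ht : t ∈ Ico 0 T) :
    SymOn R 0 0 (frameVel g Q χ L (fun x => u t (lam t * x)) (sderiv T lam lam t / lam t) (b t)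
      fun j => sderiv T lam (fun τ => b τ j) t) ∧
    ∀ k ≤ L, ip (frameVel g Q χ L (fun x => u t (lam t * x)) (sderiv T lam lam t / lam t) (b t)
      fun j => sderiv T lam (fun τ => b τ j) t) (opHpow g Q k (PhiM g Q χ L M)) = 0 := by
  have hc := coef_cb hQ hg hχ
  obtain ⟨t₂, htt, ht2⟩ := exists_between ht.2
  have hsub : Icc t t₂ ⊆ Ico 0 T := fun τ hτ => ⟨ht.1.trans hτ.1, hτ.2.trans_lt ht2⟩
  set D := fderivWithin ℝ (fun p : ℝ × ℝ => u p.1 p.2) (Ico 0 T ×ˢ univ) with hD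
  set φ' : ℝ → ℝ → ℝ := fun τ y => D (τ, lam τ * y) (1, derivWithin lam (Ico 0 T) τ * y)
      - ∑ j ∈ Finset.range L, derivWithin (fun σ => b σ (j + 1)) (Ico 0 T) τ
        * tang g Q χ L (j + 1) (b τ) y with hφ'
  have hlamc := hm.lam_smooth.continuousOn.mono hsub
  have hlam'c := (hm.lam_smooth.continuousOn_derivWithin (uniqueDiffOn_Ico 0 T) le_rfl).mono hsub
  have hdb : ∀ j, 1 ≤ j → j ≤ L → ∀ τ ∈ Ico 0 T, HasDerivWithinAt (fun σ => b σ j)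
      (derivWithin (fun σ => b σ j) (Ico 0 T) τ) (Ico 0 T) τ := fun j h1 h2 τ hτ =>
    ((hm.b_smooth j h1 h2).differentiableOn (by simp) τ hτ).hasDerivWithinAt
  have hd : ∀ τ ∈ Icc t t₂, ∀ y ∈ Ioo 0 R, HasDerivWithinAt
      (fun σ => eps g Q χ L u lam b σ y) (φ' τ y) (Icc t t₂) τ := by
    intro τ hτ y hy
    have hτ' := hsub hτ
    refine HasDerivWithinAt.mono ?_ hsub
    have e1 := (hu.hasFDerivWithinAt hτ' (lam τ * y)).comp_hasDerivWithinAt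
      (f := fun σ : ℝ => (σ, lam σ * y)) τ ((hasDerivWithinAt_id τ _).prodMk
        ((hm.lam_smooth.differentiableOn (by simp) τ hτ').hasDerivWithinAt.mul_const y))
      fun σ hσ => ⟨hσ, mem_univ _⟩
    have e2 := hasDerivWithinAt_corr hQ hg hc (β := b) hτ' (fun j h1 h2 => hdb j h1 h2 τ hτ')
      (fun σ hσ => (hb σ hσ).1.2.1) (hb τ hτ').1.1 hy.1
    refine (e1.sub (e2.const_add (Q y))).congr (fun σ hσ => ?_) ?_
    · exact eps_eq hχ u lam (hb σ hσ).1.1 ⟨hy.1, hy.2.trans_le (hb σ hσ).2⟩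
    · exact eps_eq hχ u lam (hb τ hτ').1.1 ⟨hy.1, hy.2.trans_le (hb τ hτ').2⟩
  -- Uniformity up to the origin comes from this form of the velocity: the total derivative of `u`
  -- is continuous on the compact set `[t, t₂] × [0, R]`, whereas the terms of the flow equation are
  -- separately singular at `y = 0`.
  obtain ⟨B, hB⟩ : ∃ B, ∀ τ ∈ Icc t t₂, ∀ y ∈ Ioo 0 R, |φ' τ y| ≤ B := by
    have hcomp : IsCompact (Icc t t₂ ×ˢ Icc 0 R) := isCompact_Icc.prod isCompact_Icc
    have hDc : ContinuousOn (fun p : ℝ × ℝ => D (p.1, lam p.1 * p.2)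
        (1, derivWithin lam (Ico 0 T) p.1 * p.2)) (Icc t t₂ ×ˢ Icc 0 R) := by
      have c1 : ContinuousOn (fun p : ℝ × ℝ => lam p.1) (Icc t t₂ ×ˢ Icc 0 R) :=
        hlamc.comp continuousOn_fst fun p hp => hp.1
      have c2 : ContinuousOn (fun p : ℝ × ℝ => derivWithin lam (Ico 0 T) p.1)
          (Icc t t₂ ×ˢ Icc 0 R) := hlam'c.comp continuousOn_fst fun p hp => hp.1
      refine ContinuousOn.clm_apply ?_ (continuousOn_const.prodMk (c2.mul continuousOn_snd))
      exact (hu.smooth.continuousOn_fderivWithin (uniqueDiffOn_flow T) (by simp)).comp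
        (continuousOn_fst.prodMk (c1.mul continuousOn_snd)) fun p hp => ⟨hsub hp.1, mem_univ _⟩
    obtain ⟨B₁, hB₁⟩ := hcomp.exists_bound_of_continuousOn hDc
    have hj : ∀ j ∈ Finset.range L, ∃ E, ∀ τ ∈ Icc t t₂, ∀ y ∈ Ioo 0 R,
        |derivWithin (fun σ => b σ (j + 1)) (Ico 0 T) τ * tang g Q χ L (j + 1) (b τ) y| ≤ E := by
      intro j hj
      rw [Finset.mem_range] at hj
      obtain ⟨E, hE⟩ := (isCompact_Icc (a := t) (b := t₂)).exists_bound_of_continuousOn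
        (((hm.b_smooth (j + 1) (by omega) (by omega)).continuousOn_derivWithin
          (uniqueDiffOn_Ico 0 T) le_rfl).mono hsub)
      obtain ⟨C, hC, hCb⟩ := profBd_tang hQ hg hc L hA R (j := j + 1) (by omega)
      obtain ⟨F, hF, hFb⟩ := exists_bdd_Tprof hQ hg (j + 1) R
      refine ⟨E * (F + C * R ^ 2), fun τ hτ y hy => ?_⟩
      have hbτ := (hb τ (hsub hτ)).1
      have h1 := hCb (b τ) hbτ y hy
      have h2 := (hFb y hy).1
      have h3 : C * b τ 1 ^ 1 * y ^ 2 ≤ C * R ^ 2 := by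
        have := hbτ.1.2.le
        have hb1 : b τ 1 ≤ 1 := by linarith
        have := hbτ.1.1.le
        have := hy.1.le
        have := hy.2.le
        rw [pow_one]
        calc C * b τ 1 * y ^ 2 ≤ C * 1 * R ^ 2 := by gcongr
          _ = _ := by ring
      have h4 : |tang g Q χ L (j + 1) (b τ) y| ≤ F + C * R ^ 2 := by
        have := abs_add_le (Tprof Q (j + 1) y)
          (tang g Q χ L (j + 1) (b τ) y - Tprof Q (j + 1) y)
        rw [add_sub_cancel] at this
        linarith
      rw [abs_mul]
      have h5 := hE τ hτ
      rw [Real.norm_eq_abs] at h5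
      have h6 := (abs_nonneg _).trans h5
      gcongr
    choose! E hE using hj
    refine ⟨B₁ + ∑ j ∈ Finset.range L, E j, fun τ hτ y hy => ?_⟩
    refine (abs_sub _ _).trans (add_le_add (hB₁ (τ, y) ⟨hτ, hy.1.le, hy.2.le⟩)
      ((Finset.abs_sum_le_sum_abs _ _).trans (Finset.sum_le_sum fun j hj => hE j hj τ hτ y hy)))
  have htm : t ∈ Icc t t₂ := ⟨le_rfl, htt.le⟩
  have heq : ∀ y ∈ Ioo 0 R, frameVel g Q χ L (fun x => u t (lam t * x))
      (sderiv T lam lam t / lam t) (b t) (fun j => sderiv T lam (fun τ => b τ j) t) y =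
      lam t ^ 2 * φ' t y := fun y hy => frameVel_eq hu ht (hm.lam_pos t ht) hy.1
  refine ⟨⟨?_, lam t ^ 2 * B, fun y hy => ?_⟩, fun k hk => ?_⟩
  · exact (continuousOn_frameVel hQ hg hc L (hb t ht).1.1 ((hu.contDiff ht).comp
      (contDiff_const.mul contDiff_id)) _ _).mono fun y hy => hy.1
  · rw [heq y hy, abs_mul, abs_of_nonneg (sq_nonneg _), zpow_zero, mul_one]
    exact mul_le_mul_of_nonneg_left (hB t htm y hy) (sq_nonneg _)
  · have hw := (isTest_PhiM hQ hg hχ L hM).opHpow hQ hg (by positivity) k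
    have h0 := hw.ip_deriv_eq_zero hQ hg (by positivity) hMR htt
      (fun τ hτ => symOn_eps hQ hg hχ hu lam (hsub hτ) (hb τ (hsub hτ)).1.1 (hb τ (hsub hτ)).2)
      (fun τ hτ => hm.ortho τ (hsub hτ) k hk) hd hB
    have h1 : ip (fun y => lam t ^ 2 * φ' t y) (opHpow g Q k (PhiM g Q χ L M)) = 0 := by
      rw [ip_const_mul, h0, mul_zero]
    rw [← h1, hw.ip_eq_Ioo, hw.ip_eq_Ioo]
    exact setIntegral_congr_fun measurableSet_Ioo fun y hy => by
      simp only [heq y ⟨hy.1, hy.2.trans hMR⟩]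

end Modulated

/-! ### The equation for the radiation -/

theorem lap_groundState (hQ : IsGroundState g Q) (hg : IsTarget g) {y : ℝ} (hy : 0 < y) :
    lap Q y = nonlin g (Q y) / y ^ 2 := by
  have h1 : deriv Q =ᶠ[𝓝 y] fun x => scal Q x / x := by
    filter_upwards [lt_mem_nhds hy] with x hx
    rw [scal]; field_simp
  have h2 : deriv (fun x => scal Q x / x) y = _ :=
    ((hQ.hasDerivAt_scal hg hy).div (hasDerivAt_id y) hy.ne').deriv
  rw [lap, h1.deriv_eq, h1.self_of_nhds, h2]
  simp only [id]
  field_simp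
  ring

/-- Mean value inequality for `z ↦ f(x + a + z) - f'(x) z`, whose derivative is `O(|a| + |z|)`. The
linearization stays at the ground state, so the correction `a` appears in the error. -/
theorem exists_nonlin_bound (hg : IsTarget g) (A : ℝ) : ∃ C ≥ 0, ∀ x ∈ Icc 0 Real.pi, ∀ a e : ℝ,
    |a| + |e| ≤ A → |nonlin g (x + a + e) - nonlin g (x + a) - deriv (nonlin g) x * e|
      ≤ C * (|a| + |e|) * |e| := by
  obtain ⟨C, hC, hb⟩ := exists_taylor_bound A 1 (deriv (nonlin g)) hg.smooth_deriv_nonlin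
  refine ⟨C, hC, fun x hx a e hae => ?_⟩
  have hd : ∀ z, HasDerivAt (fun z => nonlin g (x + a + z) - deriv (nonlin g) x * z)
      (deriv (nonlin g) (x + (a + z)) - deriv (nonlin g) x) z := fun z => by
    have h1 := ((hg.smooth_nonlin.differentiable (by simp)) (x + a + z)).hasDerivAt.comp_const_add
      (x + a) z
    rw [← add_assoc]
    exact (h1.sub ((hasDerivAt_id z).const_mul (deriv (nonlin g) x))).congr_deriv (by ring)
  have key := (convex_Icc (-|e|) |e|).norm_image_sub_le_of_norm_hasDerivWithin_le
      (C := C * (|a| + |e|)) (fun z _ => (hd z).hasDerivWithinAt) (fun z hz => ?_)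
      (x := 0) (y := e) ⟨by simp, by simp⟩ ⟨neg_abs_le e, le_abs_self e⟩
  · simp only [add_zero, mul_zero, sub_zero, Real.norm_eq_abs] at key
    rw [show nonlin g (x + a + e) - nonlin g (x + a) - deriv (nonlin g) x * e =
      nonlin g (x + a + e) - deriv (nonlin g) x * e - nonlin g (x + a) by ring]
    exact key
  · have hz' : |z| ≤ |e| := abs_le.2 hz
    have h2 : |a + z| ≤ |a| + |e| := (abs_add_le a z).trans (by linarith)
    have h3 := hb x hx (a + z) (h2.trans hae)
    simp only [Finset.range_one, Finset.sum_singleton, iteratedDeriv_zero, Nat.factorial_zero,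
      Nat.cast_one, div_one, pow_zero, mul_one, pow_one] at h3
    exact h3.trans (by gcongr)

/-- The part of the velocity of the radiation which is of higher order. -/
def velRem (g Q χ : ℝ → ℝ) (L : ℕ) (e : ℝ → ℝ) (ℓ : ℝ) (b d : ℕ → ℝ) (y : ℝ) : ℝ :=
  ℓ * scal e y + (ℓ + b 1) * scal (corr g Q χ L b) y
    - ∑ j ∈ Finset.range L, (d (j + 1) + rate Q χ (j + 1) b)
      * (tang g Q χ L (j + 1) b y - Tprof Q (j + 1) y)
    + profErr g Q χ L b y
    - (nonlin g (Q y + corr g Q χ L b y + e y) - nonlin g (Q y + corr g Q χ L b y)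
        - deriv (nonlin g) (Q y) * e y) / y ^ 2

/-- The equation for the radiation: insert `v = Q + α + e`, use that `Q` is stationary, and replace
the velocities by defects minus the approximate rates. The rates combine into `profErr`, the defects
multiply the `T_k`, and what is left is of higher order. -/
theorem velRem_eq (hQ : IsGroundState g Q) (hg : IsTarget g) (hc : Coef (cb Q χ)) (L : ℕ)
    {b : ℕ → ℝ} (hb : b 1 ∈ Ioo (0 : ℝ) (1 / 16)) {R : ℝ} {v e : ℝ → ℝ}
    (he : ContDiffOn ℝ ∞ e (Ioo 0 R))
    (hv : EqOn v (fun y => Q y + corr g Q χ L b y + e y) (Ioo 0 R)) (ℓ : ℝ) (d : ℕ → ℝ) {y : ℝ}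
    (hy : y ∈ Ioo 0 R) :
    velRem g Q χ L e ℓ b d y = frameVel g Q χ L v ℓ b d y + opH g Q e y
      + (-(ℓ + b 1) * Tprof Q 0 y + ∑ j ∈ Finset.range L,
        (d (j + 1) + rate Q χ (j + 1) b) * Tprof Q (j + 1) y) := by
  have hαs := (nice_corr hQ hg hc L hb).contDiffOn R
  have hQs : ContDiffOn ℝ ∞ Q (Ioo 0 R) :=
    (hQ.contDiffOn_comp hg contDiff_id).mono fun y hy => hy.1
  have h2 : (2 : WithTop ℕ∞) ≤ ∞ := by norm_cast
  have dd : ∀ {F : ℝ → ℝ}, ContDiffOn ℝ ∞ F (Ioo 0 R) → DifferentiableAt ℝ F y := fun hF =>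
    (hF.differentiableOn (by simp)).differentiableAt (isOpen_Ioo.mem_nhds hy)
  have hH : opH g Q v y = opH g Q Q y + opH g Q (corr g Q χ L b) y + opH g Q e y := by
    rw [opH_congr isOpen_Ioo hv hy,
      opH_add isOpen_Ioo ((hQs.add hαs).of_le h2) (he.of_le h2) hy,
      opH_add isOpen_Ioo (hQs.of_le h2) (hαs.of_le h2) hy]
  have hs : scal v y = scal Q y + scal (corr g Q χ L b) y + scal e y := by
    rw [scal_congr isOpen_Ioo hv hy, scal_add (dd (hQs.add hαs)) (dd he),
      scal_add (dd hQs) (dd hαs)]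
  have hlv : lap v y = nonlin g (Q y) / y ^ 2 - opH g Q (corr g Q χ L b) y - opH g Q e y
      + deriv (nonlin g) (Q y) / y ^ 2 * (corr g Q χ L b y + e y) := by
    have e1 : opH g Q v y = -lap v y + deriv (nonlin g) (Q y) / y ^ 2 * v y := rfl
    have e2 : opH g Q Q y = -lap Q y + deriv (nonlin g) (Q y) / y ^ 2 * Q y := rfl
    rw [lap_groundState hQ hg hy.1] at e2
    have e3 := hv hy
    simp only at e3
    rw [e3] at e1
    linarith
  have hsum : ∑ j ∈ Finset.range L, (d (j + 1) + rate Q χ (j + 1) b)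
      * (tang g Q χ L (j + 1) b y - Tprof Q (j + 1) y) =
      ∑ j ∈ Finset.range L, d (j + 1) * tang g Q χ L (j + 1) b y
      + ∑ j ∈ Finset.range L, rate Q χ (j + 1) b * tang g Q χ L (j + 1) b y
      - ∑ j ∈ Finset.range L, (d (j + 1) + rate Q χ (j + 1) b) * Tprof Q (j + 1) y := by
    rw [← Finset.sum_add_distrib, ← Finset.sum_sub_distrib]
    exact Finset.sum_congr rfl fun j _ => by ring
  have e3 := hv hy
  simp only at e3
  rw [velRem, frameVel, profErr, hlv, hs, e3, hsum, Tprof_zero]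
  ring

/-- The modulation defects: `ℓ + b₁` and `d_k + (2k - 1 + c_{b₁}) b₁ b_k - b_{k+1}`. -/
def defect (Q χ : ℝ → ℝ) (ℓ : ℝ) (b d : ℕ → ℝ) (k : ℕ) : ℝ :=
  if k = 0 then ℓ + b 1 else d k + rate Q χ k b

/-- Every term carries an extra factor `b₁`, using `E = O(b₁^{L+1})` and `|ℓ| ≤ S + b₁`, where `S`
is the sum of the defects. The weight `y²` removes the singular factor of the nonlinear term; it is
supplied by a test function of size `O(y)` and the measure `y dy`. -/
theorem exists_velRem_bound (hQ : IsGroundState g Q) (hg : IsTarget g) (hc : Coef (cb Q χ)) {L : ℕ}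
    (hL : 1 ≤ L) {A : ℝ} (hA : 0 ≤ A) {R : ℝ} (hR : 0 < R) {C₁ κ : ℝ} (hC₁ : 0 ≤ C₁) (hκ : 0 ≤ κ) :
    ∃ C ≥ 0, ∀ (b d : ℕ → ℝ) (ℓ E : ℝ) (e : ℝ → ℝ), ParBd A L b → 0 ≤ E → E ≤ κ * b 1 ^ (L + 1) →
      (∀ y ∈ Ioo 0 R, |e y| ≤ C₁ * E ∧ |scal e y| ≤ C₁ * E) → ∀ y ∈ Ioo 0 R,
      |velRem g Q χ L e ℓ b d y| * y ^ 2 ≤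
        C * (b 1 * ∑ k ∈ Finset.range (L + 1), |defect Q χ ℓ b d k| + b 1 ^ (L + 2)) := by
  obtain ⟨a₁, ha₁, h₁⟩ := profBd_corr hQ hg hc L hA R
  obtain ⟨a₂, ha₂, h₂⟩ := profBd_scal_corr hQ hg hc L hA R
  obtain ⟨a₃, ha₃, h₃⟩ := profBd_profErr hQ hg hc L hA R
  have ht : ∀ j : ℕ, ∃ a ≥ 0, ∀ b, ParBd A L b → ∀ y ∈ Ioo 0 R,
      |tang g Q χ L (j + 1) b y - Tprof Q (j + 1) y| ≤ a * b 1 ^ 1 * y ^ 2 :=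
    fun j => profBd_tang hQ hg hc L hA R (by omega)
  choose a₄ ha₄ h₄ using ht
  obtain ⟨a₅, ha₅, h₅⟩ := exists_nonlin_bound hg (a₁ * R ^ 2 + C₁ * κ)
  set a₆ := ∑ j ∈ Finset.range L, a₄ j with ha₆
  have ha₆0 : 0 ≤ a₆ := Finset.sum_nonneg fun j _ => ha₄ j
  refine ⟨(C₁ * κ * R ^ 2 + a₂ * R ^ 4 + a₆ * R ^ 4) + (C₁ * κ * R ^ 2 + a₃ * R ^ 4
    + a₅ * (a₁ * R ^ 2 + C₁ * κ) * (C₁ * κ)), by positivity, fun b d ℓ E e hb hE hEκ he y hy => ?_⟩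
  set S := ∑ k ∈ Finset.range (L + 1), |defect Q χ ℓ b d k| with hS
  set β := b 1 with hβ
  have hβ0 : 0 < β := hb.1.1
  have hβ1 : β ≤ 1 := by linarith [hb.1.2]
  have hy0 : 0 < y := hy.1
  have hyR := hy.2.le
  have hS0 : 0 ≤ S := Finset.sum_nonneg fun _ _ => abs_nonneg _
  have hk : ∀ k ∈ Finset.range (L + 1), |defect Q χ ℓ b d k| ≤ S := fun k hk =>
    Finset.single_le_sum (f := fun k => |defect Q χ ℓ b d k|) (fun _ _ => abs_nonneg _) hk
  have hD0 : |ℓ + β| ≤ S := by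
    have := hk 0 (by simp)
    rwa [defect, if_pos rfl] at this
  have hℓ : |ℓ| ≤ S + β := by
    have := abs_add_le (ℓ + β) (-β)
    rw [add_neg_cancel_right, abs_neg, abs_of_pos hβ0] at this
    linarith
  have hEβ : E ≤ κ * β := hEκ.trans (by
    gcongr
    calc β ^ (L + 1) ≤ β ^ 1 := pow_le_pow_of_le_one hβ0.le hβ1 (by omega)
      _ = β := pow_one β)
  have hEκ' : E ≤ κ := hEβ.trans (by nlinarith)
  have hβE : β * E ≤ κ * β ^ (L + 2) := by
    calc β * E ≤ β * (κ * β ^ (L + 1)) := by gcongr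
      _ = _ := by ring
  have hy2 : y ^ 2 ≤ R ^ 2 := by gcongr
  have t1 : |ℓ * scal e y| * y ^ 2 ≤ C₁ * κ * R ^ 2 * (β * S) + C₁ * κ * R ^ 2 * β ^ (L + 2) := by
    rw [abs_mul]
    calc |ℓ| * |scal e y| * y ^ 2 ≤ (S + β) * (C₁ * E) * R ^ 2 := by
          gcongr
          exact (he y hy).2
      _ = C₁ * R ^ 2 * S * E + C₁ * R ^ 2 * (β * E) := by ring
      _ ≤ C₁ * R ^ 2 * S * (κ * β) + C₁ * R ^ 2 * (κ * β ^ (L + 2)) := by gcongr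
      _ = _ := by ring
  have t2 : |(ℓ + β) * scal (corr g Q χ L b) y| * y ^ 2 ≤ a₂ * R ^ 4 * (β * S) := by
    rw [abs_mul]
    have := h₂ b hb y hy
    rw [pow_one] at this
    calc |ℓ + β| * |scal (corr g Q χ L b) y| * y ^ 2 ≤ S * (a₂ * β * y ^ 2) * y ^ 2 := by gcongr
      _ ≤ S * (a₂ * β * R ^ 2) * R ^ 2 := by gcongr
      _ = _ := by ring
  have t3 : |∑ j ∈ Finset.range L, (d (j + 1) + rate Q χ (j + 1) b)
      * (tang g Q χ L (j + 1) b y - Tprof Q (j + 1) y)| * y ^ 2 ≤ a₆ * R ^ 4 * (β * S) := by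
    have : |∑ j ∈ Finset.range L, (d (j + 1) + rate Q χ (j + 1) b)
        * (tang g Q χ L (j + 1) b y - Tprof Q (j + 1) y)| ≤ ∑ j ∈ Finset.range L,
          S * (a₄ j * β * R ^ 2) := by
      refine (Finset.abs_sum_le_sum_abs _ _).trans (Finset.sum_le_sum fun j hj => ?_)
      rw [abs_mul]
      have h6 := hk (j + 1) (by simpa using hj)
      rw [defect, if_neg (by omega)] at h6
      have h7 := h₄ j b hb y hy
      rw [pow_one] at h7
      have h8 : a₄ j * b 1 * y ^ 2 ≤ a₄ j * β * R ^ 2 := by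
        have := ha₄ j
        gcongr
      have := h7.trans h8
      gcongr
    calc _ ≤ (∑ j ∈ Finset.range L, S * (a₄ j * β * R ^ 2)) * R ^ 2 :=
          mul_le_mul this hy2 (sq_nonneg y) ((abs_nonneg _).trans this)
      _ = _ := by
        simp only [ha₆, Finset.sum_mul]
        exact Finset.sum_congr rfl fun j _ => by ring
  have t4 : |profErr g Q χ L b y| * y ^ 2 ≤ a₃ * R ^ 4 * β ^ (L + 2) := by
    have := h₃ b hb y hy
    calc |profErr g Q χ L b y| * y ^ 2 ≤ (a₃ * β ^ (L + 3) * R ^ 2) * R ^ 2 := by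
          gcongr
          exact this.trans (by gcongr)
      _ = a₃ * R ^ 4 * β ^ (L + 2) * β := by ring
      _ ≤ a₃ * R ^ 4 * β ^ (L + 2) * 1 := by gcongr
      _ = _ := by ring
  have t5 : |(nonlin g (Q y + corr g Q χ L b y + e y) - nonlin g (Q y + corr g Q χ L b y)
        - deriv (nonlin g) (Q y) * e y) / y ^ 2| * y ^ 2 ≤
      a₅ * (a₁ * R ^ 2 + C₁ * κ) * (C₁ * κ) * β ^ (L + 2) := by
    rw [abs_div, abs_of_pos (show (0 : ℝ) < y ^ 2 by positivity), div_mul_cancel₀ _ (by positivity)]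
    have hα := h₁ b hb y hy
    rw [pow_one] at hα
    have hsum : |corr g Q χ L b y| + |e y| ≤ (a₁ * R ^ 2 + C₁ * κ) * β := by
      have e1 : a₁ * b 1 * y ^ 2 ≤ a₁ * β * R ^ 2 := by gcongr
      have e2 : C₁ * E ≤ C₁ * (κ * β) := by gcongr
      linarith [(he y hy).1]
    have hQm := hQ.mem_Ioo hg hy.1
    have hsum1 : |corr g Q χ L b y| + |e y| ≤ a₁ * R ^ 2 + C₁ * κ :=
      hsum.trans (mul_le_of_le_one_right (by positivity) hβ1)
    refine (h₅ (Q y) ⟨hQm.1.le, hQm.2.le⟩ _ _ hsum1).trans ?_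
    calc a₅ * (|corr g Q χ L b y| + |e y|) * |e y|
        ≤ a₅ * ((a₁ * R ^ 2 + C₁ * κ) * β) * (C₁ * E) := by
          gcongr
          exact (he y hy).1
      _ = a₅ * (a₁ * R ^ 2 + C₁ * κ) * C₁ * (β * E) := by ring
      _ ≤ a₅ * (a₁ * R ^ 2 + C₁ * κ) * C₁ * (κ * β ^ (L + 2)) := by gcongr
      _ = _ := by ring
  have htri : ∀ x₁ x₂ x₃ x₄ x₅ : ℝ, |x₁ + x₂ - x₃ + x₄ - x₅| * y ^ 2 ≤
      |x₁| * y ^ 2 + |x₂| * y ^ 2 + |x₃| * y ^ 2 + |x₄| * y ^ 2 + |x₅| * y ^ 2 :=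
    fun x₁ x₂ x₃ x₄ x₅ => by
      rw [← add_mul, ← add_mul, ← add_mul, ← add_mul]
      refine mul_le_mul_of_nonneg_right ?_ (sq_nonneg y)
      have i1 := abs_sub (x₁ + x₂ - x₃ + x₄) x₅
      have i2 := abs_add_le (x₁ + x₂ - x₃) x₄
      have i3 := abs_sub (x₁ + x₂) x₃
      have i4 := abs_add_le x₁ x₂
      linarith
  rw [velRem]
  refine (htri _ _ _ _ _).trans ?_
  have hP : 0 ≤ β ^ (L + 2) := by positivity
  have hβS : 0 ≤ β * S := by positivity
  have n1 : 0 ≤ (C₁ * κ * R ^ 2 + a₂ * R ^ 4 + a₆ * R ^ 4) * β ^ (L + 2) := by positivity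
  have n2 : 0 ≤ (C₁ * κ * R ^ 2 + a₃ * R ^ 4 + a₅ * (a₁ * R ^ 2 + C₁ * κ) * (C₁ * κ)) * (β * S) := by
    positivity
  linarith [t1, t2, t3, t4, t5, n1, n2]

/-! ### The modulation estimates at a fixed time -/

/-- A version of Green's identity in which `HF` is only square integrable, needed for the last
transfer, where `HF = H^{L+1} ε`. -/
theorem IsTest.green_of_energy (hQ : IsGroundState g Q) (hg : IsTarget g) {Y R : ℝ} (hY : 0 < Y)
    (hYR : Y < R) {w F : ℝ → ℝ} (hw : IsTest Q Y w) (hF : ContDiffOn ℝ ∞ F (Ioo 0 R))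
    (hs : SymOn R 1 0 F)
    (hi : IntegrableOn (fun y => HeatFlow.opH g Q F y ^ 2 * y) (Ioo 0 R)) :
    ip (HeatFlow.opH g Q F) w = ip F (HeatFlow.opH g Q w) := by
  obtain ⟨A, hA, h1⟩ := hs.exists_bound
  obtain ⟨B, hB, h2⟩ := hs.2.2.exists_bound
  simp only [zpow_zero, mul_one] at h1 h2
  obtain ⟨W, hW, hWb⟩ := hw.exists_bounds hQ hg hY
  have hR : 0 < R := hY.trans hYR
  refine hw.green hQ hg hY hYR (A := max A B) (hF.of_le (by norm_cast))
    (fun y hy => (h1 y hy).trans (le_max_left _ _)) (fun y hy => (h2 y hy).trans (le_max_right _ _))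
    (hw.integrableOn_of_Ioo hYR ?_)
  have hwc : ContinuousOn w (Ioo 0 R) := hw.smooth.continuousOn.mono fun y hy => hy.1
  have hw2 : IntegrableOn (fun y => w y ^ 2 * y) (Ioo 0 R) := by
    have := (hw.integrableOn hQ hg hY hYR hwc (A := W * R) fun y hy =>
      (hWb y hy.1).1.trans (by have := hy.2.le; gcongr)).mono_set
      (show Ioo 0 R ⊆ Ioi 0 from fun y hy => hy.1)
    refine this.congr_fun (fun y _ => ?_) measurableSet_Ioo
    simp only; ring
  refine (weighted_cauchy_schwarz measurableSet_Ioo (fun y hy => hy.1) hi hw2 ?_).1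
  exact (((contDiffOn_opH hQ hg isOpen_Ioo (fun y hy => hy.1) hF).continuousOn.mul hwc).mul
    continuousOn_id).aestronglyMeasurable measurableSet_Ioo

/-- The estimate at one frozen time. The order of the quantifiers matters: `C` is independent of
`M`, while `C'` and the threshold `β` may depend on `M`, `A` and `κ`, because they only accompany
the higher power `b₁^{L+2}`. -/
theorem exists_defect_bound (hQ : IsGroundState g Q) (hg : IsTarget g) (hχ : IsCutoff χ) {L : ℕ}
    (hL : 1 ≤ L) : ∃ C > 0, ∀ M, 3 ≤ M → ∀ A ≥ 0, ∀ κ ≥ 0, ∃ C' ≥ 0, ∃ β > 0,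
      ∀ (b d : ℕ → ℝ) (ℓ E : ℝ) (e v : ℝ → ℝ), ParBd A L b → b 1 < β →
      0 ≤ E → E ≤ κ * b 1 ^ (L + 1) → ContDiffOn ℝ ∞ e (Ioo 0 (2 * M + 1)) →
      (∀ k ≤ L + 1, IntegrableOn (fun y => opHpow g Q k e y ^ 2 * y) (Ioo 0 (2 * M + 1))) →
      ∫ y in Ioo 0 (2 * M + 1), opHpow g Q (L + 1) e y ^ 2 * y ≤ E ^ 2 →
      (∀ k ≤ L, ip e (opHpow g Q k (PhiM g Q χ L M)) = 0) →
      EqOn v (fun y => Q y + corr g Q χ L b y + e y) (Ioo 0 (2 * M + 1)) →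
      SymOn (2 * M + 1) 0 0 (frameVel g Q χ L v ℓ b d) →
      (∀ k ≤ L, ip (frameVel g Q χ L v ℓ b d) (opHpow g Q k (PhiM g Q χ L M)) = 0) →
      (∀ k < L, |defect Q χ ℓ b d k| ≤ C' * b 1 ^ (L + 2)) ∧
        |defect Q χ ℓ b d L| ≤ C / Real.sqrt (Real.log M) * E + C' * b 1 ^ (L + 2) := by
  have hc := coef_cb hQ hg hχ
  obtain ⟨C₀, hC₀, hΦ⟩ := exists_PhiM_norm hQ hg hχ L
  obtain ⟨c₀, hc₀, hN⟩ := exists_norm_lower hQ hg hχ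
  -- The quotient of `‖Φ_M‖ ≤ √(C₀ log M)` by `(χ_M ΛQ, ΛQ) ≥ c₀ log M`, without its factor `1/√(log
  -- M)`.
  refine ⟨Real.sqrt C₀ / c₀, by positivity, fun M hM A hA κ hκ => ?_⟩
  have hM0 : 0 < M := by linarith
  have hY : 0 < 2 * M := by positivity
  have hYR : 2 * M < 2 * M + 1 := by linarith
  have hlog := one_le_log_of_three_le hM
  have hlog0 : 0 < Real.log M := by linarith
  obtain ⟨hΦi, hΦn⟩ := hΦ M hM
  have hNM := hN M hM
  set N := ip (cutLamQ Q χ M) (scal Q) with hNdef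
  have hN0 : 0 < N := lt_of_lt_of_le (by positivity) hNM
  obtain ⟨C₁, hC₁, hco⟩ := exists_coercivity hQ hg hχ hL hM
  obtain ⟨C₂, hC₂, hrem⟩ := exists_velRem_bound (χ := χ) hQ hg hc hL hA
    (show 0 < 2 * M + 1 by positivity) hC₁.le hκ
  have htest := fun k => (isTest_PhiM hQ hg hχ L hM0).opHpow hQ hg hY k
  choose W hW hWb using fun k => (htest k).exists_bounds hQ hg hY
  set W₀ := ∑ k ∈ Finset.range (L + 1), W k with hW₀
  have hW₀0 : 0 ≤ W₀ := Finset.sum_nonneg fun k _ => hW k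
  set C₅ := W₀ * C₂ * (2 * M) with hC₅
  have hC₅0 : 0 ≤ C₅ := by positivity
  set p := Real.sqrt (C₀ * Real.log M) with hp
  have hp0 : 0 ≤ p := Real.sqrt_nonneg _
  set C₆ := 2 / N * (κ * p + (L + 1) * C₅) with hC₆
  have hC₆0 : 0 ≤ C₆ := by positivity
  -- The threshold makes `(L + 1) C₅ b₁ ≤ N/2`, so that the sum of the defects on the right can be
  -- absorbed. `C₆` is the constant of the resulting crude bound `b₁^{L+1}`.
  refine ⟨C₅ * (C₆ + 1) / N, by positivity, N / (2 * ((L + 1) * C₅ + 1)), by positivity, ?_⟩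
  intro b d ℓ E e v hb hbβ hE hEκ he hint hen hor hv hX hX0
  obtain ⟨hebd, hesym⟩ := hco e E hE he hint hen hor
  have hb0 : 0 < b 1 := hb.1.1
  have hb1 : b 1 ≤ 1 := by linarith [hb.1.2]
  have hrem' := hrem b d ℓ E e hb hE hEκ hebd
  set S := ∑ k ∈ Finset.range (L + 1), |defect Q χ ℓ b d k| with hS
  have hS0 : 0 ≤ S := Finset.sum_nonneg fun _ _ => abs_nonneg _
  set σ : ℕ → ℝ := fun k => if k = 0 then -(ℓ + b 1) else d k + rate Q χ k b with hσ
  have hσabs : ∀ k, |σ k| = |defect Q χ ℓ b d k| := fun k => by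
    by_cases hk : k = 0
    · simp only [hσ, defect, hk, if_true, abs_neg]
    · simp only [hσ, defect, hk, if_false]
  have hOps : ∀ k ≤ L + 1, ContDiffOn ℝ ∞ (opHpow g Q k e) (Ioo 0 (2 * M + 1)) := fun k _ =>
    contDiffOn_opHpow hQ hg isOpen_Ioo (fun y hy => hy.1) he k
  have hgreen : ∀ j ≤ L, ∀ k, ip (opHpow g Q (j + 1) e) (opHpow g Q k (PhiM g Q χ L M)) =
      ip (opHpow g Q j e) (opHpow g Q (k + 1) (PhiM g Q χ L M)) := fun j hj k => by
    rw [opHpow_succ, opHpow_succ]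
    refine (htest k).green_of_energy hQ hg hY hYR (hOps j (by omega)) (hesym j hj) ?_
    have := hint (j + 1) (by omega)
    rwa [opHpow_succ] at this
  -- For `k < L` one transfer of `H` reaches an orthogonality condition. For `k = L` no condition
  -- with `H^{L+1} Φ_M` is available, so all powers of `H` are moved onto `e` and Cauchy–Schwarz is
  -- applied.
  have hHe : ∀ k ≤ L, |ip (opH g Q e) (opHpow g Q k (PhiM g Q χ L M))| ≤
      if k = L then E * p else 0 := by
    intro k hk
    have h0 : opH g Q e = opHpow g Q (0 + 1) e := (opHpow_succ 0 e).symm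
    rw [h0]
    by_cases hkL : k = L
    · subst hkL
      rw [if_pos rfl]
      have hchain : ∀ i ≤ k, ip (opHpow g Q (0 + 1) e) (opHpow g Q k (PhiM g Q χ k M)) =
          ip (opHpow g Q (i + 1) e) (opHpow g Q (k - i) (PhiM g Q χ k M)) := by
        intro i
        induction i with
        | zero => intro _; rfl
        | succ i ih =>
          intro hi
          rw [ih (by omega), hgreen (i + 1) hi, show k - (i + 1) + 1 = k - i by omega]
      rw [hchain k le_rfl, Nat.sub_self, opHpow_zero]
      have hΦt := isTest_PhiM hQ hg hχ k hM0
      have hwc : ContinuousOn (PhiM g Q χ k M) (Ioo 0 (2 * M + 1)) :=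
        hΦt.smooth.continuousOn.mono fun y hy => hy.1
      have hcs := (weighted_cauchy_schwarz measurableSet_Ioo (fun y hy => hy.1)
        (hint (k + 1) le_rfl) (hΦi.mono_set fun y hy => hy.1)
        (((hOps (k + 1) le_rfl).continuousOn.mul hwc).mul
          continuousOn_id |>.aestronglyMeasurable measurableSet_Ioo)).2
      have hre : ip (opHpow g Q (k + 1) e) (PhiM g Q χ k M) =
          ∫ y in Ioo 0 (2 * M + 1), opHpow g Q (k + 1) e y * PhiM g Q χ k M y * y := by
        rw [ip]
        refine setIntegral_eq_of_subset_of_forall_sdiff_eq_zero measurableSet_Ioi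
          (fun y hy => hy.1) fun y hy => ?_
        have : 2 * M ≤ y := by
          by_contra! hlt
          exact hy.2 ⟨hy.1, hlt.trans hYR⟩
        simp [hΦt.supp y this]
      rw [hre]
      refine hcs.trans (mul_le_mul ?_ ?_ (Real.sqrt_nonneg _) hE)
      · exact (Real.sqrt_le_sqrt hen).trans (by rw [Real.sqrt_sq hE])
      · refine Real.sqrt_le_sqrt (le_trans (setIntegral_mono_set hΦi ?_ ?_) hΦn)
        · refine (ae_restrict_iff' measurableSet_Ioi).2 (Eventually.of_forall fun y hy => ?_)
          exact mul_nonneg (sq_nonneg _) (le_of_lt hy)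
        · exact LE.le.eventuallyLE (fun y hy => hy.1)
    · rw [if_neg hkL, hgreen 0 (by omega), opHpow_zero, hor (k + 1) (by omega), abs_zero]
  have hmain : ∀ k ≤ L, N * |defect Q χ ℓ b d k| ≤ (if k = L then E * p else 0)
      + C₅ * (b 1 * S + b 1 ^ (L + 2)) := by
    intro k hk
    have e1 : ip (velRem g Q χ L e ℓ b d) (opHpow g Q k (PhiM g Q χ L M)) =
        ip (opH g Q e) (opHpow g Q k (PhiM g Q χ L M)) + σ k * ((-1) ^ k * N) := by
      have h1 : ip (velRem g Q χ L e ℓ b d) (opHpow g Q k (PhiM g Q χ L M)) =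
          ip (fun y => (frameVel g Q χ L v ℓ b d y + opH g Q e y)
            + ∑ i ∈ Finset.range (L + 1), σ i * Tprof Q i y)
            (opHpow g Q k (PhiM g Q χ L M)) := by
        rw [(htest k).ip_eq_Ioo, (htest k).ip_eq_Ioo]
        refine setIntegral_congr_fun measurableSet_Ioo fun y hy => ?_
        rw [velRem_eq hQ hg hc L hb.1 he hv ℓ d ⟨hy.1, hy.2.trans hYR⟩, Finset.sum_range_succ' _ L]
        simp only [hσ, if_true, Nat.succ_ne_zero, if_false]
        ring
      have hsH : SymOn (2 * M + 1) 0 0 (opH g Q e) := (hesym 1 hL).zero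
      have hsT : ∀ i ∈ Finset.range (L + 1),
          SymOn (2 * M + 1) 0 0 (fun y => σ i * Tprof Q i y) := fun i _ =>
        (symOn_zero_Tprof hQ hg _ i 0).const_mul _
      rw [h1, (htest k).ip_add hQ hg hY hYR (hX.add hsH) (SymOn.sum _ hsT),
        (htest k).ip_add hQ hg hY hYR hX hsH, hX0 k hk, zero_add,
        (htest k).ip_sum hQ hg hY hYR _ hsT]
      congr 1
      rw [Finset.sum_eq_single k]
      · rw [ip_const_mul, ip_Tprof_opHpow_PhiM hQ hg hχ hM hk, if_pos rfl]
      · intro i hi hik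
        rw [ip_const_mul, ip_Tprof_opHpow_PhiM hQ hg hχ hM
          (by simp only [Finset.mem_range] at hi; omega), if_neg hik, mul_zero]
      · intro h; exact absurd (Finset.mem_range.2 (by omega)) h
    have e2 : |ip (velRem g Q χ L e ℓ b d) (opHpow g Q k (PhiM g Q χ L M))| ≤
        W₀ * (C₂ * (b 1 * S + b 1 ^ (L + 2))) * (2 * M) := by
      refine abs_ip_le hY (fun y hy => by rw [(htest k).supp y hy]; ring) fun y hy => ?_
      have h1 := (hWb k y hy.1).1
      have h2 := hrem' y ⟨hy.1, hy.2.trans hYR⟩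
      have h3 : W k ≤ W₀ := Finset.single_le_sum (f := W) (fun i _ => hW i)
        (Finset.mem_range.2 (by omega))
      have hy0 := hy.1
      rw [abs_mul, abs_mul, abs_of_pos hy0]
      calc |velRem g Q χ L e ℓ b d y| * |opHpow g Q k (PhiM g Q χ L M) y| * y
          ≤ |velRem g Q χ L e ℓ b d y| * (W₀ * y) * y := by
            gcongr
            exact h1.trans (by gcongr)
        _ = W₀ * (|velRem g Q χ L e ℓ b d y| * y ^ 2) := by ring
        _ ≤ _ := by gcongr
    have e3 : N * |defect Q χ ℓ b d k| = |σ k * ((-1) ^ k * N)| := by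
      rw [abs_mul, abs_mul, abs_pow, abs_neg, abs_one, one_pow, one_mul, abs_of_pos hN0, hσabs]
      ring
    rw [e3, show σ k * ((-1) ^ k * N) = -ip (opH g Q e) (opHpow g Q k (PhiM g Q χ L M))
      + ip (velRem g Q χ L e ℓ b d) (opHpow g Q k (PhiM g Q χ L M)) by rw [e1]; ring]
    refine (abs_add_le _ _).trans (add_le_add ?_ ?_)
    · rw [abs_neg]; exact hHe k hk
    · refine e2.trans (le_of_eq ?_)
      rw [hC₅]; ring
  have hsumN : N * S ≤ E * p + (L + 1) * C₅ * (b 1 * S + b 1 ^ (L + 2)) := by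
    rw [hS, Finset.mul_sum]
    refine (Finset.sum_le_sum fun k hk => hmain k (by rw [Finset.mem_range] at hk; omega)).trans
      (le_of_eq ?_)
    rw [Finset.sum_add_distrib, Finset.sum_ite_eq', if_pos (by simp), Finset.sum_const,
      Finset.card_range, nsmul_eq_mul]
    push_cast
    ring
  have hS6 : S ≤ C₆ * b 1 ^ (L + 1) := by
    have h1 : (L + 1) * C₅ * b 1 ≤ N / 2 := by
      rw [lt_div_iff₀ (by positivity)] at hbβ
      nlinarith
    have h2 : (L + 1) * C₅ * (b 1 * S) ≤ N / 2 * S := by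
      calc (L + 1) * C₅ * (b 1 * S) = ((L + 1) * C₅ * b 1) * S := by ring
        _ ≤ _ := by gcongr
    have h3 : E * p ≤ κ * p * b 1 ^ (L + 1) := by
      calc E * p ≤ κ * b 1 ^ (L + 1) * p := by gcongr
        _ = _ := by ring
    have h4 : (L + 1) * C₅ * b 1 ^ (L + 2) ≤ (L + 1) * C₅ * b 1 ^ (L + 1) := by
      gcongr ?_ * ?_
      exact pow_le_pow_of_le_one hb0.le hb1 (by omega)
    have h5 : N / 2 * S ≤ (κ * p + (L + 1) * C₅) * b 1 ^ (L + 1) := by linarith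
    rw [hC₆, show 2 / N * (κ * p + (L + 1) * C₅) * b 1 ^ (L + 1) =
      ((κ * p + (L + 1) * C₅) * b 1 ^ (L + 1)) / (N / 2) by field_simp, le_div_iff₀ (by positivity)]
    linarith
  -- The crude bound on the sum, multiplied by its factor `b₁`, is reinserted and improves the
  -- remainder to `b₁^{L+2}`.
  have hfin : ∀ k ≤ L, |defect Q χ ℓ b d k| ≤ (if k = L then E * p else 0) / N
      + C₅ * (C₆ + 1) / N * b 1 ^ (L + 2) := by
    intro k hk
    have h1 := hmain k hk
    have h2 : C₅ * (b 1 * S + b 1 ^ (L + 2)) ≤ C₅ * ((C₆ + 1) * b 1 ^ (L + 2)) := by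
      gcongr
      calc b 1 * S + b 1 ^ (L + 2) ≤ b 1 * (C₆ * b 1 ^ (L + 1)) + b 1 ^ (L + 2) := by gcongr
        _ = _ := by ring
    rw [show (if k = L then E * p else 0) / N + C₅ * (C₆ + 1) / N * b 1 ^ (L + 2) =
      ((if k = L then E * p else 0) + C₅ * ((C₆ + 1) * b 1 ^ (L + 2))) / N by ring,
      le_div_iff₀ hN0]
    linarith
  refine ⟨fun k hk => ?_, ?_⟩
  · have := hfin k hk.le
    rwa [if_neg hk.ne, zero_div, zero_add] at this
  · have := hfin L le_rfl
    rw [if_pos rfl] at this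
    refine this.trans (add_le_add_left ?_ _)
    have hsl := Real.sqrt_pos.2 hlog0
    rw [div_le_iff₀ hN0, hp, Real.sqrt_mul hC₀.le]
    calc E * (Real.sqrt C₀ * Real.sqrt (Real.log M))
        = Real.sqrt C₀ / c₀ / Real.sqrt (Real.log M) * E
          * (c₀ * (Real.sqrt (Real.log M) * Real.sqrt (Real.log M))) := by
          field_simp
      _ = Real.sqrt C₀ / c₀ / Real.sqrt (Real.log M) * E * (c₀ * Real.log M) := by
          rw [Real.mul_self_sqrt hlog0.le]
      _ ≤ _ := by gcongr

/-! ### Consequences of the bootstrap bounds -/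

theorem BootstrapAt.abs_Vvar_le {L : ℕ} {P : Matrix (Fin L) (Fin L) ℝ} {K b₀ s : ℝ}
    {b : ℕ → ℝ} {e : ℝ → ℝ} (h : BootstrapAt g Q L P K b₀ s b e) (i : Fin L) :
    |Vvar L P s b i| ≤ 2 := by
  by_cases hi : i.1 = 0
  · exact h.stable i hi
  · refine le_trans ?_ h.unstable
    refine Real.abs_le_sqrt ?_
    have := Finset.single_le_sum (f := fun i : Fin L => if i.1 = 0 then 0 else Vvar L P s b i ^ 2)
      (fun i _ => by positivity) (Finset.mem_univ i)
    simpa only [hi, if_false] using this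

/-- Inverting `P` bounds `U`, so `s^k b_k = c_k + O(1/log s)`. As `c_1 = L/(2L-1)` lies in `[1/2,
1]`, `b_1` is comparable to `1/s` for `s` large, and powers of `1/s` can be exchanged for powers of
`b_1`. -/
theorem exists_parameter_bound {L : ℕ} (hL : 1 ≤ L) {P : Matrix (Fin L) (Fin L) ℝ}
    (hP : IsUnit P.det) : ∃ A ≥ 0, ∀ β > 0, ∃ s₁ > 1, ∀ s ≥ s₁, ∀ b : ℕ → ℝ,
      (∀ i, |Vvar L P s b i| ≤ 2) →
      0 < b 1 ∧ b 1 < β ∧ ∀ k, 1 ≤ k → k ≤ L → |b k| ≤ A * b 1 ^ k := by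
  set G : ℝ := ∑ i, ∑ j, |P⁻¹ i j| * 2 with hG
  have hG0 : 0 ≤ G := by positivity
  set a : ℕ → ℝ := fun i => |cseq L i| + |dseq L i| + G with ha
  have ha0 : ∀ i, 0 ≤ a i := fun i => by positivity
  have hc1 : cseq L 0 = (L : ℝ) / (2 * L - 1) := rfl
  have hLr : (1 : ℝ) ≤ L := by exact_mod_cast hL
  have hc1l : 1 / 2 ≤ cseq L 0 := by
    rw [hc1, div_le_div_iff₀ (by norm_num) (by linarith)]; linarith
  have hc1u : cseq L 0 ≤ 1 := by
    rw [hc1, div_le_one (by linarith)]; linarith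
  refine ⟨∑ i ∈ Finset.range L, a i * 4 ^ (i + 1), Finset.sum_nonneg fun i _ => by
    have := ha0 i; positivity, fun β hβ => ?_⟩
  -- `log s ≥ Z` makes the deviation of `s b_1` from `c_1` at most `1/4`, whence `1/4 ≤ s b_1 ≤ 2`.
  set Z : ℝ := 4 * (|dseq L 0| + G) + 1 with hZ
  have hZ1 : 1 ≤ Z := by rw [hZ]; have : 0 ≤ |dseq L 0| := abs_nonneg _; linarith
  refine ⟨max (Real.exp Z) (2 / β + 1), lt_max_of_lt_left (Real.one_lt_exp_iff.2 (by linarith)),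
    fun s hs b hV => ?_⟩
  have hse : Real.exp Z ≤ s := (le_max_left _ _).trans hs
  have hsβ : 2 / β + 1 ≤ s := (le_max_right _ _).trans hs
  have hs0 : 0 < s := (Real.exp_pos Z).trans_le hse
  have hlog : Z ≤ Real.log s := (Real.le_log_iff_exp_le hs0).2 hse
  have hlog1 : 1 ≤ Real.log s := hZ1.trans hlog
  have hlog0 : 0 < Real.log s := by linarith
  have hpow : Real.log s ≤ Real.log s ^ (5 / 4 : ℝ) :=
    Real.self_le_rpow_of_one_le hlog1 (by norm_num)
  set U : Fin L → ℝ := fun i =>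
    s ^ (i.1 + 1) * Real.log s ^ (5 / 4 : ℝ) * (b (i.1 + 1) - bexact L (i.1 + 1) s) with hU
  have hUV : U = P⁻¹.mulVec (Vvar L P s b) := by
    rw [Vvar, Matrix.mulVec_mulVec, Matrix.nonsing_inv_mul P hP, Matrix.one_mulVec]
  have hUb : ∀ i, |U i| ≤ G := by
    intro i
    rw [hUV, Matrix.mulVec, dotProduct]
    refine (Finset.abs_sum_le_sum_abs _ _).trans ?_
    refine le_trans (Finset.sum_le_sum fun j _ => ?_) (Finset.single_le_sum
      (f := fun i => ∑ j, |P⁻¹ i j| * 2) (fun i _ => by positivity) (Finset.mem_univ i))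
    rw [abs_mul]
    have := hV j
    gcongr
  have hkey : ∀ i, i < L → |s ^ (i + 1) * b (i + 1) - cseq L i| ≤
      (|dseq L i| + G) / Real.log s := by
    intro i hi
    have h1 := hUb ⟨i, hi⟩
    have hp0 : 0 < Real.log s ^ (5 / 4 : ℝ) := by linarith
    have e : s ^ (i + 1) * b (i + 1) - cseq L i =
        dseq L i / Real.log s + U ⟨i, hi⟩ / Real.log s ^ (5 / 4 : ℝ) := by
      simp only [hU, bexact, Nat.add_sub_cancel]
      field_simp
      ring
    rw [e, add_div]
    refine (abs_add_le _ _).trans (add_le_add ?_ ?_)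
    · rw [abs_div, abs_of_pos hlog0]
    · rw [abs_div, abs_of_pos hp0]
      gcongr
  have h1 := hkey 0 (by omega)
  rw [zero_add, pow_one] at h1
  have h1' : (|dseq L 0| + G) / Real.log s ≤ 1 / 4 := by
    rw [div_le_iff₀ hlog0]; linarith
  have h2 := abs_le.1 (h1.trans h1')
  have hb4 : 1 ≤ 4 * (s * b 1) := by linarith
  have hb1 : 0 < b 1 := by
    by_contra! h
    have := mul_nonpos_of_nonneg_of_nonpos hs0.le h
    linarith
  refine ⟨hb1, ?_, fun k hk hkL => ?_⟩
  · have h3 : s * b 1 ≤ 2 := by linarith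
    have h4 : 2 < s * β := by
      have := mul_le_mul_of_nonneg_right hsβ hβ.le
      rw [add_mul, div_mul_cancel₀ _ hβ.ne'] at this
      linarith
    by_contra! h
    have := mul_le_mul_of_nonneg_left h hs0.le
    linarith
  · obtain ⟨i, rfl⟩ := Nat.exists_eq_add_of_le' hk
    have h3 := hkey i (by omega)
    have h4 : (|dseq L i| + G) / Real.log s ≤ |dseq L i| + G := div_le_self (by positivity) hlog1
    have h5 : |s ^ (i + 1) * b (i + 1)| ≤ a i := by
      have := abs_add_le (s ^ (i + 1) * b (i + 1) - cseq L i) (cseq L i)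
      rw [sub_add_cancel] at this
      simp only [ha]
      linarith
    rw [abs_mul, abs_of_pos (pow_pos hs0 _)] at h5
    have h6 : |b (i + 1)| ≤ (s ^ (i + 1) * |b (i + 1)|) * (4 * b 1) ^ (i + 1) := by
      have : 1 ≤ (4 * (s * b 1)) ^ (i + 1) := one_le_pow₀ hb4
      calc |b (i + 1)| = 1 * |b (i + 1)| := (one_mul _).symm
        _ ≤ (4 * (s * b 1)) ^ (i + 1) * |b (i + 1)| := by gcongr
        _ = _ := by rw [mul_pow, mul_pow, mul_pow]; ring
    have h7 : a i * 4 ^ (i + 1) ≤ ∑ i ∈ Finset.range L, a i * 4 ^ (i + 1) :=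
      Finset.single_le_sum (f := fun i => a i * 4 ^ (i + 1)) (fun i _ => by
        have := ha0 i; positivity) (Finset.mem_range.2 (by omega))
    calc |b (i + 1)| ≤ (s ^ (i + 1) * |b (i + 1)|) * (4 * b 1) ^ (i + 1) := h6
      _ ≤ a i * (4 * b 1) ^ (i + 1) := by gcongr
      _ = a i * 4 ^ (i + 1) * b 1 ^ (i + 1) := by rw [mul_pow]; ring
      _ ≤ _ := by gcongr

theorem le_rtime {s₀ t : ℝ} (lam : ℝ → ℝ) (ht : 0 ≤ t) : s₀ ≤ rtime s₀ lam t := by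
  rw [rtime]
  have := intervalIntegral.integral_nonneg (f := fun τ => 1 / lam τ ^ 2) (μ := volume) ht
    fun τ _ => by positivity
  linarith

theorem one_le_abs_log {b : ℝ} (hb : b ∈ Ioo (0 : ℝ) (1 / 16)) : 1 ≤ |Real.log b| := by
  have h1 : b ≤ Real.exp (-1) := by
    have := Real.exp_neg_one_gt_d9
    linarith [hb.2]
  have h2 : Real.log b ≤ -1 := (Real.log_le_iff_le_exp hb.1).2 h1
  rw [abs_of_neg (by linarith)]; linarith

/-- The inequality `|x log x| < 1` is applied to `x = √b`; half a power of `b` pays for the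
logarithm. -/
theorem mul_abs_log_le {b : ℝ} (hb : 0 < b) (hb1 : b ≤ 1) : b * |Real.log b| ≤ 2 * Real.sqrt b := by
  have hs := Real.sqrt_pos.2 hb
  have h1 := Real.abs_log_mul_self_lt (Real.sqrt b) hs (Real.sqrt_le_one.2 hb1)
  rw [abs_mul, abs_of_pos hs, Real.log_sqrt hb.le, abs_div, abs_of_pos (zero_lt_two (α := ℝ))] at h1
  calc b * |Real.log b| = 2 * Real.sqrt b * (|Real.log b| / 2 * Real.sqrt b) := by
        nth_rewrite 1 [← Real.mul_self_sqrt hb.le]; ring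
    _ ≤ 2 * Real.sqrt b * 1 := by gcongr
    _ = _ := mul_one _

theorem BootstrapAt.sqrt_energy_le {L : ℕ} {P : Matrix (Fin L) (Fin L) ℝ} {K b₀ s : ℝ}
    {b : ℕ → ℝ} {e : ℝ → ℝ} (h : BootstrapAt g Q L P K b₀ s b e) (hK : 0 ≤ K)
    (hb : b 1 ∈ Ioo (0 : ℝ) (1 / 16)) :
    Real.sqrt (energy g Q (L + 1) e) ≤ Real.sqrt K * b 1 ^ (L + 1) := by
  have hb0 := hb.1
  have h1 : energy g Q (L + 1) e ≤ K * (b 1 ^ (L + 1)) ^ 2 := by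
    refine h.energy_high.trans ?_
    gcongr
    rw [← pow_mul, show (L + 1) * 2 = 2 * L + 2 by ring]
    exact div_le_self (by positivity) (one_le_pow₀ (one_le_abs_log hb))
  refine (Real.sqrt_le_sqrt h1).trans (le_of_eq ?_)
  rw [Real.sqrt_mul hK, Real.sqrt_sq (by positivity)]

/-- The case `k = 0` is not among the energies. On a bounded interval it follows from the Hardy
term, since `e² y ≤ R² (e/y)² y`. -/
theorem BootstrapAt.integrableOn_opHpow {L : ℕ} {P : Matrix (Fin L) (Fin L) ℝ} {K b₀ s R : ℝ}
    {b : ℕ → ℝ} {e : ℝ → ℝ} (h : BootstrapAt g Q L P K b₀ s b e)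
    (he : ContinuousOn e (Ioo 0 R)) {k : ℕ} (hk : k ≤ L + 1) :
    IntegrableOn (fun y => opHpow g Q k e y ^ 2 * y) (Ioo 0 R) := by
  rcases Nat.eq_zero_or_pos k with rfl | hk0
  · rw [opHpow_zero]
    refine Integrable.mono' (g := fun y => R ^ 2 * ((e y / y) ^ 2 * y))
      ((h.hardy_int.mono_set fun y hy => hy.1).const_mul _)
      (((he.pow 2).mul continuousOn_id).aestronglyMeasurable measurableSet_Ioo) ?_
    refine (ae_restrict_iff' measurableSet_Ioo).2 (Eventually.of_forall fun y hy => ?_)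
    have hy0 := hy.1
    have hyR := hy.2.le
    rw [Real.norm_eq_abs, abs_of_nonneg (by positivity)]
    calc e y ^ 2 * y = y ^ 2 * ((e y / y) ^ 2 * y) := by field_simp
      _ ≤ _ := by gcongr
  · exact (h.energy_int k hk0 hk).mono_set fun y hy => hy.1

end HeatFlow

end

/-! ### The modulation equations: choice of constants and conclusion -/

theorem lemma3p2 (L : ℕ) (hL : 1 ≤ L) (g : ℝ → ℝ) (hg : HeatFlow.IsTarget g)
    (χ : ℝ → ℝ) (hχ : HeatFlow.IsCutoff χ) (Q : ℝ → ℝ) (hQ : HeatFlow.IsGroundState g Q)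
    (P : Matrix (Fin L) (Fin L) ℝ) (hP : HeatFlow.Diagonalizes L P) :
    ∃ C : ℝ, 0 < C ∧ ∃ M₀ : ℝ, 1 < M₀ ∧ ∀ M : ℝ, M₀ ≤ M → ∀ K : ℝ, 0 < K →
      ∃ s_min : ℝ, 1 < s_min ∧ ∀ s₀ : ℝ, s_min ≤ s₀ →
        ∀ (T : ℝ) (u : ℝ → ℝ → ℝ) (lam : ℝ → ℝ) (b : ℝ → ℕ → ℝ),
          HeatFlow.IsFlow g T u →
          HeatFlow.IsModulated g Q χ L M T u lam b →
          (∀ t ∈ Set.Ico 0 T,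
            HeatFlow.BootstrapAt g Q L P K (b 0 1) (HeatFlow.rtime s₀ lam t) (b t)
              (HeatFlow.eps g Q χ L u lam b t)) →
          ∀ t ∈ Set.Ico 0 T,
            |HeatFlow.sderiv T lam lam t / lam t + b t 1|
                + ∑ k ∈ Finset.Icc 1 (L - 1),
                    |HeatFlow.sderiv T lam (fun τ => b τ k) t
                      + (2 * (k : ℝ) - 1 + HeatFlow.cb Q χ (b t 1)) * b t 1 * b t k
                      - b t (k + 1)|
              ≤ C * b t 1 ^ ((L : ℝ) + 3 / 2) ∧
            |HeatFlow.sderiv T lam (fun τ => b τ L) t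
                + (2 * (L : ℝ) - 1 + HeatFlow.cb Q χ (b t 1)) * b t 1 * b t L|
              ≤ C / Real.sqrt (Real.log M) *
                (Real.sqrt (HeatFlow.energy g Q (L + 1) (HeatFlow.eps g Q χ L u lam b t))
                  + b t 1 ^ (L + 1) / |Real.log (b t 1)|) := by
  open HeatFlow Set in
  obtain ⟨C, hC, hdef⟩ := exists_defect_bound hQ hg hχ hL
  obtain ⟨A, hA, hpar⟩ := exists_parameter_bound hL hP.1
  -- The additional `1` absorbs the terms in `b₁^{L+2}`, whose constants depend on `M` and `K`. From
  -- `M ≥ 3` on, `log M ≥ 1`.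
  refine ⟨C + 1, by positivity, 3, by norm_num, fun M hM K hK => ?_⟩
  obtain ⟨C', hC', β, hβ, hbd⟩ := hdef M hM A hA (Real.sqrt K) (Real.sqrt_nonneg K)
  set R := 2 * M + 1 with hR
  have hR0 : 0 < R := by positivity
  have hlogM : 0 < Real.log M := by have := one_le_log_of_three_le hM; linarith
  have hsl := Real.sqrt_pos.2 hlogM
  -- For `√b₁ G ≤ 1` the four summands serve in turn: to absorb the sum of the first `L` defects, to
  -- absorb the error in the last equation, to place `(0, R)` inside `y < B₀/4`, and to ensure `b₁ <
  -- 1/16`.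
  set G := (L : ℝ) * C' + 2 * C' * Real.sqrt (Real.log M) + 4 * R + 4 with hG
  have hG0 : 0 < G := by positivity
  obtain ⟨s₁, hs₁, hs⟩ := hpar (min β (1 / G ^ 2)) (lt_min hβ (by positivity))
  refine ⟨s₁, hs₁, fun s₀ hs₀ T u lam b hu hm hboot => ?_⟩
  have hparam : ∀ τ ∈ Ico 0 T, ParBd A L (b τ) ∧ R ≤ B0 (b τ 1) / 4 ∧
      b τ 1 < β ∧ Real.sqrt (b τ 1) * G ≤ 1 := by
    intro τ hτ
    obtain ⟨h1, h2, h3⟩ := hs _ (hs₀.trans (le_rtime lam hτ.1)) (b τ) (hboot τ hτ).abs_Vvar_le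
    have h4 := (h2.trans_le (min_le_right _ _)).le
    have hsq : Real.sqrt (b τ 1) * G ≤ 1 := by
      have := Real.sqrt_le_sqrt h4
      rw [Real.sqrt_div zero_le_one, Real.sqrt_one, Real.sqrt_sq hG0.le] at this
      rwa [le_div_iff₀ hG0] at this
    have hsp := Real.sqrt_pos.2 h1
    have h5 : Real.sqrt (b τ 1) * (4 * R) ≤ 1 := by
      refine le_trans ?_ hsq
      have : 4 * R ≤ G := by
        rw [hG]
        have : 0 ≤ (L : ℝ) * C' + 2 * C' * Real.sqrt (Real.log M) := by positivity
        linarith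
      gcongr
    have h6 : b τ 1 < 1 / 16 := by
      refine (h2.trans_le (min_le_right _ _)).trans_le ?_
      have : 4 ≤ G := by
        rw [hG]
        have : 0 ≤ (L : ℝ) * C' + 2 * C' * Real.sqrt (Real.log M) + 4 * R := by positivity
        linarith
      exact one_div_le_one_div_of_le (by norm_num) (by nlinarith)
    refine ⟨⟨⟨h1, h6⟩, hm.b_conv τ hτ _ (by omega), h3⟩, ?_, h2.trans_le (min_le_left _ _), hsq⟩
    rw [B0, div_div, le_div_iff₀ (by positivity)]
    linarith
  intro t ht
  obtain ⟨hP1, hP2, hP3, hP4⟩ := hparam t ht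
  have hb0 : 0 < b t 1 := hP1.1.1
  have hbt := hboot t ht
  have hsm := contDiffOn_eps (L := L) (b := b) hQ hg hχ hu lam ht hP1.1 hP2
  obtain ⟨hX, hX0⟩ := ip_frameVel_eq_zero hQ hg hχ hu hm hA (by linarith)
    (show 2 * M < R by rw [hR]; linarith) (fun τ hτ => ⟨(hparam τ hτ).1, (hparam τ hτ).2.1⟩) ht
  have hE0 : 0 ≤ energy g Q (L + 1) (eps g Q χ L u lam b t) :=
    MeasureTheory.setIntegral_nonneg measurableSet_Ioi fun y hy =>
      mul_nonneg (sq_nonneg _) (le_of_lt hy)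
  obtain ⟨hlow, hhigh⟩ := hbd (b t) (fun j => sderiv T lam (fun τ => b τ j) t)
    (sderiv T lam lam t / lam t) _ (eps g Q χ L u lam b t) (fun x => u t (lam t * x)) hP1 hP3
    (Real.sqrt_nonneg _) (hbt.sqrt_energy_le hK.le hP1.1) hsm
    (fun k hk => hbt.integrableOn_opHpow hsm.continuousOn hk)
    (by
      rw [Real.sq_sqrt hE0]
      exact MeasureTheory.setIntegral_mono_set (hbt.energy_int (L + 1) (by omega) le_rfl)
        ((MeasureTheory.ae_restrict_iff' measurableSet_Ioi).2 (Filter.Eventually.of_forall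
          fun y hy => mul_nonneg (sq_nonneg _) (le_of_lt hy)))
        (LE.le.eventuallyLE fun y hy => hy.1))
    (hm.ortho t ht)
    (fun y hy => by
      show u t (lam t * y) = Q y + corr g Q χ L (b t) y + eps g Q χ L u lam b t y
      rw [eps_eq hχ u lam hP1.1 ⟨hy.1, hy.2.trans_le hP2⟩]; ring) hX hX0
  have hsp := Real.sqrt_pos.2 hb0
  have hLG : Real.sqrt (b t 1) * (L * C') ≤ 1 := by
    refine le_trans ?_ hP4
    have : (L : ℝ) * C' ≤ G := by
      rw [hG]
      have : 0 ≤ 2 * C' * Real.sqrt (Real.log M) + 4 * R + 4 := by positivity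
      linarith
    gcongr
  have hCG : Real.sqrt (b t 1) * (2 * C' * Real.sqrt (Real.log M)) ≤ 1 := by
    refine le_trans ?_ hP4
    have : 2 * C' * Real.sqrt (Real.log M) ≤ G := by
      rw [hG]
      have : 0 ≤ (L : ℝ) * C' + 4 * R + 4 := by positivity
      linarith
    gcongr
  have hdk : ∀ k, 1 ≤ k → sderiv T lam (fun τ => b τ k) t
      + (2 * (k : ℝ) - 1 + cb Q χ (b t 1)) * b t 1 * b t k - b t (k + 1) =
      defect Q χ (sderiv T lam lam t / lam t) (b t)
        (fun j => sderiv T lam (fun τ => b τ j) t) k := fun k hk => by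
    rw [defect, if_neg (by omega), rate]; ring
  constructor
  · have h0 := hlow 0 (by omega)
    rw [defect, if_pos rfl] at h0
    have h1 : ∑ k ∈ Finset.Icc 1 (L - 1), |sderiv T lam (fun τ => b τ k) t
        + (2 * (k : ℝ) - 1 + cb Q χ (b t 1)) * b t 1 * b t k - b t (k + 1)| ≤
        ((L : ℝ) - 1) * (C' * b t 1 ^ (L + 2)) := by
      refine (Finset.sum_le_sum fun k hk => ?_).trans (le_of_eq (a := ∑ k ∈ Finset.Icc 1 (L - 1),
        C' * b t 1 ^ (L + 2)) ?_)
      · rw [Finset.mem_Icc] at hk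
        rw [hdk k hk.1]
        exact hlow k (by omega)
      · rw [Finset.sum_const, Nat.card_Icc, nsmul_eq_mul, Nat.add_sub_cancel, Nat.cast_sub hL,
          Nat.cast_one]
    -- The proof gives the power `L + 2`; half a power is given up to make the constant independent
    -- of `M` and `K`.
    have h2 : b t 1 ^ (L + 2) = Real.sqrt (b t 1) * b t 1 ^ ((L : ℝ) + 3 / 2) := by
      rw [Real.sqrt_eq_rpow, ← Real.rpow_add hb0, ← Real.rpow_natCast]
      congr 1
      push_cast
      ring
    have h3 : 0 < b t 1 ^ ((L : ℝ) + 3 / 2) := Real.rpow_pos_of_pos hb0 _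
    calc _ ≤ C' * b t 1 ^ (L + 2) + ((L : ℝ) - 1) * (C' * b t 1 ^ (L + 2)) := add_le_add h0 h1
      _ = Real.sqrt (b t 1) * (L * C') * b t 1 ^ ((L : ℝ) + 3 / 2) := by rw [h2]; ring
      _ ≤ (C + 1) * b t 1 ^ ((L : ℝ) + 3 / 2) := by
        gcongr
        linarith
  · have h1 := hdk L hL
    rw [hP1.2.1, sub_zero] at h1
    rw [h1]
    refine hhigh.trans ?_
    have hlb := one_le_abs_log hP1.1
    have h2 : C' * b t 1 ^ (L + 2) ≤
        1 / Real.sqrt (Real.log M) * (b t 1 ^ (L + 1) / |Real.log (b t 1)|) := by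
      rw [div_mul_div_comm, one_mul, le_div_iff₀ (by positivity)]
      calc C' * b t 1 ^ (L + 2) * (Real.sqrt (Real.log M) * |Real.log (b t 1)|)
          = C' * Real.sqrt (Real.log M) * b t 1 ^ (L + 1) * (b t 1 * |Real.log (b t 1)|) := by ring
        _ ≤ C' * Real.sqrt (Real.log M) * b t 1 ^ (L + 1) * (2 * Real.sqrt (b t 1)) :=
          mul_le_mul_of_nonneg_left (mul_abs_log_le hb0 (by linarith [hP1.1.2])) (by positivity)
        _ = b t 1 ^ (L + 1) * (Real.sqrt (b t 1) * (2 * C' * Real.sqrt (Real.log M))) := by ring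
        _ ≤ b t 1 ^ (L + 1) * 1 := by gcongr
        _ = _ := mul_one _
    have h3 : 0 ≤ 1 / Real.sqrt (Real.log M)
        * Real.sqrt (energy g Q (L + 1) (eps g Q χ L u lam b t)) := by positivity
    have h4 : 0 ≤ C / Real.sqrt (Real.log M) * (b t 1 ^ (L + 1) / |Real.log (b t 1)|) := by
      positivity
    rw [add_div, mul_add, add_mul, add_mul]
    linarith
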